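/- Let $D$ be $\mathbb{R}\oplus\mathbb{R}$ (with the swap) or $\mathbb{C}$ (with complex conjugation); write $x\mapsto\bar x$ for the involution and $\operatorname{Tr}x=x+\bar x\in\mathbb{R}$. Let $H^n(D)$ be the real vector space of $n\times n$ hermitian matrices over $D$, let $N=N^n(D)$ be the group of upper triangular matrices with unit diagonal, acting on $H^n(D)$ by $x\mapsto \bar u^t x u$, let $\psi$ be a non-trivial continuous unitary character of $\mathbb{R}$, and put $\chi(u)=\psi\big(\sum_{i=1}^{n-1}\operatorname{Tr}u_{i,i+1}\big)$. Measures. On $D$ take $dx_1dx_2$ if $D=\mathbb{R}\oplus\mathbb{R}$ and $2\,dx\,dy$ if $D=\mathbb{C}$, and on $N$ the product measure $du$ over the entries above the diagonal. For $g\in H^n(D)$ the stabilizer $N_g$ is given the image under $\exp$ of Lebesgue measure on its Lie algebra (for the Euclidean structure with norm $x_1^2+x_2^2$, resp. $2(x^2+y^2)$, in each entry above the diagonal), and $N/N_g$, the set of cosets $N_gu$, is given the quotient measure. For a function $\Phi$ on $H^n(D)$, real invertible diagonal $a$, and $g$ with $\chi|_{N_g}=1$, put $$\Omega(\Phi)(a)=\int_N\Phi(\bar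 u^t a u)\chi(u)\,du,\qquad \Omega(\Phi,g)=\int_{N/N_g}\Phi(\bar u^t g u)\chi(u)\,du .$$ Schwartz along $\det$. Let $V$ be $\mathbb{R}$ or $\mathbb{R}^\times$. The space $\mathcal{S}^{\det,V}$ consists of the smooth functions $\Phi$ on $\{x\in H^n(D):\det x\in V\}$ such that $(f\circ\det)\Phi$ is a Schwartz function on this open set for every Schwartz function $f$ on $V$; here the Schwartz functions on an open set $\{x : \det x\in V\}$ or $V$ are the Schwartz functions on the ambient vector space that vanish with all derivatives outside the set. Transfer factor. Let $w_m$ be the $m\times m$ antidiagonal permutation matrix and let $c=c(\mathbb{C},\psi)$ be the Weil constant: for all real $a\ne0$ the Fourier transform on $\mathbb{C}$ (with kernel $\psi(\operatorname{Tr}(x\bar y))$ and self-dual measure) of $\psi(a x\bar x)$ is $|a|^{-1}\operatorname{sign}(a)\,c\,\psi(-x\bar x/a)$. For $a=\operatorname{diag}(a_1,\dots,a_n)$ put $\gamma(a)=\prod_{k=1}^{n-1}\operatorname{sign}(a_1\cdots a_k)$. Define $\gamma(g,\psi)$ for block diagonal $g$ by $\gamma(\emptyset,\psi)=1$, $$\gamma(a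 w_m,\psi)=\gamma(-a^{-1}w_{m-1},\bar\psi)\,c(\mathbb{C},\psi)^{m(m-1)/2}\operatorname{sign}\det(-a^{-1}w_{m-1})\ (m\ge2),\quad \gamma(a w_1,\psi)=1,$$ $$\gamma(\operatorname{diag}(x,y),\psi)=\gamma(x,\psi)\,\gamma(y,\psi)\,\operatorname{sign}(\det x)^{r},\qquad y\text{ of size } r\times r\ (\text{the last factor is }1\text{ if } r=0).$$ Theorem. Let $V\in\{\mathbb{R},\mathbb{R}^\times\}$ and let $\Phi$ on $H^n(\mathbb{R}\oplus\mathbb{R})$ and $\Psi$ on $H^n(\mathbb{C})$ belong to $\mathcal{S}^{\det,V}$. Suppose that $\Omega(\Phi)(a)=\gamma(a)\,\Omega(\Psi)(a)$ for every real invertible diagonal $a$. Let $g=\operatorname{diag}(a_1w_{m_1},\dots,a_jw_{m_j})$ with $m_i\ge1$, $m_1+\dots+m_j=n$, $a_i\in\mathbb{R}$, with $\det g\in V$, and such that the leading principal minor $\Delta_{n-1}(g)$ is non-zero if $\det g=0$. Then the quotient measures on $N/N_g$ exist and the integrals $\Omega(\Phi,g)$ and $\Omega(\Psi,g)$ converge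 absolutely, $$\Omega(\Phi,g)=\gamma(g,\psi)\,\Omega(\Psi,g),$$ and $\gamma(g,\psi)^4=1$. -/

import Mathlib

open MeasureTheory Matrix
open scoped ContDiff SchwartzMap ENNReal

attribute [local instance] Matrix.normedAddCommGroup Matrix.normedSpace

noncomputable section

namespace Kloosterman

/-! ### The two quadratic algebras `ℂ` and `ℝ ⊕ ℝ` -/

/-- A two-dimensional semisimple real algebra `D = ℝ ⊕ ℝ δ` with its non-trivial involution
`conj`; only the two instances below are used. -/
class QuadAlg (D : Type) [NormedCommRing D] [NormedAlgebra ℝ D] where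
  conj : D ≃ₐ[ℝ] D
  conj_conj : ∀ x, conj (conj x) = x
  δ : D
  conj_δ : conj δ = -δ

/-- `ℂ` with complex conjugation, `δ = i`. -/
instance : QuadAlg ℂ where
  conj := Complex.conjAe
  conj_conj := by intro x; simp
  δ := Complex.I
  conj_δ := by simp

/-- `ℝ ⊕ ℝ` with the swap, `δ = (1, -1)`. -/
instance : QuadAlg (ℝ × ℝ) where
  conj :=
    { toFun := fun x => (x.2, x.1)
      invFun := fun x => (x.2, x.1)
      left_inv := fun _ => rfl
      right_inv := fun _ => rfl
      map_mul' := fun _ _ => rfl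
      map_add' := fun _ _ => rfl
      commutes' := fun _ => rfl }
  conj_conj := fun _ => rfl
  δ := (1, -1)
  conj_δ := by
    change ((-1 : ℝ), (1 : ℝ)) = -((1 : ℝ), (-1 : ℝ))
    simp

variable {n : ℕ} {D : Type} [NormedCommRing D] [NormedAlgebra ℝ D] [QuadAlg D]

/-! ### Hermitian matrices and the unipotent group -/

/-- The conjugate transpose with respect to the involution of `D`. -/
def star' (x : Matrix (Fin n) (Fin n) D) : Matrix (Fin n) (Fin n) D :=
  (x.map (QuadAlg.conj (D := D)))ᵀ

theorem star'_mul (x y : Matrix (Fin n) (Fin n) D) : star' (x * y) = star' y * star' x := by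
  simp [star', Matrix.map_mul, Matrix.transpose_mul]

theorem star'_star' (x : Matrix (Fin n) (Fin n) D) : star' (star' x) = x := by
  ext i j; simp [star', QuadAlg.conj_conj]

theorem star'_add (x y : Matrix (Fin n) (Fin n) D) : star' (x + y) = star' x + star' y := by
  ext i j; simp [star']

theorem star'_smul (r : ℝ) (x : Matrix (Fin n) (Fin n) D) : star' (r • x) = r • star' x := by
  ext i j; simp [star']

theorem star'_zero : star' (0 : Matrix (Fin n) (Fin n) D) = 0 := by
  ext i j; simp [star']

theorem star'_one : star' (1 : Matrix (Fin n) (Fin n) D) = 1 := by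
  simp [star', Matrix.map_one]

variable (n D) in
/-- `H^n(D)`, the real vector space of hermitian `n × n` matrices over `D`. -/
def Herm : Submodule ℝ (Matrix (Fin n) (Fin n) D) where
  carrier := {x | star' x = x}
  add_mem' := by
    intro x y hx hy
    simp only [Set.mem_ofPred_eq] at *
    rw [star'_add, hx, hy]
  zero_mem' := star'_zero
  smul_mem' := by
    intro r x hx
    simp only [Set.mem_ofPred_eq] at *
    rw [star'_smul, hx]

/-- The determinant of a hermitian matrix as a real number: `det x` is fixed by the involution,
so it lies in `ℝ` and equals half of its trace from `D` to `ℝ`. -/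
def hdet (x : Herm n D) : ℝ := Algebra.trace ℝ D (x : Matrix (Fin n) (Fin n) D).det / 2

/-- A real symmetric matrix as an element of `H^n(D)`. -/
def ofReal (g : Matrix (Fin n) (Fin n) ℝ) (hg : gᵀ = g) : Herm n D :=
  ⟨g.map (algebraMap ℝ D), by
    change star' _ = _
    ext i j
    have h : g j i = g i j := congrFun (congrFun hg i) j
    simp [star', h]⟩

/-- Upper triangular with unit diagonal. -/
def IsUpperUnip (u : Matrix (Fin n) (Fin n) D) : Prop :=
  (∀ i j, j < i → u i j = 0) ∧ ∀ i, u i i = 1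

theorem IsUpperUnip.one {n : ℕ} {D : Type} [NormedCommRing D] : IsUpperUnip (1 : Matrix (Fin n) (Fin n) D) :=
  ⟨fun _ _ h => Matrix.one_apply_ne (ne_of_gt h), fun i => Matrix.one_apply_eq i⟩

theorem IsUpperUnip.mul {n : ℕ} {D : Type} [NormedCommRing D] {u v : Matrix (Fin n) (Fin n) D} (hu : IsUpperUnip u)
    (hv : IsUpperUnip v) : IsUpperUnip (u * v) := by
  refine ⟨fun i j hij => ?_, fun i => ?_⟩
  · rw [Matrix.mul_apply]
    refine Finset.sum_eq_zero fun k _ => ?_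
    rcases lt_or_ge k i with h | h
    · rw [hu.1 i k h, zero_mul]
    · rw [hv.1 k j (lt_of_lt_of_le hij h), mul_zero]
  · rw [Matrix.mul_apply, Finset.sum_eq_single i]
    · rw [hu.2, hv.2, one_mul]
    · intro k _ hk
      rcases lt_or_gt_of_ne hk with h | h
      · rw [hu.1 i k h, zero_mul]
      · rw [hv.1 k i h, mul_zero]
    · simp

theorem IsUpperUnip.det {n : ℕ} {D : Type} [NormedCommRing D] {u : Matrix (Fin n) (Fin n) D} (hu : IsUpperUnip u) : u.det = 1 := by
  rw [Matrix.det_of_isUpperTriangular (fun i j h => hu.1 i j h)]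
  exact Finset.prod_eq_one fun i _ => hu.2 i

theorem IsUpperUnip.inv {n : ℕ} {D : Type} [NormedCommRing D] {u v : Matrix (Fin n) (Fin n) D} (hu : IsUpperUnip u)
    (huv : u * v = 1) : IsUpperUnip v := by
  have hdet : IsUnit u.det := by rw [hu.det]; exact isUnit_one
  have hv : v = u⁻¹ := (Matrix.inv_eq_right_inv huv).symm
  have hinv : Invertible u := Matrix.invertibleOfIsUnitDet u hdet
  have hb : (u⁻¹).BlockTriangular id :=
    Matrix.blockTriangular_inv_of_blockTriangular (fun i j h => hu.1 i j h)
  rw [← hv] at hb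
  refine ⟨fun i j h => hb h, fun i => ?_⟩
  have h1 : (u * v) i i = 1 := by rw [huv]; exact Matrix.one_apply_eq i
  rw [Matrix.mul_apply, Finset.sum_eq_single i] at h1
  · rwa [hu.2, one_mul] at h1
  · intro k _ hk
    rcases lt_or_gt_of_ne hk with h | h
    · rw [hu.1 i k h, zero_mul]
    · rw [hb h, mul_zero]
  · simp

variable (n D) in
/-- `N = N^n(D)`, the group of upper unipotent matrices. -/
def Unip : Subgroup (GL (Fin n) D) where
  carrier := {u | IsUpperUnip (u : Matrix (Fin n) (Fin n) D)}
  mul_mem' := fun hu hv => IsUpperUnip.mul hu hv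
  one_mem' := IsUpperUnip.one
  inv_mem' := by
    intro u hu
    exact IsUpperUnip.inv hu (Units.mul_inv u)

instance : MeasurableSpace (Unip n D) := borel _

instance : BorelSpace (Unip n D) := ⟨rfl⟩

/-- An upper unipotent matrix as an element of `N`. -/
def mkUnip (u : Matrix (Fin n) (Fin n) D) (hu : IsUpperUnip u) : Unip n D :=
  ⟨Matrix.GeneralLinearGroup.mk'' u (by rw [hu.det]; exact isUnit_one), hu⟩

/-- The underlying matrix of an element of `N`. -/
def umat (u : Unip n D) : Matrix (Fin n) (Fin n) D := ((u : GL (Fin n) D) : Matrix _ _ D)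

theorem umat_mul {n : ℕ} {D : Type} [NormedCommRing D] (u v : Unip n D) : umat (u * v) = umat u * umat v := rfl

theorem umat_one {n : ℕ} {D : Type} [NormedCommRing D] : umat (1 : Unip n D) = 1 := rfl

/-- The (right) action `x ↦ ūᵗ x u` of `N` on `H^n(D)`. -/
def act (x : Herm n D) (u : Unip n D) : Herm n D :=
  ⟨star' (umat u) * x.1 * umat u, by
    change star' _ = _
    have hx : star' x.1 = x.1 := x.2
    rw [star'_mul, star'_mul, star'_star', hx, Matrix.mul_assoc]⟩

theorem act_one (x : Herm n D) : act x 1 = x := by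
  apply Subtype.ext
  simp [act, umat_one, star'_one]

theorem act_mul (x : Herm n D) (u v : Unip n D) : act x (u * v) = act (act x u) v := by
  apply Subtype.ext
  simp [act, umat_mul, star'_mul, Matrix.mul_assoc]

/-- The stabilizer `N_g` of `g ∈ H^n(D)` in `N`. -/
def stab (g : Herm n D) : Subgroup (Unip n D) where
  carrier := {u | act g u = g}
  mul_mem' := by
    intro u v hu hv
    simp only [Set.mem_ofPred_eq] at *
    rw [act_mul, hu, hv]
  one_mem' := act_one g
  inv_mem' := by
    intro u hu
    simp only [Set.mem_ofPred_eq] at *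
    conv_lhs => rw [← hu]
    rw [← act_mul, mul_inv_cancel, act_one]

/-- The character `χ(u) = ψ(∑ (u_{i,i+1} + ū_{i,i+1}))` of `N`. -/
def chi (ψ : AddChar ℝ Circle) (u : Unip n D) : ℂ :=
  ψ (∑ i : Fin n, ∑ j : Fin n,
    if (i : ℕ) + 1 = j then Algebra.trace ℝ D (umat u i j) else 0)

/-! ### Haar measures -/

/-- Real coordinates on the Lie algebra `𝔫` of `N`: two for each entry above the diagonal. -/
abbrev Coord (n : ℕ) : Type :=
  EuclideanSpace ℝ ({p : Fin n × Fin n // p.1 < p.2} × Fin 2)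

/-- The element of `𝔫` with given coordinates: the entry with coordinates `(s, t)` is
`(s + t δ) / √2`. In these coordinates Lebesgue measure is, in each entry, `dx₁ dx₂` for
`(x₁, x₂) ∈ ℝ ⊕ ℝ` and `2 dx dy` for `x + i y ∈ ℂ`. -/
def lieMat (x : Coord n) : Matrix (Fin n) (Fin n) D := fun i j =>
  if h : i < j then
    (Real.sqrt 2)⁻¹ • (x (⟨(i, j), h⟩, 0) • (1 : D) + x (⟨(i, j), h⟩, 1) • QuadAlg.δ)
  else 0

theorem lieMat_add (x y : Coord n) :
    (lieMat (x + y) : Matrix (Fin n) (Fin n) D) = lieMat x + lieMat y := by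
  ext i j
  by_cases h : i < j
  · simp only [lieMat, Matrix.add_apply, h, dif_pos, PiLp.add_apply, ← smul_add]
    congr 1
    rw [add_smul, add_smul]; abel
  · simp [lieMat, h]

theorem lieMat_smul (r : ℝ) (x : Coord n) :
    (lieMat (r • x) : Matrix (Fin n) (Fin n) D) = r • lieMat x := by
  ext i j
  by_cases h : i < j
  · simp only [lieMat, Matrix.smul_apply, h, dif_pos, PiLp.smul_apply, smul_eq_mul, smul_add,
      smul_smul]
    congr 2 <;> ring
  · simp [lieMat, h]

theorem lieMat_zero : (lieMat (0 : Coord n) : Matrix (Fin n) (Fin n) D) = 0 := by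
  ext i j
  simp [lieMat]

theorem isUpperUnip_one_add_lieMat (x : Coord n) :
    IsUpperUnip (1 + lieMat x : Matrix (Fin n) (Fin n) D) := by
  refine ⟨fun i j h => ?_, fun i => ?_⟩
  · simp [lieMat, not_lt_of_gt h, Matrix.one_apply_ne (ne_of_gt h)]
  · simp [lieMat]

/-- The exponential of a nilpotent `n × n` matrix `X` (for which `X ^ n = 0`). -/
def nilExp (X : Matrix (Fin n) (Fin n) D) : Matrix (Fin n) (Fin n) D :=
  ∑ k ∈ Finset.range n, ((k.factorial : ℝ)⁻¹) • X ^ k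

theorem lieMat_pow (x : Coord n) (k : ℕ) (i j : Fin n) (h : j ≤ i) :
    ((lieMat x : Matrix (Fin n) (Fin n) D) ^ (k + 1)) i j = 0 := by
  induction k generalizing j with
  | zero => simp [lieMat, not_lt_of_ge h]
  | succ k ih =>
    rw [pow_succ, Matrix.mul_apply]
    refine Finset.sum_eq_zero fun l _ => ?_
    rcases le_or_gt l i with hl | hl
    · rw [ih l hl, zero_mul]
    · have : (lieMat x : Matrix (Fin n) (Fin n) D) l j = 0 := by
        simp [lieMat, not_lt_of_ge (h.trans hl.le)]
      rw [this, mul_zero]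

theorem isUpperUnip_nilExp (x : Coord n) :
    IsUpperUnip (nilExp (lieMat x) : Matrix (Fin n) (Fin n) D) := by
  have key : ∀ i j : Fin n, j ≤ i → (nilExp (lieMat x) : Matrix (Fin n) (Fin n) D) i j =
      (1 : Matrix (Fin n) (Fin n) D) i j := by
    intro i j h
    have hn : n = (n - 1) + 1 := by have := i.2; omega
    have h0 : ∀ k ∈ Finset.range (n - 1),
        ((((k + 1).factorial : ℝ)⁻¹) • (lieMat x : Matrix (Fin n) (Fin n) D) ^ (k + 1)) i j = 0 := by
      intro k _
      rw [Matrix.smul_apply, lieMat_pow x k i j h, smul_zero]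
    have hr : Finset.range n = Finset.range ((n - 1) + 1) := by rw [← hn]
    rw [nilExp, hr, Finset.sum_range_succ', Matrix.add_apply, Matrix.sum_apply,
      Finset.sum_eq_zero h0]
    simp
  refine ⟨fun i j h => ?_, fun i => ?_⟩
  · rw [key i j h.le, Matrix.one_apply_ne (ne_of_gt h)]
  · rw [key i i le_rfl, Matrix.one_apply_eq]

variable (n D) in
/-- The standard Haar measure `du` on `N`: the product of the Haar measures on `D` in the
entries above the diagonal. -/
def haarN : Measure (Unip n D) :=
  Measure.map (fun x : Coord n => mkUnip (1 + lieMat x) (isUpperUnip_one_add_lieMat x)) volume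

/-- The Lie algebra `𝔫_g = {X ∈ 𝔫 | X̄ᵗ g + g X = 0}` of the stabilizer `N_g`. -/
def stabLie (g : Herm n D) : Submodule ℝ (Coord n) where
  carrier := {x | star' (lieMat x) * g.1 + g.1 * lieMat x = 0}
  add_mem' := by
    intro x y hx hy
    simp only [Set.mem_ofPred_eq] at *
    rw [lieMat_add, star'_add, Matrix.add_mul, Matrix.mul_add, add_add_add_comm, hx, hy, add_zero]
  zero_mem' := by
    simp only [Set.mem_ofPred_eq]
    rw [lieMat_zero, star'_zero, Matrix.zero_mul, Matrix.mul_zero, add_zero]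
  smul_mem' := by
    intro r x hx
    simp only [Set.mem_ofPred_eq] at *
    rw [lieMat_smul, star'_smul, Matrix.smul_mul, Matrix.mul_smul, ← smul_add, hx, smul_zero]

/-- The standard Haar measure of the unipotent group `N_g`, as a measure on `N` carried by `N_g`:
the image under `exp : 𝔫_g → N_g` of Lebesgue measure on `𝔫_g` (for the Euclidean structure
induced from `𝔫`). -/
def haarStab (g : Herm n D) : Measure (Unip n D) :=
  Measure.map (fun x : stabLie g => mkUnip (nilExp (lieMat x.1)) (isUpperUnip_nilExp x.1)) volume

/-- The quotient of `N` by `N_g`. As `u ↦ ūᵗ g u` is a right action, this is the set of cosets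
`N_g u`, that is, the orbit of `g`. -/
abbrev QuotStab (g : Herm n D) : Type := Quotient (QuotientGroup.rightRel (stab g))

/-- `ν` is the quotient of the Haar measure of `N` by that of `N_g`:
`∫_N f(u) du = ∫_{N/N_g} ∫_{N_g} f(s u) ds dν(u)`. -/
def IsQuotientMeasure (g : Herm n D) (ν : Measure (QuotStab g)) : Prop :=
  ∀ f : Unip n D → ℝ≥0∞, Measurable f →
    ∫⁻ u, f u ∂(haarN n D) = ∫⁻ q, ∫⁻ s, f (s * Quotient.out q) ∂(haarStab g) ∂ν

open Classical in
/-- The (unique) quotient measure on `N/N_g`. -/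
def quotMeasure (g : Herm n D) : Measure (QuotStab g) :=
  if h : ∃ ν : Measure (QuotStab g), IsQuotientMeasure g ν then h.choose else 0

/-! ### Kloosterman integrals -/

/-- The regular Kloosterman integral `∫_N Φ(ūᵗ a u) χ(u) du` at `diag(a)`. -/
def regInt (ψ : AddChar ℝ Circle) (Φ : Herm n D → ℂ) (a : Fin n → ℝ) : ℂ :=
  ∫ u, Φ (act (ofReal (Matrix.diagonal a) (Matrix.diagonal_transpose a)) u) * chi ψ u ∂(haarN n D)

/-- The integrand `Φ(ūᵗ g u) χ(u)` on `N/N_g`; it does not depend on the choice of the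
representative of the coset when `χ` is trivial on `N_g`. -/
def orbIntegrand (ψ : AddChar ℝ Circle) (Φ : Herm n D → ℂ) (g : Herm n D) (q : QuotStab g) : ℂ :=
  Φ (act g (Quotient.out q)) * chi ψ (Quotient.out q)

/-- The Kloosterman integral `∫_{N/N_g} Φ(ūᵗ g u) χ(u) du`. -/
def orbInt (ψ : AddChar ℝ Circle) (Φ : Herm n D → ℂ) (g : Herm n D) : ℂ :=
  ∫ q, orbIntegrand ψ Φ g q ∂(quotMeasure g)

/-! ### Schwartz functions along the determinant -/

/-- `F` is a Schwartz function on `E` that vanishes with all its derivatives outside `W`, that is,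
a Schwartz function on the open set `W` extended by zero. -/
def IsSchwartzOn {E : Type*} [NormedAddCommGroup E] [NormedSpace ℝ E] (W : Set E)
    (F : 𝓢(E, ℂ)) : Prop :=
  ∀ x ∉ W, ∀ k : ℕ, iteratedFDeriv ℝ k F x = 0

/-- For an open set `V` of reals (`ℝ` or `ℝˣ`), `Φ` restricts to an element of
`𝓢^{det,V}(det⁻¹ V)`: it is smooth on `det⁻¹ V`, and `(f ∘ det) Φ` is a Schwartz function on
`det⁻¹ V` for every Schwartz function `f` on `V`. -/
def IsSchwartzAlongDet (V : Set ℝ) (Φ : Herm n D → ℂ) : Prop :=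
  ContDiffOn ℝ ∞ Φ (hdet ⁻¹' V) ∧
  ∀ f : 𝓢(ℝ, ℂ), IsSchwartzOn V f →
    ∃ F : 𝓢(Herm n D, ℂ), IsSchwartzOn (hdet ⁻¹' V) F ∧
      ∀ x, hdet x ∈ V → F x = f (hdet x) * Φ x

/-! ### Orbit representatives -/

/-- The `m × m` permutation matrix `w_m` with ones on the antidiagonal. -/
def antidiag (m : ℕ) : Matrix (Fin m) (Fin m) ℝ := fun i j => if (i : ℕ) + j + 1 = m then 1 else 0

/-- The block diagonal matrix with blocks `a_k w_{m_k}`, where `m_1 + ... + m_j = n` is the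
composition `c`. -/
def blockRep (c : Composition n) (a : Fin c.length → ℝ) : Matrix (Fin n) (Fin n) ℝ := fun i j =>
  if c.index i = c.index j ∧
      (c.invEmbedding i : ℕ) + (c.invEmbedding j : ℕ) + 1 = c.blocksFun (c.index i) then
    a (c.index i)
  else 0

theorem blockRep_transpose (c : Composition n) (a : Fin c.length → ℝ) :
    (blockRep c a)ᵀ = blockRep c a := by
  ext i j
  simp only [blockRep, Matrix.transpose_apply]
  by_cases h : c.index i = c.index j
  · simp only [h, add_comm (c.invEmbedding j : ℕ)]
  · rw [if_neg (fun hh => h hh.1.symm), if_neg (fun hh => h hh.1)]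

/-- The leading principal minor `Δ_k`. -/
def minor (k : ℕ) (g : Matrix (Fin n) (Fin n) ℝ) : ℝ :=
  (g.toSquareBlockProp fun i => (i : ℕ) < k).det

/-! ### The transfer factor -/

/-- `c` is the constant of the Weil formula for `ℂ` and `ψ`. With the Fourier transform
`𝓕f(x) = ∫ f(y) ψ(Tr(x ȳ)) dμ(y)`, where `μ` is the self-dual Haar measure (which is expressed by
Fourier inversion), the Fourier transform of the distribution `ψ(a x x̄) dμ(x)` is
`|a|⁻¹ sign(a) c ψ(-x x̄ / a) dμ(x)`. -/
def IsWeilConst (ψ : AddChar ℝ Circle) (c : ℂ) : Prop :=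
  ∃ μ : Measure ℂ, μ.IsAddHaarMeasure ∧
    (∀ (f : 𝓢(ℂ, ℂ)) (z : ℂ),
      ∫ x, (∫ y, f y * ψ (Algebra.trace ℝ ℂ (x * starRingEnd ℂ y)) ∂μ)
        * ψ (-Algebra.trace ℝ ℂ (x * starRingEnd ℂ z)) ∂μ = f z) ∧
    ∀ (f : 𝓢(ℂ, ℂ)) (a : ℝ), a ≠ 0 →
      ∫ x, (ψ (a * Complex.normSq x) : ℂ)
          * (∫ y, f y * ψ (Algebra.trace ℝ ℂ (x * starRingEnd ℂ y)) ∂μ) ∂μ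
        = ((|a|⁻¹ * Real.sign a : ℝ) : ℂ) * c
          * ∫ x, (ψ (-(Complex.normSq x / a)) : ℂ) * f x ∂μ

open Classical in
/-- The Weil constant `c(ℂ, ψ)`. -/
def weilConst (ψ : AddChar ℝ Circle) : ℂ :=
  if h : ∃ c, IsWeilConst ψ c then h.choose else 0

/-- The regular transfer factor `sign(a_1) sign(a_1 a_2) ... sign(a_1 ... a_{n-1})`. -/
def regFactor (a : Fin n → ℝ) : ℂ :=
  ((∏ k ∈ Finset.univ.filter (fun k : Fin n => (k : ℕ) + 1 < n),
    Real.sign (∏ i ∈ Finset.Iic k, a i) : ℝ) : ℂ)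

/-- The transfer factor `γ(a w_m, ψ)`; here `ψ⁻¹ = ψ̄`. -/
def antidiagFactor : ℕ → ℝ → AddChar ℝ Circle → ℂ
  | 0, _, _ => 1
  | m + 1, a, ψ => antidiagFactor m (-a⁻¹) ψ⁻¹ * weilConst ψ ^ ((m + 1) * m / 2)
      * ((Real.sign ((-a⁻¹) • antidiag m).det : ℝ) : ℂ)

/-- The transfer factor of the block diagonal matrix with blocks `a w_m` for `(m, a)` in the list:
`γ(diag(x, y)) = γ(x) γ(y) sign(det x)^r` with `r` the size of `y`. -/
def listFactor (ψ : AddChar ℝ Circle) : List (ℕ × ℝ) → ℂ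
  | [] => 1
  | (m, a) :: l => antidiagFactor m a ψ * listFactor ψ l
      * ((Real.sign (a • antidiag m).det : ℝ) : ℂ) ^ (l.map Prod.fst).sum

/-- The extended transfer factor `γ(g, ψ)` of `g = blockRep c a`. -/
def factor (ψ : AddChar ℝ Circle) (c : Composition n) (a : Fin c.length → ℝ) : ℂ :=
  listFactor ψ (List.ofFn fun k => (c.blocksFun k, a k))

end Kloosterman

end

/-!
All representatives are monomial matrices, encoded by `Monomial`: an involution `σ` and a coefficient
for each row. For such a `g` the stabilizer has an explicit Lie algebra, and the coordinates above the
diagonal indexed by a set `K` of positions parametrize a transversal `U` of the stabilizer in `N`. The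
map (transversal, stabilizer) → `N` is triangular with constant Jacobian, and so is the map from the
transversal to suitable coordinates of the orbit. The first fact gives existence and uniqueness of the
quotient measure and the formula `Monomial.orbInt_eq` for the orbit integral as an integral
`Monomial.J` over `K → ℝ`, with a constant that is the same for `ℝ ⊕ ℝ` and `ℂ`; the second one gives
absolute convergence for Schwartz functions (`Monomial.integrable_actM_U`). The determinant is constant
on orbits, so multiplication by a function of it reduces the theorem to Schwartz functions
(`Transfers.orbInt_eq`).

Schwartz functions `Φ` and `Ψ` match (`Matching`) if their regular integrals agree up to the regular
transfer factor and a constant. Two operations preserve this. First, a block diagonal matrix has an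
orbit integral that is an iterated one, over the first block and over its Schur complement
(`Monomial.integrable_and_J_cat`); freezing a last diagonal entry therefore gives matching functions of
smaller size (`Matching.snoc`). The cut-off that keeps them Schwartz also fixes the sign of the
determinant of the first block. Secondly, the Fourier transforms of matching functions match for the
conjugate character (`Matching.fourier`). The proof is by induction on the size: the regular integral
of a Fourier transform with a given first entry leads to a Gaussian integral over the first row
(`exists_fourier_slice_actM`). For `ℝ ⊕ ℝ` the form is a sum of hyperbolic planes and for `ℂ` a sum of
definite ones; the quotient of the two Gaussian constants is a power of the Weil constant, `i` or `-i`,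
times signs (`gaussProd_prod_eq`, `isWeilConst_iff`).

For `g = a w_n` the orbit is the affine space of hermitian matrices with the same entries above the
antidiagonal, and the character is a linear function of the entries just below it
(`Monomial.integral_J_anti`). The union over `d` of the orbits of `-a⁻¹ w_{n-1} ⊕ d` is an affine
space too, and partial Fourier inversion exchanges the integrals over the two
(`exists_J_single_eq`). Since Fourier transforms match, this determines the transfer factor of `a w_n`
from that of `-a⁻¹ w_{n-1}` (`transfers_single`). For several blocks, integrating out the first one
leaves matching functions on the others, because the case of a first block followed by a diagonal
matrix is known (`Transfers.cons`), and induction on the number of blocks concludes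
(`exists_transfers`). If the determinant vanishes, the condition on the minor says that only a last
block of size one is zero; that case follows by continuity (`transfers_of_eq_one`).

The factor is a product of signs and Weil constants, so its fourth power is one.
-/

set_option linter.unusedSectionVars false
set_option linter.unusedSimpArgs false

noncomputable section

namespace Kloosterman

/-! ### Triangular changes of variables -/

section Triangular

variable {ι : Type*} [Fintype ι]

/-- `F` differs from the identity, in each coordinate, by a function of the coordinates of strictly
smaller height. -/
def IsTriangular (ht : ι → ℕ) (F : (ι → ℝ) → ι → ℝ) : Prop :=
  ∀ i x x', (∀ j, ht j < ht i → x j = x' j) → F x i - x i = F x' i - x' i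

open Classical in
/-- The shear in the coordinates of height `h` is a skew product of the identity with translations. -/
theorem shear_measurePreserving (ht : ι → ℕ) (F : (ι → ℝ) → ι → ℝ) (hF : IsTriangular ht F)
    (hm : Measurable F) (h : ℕ) :
    MeasurePreserving (fun x i => if ht i = h then F x i else x i) volume volume := by
  let e := MeasurableEquiv.piEquivPiSubtypeProd (fun _ : ι => ℝ) (fun i => ht i ≠ h)
  have he : MeasurePreserving e volume volume :=
    volume_preserving_piEquivPiSubtypeProd (fun _ : ι => ℝ) (fun i => ht i ≠ h)
  let G : ({i // ht i ≠ h} → ℝ) → {i // ¬ ht i ≠ h} → ℝ := fun a i =>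
    F (e.symm (a, 0)) i - e.symm (a, 0) i
  have hG : Measurable G := by
    refine measurable_pi_lambda _ fun i => ?_
    have h1 : Measurable fun a : {i // ht i ≠ h} → ℝ => e.symm (a, 0) :=
      e.symm.measurable.comp (measurable_id.prodMk measurable_const)
    exact ((measurable_pi_apply _).comp (hm.comp h1)).sub ((measurable_pi_apply _).comp h1)
  have hs : MeasurePreserving
      (fun p : ({i // ht i ≠ h} → ℝ) × ({i // ¬ ht i ≠ h} → ℝ) => (p.1, p.2 + G p.1))
      (volume.prod volume) (volume.prod volume) := by
    refine (MeasurePreserving.id volume).skew_product (g := fun a c => c + G a) ?_ ?_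
    · exact measurable_snd.add (hG.comp measurable_fst)
    · exact Filter.Eventually.of_forall fun a => map_add_right_eq_self _ _
  have := (he.symm e).comp (hs.comp he)
  suffices hfun : (fun (x : ι → ℝ) i => if ht i = h then F x i else x i) = e.symm ∘
      (fun p : ({i // ht i ≠ h} → ℝ) × ({i // ¬ ht i ≠ h} → ℝ) => (p.1, p.2 + G p.1)) ∘ e by
    rw [hfun]; exact this
  funext x i
  by_cases hi : ht i = h
  · have key := hF i x (e.symm ((e x).1, 0)) (fun j hj => by
      have hj' : ht j ≠ h := by omega
      simp [e, MeasurableEquiv.piEquivPiSubtypeProd, Equiv.piEquivPiSubtypeProd, hj'])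
    have : (e.symm ((e x).1, (e x).2 + G (e x).1)) i = x i + G (e x).1 ⟨i, by simpa using hi⟩ := by
      simp [e, MeasurableEquiv.piEquivPiSubtypeProd, Equiv.piEquivPiSubtypeProd, hi]
    simp only [Function.comp_apply, if_pos hi]
    rw [this]
    simp only [G]
    linarith
  · simp [hi, e, MeasurableEquiv.piEquivPiSubtypeProd, Equiv.piEquivPiSubtypeProd]

open Classical in
/-- The increment depends only on coordinates that the shear leaves fixed, so subtracting it inverts
the shear. -/
theorem shear_bijective {ι : Type*} (ht : ι → ℕ) (F : (ι → ℝ) → ι → ℝ) (hF : IsTriangular ht F) (h : ℕ) :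
    Function.Bijective (fun (x : ι → ℝ) i => if ht i = h then F x i else x i) := by
  refine Function.bijective_iff_has_inverse.2
    ⟨fun x i => if ht i = h then x i - (F x i - x i) else x i, fun x => ?_, fun x => ?_⟩
  · funext i
    by_cases hi : ht i = h
    · have := hF i (fun i => if ht i = h then F x i else x i) x fun j hj => by
        rw [if_neg (by omega)]
      simp only [if_pos hi] at this ⊢
      linarith
    · simp [hi]
  · funext i
    by_cases hi : ht i = h
    · have := hF i (fun i => if ht i = h then x i - (F x i - x i) else x i) x fun j hj => by
        rw [if_neg (by omega)]
      simp only [if_pos hi] at this ⊢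
      linarith
    · simp [hi]

/-- A triangular map is the composition of the shears in the coordinates of a fixed height. -/
theorem IsTriangular.bijective_measurePreserving {ht : ι → ℕ} {F : (ι → ℝ) → ι → ℝ}
    (hF : IsTriangular ht F) (hm : Measurable F) :
    Function.Bijective F ∧ MeasurePreserving F volume volume := by
  classical
  have key : ∀ h : ℕ, Function.Bijective (fun (x : ι → ℝ) i => if ht i < h then F x i else x i) ∧
      MeasurePreserving (fun (x : ι → ℝ) i => if ht i < h then F x i else x i) volume volume := by
    intro h
    induction h with
    | zero => simpa using ⟨Function.bijective_id, MeasurePreserving.id _⟩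
    | succ h ih =>
      -- The shear at height `h` is applied first, while the lower coordinates are still unchanged.
      have hc : (fun (x : ι → ℝ) i => if ht i < h + 1 then F x i else x i) =
          (fun (x : ι → ℝ) i => if ht i < h then F x i else x i) ∘
          (fun x i => if ht i = h then F x i else x i) := by
        funext x i
        have h1 := hF i (fun i => if ht i = h then F x i else x i) x
        simp only [Function.comp_apply]
        rcases lt_trichotomy (ht i) h with hi | hi | hi
        · have := h1 fun j hj => by rw [if_neg (by omega)]
          rw [if_pos (by omega), if_pos hi]
          simp only [if_neg (show ht i ≠ h by omega)] at this
          linarith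
        · rw [if_pos (by omega), if_neg (by omega), if_pos hi]
        · rw [if_neg (by omega), if_neg (by omega), if_neg (by omega)]
      rw [hc]
      exact ⟨ih.1.comp (shear_bijective ht F hF h),
        ih.2.comp (shear_measurePreserving ht F hF hm h)⟩
  have := key (Finset.univ.sup ht + 1)
  have hlt : ∀ i, ht i < Finset.univ.sup ht + 1 := fun i =>
    Nat.lt_succ_of_le (Finset.le_sup (Finset.mem_univ i))
  simpa [hlt] using this

/-- The version of `IsTriangular.bijective_measurePreserving` in which the diagonal part of the map
is multiplication by non-zero constants. -/
theorem IsTriangular.map_volume_of_scaled {ht : ι → ℕ} {F : (ι → ℝ) → ι → ℝ} {c : ι → ℝ}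
    (hc : ∀ i, c i ≠ 0)
    (hF : ∀ i x x', (∀ j, ht j < ht i → x j = x' j) → F x i - c i * x i = F x' i - c i * x' i)
    (hm : Measurable F) :
    Function.Bijective F ∧
      Measure.map F volume = ENNReal.ofReal (∏ i, |c i|)⁻¹ • (volume : Measure (ι → ℝ)) := by
  classical
  have hF' : IsTriangular ht fun x i => (c i)⁻¹ * F x i := by
    intro i x x' h
    have := hF i x x' h
    have hci := hc i
    have h2 : ∀ y : ι → ℝ, (c i)⁻¹ * F y i - y i = (c i)⁻¹ * (F y i - c i * y i) := by
      intro y; field_simp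
    rw [h2, h2, this]
  have hm' : Measurable fun x i => (c i)⁻¹ * F x i :=
    measurable_pi_lambda _ fun i => ((measurable_pi_apply i).comp hm).const_mul _
  obtain ⟨hb, hmp⟩ := hF'.bijective_measurePreserving hm'
  -- `F` is a triangular map followed by a diagonal one.
  have hcomp : F = (fun y i => c i * y i) ∘ fun x i => (c i)⁻¹ * F x i := by
    funext x i
    simp [mul_inv_cancel_left₀ (hc i)]
  have hbij : Function.Bijective fun (y : ι → ℝ) i => c i * y i :=
    Function.bijective_iff_has_inverse.2 ⟨fun y i => (c i)⁻¹ * y i,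
      fun y => by funext i; simp [inv_mul_cancel_left₀ (hc i)],
      fun y => by funext i; simp [mul_inv_cancel_left₀ (hc i)]⟩
  refine ⟨hcomp ▸ hbij.comp hb, ?_⟩
  have hms : Measurable fun (y : ι → ℝ) i => c i * y i :=
    measurable_pi_lambda _ fun i => (measurable_pi_apply i).const_mul _
  rw [hcomp, ← Measure.map_map hms hmp.measurable, hmp.map_eq]
  have hdet : (Matrix.diagonal c).det ≠ 0 := by
    rw [Matrix.det_diagonal]; exact Finset.prod_ne_zero_iff.2 fun i _ => hc i
  have := Real.map_matrix_volume_pi_eq_smul_volume_pi hdet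
  rw [Matrix.det_diagonal, abs_inv, Finset.abs_prod] at this
  have hfun : (fun (y : ι → ℝ) i => c i * y i) = Matrix.toLin' (Matrix.diagonal c) := by
    funext y i
    simp [Matrix.toLin'_apply, Matrix.mulVec_diagonal]
  rw [hfun]
  exact this

end Triangular

/-! ### Functions of temperate growth and Schwartz functions -/

section Temperate

variable {E F G : Type*} [NormedAddCommGroup E] [NormedSpace ℝ E]
  [NormedAddCommGroup F] [NormedSpace ℝ F] [NormedAddCommGroup G] [NormedSpace ℝ G]

theorem hasTemperateGrowth_linearMap [FiniteDimensional ℝ E] (f : E →ₗ[ℝ] F) :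
    Function.HasTemperateGrowth f :=
  (LinearMap.toContinuousLinearMap f).hasTemperateGrowth

theorem hasTemperateGrowth_linearMap_comp [FiniteDimensional ℝ F] (L : F →ₗ[ℝ] G) {f : E → F}
    (hf : f.HasTemperateGrowth) : (fun x => L (f x)).HasTemperateGrowth :=
  (hasTemperateGrowth_linearMap L).comp hf

theorem hasTemperateGrowth_prodMk {f : E → F} {g : E → G} (hf : f.HasTemperateGrowth)
    (hg : g.HasTemperateGrowth) : (fun x => (f x, g x)).HasTemperateGrowth := by
  have h1 := (ContinuousLinearMap.inl ℝ F G).hasTemperateGrowth.comp hf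
  have h2 := (ContinuousLinearMap.inr ℝ F G).hasTemperateGrowth.comp hg
  convert h1.add h2 using 1
  funext x
  simp

theorem hasTemperateGrowth_pi {ι : Type*} [Fintype ι] {f : E → ι → F}
    (hf : ∀ i, (fun x => f x i).HasTemperateGrowth) : f.HasTemperateGrowth := by
  classical
  have h : ∀ i, (fun x => ContinuousLinearMap.single ℝ (fun _ : ι => F) i
      (f x i)).HasTemperateGrowth := fun i =>
    (ContinuousLinearMap.single ℝ (fun _ : ι => F) i).hasTemperateGrowth.comp (hf i)
  have h2 := Function.HasTemperateGrowth.sum (s := Finset.univ) fun i _ => h i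
  convert h2 using 1
  funext x i
  simp [Finset.sum_apply, Pi.single_apply]

theorem hasTemperateGrowth_fst_comp {f : E → F × G} (hf : f.HasTemperateGrowth) :
    (fun x => (f x).1).HasTemperateGrowth :=
  (ContinuousLinearMap.fst ℝ F G).hasTemperateGrowth.comp hf

theorem hasTemperateGrowth_snd_comp {f : E → F × G} (hf : f.HasTemperateGrowth) :
    (fun x => (f x).2).HasTemperateGrowth :=
  (ContinuousLinearMap.snd ℝ F G).hasTemperateGrowth.comp hf

theorem hasTemperateGrowth_prod {ι R : Type*} [NormedCommRing R] [NormedAlgebra ℝ R]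
    {f : ι → E → R} (s : Finset ι) (hf : ∀ i, (f i).HasTemperateGrowth) :
    (fun x => ∏ i ∈ s, f i x).HasTemperateGrowth := by
  classical
  induction s using Finset.induction_on with
  | empty => simp
  | insert a s ha ih => simpa [Finset.prod_insert ha] using (hf a).fun_mul ih

/-- Composition with a map of temperate growth that has a left inverse of temperate growth. -/
def compLeftInv {g : E → F} (hg : g.HasTemperateGrowth) {h : F → E} (hh : h.HasTemperateGrowth)
    (hhg : ∀ x, h (g x) = x) (f : 𝓢(F, ℂ)) : 𝓢(E, ℂ) :=
  SchwartzMap.compCLM ℂ hg (by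
    obtain ⟨k, C, hC⟩ := hh.2 0
    refine ⟨k, C, fun x => ?_⟩
    have := hC (g x)
    rwa [norm_iteratedFDeriv_zero, hhg] at this) f

theorem compLeftInv_apply {g : E → F} (hg : g.HasTemperateGrowth) {h : F → E}
    (hh : h.HasTemperateGrowth) (hhg : ∀ x, h (g x) = x) (f : 𝓢(F, ℂ)) (x : E) :
    compLeftInv hg hh hhg f x = f (g x) := rfl

end Temperate

section PartialIntegral

variable {E Y : Type} [NormedAddCommGroup E] [NormedSpace ℝ E] [NormedAddCommGroup Y]
  [NormedSpace ℝ Y] [FiniteDimensional ℝ Y] [MeasurableSpace Y] [BorelSpace Y]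
  (μ : Measure Y) [μ.IsAddHaarMeasure]

/-- Decay in `x` that is uniform up to an integrable function of `y`. -/
theorem exists_bound_mul_integrable {F : Type} [NormedAddCommGroup F] [NormedSpace ℝ F]
    (f : 𝓢(E × Y, F)) (m : ℕ) : ∃ g : Y → ℝ, Integrable g μ ∧
      ∀ x y, ‖x‖ ^ m * ‖f (x, y)‖ ≤ g y := by
  obtain ⟨C, hC⟩ := f.decay m 0
  obtain ⟨C', hC'⟩ := f.decay (m + μ.integrablePower) 0
  refine ⟨fun y => 2 ^ μ.integrablePower * (C + C') * (1 + ‖y‖) ^ (-(μ.integrablePower : ℝ)),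
    Measure.integrable_pow_neg_integrablePower μ |>.const_mul _, fun x y => ?_⟩
  have h1 := hC.2 (x, y)
  have h2 := hC'.2 (x, y)
  rw [norm_iteratedFDeriv_zero] at h1 h2
  have hx : ‖x‖ ≤ ‖(x, y)‖ := by simp [Prod.norm_def]
  have hy : ‖y‖ ≤ ‖(x, y)‖ := by simp [Prod.norm_def]
  have h3 : ‖x‖ ^ m * ‖f (x, y)‖ ≤ ‖(x, y)‖ ^ m * ‖f (x, y)‖ := by gcongr
  have h4 : ‖y‖ ^ μ.integrablePower * (‖x‖ ^ m * ‖f (x, y)‖) ≤ C' := by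
    refine le_trans ?_ h2
    rw [pow_add, mul_comm (‖(x, y)‖ ^ m), mul_assoc]
    gcongr
  have := pow_mul_le_of_le_of_pow_mul_le (k := 0) (l := μ.integrablePower) (norm_nonneg y)
    (by positivity) (h3.trans h1) (by simpa using h4)
  simpa using this

theorem hasFDerivAt_partialIntegral {F : Type} [NormedAddCommGroup F] [NormedSpace ℝ F]
    [CompleteSpace F] (f : 𝓢(E × Y, F)) (x : E) :
    HasFDerivAt (fun x => ∫ y, f (x, y) ∂μ)
      (∫ y, (SchwartzMap.postcompCLM (𝕜 := ℝ) (ContinuousLinearMap.precomp F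
        (ContinuousLinearMap.inl ℝ E Y)) (SchwartzMap.fderivCLM ℝ (E × Y) F f)) (x, y) ∂μ) x := by
  set f' := SchwartzMap.postcompCLM (𝕜 := ℝ) (ContinuousLinearMap.precomp F
        (ContinuousLinearMap.inl ℝ E Y)) (SchwartzMap.fderivCLM ℝ (E × Y) F f)
  obtain ⟨g, hg, hbound⟩ := exists_bound_mul_integrable μ f' 0
  obtain ⟨g0, hg0, hbound0⟩ := exists_bound_mul_integrable μ f 0
  have hmeas : ∀ x, AEStronglyMeasurable (fun y => f (x, y)) μ := fun x =>
    (f.continuous.comp (by fun_prop)).aestronglyMeasurable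
  refine hasFDerivAt_integral_of_dominated_of_fderiv_le (F := fun x y => f (x, y))
    (F' := fun x y => f' (x, y)) (bound := g) (s := Set.univ) Filter.univ_mem
    (Filter.Eventually.of_forall hmeas) (hg0.mono' (hmeas x) ?_) ?_ ?_ hg ?_
  · exact Filter.Eventually.of_forall fun y => by simpa using hbound0 x y
  · exact (f'.continuous.comp (by fun_prop)).aestronglyMeasurable
  · exact Filter.Eventually.of_forall fun y z _ => by simpa using hbound z y
  · refine Filter.Eventually.of_forall fun y z _ => ?_
    have h1 := f.hasFDerivAt (z, y)
    have h2 : HasFDerivAt (fun z : E => (z, y)) (ContinuousLinearMap.inl ℝ E Y) z := by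
      exact hasFDerivAt_prodMk_left z y
    exact h1.comp z h2

/-- The derivative of a partial integral is the partial integral of a partial derivative, which takes
values in another space; hence the induction is over all values of `F`. -/
theorem partialIntegral_decay (k : ℕ) : ∀ {F : Type} [NormedAddCommGroup F] [NormedSpace ℝ F]
    [CompleteSpace F] (f : 𝓢(E × Y, F)), ContDiff ℝ k (fun x => ∫ y, f (x, y) ∂μ) ∧
      ∀ m : ℕ, ∃ C, ∀ x, ‖x‖ ^ m * ‖iteratedFDeriv ℝ k (fun x => ∫ y, f (x, y) ∂μ) x‖ ≤ C := by
  induction k with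
  | zero =>
    intro F _ _ _ f
    refine ⟨contDiff_zero.2 ?_, fun m => ?_⟩
    · exact continuous_iff_continuousAt.2 fun x => (hasFDerivAt_partialIntegral μ f x).continuousAt
    · obtain ⟨g, hg, hb⟩ := exists_bound_mul_integrable μ f m
      refine ⟨∫ y, g y ∂μ, fun x => ?_⟩
      rw [norm_iteratedFDeriv_zero]
      calc ‖x‖ ^ m * ‖∫ y, f (x, y) ∂μ‖ ≤ ‖x‖ ^ m * ∫ y, ‖f (x, y)‖ ∂μ := by
            gcongr; exact norm_integral_le_integral_norm _
        _ = ∫ y, ‖x‖ ^ m * ‖f (x, y)‖ ∂μ := (integral_const_mul _ _).symm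
        _ ≤ ∫ y, g y ∂μ := integral_mono_of_nonneg
            (Filter.Eventually.of_forall fun y => by positivity) hg
            (Filter.Eventually.of_forall fun y => hb x y)
  | succ k ih =>
    intro F _ _ _ f
    obtain ⟨h1, h2⟩ := ih (SchwartzMap.postcompCLM (𝕜 := ℝ) (ContinuousLinearMap.precomp F
        (ContinuousLinearMap.inl ℝ E Y)) (SchwartzMap.fderivCLM ℝ (E × Y) F f))
    have hd : fderiv ℝ (fun x => ∫ y, f (x, y) ∂μ) = _ :=
      funext fun x => (hasFDerivAt_partialIntegral μ f x).fderiv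
    refine ⟨?_, fun m => ?_⟩
    · push_cast
      refine contDiff_succ_iff_fderiv.2 ⟨fun x =>
        (hasFDerivAt_partialIntegral μ f x).differentiableAt, by simp, ?_⟩
      rw [hd]; exact h1
    · obtain ⟨C, hC⟩ := h2 m
      refine ⟨C, fun x => ?_⟩
      rw [← norm_iteratedFDeriv_fderiv, hd]
      exact hC x

/-- The integral of a Schwartz function over some of the variables is a Schwartz function of the
others. -/
def partialIntegral (f : 𝓢(E × Y, ℂ)) : 𝓢(E, ℂ) where
  toFun x := ∫ y, f (x, y) ∂μ
  smooth' := contDiff_infty.2 fun k => (partialIntegral_decay μ k f).1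
  decay' m k := (partialIntegral_decay μ k f).2 m

theorem partialIntegral_apply (f : 𝓢(E × Y, ℂ)) (x : E) :
    partialIntegral μ f x = ∫ y, f (x, y) ∂μ := rfl

end PartialIntegral

/-! ### Characters of the real line and Gaussian integrals -/

/-- Integrating the functional equation over a short interval shows that a continuous character is
differentiable, hence solves `f' = c f`. -/
theorem exists_eq_exp_of_continuous (ψ : AddChar ℝ Circle) (hψ : Continuous ψ) :
    ∃ t : ℝ, ∀ x, (ψ x : ℂ) = Complex.exp (2 * Real.pi * Complex.I * (t * x : ℝ)) := by
  let f : ℝ → ℂ := fun x => ψ x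
  have hf : Continuous f := continuous_induced_dom.comp hψ
  have hadd : ∀ x y, f (x + y) = f x * f y := fun x y => by
    simp [f, AddChar.map_add_eq_mul]
  have h0 : f 0 = 1 := by simp [f]
  let F : ℝ → ℂ := fun x => ∫ t in (0 : ℝ)..x, f t
  have hF : ∀ x, HasDerivAt F (f x) x := fun x =>
    intervalIntegral.integral_hasDerivAt_right (hf.intervalIntegrable _ _)
      hf.aestronglyMeasurable.stronglyMeasurableAtFilter hf.continuousAt
  -- The primitive `F` is not identically zero, because `F' = f` and `f 0 = 1`.
  obtain ⟨δ, hδ⟩ : ∃ δ, F δ ≠ 0 := by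
    by_contra! h
    have h1 := hF 0
    have h2 : F = fun _ => (0 : ℂ) := funext h
    rw [h2] at h1
    have := h1.unique (hasDerivAt_const (0 : ℝ) (0 : ℂ))
    rw [h0] at this
    exact one_ne_zero this
  -- `f` is a multiple of a difference of values of the differentiable function `F`.
  have hshift : ∀ x, f x * F δ = F (x + δ) - F x := by
    intro x
    have h1 : F (x + δ) - F x = ∫ t in x..(x + δ), f t :=
      intervalIntegral.integral_interval_sub_left (hf.intervalIntegrable _ _)
        (hf.intervalIntegrable _ _)
    rw [h1, ← intervalIntegral.integral_const_mul]
    have h2 := intervalIntegral.integral_comp_add_left (a := 0) (b := δ) f x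
    rw [add_zero] at h2
    rw [← h2]
    exact intervalIntegral.integral_congr fun t _ => (hadd x t).symm
  have hderiv : ∀ x, HasDerivAt f ((f δ - 1) / F δ * f x) x := by
    intro x
    have h1 : f = fun x => (F (x + δ) - F x) / F δ := by
      funext x
      rw [← hshift, mul_div_cancel_right₀ _ hδ]
    have h2 : HasDerivAt (fun x => (F (x + δ) - F x) / F δ) ((f (x + δ) - f x) / F δ) x :=
      (((hF (x + δ)).comp_add_const x δ).sub (hF x)).div_const _
    rw [← h1] at h2
    convert h2 using 1
    rw [hadd]; ring
  set c := (f δ - 1) / F δ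
  have hexp : ∀ x, f x = Complex.exp (c * x) := by
    have hconst : ∀ x, HasDerivAt (fun x : ℝ => f x * Complex.exp (-(c * x))) 0 x := by
      intro x
      have h1 : HasDerivAt (fun x : ℝ => Complex.exp (-(c * x)))
          (Complex.exp (-(c * x)) * (-(c * 1))) x :=
        (((Complex.ofRealCLM.hasDerivAt (x := x)).const_mul c).neg).cexp
      have := (hderiv x).mul h1
      exact this.congr_deriv (by ring)
    intro x
    have h1 := is_const_of_deriv_eq_zero (fun x => (hconst x).differentiableAt)
      (fun x => (hconst x).deriv) x 0
    simp only [h0, Complex.ofReal_zero, mul_zero, neg_zero, Complex.exp_zero, mul_one] at h1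
    rw [Complex.exp_neg] at h1
    field_simp at h1
    exact h1
  -- The values lie on the unit circle, so the exponent is imaginary.
  have hre : c.re = 0 := by
    have h1 : ‖f 1‖ = 1 := Circle.norm_coe _
    rw [hexp, Complex.norm_exp] at h1
    simpa using h1
  refine ⟨c.im / (2 * Real.pi), fun x => ?_⟩
  have hc : c = c.im * Complex.I := by
    apply Complex.ext <;> simp [hre]
  change f x = _
  rw [hexp, hc]
  congr 1
  have : (Real.pi : ℂ) ≠ 0 := by exact_mod_cast Real.pi_ne_zero
  simp
  field_simp

section Gauss

variable {B : Type} [Fintype B]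

open Filter Topology

/-- The Fourier transform of the oscillating Gaussian `e(∑ (c_j w_j² / 2 + l_j w_j))`, tested
against the Fourier transform of `φ`. It is obtained from the Gaussian integrals with
`c_j` replaced by `c_j + i δ`, where `δ > 0` tends to zero. -/
theorem integral_oscillating_gaussian_mul_fourier (c l μ : B → ℝ) (hc : ∀ j, c j ≠ 0)
    (φ : (B → ℝ) → ℂ) (hφ : Integrable φ)
    (hT : Integrable fun w : B → ℝ =>
      ∫ b, φ b * Complex.exp (-(2 * Real.pi * Complex.I * (∑ j, μ j * b j * w j : ℝ)))) :
    ∫ w : B → ℝ, Complex.exp (2 * Real.pi * Complex.I * (∑ j, (c j * w j ^ 2 / 2 + l j * w j) : ℝ))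
        * ∫ b, φ b * Complex.exp (-(2 * Real.pi * Complex.I * (∑ j, μ j * b j * w j : ℝ)))
      = (∏ j, (Complex.I / c j) ^ (1 / 2 : ℂ)) * ∫ b, φ b * Complex.exp
          (-(2 * Real.pi * Complex.I * (∑ j, (μ j * b j - l j) ^ 2 / (2 * c j) : ℝ))) := by
  set T := fun w : B → ℝ =>
      ∫ b, φ b * Complex.exp (-(2 * Real.pi * Complex.I * (∑ j, μ j * b j * w j : ℝ)))
  -- `G δ` is the Gaussian regularised by `δ`, and `K δ * R δ` is its Fourier transform.
  let β : ℝ → B → ℂ := fun δ j => Real.pi * (δ - Complex.I * c j)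
  let G : ℝ → (B → ℝ) → ℂ := fun δ w =>
    Complex.exp (-∑ j, β δ j * (w j : ℂ) ^ 2 + ∑ j, (2 * Real.pi * Complex.I * l j) * w j)
  have hpi := Real.pi_pos
  have hβ : ∀ δ, 0 < δ → ∀ j, 0 < (β δ j).re := fun δ hδ j => by
    simp [β]; positivity
  have hGi : ∀ δ, 0 < δ → Integrable (G δ) := fun δ hδ =>
    GaussianFourier.integrable_cexp_neg_sum_mul_add (hβ δ hδ) _
  have hGc : ∀ δ, Continuous (G δ) := fun δ => by fun_prop
  have hGn : ∀ δ, 0 ≤ δ → ∀ w, ‖G δ w‖ ≤ 1 := by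
    intro δ hδ w
    rw [Complex.norm_exp, Real.exp_le_one_iff]
    rw [Complex.add_re, Complex.neg_re, Complex.re_sum, Complex.re_sum]
    simp only [← Complex.ofReal_pow, β]
    have h1 : 0 ≤ ∑ j, (((Real.pi : ℂ) * (δ - Complex.I * c j)) * ((w j ^ 2 : ℝ) : ℂ)).re :=
      Finset.sum_nonneg fun j _ => by rw [Complex.re_mul_ofReal]; simp; positivity
    have h2 : ∑ j, ((2 * Real.pi * Complex.I * l j : ℂ) * w j).re = 0 :=
      Finset.sum_eq_zero fun j _ => by rw [Complex.re_mul_ofReal]; simp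
    linarith
  let K : ℝ → ℂ := fun δ => ∏ j, (1 / (δ - Complex.I * c j)) ^ (1 / 2 : ℂ)
  let R : ℝ → (B → ℝ) → ℂ := fun δ b =>
    Complex.exp (∑ j, -(((Real.pi * (μ j * b j - l j) ^ 2 : ℝ) : ℂ) * (1 / (δ - Complex.I * c j))))
  have hden : ∀ δ : ℝ, ∀ j, (δ - Complex.I * c j : ℂ) ≠ 0 := fun δ j h => by
    have := congrArg Complex.im h
    simp at this
    exact hc j this
  have hGF : ∀ δ, 0 < δ → ∀ b : B → ℝ, ∫ w, G δ w *
      Complex.exp (-(2 * Real.pi * Complex.I * (∑ j, μ j * b j * w j : ℝ))) = K δ * R δ b := by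
    intro δ hδ b
    have h1 := GaussianFourier.integral_cexp_neg_sum_mul_add (hβ δ hδ)
      (fun j => 2 * Real.pi * Complex.I * (l j - μ j * b j))
    have h2 : ∀ w : B → ℝ, G δ w *
        Complex.exp (-(2 * Real.pi * Complex.I * (∑ j, μ j * b j * w j : ℝ))) =
        Complex.exp (-∑ j, β δ j * (w j : ℂ) ^ 2 +
          ∑ j, (2 * Real.pi * Complex.I * (l j - μ j * b j)) * w j) := by
      intro w
      rw [← Complex.exp_add]
      congr 1
      push_cast
      rw [Finset.mul_sum, add_assoc, ← sub_eq_add_neg, ← Finset.sum_sub_distrib]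
      congr 1
      exact Finset.sum_congr rfl fun j _ => by ring
    simp_rw [h2]
    rw [h1, Finset.prod_mul_distrib, ← Complex.exp_sum]
    have hpi' : (Real.pi : ℂ) ≠ 0 := by exact_mod_cast Real.pi_ne_zero
    congr 1
    · refine Finset.prod_congr rfl fun j _ => ?_
      congr 1
      simp only [β]
      have := hden δ j
      field_simp
    · congr 1
      refine Finset.sum_congr rfl fun j _ => ?_
      simp only [β]
      have := hden δ j
      push_cast
      field_simp
      rw [Complex.I_sq]; ring
  have hRn : ∀ δ, 0 ≤ δ → ∀ b, ‖R δ b‖ ≤ 1 := by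
    intro δ hδ b
    rw [Complex.norm_exp, Real.exp_le_one_iff, Complex.re_sum]
    refine Finset.sum_nonpos fun j _ => ?_
    rw [Complex.neg_re, Complex.re_ofReal_mul, neg_nonpos]
    refine mul_nonneg (by positivity) ?_
    rw [one_div, Complex.inv_re]
    refine div_nonneg ?_ (Complex.normSq_nonneg _)
    simpa using hδ
  have hswap : ∀ δ, 0 < δ → ∫ w, G δ w * T w = K δ * ∫ b, φ b * R δ b := by
    intro δ hδ
    have hint : Integrable (Function.uncurry fun (w b : B → ℝ) => G δ w * (φ b *
        Complex.exp (-(2 * Real.pi * Complex.I * (∑ j, μ j * b j * w j : ℝ)))))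
        (volume.prod volume) := by
      have h1 := (hGi δ hδ).mul_prod hφ
      refine (h1.mul_bdd (c := 1) (g := fun p : (B → ℝ) × (B → ℝ) =>
        Complex.exp (-(2 * Real.pi * Complex.I * (∑ j, μ j * p.2 j * p.1 j : ℝ)))) ?_ ?_).congr ?_
      · exact Continuous.aestronglyMeasurable (by fun_prop)
      · refine Eventually.of_forall fun p => ?_
        rw [Complex.norm_exp, Real.exp_le_one_iff, Complex.neg_re, Complex.re_mul_ofReal]
        simp
      · exact Eventually.of_forall fun p => by simp [Function.uncurry, mul_assoc]
    calc ∫ w, G δ w * T w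
        = ∫ w, ∫ b, G δ w * (φ b *
          Complex.exp (-(2 * Real.pi * Complex.I * (∑ j, μ j * b j * w j : ℝ)))) :=
          integral_congr_ae (Eventually.of_forall fun w => (integral_const_mul _ _).symm)
      _ = ∫ b, ∫ w, G δ w * (φ b *
          Complex.exp (-(2 * Real.pi * Complex.I * (∑ j, μ j * b j * w j : ℝ)))) :=
          integral_integral_swap hint
      _ = ∫ b, K δ * (φ b * R δ b) := by
          refine integral_congr_ae (Eventually.of_forall fun b => ?_)
          have : ∀ w, G δ w * (φ b *
            Complex.exp (-(2 * Real.pi * Complex.I * (∑ j, μ j * b j * w j : ℝ)))) = φ b * (G δ w *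
            Complex.exp (-(2 * Real.pi * Complex.I * (∑ j, μ j * b j * w j : ℝ)))) :=
            fun w => by ring
          simp only [this]
          rw [integral_const_mul, hGF δ hδ]
          ring
      _ = _ := integral_const_mul _ _
  have hlim : Tendsto (fun δ : ℝ => δ) (𝓝[>] 0) (𝓝 0) := tendsto_id.mono_left nhdsWithin_le_nhds
  have hpos : ∀ᶠ δ : ℝ in 𝓝[>] 0, 0 < δ := eventually_mem_nhdsWithin
  -- Both sides of `hswap` converge as `δ` tends to zero, by dominated convergence.
  have hL : Tendsto (fun δ => ∫ w, G δ w * T w) (𝓝[>] 0) (𝓝 (∫ w, G 0 w * T w)) := by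
    refine tendsto_integral_filter_of_dominated_convergence (fun w => ‖T w‖)
      (Eventually.of_forall fun δ => (hGc δ).aestronglyMeasurable.mul hT.aestronglyMeasurable)
      ?_ hT.norm (Eventually.of_forall fun w => ?_)
    · filter_upwards [hpos] with δ hδ
      refine Eventually.of_forall fun w => ?_
      rw [norm_mul]
      exact mul_le_of_le_one_left (norm_nonneg _) (hGn δ hδ.le w)
    · have : Continuous fun δ => G δ w * T w := by fun_prop
      exact (this.tendsto 0).comp hlim
  have hinv : ∀ j, ContinuousAt (fun δ : ℝ => (1 / (δ - Complex.I * c j) : ℂ)) 0 := fun j => by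
    refine ContinuousAt.div continuousAt_const (by fun_prop) ?_
    simpa using hden 0 j
  have hinv0 : ∀ j, (1 / ((0 : ℝ) - Complex.I * c j) : ℂ) = Complex.I / c j := fun j => by
    have : (c j : ℂ) ≠ 0 := by exact_mod_cast hc j
    rw [div_eq_div_iff (hden 0 j) this]
    push_cast
    linear_combination (c j : ℂ) * Complex.I_sq
  -- The principal branch is continuous at the limit, which is imaginary and non-zero.
  have hKl : Tendsto K (𝓝[>] 0) (𝓝 (∏ j, (Complex.I / c j) ^ (1 / 2 : ℂ))) := by
    refine tendsto_finsetProd _ fun j _ => ?_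
    have h1 : ContinuousAt (fun δ : ℝ => (1 / (δ - Complex.I * c j) : ℂ) ^ (1 / 2 : ℂ)) 0 := by
      refine (hinv j).cpow continuousAt_const ?_
      rw [hinv0]
      right
      simpa [Complex.div_im] using hc j
    have h2 := h1.tendsto
    simp only [hinv0] at h2
    exact h2.comp hlim
  have hRl : Tendsto (fun δ => ∫ b, φ b * R δ b) (𝓝[>] 0) (𝓝 (∫ b, φ b * R 0 b)) := by
    refine tendsto_integral_filter_of_dominated_convergence (fun w => ‖φ w‖)
      (Eventually.of_forall fun δ => hφ.aestronglyMeasurable.mul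
        (Continuous.aestronglyMeasurable (by fun_prop)))
      ?_ hφ.norm (Eventually.of_forall fun w => ?_)
    · filter_upwards [hpos] with δ hδ
      refine Eventually.of_forall fun w => ?_
      rw [norm_mul]
      exact mul_le_of_le_one_right (norm_nonneg _) (hRn δ hδ.le w)
    · have : ContinuousAt (fun δ => φ w * R δ w) 0 := by
        refine continuousAt_const.mul (Complex.continuous_exp.continuousAt.comp ?_)
        refine tendsto_finsetSum _ fun j _ => ?_
        exact ((continuousAt_const (y := ((Real.pi * (μ j * w j - l j) ^ 2 : ℝ) : ℂ))).mul
          (hinv j)).neg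
      exact this.tendsto.comp hlim
  have heq : (fun δ => ∫ w, G δ w * T w) =ᶠ[𝓝[>] 0] fun δ => K δ * ∫ b, φ b * R δ b := by
    filter_upwards [hpos] with δ hδ using hswap δ hδ
  have hfin := tendsto_nhds_unique (hL.congr' heq) (hKl.mul hRl)
  convert hfin using 1
  · refine integral_congr_ae (Eventually.of_forall fun w => ?_)
    simp only [G, β]
    congr 2
    push_cast
    rw [Finset.mul_sum, ← Finset.sum_neg_distrib, ← Finset.sum_add_distrib]
    exact Finset.sum_congr rfl fun j _ => by ring
  · congr 1
    refine integral_congr_ae (Eventually.of_forall fun b => ?_)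
    simp only [R, hinv0]
    congr 2
    push_cast
    rw [Finset.mul_sum, ← Finset.sum_neg_distrib]
    refine Finset.sum_congr rfl fun j _ => ?_
    have : (c j : ℂ) ≠ 0 := by exact_mod_cast hc j
    field_simp

end Gauss

/-! ### Coordinates on the quadratic algebra and on hermitian matrices -/

/-- The properties of `ℂ` and `ℝ ⊕ ℝ` used below: `D = ℝ ⊕ ℝ δ` with `δ² = ε` and `ε = ± 1`. -/
class QuadBasis (D : Type) [NormedCommRing D] [NormedAlgebra ℝ D] [QuadAlg D] where
  ε : ℝ
  ε_sq : ε * ε = 1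
  δ_sq : (QuadAlg.δ : D) * QuadAlg.δ = ε • 1
  exists_eq : ∀ x : D, ∃ s t : ℝ, x = s • (1 : D) + t • QuadAlg.δ
  finite : FiniteDimensional ℝ D
  trace_one : Algebra.trace ℝ D 1 = 2
  trace_δ : Algebra.trace ℝ D QuadAlg.δ = 0

attribute [instance] QuadBasis.finite

instance : QuadBasis ℂ where
  ε := -1
  ε_sq := by norm_num
  δ_sq := by simp [QuadAlg.δ]
  exists_eq x := ⟨x.re, x.im, by simp [QuadAlg.δ]⟩
  finite := inferInstance
  trace_one := by rw [Algebra.trace_complex_apply]; norm_num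
  trace_δ := by rw [Algebra.trace_complex_apply]; simp [QuadAlg.δ]

instance : QuadBasis (ℝ × ℝ) where
  ε := 1
  ε_sq := by norm_num
  δ_sq := by ext <;> simp [QuadAlg.δ]
  exists_eq x := ⟨(x.1 + x.2) / 2, (x.1 - x.2) / 2, by ext <;> simp [QuadAlg.δ] <;> ring⟩
  finite := inferInstance
  trace_one := by simp [Algebra.trace_prod_apply]; norm_num
  trace_δ := by simp [QuadAlg.δ, Algebra.trace_prod_apply]

section Coordinates

variable {D : Type} [NormedCommRing D] [NormedAlgebra ℝ D] [QuadAlg D] [QuadBasis D]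

variable (D) in
/-- The sign `δ²`: it is `1` for `ℝ ⊕ ℝ` and `-1` for `ℂ`. -/
abbrev eps : ℝ := QuadBasis.ε D

/-- The trace from `D` to `ℝ`. -/
abbrev tr : D →ₗ[ℝ] ℝ := Algebra.trace ℝ D

/-- The element of `D` with coordinates `(s, t)`. -/
def mkD (s t : ℝ) : D := (Real.sqrt 2)⁻¹ • (s • (1 : D) + t • QuadAlg.δ)

/-- The first coordinate on `D`. -/
def cs : D →ₗ[ℝ] ℝ := (Real.sqrt 2)⁻¹ • tr

/-- The second coordinate on `D`. -/
def ct : D →ₗ[ℝ] ℝ := ((Real.sqrt 2)⁻¹ * eps D) • tr ∘ₗ LinearMap.mulRight ℝ QuadAlg.δ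

theorem sqrt_two_mul_self : Real.sqrt 2 * Real.sqrt 2 = 2 := Real.mul_self_sqrt (by norm_num)

theorem sqrt_two_inv_mul_self : (Real.sqrt 2)⁻¹ * (Real.sqrt 2)⁻¹ = 2⁻¹ := by
  rw [← mul_inv, sqrt_two_mul_self]

theorem sqrt_two_inv_mul_two : (Real.sqrt 2)⁻¹ * 2 = Real.sqrt 2 := by
  have : Real.sqrt 2 ≠ 0 := by positivity
  field_simp
  rw [sq, sqrt_two_mul_self]

theorem mkD_mul_mkD (s t s' t' : ℝ) : (mkD s t * mkD s' t' : D) =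
    (2⁻¹ : ℝ) • ((s * s' + eps D * (t * t')) • (1 : D) + (s * t' + t * s') • QuadAlg.δ) := by
  have h : (s • (1 : D) + t • QuadAlg.δ) * (s' • (1 : D) + t' • QuadAlg.δ) =
      (s * s' + eps D * (t * t')) • (1 : D) + (s * t' + t * s') • QuadAlg.δ := by
    simp only [add_mul, mul_add, smul_mul_smul_comm, one_mul, mul_one, QuadBasis.δ_sq, smul_smul]
    rw [mul_comm (eps D)]
    simp only [add_smul]
    abel
  rw [mkD, mkD, smul_mul_smul_comm, h, sqrt_two_inv_mul_self]

theorem tr_mkD (s t : ℝ) : tr (mkD s t : D) = Real.sqrt 2 * s := by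
  simp only [mkD, tr, map_smul, map_add, QuadBasis.trace_one, QuadBasis.trace_δ, smul_eq_mul]
  linear_combination s * sqrt_two_inv_mul_two

theorem tr_mkD_mul (s t s' t' : ℝ) :
    tr (mkD s t * mkD s' t' : D) = s * s' + eps D * (t * t') := by
  rw [mkD_mul_mkD]
  simp only [tr, map_smul, map_add, QuadBasis.trace_one, QuadBasis.trace_δ, smul_eq_mul]
  ring

theorem δ_eq_mkD : (QuadAlg.δ : D) = mkD 0 (Real.sqrt 2) := by
  have : Real.sqrt 2 ≠ 0 := by positivity
  simp [mkD, smul_smul, this]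

theorem algebraMap_eq_mkD (r : ℝ) : algebraMap ℝ D r = mkD (Real.sqrt 2 * r) 0 := by
  have : Real.sqrt 2 ≠ 0 := by positivity
  simp [mkD, smul_smul, this, Algebra.algebraMap_eq_smul_one]

@[simp] theorem cs_mkD (s t : ℝ) : cs (mkD s t : D) = s := by
  have : Real.sqrt 2 ≠ 0 := by positivity
  simp [cs, tr_mkD, this]

@[simp] theorem ct_mkD (s t : ℝ) : ct (mkD s t : D) = t := by
  have : Real.sqrt 2 ≠ 0 := by positivity
  simp only [ct, LinearMap.smul_apply, LinearMap.comp_apply, LinearMap.mulRight_apply, smul_eq_mul]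
  rw [δ_eq_mkD, tr_mkD_mul]
  have h := QuadBasis.ε_sq (D := D)
  have h2 := inv_mul_cancel₀ this
  linear_combination t * h + eps D * eps D * t * h2

@[simp] theorem mkD_cs_ct (x : D) : mkD (cs x) (ct x) = x := by
  obtain ⟨s, t, rfl⟩ := QuadBasis.exists_eq x
  have : Real.sqrt 2 ≠ 0 := by positivity
  have h : s • (1 : D) + t • QuadAlg.δ = mkD (Real.sqrt 2 * s) (Real.sqrt 2 * t) := by
    simp [mkD, smul_smul, smul_add, this]
  rw [h, cs_mkD, ct_mkD]

theorem mkD_add (s t s' t' : ℝ) : (mkD (s + s') (t + t') : D) = mkD s t + mkD s' t' := by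
  simp only [mkD, ← smul_add]
  congr 1
  rw [add_smul, add_smul]; abel

theorem mkD_smul (r s t : ℝ) : (mkD (r * s) (r * t) : D) = r • mkD s t := by
  simp only [mkD, smul_add, smul_smul]
  congr 2 <;> ring

@[simp] theorem mkD_zero : (mkD 0 0 : D) = 0 := by simp [mkD]

theorem conj_mkD (s t : ℝ) : QuadAlg.conj (mkD s t : D) = mkD s (-t) := by
  simp [mkD, QuadAlg.conj_δ]

theorem tr_conj (x : D) : tr (QuadAlg.conj x) = tr x := by
  rw [← mkD_cs_ct x, conj_mkD, tr_mkD, tr_mkD]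

theorem cs_conj (x : D) : cs (QuadAlg.conj x) = cs x := by
  rw [← mkD_cs_ct x, conj_mkD, cs_mkD, cs_mkD]

theorem ct_conj (x : D) : ct (QuadAlg.conj x) = -ct x := by
  rw [← mkD_cs_ct x, conj_mkD, ct_mkD, ct_mkD]

theorem tr_eq_cs (x : D) : tr x = Real.sqrt 2 * cs x := by
  rw [← mkD_cs_ct x, tr_mkD, cs_mkD]

theorem tr_algebraMap (r : ℝ) : tr (algebraMap ℝ D r) = 2 * r := by
  rw [algebraMap_eq_mkD, tr_mkD, ← mul_assoc, sqrt_two_mul_self]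

theorem eq_algebraMap_of_conj_eq {x : D} (hx : QuadAlg.conj x = x) :
    x = algebraMap ℝ D (tr x / 2) := by
  have h : ct x = 0 := by
    have h2 := ct_conj x
    rw [hx] at h2
    linarith
  have h2 : Real.sqrt 2 ≠ 0 := by positivity
  rw [algebraMap_eq_mkD, tr_eq_cs]
  conv_lhs => rw [← mkD_cs_ct x, h]
  congr 1
  have := sqrt_two_mul_self
  linear_combination (-cs x / 2) * this

theorem ext_cs_ct {x y : D} (h1 : cs x = cs y) (h2 : ct x = ct y) : x = y := by
  rw [← mkD_cs_ct x, ← mkD_cs_ct y, h1, h2]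

variable {m n r : ℕ}

/-- The matrix with the given real coordinates. -/
def vmat : (Fin m × Fin r × Fin 2 → ℝ) ≃ₗ[ℝ] Matrix (Fin m) (Fin r) D where
  toFun v := Matrix.of fun i j => mkD (v (i, j, 0)) (v (i, j, 1))
  map_add' v w := by ext i j; simp [mkD_add]
  map_smul' c v := by ext i j; simp [mkD_smul]
  invFun M := fun p => if p.2.2 = 0 then cs (M p.1 p.2.1) else ct (M p.1 p.2.1)
  left_inv v := by
    funext ⟨i, j, e⟩
    fin_cases e <;> simp
  right_inv M := by ext i j; simp

theorem vmat_apply (v : Fin m × Fin r × Fin 2 → ℝ) (i : Fin m) (j : Fin r) :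
    (vmat v : Matrix (Fin m) (Fin r) D) i j = mkD (v (i, j, 0)) (v (i, j, 1)) := rfl

theorem vmat_symm_apply (M : Matrix (Fin m) (Fin r) D) (p : Fin m × Fin r × Fin 2) :
    vmat.symm M p = if p.2.2 = 0 then cs (M p.1 p.2.1) else ct (M p.1 p.2.1) := rfl

theorem herm_apply (x : Herm n D) (i j : Fin n) : QuadAlg.conj (x.1 j i) = x.1 i j :=
  congrFun (congrFun (show star' x.1 = x.1 from x.2) i) j

/-- The hermitian matrix with the given real coordinates: the coordinate at `(i, i)` is the diagonal
entry, and those at `(i, j)` and `(j, i)` are the two coordinates of the entry at `(i, j)`,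
`i < j`. -/
def hm : (Fin n × Fin n → ℝ) ≃ₗ[ℝ] Herm n D where
  toFun v := ⟨Matrix.of fun i j => if i < j then mkD (v (i, j)) (v (j, i)) else
    if i = j then algebraMap ℝ D (v (i, i)) else mkD (v (j, i)) (-v (i, j)), by
      change star' _ = _
      ext i j
      simp only [star', Matrix.transpose_apply, Matrix.map_apply]
      rcases lt_trichotomy i j with h | rfl | h
      · simp [h, not_lt_of_gt h, h.ne', conj_mkD]
      · simp
      · simp [h, not_lt_of_gt h, h.ne', conj_mkD]⟩
  map_add' v w := by
    apply Subtype.ext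
    ext i j
    simp only [Submodule.coe_add, Matrix.add_apply, Matrix.of_apply]
    split_ifs <;> simp [← mkD_add, add_comm]
  map_smul' c v := by
    apply Subtype.ext
    ext i j
    simp only [Submodule.coe_smul, Matrix.smul_apply, RingHom.id_apply, Matrix.of_apply]
    split_ifs
    · simp [← mkD_smul]
    · simp [Algebra.smul_def]
    · simp [← mkD_smul]
  invFun x := fun p => if p.1 < p.2 then cs (x.1 p.1 p.2) else
    if p.1 = p.2 then tr (x.1 p.1 p.1) / 2 else ct (x.1 p.2 p.1)
  left_inv v := by
    funext ⟨i, j⟩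
    rcases lt_trichotomy i j with h | rfl | h
    · simp [h]
    · simp [-Algebra.trace_algebraMap, tr_algebraMap]
    · simp [h, not_lt_of_gt h, h.ne']
  right_inv x := by
    apply Subtype.ext
    ext i j
    rcases lt_trichotomy i j with h | rfl | h
    · simp [h, not_lt_of_gt h, h.ne']
    · simpa using (eq_algebraMap_of_conj_eq (herm_apply x i i)).symm
    · simp only [h, not_lt_of_gt h, h.ne', if_true, if_false, Matrix.of_apply]
      rw [← conj_mkD, mkD_cs_ct, herm_apply]

theorem hm_apply_lt (v : Fin n × Fin n → ℝ) {i j : Fin n} (h : i < j) :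
    (hm v : Herm n D).1 i j = mkD (v (i, j)) (v (j, i)) := by simp [hm, h]

theorem hm_apply_self (v : Fin n × Fin n → ℝ) (i : Fin n) :
    (hm v : Herm n D).1 i i = algebraMap ℝ D (v (i, i)) := by simp [hm]

theorem hm_symm_apply (x : Herm n D) (p : Fin n × Fin n) : hm.symm x p =
    if p.1 < p.2 then cs (x.1 p.1 p.2) else
    if p.1 = p.2 then tr (x.1 p.1 p.1) / 2 else ct (x.1 p.2 p.1) := rfl

theorem herm_ext {x y : Herm n D} (h : ∀ i j, i ≤ j → x.1 i j = y.1 i j) : x = y := by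
  apply Subtype.ext
  ext i j
  rcases le_total i j with hij | hij
  · exact h i j hij
  · rw [← herm_apply x, ← herm_apply y, h j i hij]

theorem hasTemperateGrowth_matrix {E : Type*} [NormedAddCommGroup E] [NormedSpace ℝ E]
    {M : E → Matrix (Fin m) (Fin r) D} (hM : ∀ i j, (fun x => M x i j).HasTemperateGrowth) :
    M.HasTemperateGrowth :=
  hasTemperateGrowth_pi (F := Fin r → D) fun i => hasTemperateGrowth_pi (hM i)

theorem hasTemperateGrowth_entry {E : Type*} [NormedAddCommGroup E] [NormedSpace ℝ E]
    {M : E → Matrix (Fin m) (Fin r) D} (hM : M.HasTemperateGrowth) (i : Fin m) (j : Fin r) :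
    (fun x => M x i j).HasTemperateGrowth :=
  hasTemperateGrowth_linearMap_comp
    (F := Matrix (Fin m) (Fin r) D) (Matrix.entryLinearMap ℝ D i j) hM

theorem hasTemperateGrowth_matrix_mul {E : Type*} [NormedAddCommGroup E] [NormedSpace ℝ E] {k : ℕ}
    {M : E → Matrix (Fin m) (Fin r) D} {N : E → Matrix (Fin r) (Fin k) D}
    (hM : M.HasTemperateGrowth) (hN : N.HasTemperateGrowth) :
    (fun x => M x * N x).HasTemperateGrowth := by
  refine hasTemperateGrowth_matrix fun i j => ?_
  simp only [Matrix.mul_apply]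
  exact Function.HasTemperateGrowth.sum fun l _ =>
    (hasTemperateGrowth_entry hM i l).fun_mul (hasTemperateGrowth_entry hN l j)

theorem hasTemperateGrowth_herm_coe {E : Type*} [NormedAddCommGroup E] [NormedSpace ℝ E]
    {M : E → Herm n D} (hM : M.HasTemperateGrowth) :
    (fun x => (M x).1).HasTemperateGrowth :=
  hasTemperateGrowth_linearMap_comp (Herm n D).subtype hM

theorem hasTemperateGrowth_herm {E : Type*} [NormedAddCommGroup E] [NormedSpace ℝ E]
    {M : E → Herm n D} (hM : (fun x => (M x).1).HasTemperateGrowth) :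
    M.HasTemperateGrowth := by
  -- A linear retraction of all matrices onto the hermitian ones.
  obtain ⟨f, hf⟩ := LinearMap.exists_leftInverse_of_injective (Herm n D).subtype
    (LinearMap.ker_eq_bot.2 Subtype.val_injective)
  have h := hasTemperateGrowth_linearMap_comp f hM
  convert h using 1
  funext x
  exact (LinearMap.congr_fun hf (M x)).symm

theorem hasTemperateGrowth_det {E : Type*} [NormedAddCommGroup E] [NormedSpace ℝ E]
    {M : E → Matrix (Fin m) (Fin m) D} (hM : M.HasTemperateGrowth) :
    (fun x => (M x).det).HasTemperateGrowth := by
  simp only [Matrix.det_apply]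
  refine Function.HasTemperateGrowth.sum fun σ _ => ?_
  have h := hasTemperateGrowth_prod Finset.univ
    fun i => hasTemperateGrowth_entry hM (σ i) i
  rcases Int.units_eq_one_or (Equiv.Perm.sign σ) with h1 | h1
  · simpa [h1] using h
  · simpa [h1] using h.fun_neg

theorem hasTemperateGrowth_adjugate {E : Type*} [NormedAddCommGroup E] [NormedSpace ℝ E]
    {M : E → Matrix (Fin m) (Fin m) D} (hM : M.HasTemperateGrowth) :
    (fun x => (M x).adjugate).HasTemperateGrowth := by
  refine hasTemperateGrowth_matrix fun i j => ?_
  simp only [Matrix.adjugate_apply]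
  refine hasTemperateGrowth_det (hasTemperateGrowth_matrix fun k l => ?_)
  by_cases hk : k = j
  · subst hk; simp
  · simpa [Matrix.updateRow_apply, hk] using hasTemperateGrowth_entry hM k l

end Coordinates

/-! ### Monomial representatives -/

/-- The index set of the real coordinates on the Lie algebra of `N`. -/
abbrev Ix (n : ℕ) : Type := {p : Fin n × Fin n // p.1 < p.2} × Fin 2

/-- A real symmetric monomial matrix, with entries `α i` at `(i, σ i)` for an involution `σ`, such
that `{0, …, n - 1}` splits into intervals that `σ` reverses and on which `α` is constant.
Two indices `i < j` lie in different intervals if `σ i < σ j` and in the same interval if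
`σ j < σ i`. Only the last interval may have `α = 0`, and only if it consists of a single point. -/
structure Monomial (n : ℕ) where
  σ : Fin n → Fin n
  α : Fin n → ℝ
  invol : ∀ i, σ (σ i) = i
  α_σ : ∀ i, α (σ i) = α i
  order : ∀ i j, i < j → (σ i < σ j ∧ (i : ℕ) + σ i < j + σ j ∧ α i ≠ 0) ∨
    (σ j < σ i ∧ (i : ℕ) + σ i = j + σ j ∧ α i = α j ∧ α i ≠ 0)

/-- The coordinate of index `e` at the position `(i, j)`, or zero if `j ≤ i`. -/
def coordAt {n : ℕ} (x : Ix n → ℝ) (i j : Fin n) (e : Fin 2) : ℝ :=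
  if h : i < j then x (⟨(i, j), h⟩, e) else 0

namespace Monomial

variable {n : ℕ} (d : Monomial n)

/-- The symmetric matrix of `d`. -/
def mat : Matrix (Fin n) (Fin n) ℝ := Matrix.of fun i j => if d.σ i = j then d.α i else 0

theorem mat_transpose : d.matᵀ = d.mat := by
  ext i j
  simp only [mat, Matrix.transpose_apply, Matrix.of_apply]
  by_cases h : d.σ i = j
  · rw [if_pos (by rw [← h, d.invol]), if_pos h, ← h, d.α_σ]
  · rw [if_neg h, if_neg (fun h' => h (by rw [← h', d.invol]))]

theorem σ_injective : Function.Injective d.σ := fun i j h => by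
  rw [← d.invol i, h, d.invol]

theorem α_ne {i j : Fin n} (h : i < j) : d.α i ≠ 0 := by
  rcases d.order i j h with h | h
  · exact h.2.2
  · exact h.2.2.2

/-- The indices of the coordinates of a complement of the Lie algebra of the stabilizer. Of each pair
of positions `(i, j)` and `(σ j, σ i)` inside an interval of `σ` it contains one, and the first
coordinate if the two agree. -/
def InK (q : Ix n) : Prop :=
  d.σ q.1.1.1 < d.σ q.1.1.2 ∨ d.σ q.1.1.2 < q.1.1.1 ∨ (d.σ q.1.1.2 = q.1.1.1 ∧ q.2 = 0)

instance : DecidablePred d.InK := fun q => by unfold InK; infer_instance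

/-- The coordinates that parametrize the quotient of `N` by the stabilizer. -/
abbrev K : Type := {q : Ix n // d.InK q}

/-- The complementary coordinates, which parametrize the stabilizer. -/
abbrev KC : Type := {q : Ix n // ¬ d.InK q}

/-- Extension by zero. -/
def ext (y : d.K → ℝ) : Ix n → ℝ := fun q => if h : d.InK q then y ⟨q, h⟩ else 0

/-- Extension by zero. -/
def extC (w : d.KC → ℝ) : Ix n → ℝ := fun q => if h : d.InK q then 0 else w ⟨q, h⟩

/-- The element of the Lie algebra of the stabilizer with given coordinates outside `K`: the
coordinates at `(i, j)` and at the partner `(σ j, σ i)` determine each other. -/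
def lie (w : d.KC → ℝ) : Ix n → ℝ := fun q =>
  if d.InK q then
    (if q.2 = 0 then -1 else 1) * coordAt (d.extC w) (d.σ q.1.1.2) (d.σ q.1.1.1) q.2
  else d.extC w q

/-- The equations of the Lie algebra of the stabilizer in coordinates: the entry at `(i, j)` is zero if
`σ i < σ j`, and otherwise the negative of the conjugate of the entry at `(σ j, σ i)`. -/
def IsLie (x : Ix n → ℝ) : Prop :=
  ∀ i j, ∀ hij : i < j, (d.σ i < d.σ j → ∀ e, x (⟨(i, j), hij⟩, e) = 0) ∧
    ∀ h : d.σ j < d.σ i, x (⟨(i, j), hij⟩, 0) = -x (⟨(d.σ j, d.σ i), h⟩, 0) ∧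
      x (⟨(i, j), hij⟩, 1) = x (⟨(d.σ j, d.σ i), h⟩, 1)

theorem isLie_lie (w : d.KC → ℝ) : d.IsLie (d.lie w) := by
  intro i j hij
  refine ⟨fun h e => ?_, fun h => ?_⟩
  · have hK : d.InK (⟨(i, j), hij⟩, e) := Or.inl h
    simp [lie, hK, coordAt, not_lt_of_gt h]
  · have hK : ∀ (i j) (hij : i < j) (h : d.σ j < d.σ i) (e : Fin 2),
        d.InK (⟨(i, j), hij⟩, e) ↔ (d.σ j < i ∨ (d.σ j = i ∧ e = 0)) := by
      intro i j hij h e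
      simp only [InK]
      constructor
      · rintro (h1 | h1 | h1)
        · exact absurd h1 (lt_asymm h)
        · exact Or.inl h1
        · exact Or.inr h1
      · exact Or.inr
    have hf : d.σ (d.σ i) < d.σ (d.σ j) := by rw [d.invol, d.invol]; exact hij
    -- At most one of the positions `(i, j)` and `(σ j, σ i)` lies in `K`, except that a position which
    -- is its own partner contributes its first coordinate to `K`.
    have key : ∀ e : Fin 2, d.lie w (⟨(i, j), hij⟩, e) =
        (if e = 0 then -1 else 1) * d.lie w (⟨(d.σ j, d.σ i), h⟩, e) := by
      intro e
      have h1 := hK i j hij h e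
      have h2 := hK (d.σ j) (d.σ i) h hf e
      rw [d.invol] at h2
      simp only [lie, coordAt, d.invol, h, hij, dif_pos]
      by_cases ha : d.InK (⟨(i, j), hij⟩, e) <;> by_cases hb : d.InK (⟨(d.σ j, d.σ i), h⟩, e)
      · simp [extC, ha, hb]
      · simp [extC, ha, hb]
      · rw [if_neg ha, if_pos hb, ← mul_assoc]
        split_ifs <;> simp
      · have h3 : d.σ j = i ∧ e = 1 := by
          rw [h1] at ha
          rw [h2] at hb
          push Not at ha hb
          refine ⟨le_antisymm hb.1 ha.1, ?_⟩
          have := ha.2 (le_antisymm hb.1 ha.1)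
          omega
        rw [if_neg ha, if_neg hb]
        obtain ⟨h3, rfl⟩ := h3
        have h4 : d.σ i = j := by rw [← h3, d.invol]
        simp [h3, h4]
    exact ⟨by simpa using key 0, by simpa using key 1⟩

/-- An element of the Lie algebra is determined by its coordinates outside `K`. -/
theorem IsLie.eq_zero {x : Ix n → ℝ} (hx : d.IsLie x) (h : ∀ q, ¬ d.InK q → x q = 0) : x = 0 := by
  funext ⟨⟨⟨i, j⟩, hij⟩, e⟩
  change i < j at hij
  simp only [Pi.zero_apply]
  by_cases hK : d.InK (⟨(i, j), hij⟩, e)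
  · have hx' := hx i j hij
    by_cases h1 : d.σ i < d.σ j
    · exact hx'.1 h1 e
    · have h2 : d.σ j < d.σ i :=
        lt_of_le_of_ne (not_lt.1 h1) fun h => hij.ne' (d.σ_injective h)
      have h3 := hx'.2 h2
      have hK' : d.σ j < i ∨ (d.σ j = i ∧ e = 0) := hK.resolve_left h1
      rcases hK' with hK' | ⟨hK', rfl⟩
      · have h4 : ∀ e, ¬ d.InK (⟨(d.σ j, d.σ i), h2⟩, e) := by
          intro e
          simp only [InK, d.invol]
          push Not
          exact ⟨hij.le, hK'.le, fun h => absurd h hK'.ne'⟩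
        fin_cases e
        · simpa [h _ (h4 0)] using h3.1
        · simpa [h _ (h4 1)] using h3.2
      · have h4 : d.σ i = j := by rw [← hK', d.invol]
        have h5 := h3.1
        simp only [hK', h4] at h5
        linarith
  · exact h _ hK

theorem lie_apply_of_not (w : d.KC → ℝ) (q : d.KC) : d.lie w q = w q := by
  rw [lie, if_neg q.2, extC, dif_neg q.2]

theorem lie_add (w w' : d.KC → ℝ) : d.lie (w + w') = d.lie w + d.lie w' := by
  funext q
  simp only [lie, extC, coordAt, Pi.add_apply]
  split_ifs <;> simp [mul_add, add_comm]

theorem lie_smul (c : ℝ) (w : d.KC → ℝ) : d.lie (c • w) = c • d.lie w := by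
  funext q
  simp only [lie, extC, coordAt, Pi.smul_apply, smul_eq_mul]
  split_ifs <;> simp

theorem eq_lie_of_isLie {x : Ix n → ℝ} (hx : d.IsLie x) : x = d.lie fun q => x q := by
  have h1 : d.IsLie (x - d.lie fun q => x q) := by
    intro i j hij
    have ha := hx i j hij
    have hb := d.isLie_lie (fun q => x q) i j hij
    refine ⟨fun h e => by simp [ha.1 h e, hb.1 h e], fun h => ⟨?_, ?_⟩⟩
    · simp only [Pi.sub_apply]; rw [(ha.2 h).1, (hb.2 h).1]; ring
    · simp only [Pi.sub_apply]; rw [(ha.2 h).2, (hb.2 h).2]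
  have h2 := h1.eq_zero d fun q hq => by simp [d.lie_apply_of_not _ ⟨q, hq⟩]
  exact sub_eq_zero.1 h2

end Monomial

/-! ### Coordinates on the unipotent group and the stabilizer -/

section Unipotent

variable {n : ℕ} {D : Type} [NormedCommRing D] [NormedAlgebra ℝ D] [QuadAlg D] [QuadBasis D]

/-- The strictly upper triangular matrix with given coordinates. -/
def nmat (x : Ix n → ℝ) : Matrix (Fin n) (Fin n) D :=
  Matrix.of fun i j => mkD (coordAt x i j 0) (coordAt x i j 1)

/-- The real coordinates of the entries of a matrix above the diagonal. -/
def crd (u : Matrix (Fin n) (Fin n) D) : Ix n → ℝ := fun q =>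
  if q.2 = 0 then cs (u q.1.1.1 q.1.1.2) else ct (u q.1.1.1 q.1.1.2)

theorem lieMat_eq_nmat (x : Coord n) : (lieMat x : Matrix (Fin n) (Fin n) D) = nmat x.ofLp := by
  ext i j
  by_cases h : i < j
  · simp [lieMat, nmat, coordAt, h, mkD]
  · simp [lieMat, nmat, coordAt, h]

theorem nmat_apply_of_lt (x : Ix n → ℝ) {i j : Fin n} (h : i < j) :
    (nmat x : Matrix (Fin n) (Fin n) D) i j =
      mkD (x (⟨(i, j), h⟩, 0)) (x (⟨(i, j), h⟩, 1)) := by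
  simp [nmat, coordAt, h]

theorem nmat_apply_of_le (x : Ix n → ℝ) {i j : Fin n} (h : j ≤ i) :
    (nmat x : Matrix (Fin n) (Fin n) D) i j = 0 := by
  simp [nmat, coordAt, not_lt_of_ge h]

theorem isUpperUnip_one_add_nmat (x : Ix n → ℝ) :
    IsUpperUnip (1 + nmat x : Matrix (Fin n) (Fin n) D) :=
  ⟨fun i j h => by simp [nmat_apply_of_le x h.le, Matrix.one_apply_ne (ne_of_gt h)],
    fun i => by simp [nmat_apply_of_le x le_rfl]⟩

theorem crd_one_add_nmat (x : Ix n → ℝ) :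
    crd (1 + nmat x : Matrix (Fin n) (Fin n) D) = x := by
  funext ⟨⟨⟨i, j⟩, h⟩, e⟩
  have h' : i < j := h
  fin_cases e <;> simp [crd, nmat_apply_of_lt x h', Matrix.one_apply_ne h'.ne]

theorem one_add_nmat_crd {u : Matrix (Fin n) (Fin n) D} (hu : IsUpperUnip u) :
    1 + nmat (crd u) = u := by
  ext i j
  rcases lt_trichotomy i j with h | rfl | h
  · simp [nmat_apply_of_lt _ h, crd, Matrix.one_apply_ne h.ne]
  · simp [nmat_apply_of_le, hu.2]
  · simp [nmat_apply_of_le _ h.le, hu.1 _ _ h, Matrix.one_apply_ne h.ne']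

/-- The entries of `A` and `B` less than `h` steps above the diagonal agree. -/
def AgreeBelow (h : ℕ) (A B : Matrix (Fin n) (Fin n) D) : Prop :=
  ∀ i j : Fin n, (j : ℕ) < i + h → A i j = B i j

/-- Strictly upper triangular matrices. -/
def StrictUpper (A : Matrix (Fin n) (Fin n) D) : Prop := ∀ i j, j ≤ i → A i j = 0

theorem strictUpper_nmat (x : Ix n → ℝ) : StrictUpper (nmat x : Matrix (Fin n) (Fin n) D) :=
  fun _ _ h => nmat_apply_of_le x h

theorem StrictUpper.mul_agreeBelow {h : ℕ} {A A' B B' : Matrix (Fin n) (Fin n) D}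
    (hA : StrictUpper A) (hA' : StrictUpper A') (hB : StrictUpper B) (hB' : StrictUpper B')
    (h1 : AgreeBelow h A A') (h2 : AgreeBelow h B B') :
    AgreeBelow (h + 1) (A * B) (A' * B') := by
  intro i j hij
  rw [Matrix.mul_apply, Matrix.mul_apply]
  refine Finset.sum_congr rfl fun k _ => ?_
  rcases le_or_gt k i with hk | hk
  · rw [hA i k hk, hA' i k hk, zero_mul, zero_mul]
  · rcases le_or_gt j k with hk' | hk'
    · rw [hB k j hk', hB' k j hk', mul_zero, mul_zero]
    · rw [h1 i k (by rw [Fin.lt_def] at *; omega), h2 k j (by rw [Fin.lt_def] at *; omega)]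

theorem StrictUpper.mul {A B : Matrix (Fin n) (Fin n) D}
    (hA : StrictUpper A) (hB : StrictUpper B) : StrictUpper (A * B) := by
  intro i j hij
  rw [Matrix.mul_apply]
  refine Finset.sum_eq_zero fun k _ => ?_
  rcases le_or_gt k i with hk | hk
  · rw [hA i k hk, zero_mul]
  · rw [hB k j (hij.trans hk.le), mul_zero]

theorem StrictUpper.pow_succ {A : Matrix (Fin n) (Fin n) D} (hA : StrictUpper A) (k : ℕ) :
    StrictUpper (A ^ (k + 1)) := by
  induction k with
  | zero => simpa using hA
  | succ k ih => rw [_root_.pow_succ]; exact ih.mul hA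

theorem StrictUpper.pow_apply {A : Matrix (Fin n) (Fin n) D} (hA : StrictUpper A) (k : ℕ)
    (i j : Fin n) (h : (j : ℕ) < i + k) : (A ^ k) i j = 0 := by
  induction k generalizing j with
  | zero => simp only [pow_zero]; exact Matrix.one_apply_ne (by rintro rfl; omega)
  | succ k ih =>
    rw [_root_.pow_succ, Matrix.mul_apply]
    refine Finset.sum_eq_zero fun l _ => ?_
    rcases le_or_gt j l with hl | hl
    · rw [hA l j hl, mul_zero]
    · rw [ih l (by rw [Fin.lt_def] at hl; omega), zero_mul]

theorem StrictUpper.pow_eq_zero {A : Matrix (Fin n) (Fin n) D} (hA : StrictUpper A) {k : ℕ}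
    (hk : n ≤ k) : A ^ k = 0 := by
  ext i j
  exact hA.pow_apply k i j (by have := j.2; omega)

theorem StrictUpper.nilExp_eq {A : Matrix (Fin n) (Fin n) D} (hA : StrictUpper A) :
    nilExp A = 1 + A + ∑ k ∈ Finset.range n, (((k + 2).factorial : ℝ)⁻¹) • A ^ (k + 2) := by
  have h1 : nilExp A = ∑ k ∈ Finset.range (n + 2), ((k.factorial : ℝ)⁻¹) • A ^ k := by
    rw [nilExp, Finset.sum_range_succ, Finset.sum_range_succ, hA.pow_eq_zero le_rfl,
      hA.pow_eq_zero (Nat.le_succ n)]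
    simp
  rw [h1, Finset.sum_range_succ', Finset.sum_range_succ']
  simp
  abel

/-- Each entry of `exp A - A` depends only on the entries of `A` closer to the diagonal. -/
theorem StrictUpper.nilExp_sub_agreeBelow {h : ℕ} {A A' : Matrix (Fin n) (Fin n) D}
    (hA : StrictUpper A) (hA' : StrictUpper A') (h1 : AgreeBelow h A A') :
    AgreeBelow (h + 1) (nilExp A - A) (nilExp A' - A') := by
  have hpow : ∀ k, AgreeBelow (h + 1) (A ^ (k + 2)) (A' ^ (k + 2)) := by
    intro k
    induction k with
    | zero =>
      simp only [zero_add, sq]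
      exact hA.mul_agreeBelow hA' hA hA' h1 h1
    | succ k ih =>
      have e : ∀ B : Matrix (Fin n) (Fin n) D, B ^ (k + 1 + 2) = B ^ (k + 2) * B := fun B => by
        rw [← _root_.pow_succ]
      rw [e, e]
      exact (hA.pow_succ (k + 1)).mul_agreeBelow (hA'.pow_succ (k + 1)) hA hA'
        (fun i j hij => ih i j (by omega)) h1
  intro i j hij
  rw [hA.nilExp_eq, hA'.nilExp_eq]
  simp only [Matrix.sub_apply, Matrix.add_apply, Matrix.sum_apply, Matrix.smul_apply]
  have := Finset.sum_congr (rfl : Finset.range n = Finset.range n)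
    fun k _ => congrArg (fun z => (((k + 2).factorial : ℝ)⁻¹) • z) (hpow k i j hij)
  rw [this]
  ring

theorem StrictUpper.nilExp_sub_one {A : Matrix (Fin n) (Fin n) D} (hA : StrictUpper A) :
    StrictUpper (nilExp A - 1) := by
  intro i j hij
  rw [hA.nilExp_eq]
  simp only [Matrix.sub_apply, Matrix.add_apply, Matrix.sum_apply, Matrix.smul_apply]
  rw [hA i j hij, Finset.sum_eq_zero fun k _ => by rw [hA.pow_succ (k + 1) i j hij, smul_zero]]
  ring

theorem StrictUpper.isUpperUnip_nilExp {A : Matrix (Fin n) (Fin n) D} (hA : StrictUpper A) :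
    IsUpperUnip (nilExp A) := by
  have h := hA.nilExp_sub_one
  refine ⟨fun i j hij => ?_, fun i => ?_⟩
  · have := h i j hij.le
    rwa [Matrix.sub_apply, Matrix.one_apply_ne hij.ne', sub_zero] at this
  · have := h i i le_rfl
    rwa [Matrix.sub_apply, Matrix.one_apply_eq, sub_eq_zero] at this

/-- Each entry of `exp A · (1 + B) - A - B` depends only on the entries of `A` and `B` closer to
the diagonal. -/
theorem StrictUpper.nilExp_mul_agreeBelow {h : ℕ} {A A' B B' : Matrix (Fin n) (Fin n) D}
    (hA : StrictUpper A) (hA' : StrictUpper A') (hB : StrictUpper B) (hB' : StrictUpper B')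
    (h1 : AgreeBelow h A A') (h2 : AgreeBelow h B B') :
    AgreeBelow (h + 1) (nilExp A * (1 + B) - A - B) (nilExp A' * (1 + B') - A' - B') := by
  have e : ∀ A B : Matrix (Fin n) (Fin n) D, nilExp A * (1 + B) - A - B =
      (nilExp A - A) + (nilExp A - 1) * B := fun A B => by
    rw [mul_add, sub_mul, mul_one, one_mul]; abel
  have h3 := hA.nilExp_sub_agreeBelow hA' h1
  have h4 : AgreeBelow h (nilExp A - 1) (nilExp A' - 1) := fun i j hij => by
    have a := h3 i j (by omega)
    have b := h1 i j hij
    simp only [Matrix.sub_apply] at a ⊢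
    linear_combination a + b
  have h5 := hA.nilExp_sub_one.mul_agreeBelow hA'.nilExp_sub_one hB hB' h4 h2
  intro i j hij
  rw [e, e, Matrix.add_apply, Matrix.add_apply, h3 i j hij, h5 i j hij]

theorem StrictUpper.neg {A : Matrix (Fin n) (Fin n) D} (hA : StrictUpper A) : StrictUpper (-A) :=
  fun i j h => by rw [Matrix.neg_apply, hA i j h, neg_zero]

theorem StrictUpper.nilExp_neg_mul {A : Matrix (Fin n) (Fin n) D} (hA : StrictUpper A) :
    nilExp (-A) * nilExp A = 1 := by
  let _ : Algebra ℚ (Matrix (Fin n) (Fin n) D) := Algebra.compHom _ (algebraMap ℚ ℝ)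
  have hq : ∀ (k : ℕ) (B : Matrix (Fin n) (Fin n) D),
      ((k.factorial : ℚ)⁻¹) • B = ((k.factorial : ℝ)⁻¹) • B := by
    intro k B
    have : ((k.factorial : ℝ)⁻¹) = algebraMap ℚ ℝ ((k.factorial : ℚ)⁻¹) := by simp
    rw [this]
    rfl
  have he : ∀ {B : Matrix (Fin n) (Fin n) D}, StrictUpper B → nilExp B = IsNilpotent.exp B := by
    intro B hB
    rw [IsNilpotent.exp_eq_sum (hB.pow_eq_zero le_rfl), nilExp]
    exact Finset.sum_congr rfl fun k _ => (hq k _).symm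
  have hn : IsNilpotent A := ⟨n, hA.pow_eq_zero le_rfl⟩
  rw [he hA, he hA.neg]
  exact IsNilpotent.exp_neg_mul_exp_self hn

theorem star'_pow (A : Matrix (Fin n) (Fin n) D) (k : ℕ) : star' (A ^ k) = star' A ^ k := by
  induction k with
  | zero => simp [star'_one]
  | succ k ih => rw [_root_.pow_succ, star'_mul, ih, ← _root_.pow_succ']

theorem star'_nilExp (A : Matrix (Fin n) (Fin n) D) : star' (nilExp A) = nilExp (star' A) := by
  rw [nilExp, nilExp]
  have : ∀ (s : Finset ℕ) (f : ℕ → Matrix (Fin n) (Fin n) D),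
      star' (∑ k ∈ s, f k) = ∑ k ∈ s, star' (f k) := by
    intro s f
    classical
    induction s using Finset.induction_on with
    | empty => simp [star'_zero]
    | insert a s ha ih => rw [Finset.sum_insert ha, Finset.sum_insert ha, star'_add, ih]
  rw [this]
  exact Finset.sum_congr rfl fun k _ => by rw [star'_smul, star'_pow]

/-- The exponential maps the Lie algebra of the stabilizer to the stabilizer. -/
theorem StrictUpper.nilExp_stab {A G : Matrix (Fin n) (Fin n) D} (hA : StrictUpper A)
    (h : star' A * G + G * A = 0) : star' (nilExp A) * G * nilExp A = G := by
  have h1 : star' A * G = G * -A := by rw [mul_neg]; exact eq_neg_of_add_eq_zero_left h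
  have h2 : ∀ k, star' A ^ k * G = G * (-A) ^ k := by
    intro k
    induction k with
    | zero => simp
    | succ k ih => rw [_root_.pow_succ', mul_assoc, ih, ← mul_assoc, h1, mul_assoc,
        ← _root_.pow_succ']
  have h3 : star' (nilExp A) * G = G * nilExp (-A) := by
    rw [star'_nilExp, nilExp, nilExp, Finset.sum_mul, Finset.mul_sum]
    exact Finset.sum_congr rfl fun k _ => by rw [smul_mul_assoc, h2, mul_smul_comm]
  rw [h3, mul_assoc, hA.nilExp_neg_mul, mul_one]

end Unipotent

namespace Monomial

variable {n : ℕ} (d : Monomial n) {D : Type} [NormedCommRing D] [NormedAlgebra ℝ D] [QuadAlg D]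
  [QuadBasis D]

variable (D) in
/-- The hermitian matrix of `d`. -/
def herm : Herm n D := ofReal d.mat d.mat_transpose

theorem herm_apply (i j : Fin n) : (d.herm D).1 i j = if d.σ i = j then algebraMap ℝ D (d.α i)
    else 0 := by
  simp only [herm, ofReal, mat, Matrix.map_apply, Matrix.of_apply]
  split_ifs <;> simp

theorem herm_mul_apply {m : ℕ} (M : Matrix (Fin n) (Fin m) D) (i : Fin n) (j : Fin m) :
    ((d.herm D).1 * M) i j = d.α i • M (d.σ i) j := by
  rw [Matrix.mul_apply, Finset.sum_eq_single (d.σ i)]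
  · rw [herm_apply, if_pos rfl, Algebra.smul_def]
  · intro k _ hk
    rw [herm_apply, if_neg (fun h => hk h.symm), zero_mul]
  · simp

theorem mul_herm_apply {m : ℕ} (M : Matrix (Fin m) (Fin n) D) (i : Fin m) (j : Fin n) :
    (M * (d.herm D).1) i j = d.α j • M i (d.σ j) := by
  rw [Matrix.mul_apply, Finset.sum_eq_single (d.σ j)]
  · rw [herm_apply, if_pos (d.invol j), Algebra.smul_def, d.α_σ, mul_comm]
  · intro k _ hk
    rw [herm_apply, if_neg (fun h => hk (by rw [← h, d.invol])), mul_zero]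
  · simp

theorem star'_mul_herm_mul_apply (u : Matrix (Fin n) (Fin n) D) (i j : Fin n) :
    (star' u * (d.herm D).1 * u) i j =
      ∑ k, d.α k • (QuadAlg.conj (u k i) * u (d.σ k) j) := by
  rw [Matrix.mul_assoc, Matrix.mul_apply]
  refine Finset.sum_congr rfl fun k _ => ?_
  rw [herm_mul_apply, mul_smul_comm]
  rfl

/-- The equation of the Lie algebra, read off in row `σ i` and column `j`. -/
theorem stabLie_iff (x : Ix n → ℝ) :
    star' (nmat x : Matrix (Fin n) (Fin n) D) * (d.herm D).1 + (d.herm D).1 * nmat x = 0 ↔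
      d.IsLie x := by
  have h1 : ∀ i j, (star' (nmat x : Matrix (Fin n) (Fin n) D) * (d.herm D).1 +
      (d.herm D).1 * nmat x : Matrix (Fin n) (Fin n) D) (d.σ i) j =
      d.α j • QuadAlg.conj ((nmat x : Matrix (Fin n) (Fin n) D) (d.σ j) (d.σ i)) +
        d.α i • nmat x i j := by
    intro i j
    rw [Matrix.add_apply, mul_herm_apply, herm_mul_apply, d.invol, d.α_σ]
    rfl
  have h2 : (star' (nmat x : Matrix (Fin n) (Fin n) D) * (d.herm D).1 +
      (d.herm D).1 * nmat x = 0) ↔ ∀ i j,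
      d.α j • QuadAlg.conj ((nmat x : Matrix (Fin n) (Fin n) D) (d.σ j) (d.σ i)) +
        d.α i • nmat x i j = 0 := by
    constructor
    · intro h i j
      rw [← h1, h]; rfl
    · intro h
      ext i j
      rw [← d.invol i, h1, h]; rfl
  rw [h2]
  have hc : ∀ {a : ℝ} {s t s' t' : ℝ}, a ≠ 0 → (a • QuadAlg.conj (mkD s' t' : D) + a • mkD s t = 0
      ↔ s = -s' ∧ t = t') := by
    intro a s t s' t' ha
    rw [← smul_add, smul_eq_zero_iff_right ha, conj_mkD, ← mkD_add]
    constructor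
    · intro h
      have h1 := congrArg cs h
      have h2 := congrArg ct h
      rw [cs_mkD, map_zero] at h1
      rw [ct_mkD, map_zero] at h2
      constructor <;> linarith
    · rintro ⟨rfl, rfl⟩
      simp
  constructor
  · intro h i j hij
    refine ⟨fun hs e => ?_, fun hs => ?_⟩
    · have h3 := h i j
      rw [nmat_apply_of_le x hs.le, map_zero, smul_zero, zero_add,
        smul_eq_zero_iff_right (d.α_ne hij), nmat_apply_of_lt x hij] at h3
      have h4 := congrArg cs h3
      have h5 := congrArg ct h3
      rw [cs_mkD, map_zero] at h4
      rw [ct_mkD, map_zero] at h5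
      fin_cases e
      · exact h4
      · exact h5
    · have h3 := h i j
      have h4 : d.α i = d.α j := by
        rcases d.order i j hij with h | h
        · exact absurd h.1 (lt_asymm hs)
        · exact h.2.2.1
      rw [nmat_apply_of_lt x hij, nmat_apply_of_lt x hs, ← h4, hc (d.α_ne hij)] at h3
      exact h3
  · intro h i j
    rcases lt_trichotomy i j with hij | rfl | hij
    · rcases d.order i j hij with hs | hs
      · rw [nmat_apply_of_le x hs.1.le, nmat_apply_of_lt x hij, (h i j hij).1 hs.1,
          (h i j hij).1 hs.1]
        simp
      · obtain ⟨hs1, -, hα, hne⟩ := hs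
        have h3 := (h i j hij).2 hs1
        rw [nmat_apply_of_lt x hs1, nmat_apply_of_lt x hij, ← hα]
        exact (hc hne).2 h3
    · rw [nmat_apply_of_le x le_rfl, nmat_apply_of_le x le_rfl]; simp
    · rw [nmat_apply_of_le x hij.le]
      rcases d.order j i hij with hs | hs
      · rw [nmat_apply_of_lt x hs.1]
        have h3 := (h (d.σ j) (d.σ i) hs.1).1 (by rw [d.invol, d.invol]; exact hij)
        rw [h3, h3]; simp
      · rw [nmat_apply_of_le x hs.1.le]; simp

/-- An element of the stabilizer has no entries joining different intervals. -/
theorem stab_apply_eq_zero {u : Matrix (Fin n) (Fin n) D} (hu : IsUpperUnip u)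
    (h : star' u * (d.herm D).1 * u = (d.herm D).1) {i j : Fin n} (hij : i < j)
    (hs : d.σ i < d.σ j) : u i j = 0 := by
  have hd : IsUnit u.det := by rw [hu.det]; exact isUnit_one
  obtain ⟨v, huv⟩ : ∃ v, u * v = 1 := ⟨u⁻¹, Matrix.mul_nonsing_inv u hd⟩
  have hv := hu.inv huv
  have h1 : star' v * star' u = 1 := by rw [← star'_mul, huv, star'_one]
  have h2 : (d.herm D).1 * u = star' v * (d.herm D).1 := by
    rw [← h]
    simp only [← Matrix.mul_assoc]
    rw [h1, Matrix.one_mul, h]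
  have h3 := congrFun (congrFun h2 (d.σ i)) j
  rw [herm_mul_apply, mul_herm_apply, d.invol, d.α_σ] at h3
  have h4 : star' v (d.σ i) (d.σ j) = 0 := by
    simp only [star', Matrix.transpose_apply, Matrix.map_apply]
    rw [hv.1 _ _ hs, map_zero]
  rw [h4, smul_zero, smul_eq_zero_iff_right (d.α_ne hij)] at h3
  exact h3

/-- The leading terms of the difference of two elements of the stabilizer satisfy the equations
of the Lie algebra. -/
theorem stab_sub_leading {u u' : Matrix (Fin n) (Fin n) D} (hu : IsUpperUnip u)
    (hu' : IsUpperUnip u') (h : star' u * (d.herm D).1 * u = (d.herm D).1)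
    (h' : star' u' * (d.herm D).1 * u' = (d.herm D).1) {i j : Fin n} (hij : i < j)
    (hagree : AgreeBelow ((j : ℕ) - i) u u') (hs : d.σ j < d.σ i) :
    u i j - u' i j = -QuadAlg.conj (u (d.σ j) (d.σ i) - u' (d.σ j) (d.σ i)) := by
  have hα : d.α i = d.α j := by
    rcases d.order i j hij with h | h
    · exact absurd h.1 (lt_asymm hs)
    · exact h.2.2.1
  -- In the entry `(σ i, σ j)` of the equation, the other terms only involve entries closer to the
  -- diagonal, or entries that vanish.
  have key : ∀ k, k ≠ d.σ i → k ≠ d.σ j →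
      d.α k • (QuadAlg.conj (u k (d.σ i)) * u (d.σ k) j) =
      d.α k • (QuadAlg.conj (u' k (d.σ i)) * u' (d.σ k) j) := by
    intro k hk1 hk2
    rcases lt_trichotomy k (d.σ i) with hk | hk | hk
    · rcases lt_trichotomy (d.σ k) j with hk' | hk' | hk'
      · rcases lt_trichotomy (d.σ k) i with hi | hi | hi
        · have h1 := d.stab_apply_eq_zero hu h hk (by rw [d.invol]; exact hi)
          have h2 := d.stab_apply_eq_zero hu' h' hk (by rw [d.invol]; exact hi)
          rw [h1, h2]; simp
        · exact absurd (by rw [← hi, d.invol]) hk1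
        · have h1 := d.order k (d.σ i) hk
          rw [d.invol] at h1
          have h2 : (k : ℕ) + d.σ k = d.σ i + i := by
            rcases h1 with h1 | h1
            · exact absurd h1.1 (lt_asymm hi)
            · exact h1.2.1
          rw [Fin.lt_def] at *
          rw [hagree k (d.σ i) (by omega), hagree (d.σ k) j (by omega)]
      · exact absurd (by rw [← hk', d.invol]) hk2
      · rw [hu.1 _ _ hk', hu'.1 _ _ hk']; simp
    · exact absurd hk hk1
    · rw [hu.1 _ _ hk, hu'.1 _ _ hk]; simp
  have hne : d.σ i ≠ d.σ j := hs.ne'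
  have e := congrFun (congrFun (h.trans h'.symm) (d.σ i)) j
  rw [star'_mul_herm_mul_apply, star'_mul_herm_mul_apply, ← sub_eq_zero,
    ← Finset.sum_sub_distrib, Fintype.sum_eq_add (d.σ i) (d.σ j) hne
    (fun k hk => sub_eq_zero.2 (key k hk.1 hk.2))] at e
  simp only [d.invol, d.α_σ, hu.2, hu'.2, ← hα, ← smul_sub, map_one, one_mul, mul_one] at e
  rw [← smul_add, smul_eq_zero_iff_right (d.α_ne hij)] at e
  rw [map_sub]
  linear_combination e

/-- An element of the stabilizer is determined by its coordinates outside `K`. -/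
theorem stab_ext {u u' : Matrix (Fin n) (Fin n) D} (hu : IsUpperUnip u)
    (hu' : IsUpperUnip u') (h : star' u * (d.herm D).1 * u = (d.herm D).1)
    (h' : star' u' * (d.herm D).1 * u' = (d.herm D).1)
    (hc : ∀ q : d.KC, crd u q = crd u' q) : u = u' := by
  have hdiff : ∀ i j, i < j → d.σ j < d.σ i → i < d.σ j → u i j = u' i j := by
    intro i j hij hs hi
    have hK : ∀ e, ¬ d.InK (⟨(i, j), hij⟩, e) := by
      intro e
      simp only [InK]
      push Not
      exact ⟨hs.le, hi.le, fun h => absurd h hi.ne'⟩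
    have h0 := hc ⟨_, hK 0⟩
    have h1 := hc ⟨_, hK 1⟩
    simp only [crd, if_true, if_false, one_ne_zero] at h0 h1
    exact ext_cs_ct h0 h1
  -- Induction on the distance from the diagonal.
  have hall : ∀ k, AgreeBelow k u u' := by
    intro k
    induction k with
    | zero =>
      intro i j hij
      rw [hu.1 i j (by rw [Fin.lt_def]; omega), hu'.1 i j (by rw [Fin.lt_def]; omega)]
    | succ k ih =>
      intro i j hj
      rcases Nat.lt_succ_iff_lt_or_eq.1 (show (j : ℕ) < (i + k).succ from hj) with hj | hj
      · exact ih i j hj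
      rcases Nat.eq_zero_or_pos k with rfl | hk
      · have : j = i := Fin.ext (by omega)
        rw [this, hu.2, hu'.2]
      have hij : i < j := by rw [Fin.lt_def]; omega
      have ha : AgreeBelow ((j : ℕ) - i) u u' := by
        convert ih using 1; omega
      rcases d.order i j hij with hs | hs
      · rw [d.stab_apply_eq_zero hu h hij hs.1, d.stab_apply_eq_zero hu' h' hij hs.1]
      · have hl := d.stab_sub_leading hu hu' h h' hij ha hs.1
        rcases lt_trichotomy i (d.σ j) with hi | hi | hi
        · exact hdiff i j hij hs.1 hi
        · have h4 : d.σ i = j := by rw [hi, d.invol]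
          rw [← hi, h4] at hl
          have hK : ¬ d.InK (⟨(i, j), hij⟩, 1) := by
            simp only [InK]
            push Not
            exact ⟨hs.1.le, hi.le, fun _ => one_ne_zero⟩
          have h1 := hc ⟨_, hK⟩
          simp only [crd, if_false, one_ne_zero] at h1
          refine ext_cs_ct ?_ h1
          have h2 := congrArg cs hl
          rw [map_neg, cs_conj, map_sub] at h2
          linarith
        · have hd := hdiff (d.σ j) (d.σ i) hs.1
            (by rw [d.invol, d.invol]; exact hij) (by rw [d.invol]; exact hi)
          rw [hd, sub_self, map_zero, neg_zero] at hl
          exact sub_eq_zero.1 hl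
  ext i j
  exact hall n i j (by have := j.2; omega)

end Monomial

/-! ### The quotient measure -/

theorem IsTriangular.measurableEmbedding {ι : Type*} [Fintype ι] {ht : ι → ℕ}
    {F : (ι → ℝ) → ι → ℝ} (hF : IsTriangular ht F) (hm : Measurable F) : MeasurableEmbedding F :=
  hm.measurableEmbedding (hF.bijective_measurePreserving hm).1.1

section Measurability

variable {n : ℕ} {D : Type} [NormedCommRing D] [NormedAlgebra ℝ D] [QuadAlg D] [QuadBasis D]

theorem continuous_conj : Continuous (QuadAlg.conj : D → D) :=
  (QuadAlg.conj (D := D)).toLinearMap.continuous_of_finiteDimensional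

theorem continuous_mkD : Continuous fun p : ℝ × ℝ => (mkD p.1 p.2 : D) := by
  unfold mkD
  fun_prop

theorem continuous_cs : Continuous (cs : D → ℝ) := cs.continuous_of_finiteDimensional

theorem continuous_ct : Continuous (ct : D → ℝ) := ct.continuous_of_finiteDimensional

theorem continuous_tr : Continuous (tr : D → ℝ) :=
  (tr : D →ₗ[ℝ] ℝ).continuous_of_finiteDimensional

theorem continuous_coordAt (i j : Fin n) (e : Fin 2) :
    Continuous fun x : Ix n → ℝ => coordAt x i j e := by
  unfold coordAt
  split_ifs <;> fun_prop

theorem continuous_nmat : Continuous (nmat : (Ix n → ℝ) → Matrix (Fin n) (Fin n) D) :=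
  continuous_matrix fun i j => continuous_mkD.comp
    ((continuous_coordAt i j 0).prodMk (continuous_coordAt i j 1))

theorem continuous_crd : Continuous (crd : Matrix (Fin n) (Fin n) D → Ix n → ℝ) := by
  refine continuous_pi fun q => ?_
  simp only [crd]
  split_ifs
  · exact continuous_cs.comp (continuous_apply_apply _ _)
  · exact continuous_ct.comp (continuous_apply_apply _ _)

theorem continuous_star' : Continuous (star' : Matrix (Fin n) (Fin n) D → _) :=
  (Continuous.matrix_map continuous_id continuous_conj).matrix_transpose

theorem continuous_nilExp : Continuous (nilExp : Matrix (Fin n) (Fin n) D → _) := by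
  unfold nilExp
  refine continuous_finsetSum _ fun k _ => ?_
  have := continuous_pow (M := Matrix (Fin n) (Fin n) D) k
  fun_prop

theorem continuous_umat : Continuous (umat : Unip n D → _) :=
  Units.continuous_val.comp continuous_subtype_val

theorem continuous_mkUnip {X : Type*} [TopologicalSpace X] {u : X → Matrix (Fin n) (Fin n) D}
    (hu : ∀ x, IsUpperUnip (u x)) (h : Continuous u) :
    Continuous fun x => mkUnip (u x) (hu x) := by
  refine Continuous.subtype_mk ?_ _
  refine Units.continuous_iff.2 ⟨h, ?_⟩
  have : ∀ x, ((Matrix.GeneralLinearGroup.mk'' (u x) (by rw [(hu x).det]; exact isUnit_one))⁻¹ :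
      GL (Fin n) D).1 = (u x).adjugate := by
    intro x
    rw [Matrix.coe_units_inv, Matrix.inv_def]
    change Ring.inverse (u x).det • (u x).adjugate = _
    rw [(hu x).det]; simp
  simp only [this]
  exact h.matrix_adjugate

@[simp] theorem umat_mkUnip (u : Matrix (Fin n) (Fin n) D) (hu : IsUpperUnip u) :
    umat (mkUnip u hu) = u := rfl

theorem umat_injective : Function.Injective (umat : Unip n D → _) := fun _ _ h =>
  Subtype.ext (Units.ext h)

theorem umat_isUpperUnip (u : Unip n D) : IsUpperUnip (umat u) := u.2

theorem mem_stab_iff (g : Herm n D) (u : Unip n D) :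
    u ∈ stab g ↔ star' (umat u) * g.1 * umat u = g.1 :=
  Subtype.ext_iff

/-- The action of a matrix `u` on hermitian matrices. -/
def actM (g : Herm n D) (u : Matrix (Fin n) (Fin n) D) : Herm n D :=
  ⟨star' u * g.1 * u, by
    change star' _ = _
    have hx : star' g.1 = g.1 := g.2
    rw [star'_mul, star'_mul, star'_star', hx, Matrix.mul_assoc]⟩

theorem act_eq_actM (g : Herm n D) (u : Unip n D) : act g u = actM g (umat u) := rfl

theorem continuous_actM (g : Herm n D) : Continuous (actM g) :=
  Continuous.subtype_mk (((continuous_star'.matrix_mul continuous_const)).matrix_mul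
    continuous_id) _

/-- The character `χ` as a function of a matrix. -/
def chiM (ψ : AddChar ℝ Circle) (u : Matrix (Fin n) (Fin n) D) : ℂ :=
  ψ (∑ i : Fin n, ∑ j : Fin n, if (i : ℕ) + 1 = j then tr (u i j) else 0)

theorem chi_eq_chiM (ψ : AddChar ℝ Circle) (u : Unip n D) : chi ψ u = chiM ψ (umat u) := rfl

theorem continuous_chiM {ψ : AddChar ℝ Circle} (hψ : Continuous ψ) :
    Continuous (chiM ψ : Matrix (Fin n) (Fin n) D → ℂ) := by
  unfold chiM
  refine continuous_induced_dom.comp (hψ.comp ?_)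
  refine continuous_finsetSum _ fun i _ => continuous_finsetSum _ fun j _ => ?_
  split_ifs
  · exact continuous_tr.comp (continuous_apply_apply _ _)
  · exact continuous_const

theorem norm_chiM (ψ : AddChar ℝ Circle) (u : Matrix (Fin n) (Fin n) D) : ‖chiM ψ u‖ = 1 :=
  Circle.norm_coe _

theorem sum_superdiag_mul {u v : Matrix (Fin n) (Fin n) D} (hu : IsUpperUnip u)
    (hv : IsUpperUnip v) {i j : Fin n} (h : (i : ℕ) + 1 = j) :
    (u * v) i j = u i j + v i j := by
  have hij : i < j := by rw [Fin.lt_def]; omega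
  suffices key : ∀ k, k ≠ i ∧ k ≠ j → u i k * v k j = 0 by
    rw [Matrix.mul_apply, Fintype.sum_eq_add i j hij.ne key, hu.2, hv.2, one_mul, mul_one,
      add_comm]
  intro k hk
  obtain ⟨hk1, hk2⟩ := hk
  rcases lt_or_gt_of_ne hk1 with hk | hk
  · rw [hu.1 _ _ hk, zero_mul]
  · rw [hv.1 _ _ (by rw [Fin.lt_def] at *; have : (k : ℕ) ≠ j := fun h => hk2 (Fin.ext h); omega),
      mul_zero]

theorem chiM_mul (ψ : AddChar ℝ Circle) {u v : Matrix (Fin n) (Fin n) D} (hu : IsUpperUnip u)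
    (hv : IsUpperUnip v) : chiM ψ (u * v) = chiM ψ u * chiM ψ v := by
  unfold chiM
  rw [← Circle.coe_mul, ← AddChar.map_add_eq_mul]
  refine congrArg (fun x => ((ψ x : Circle) : ℂ)) ?_
  rw [← Finset.sum_add_distrib]
  refine Finset.sum_congr rfl fun i _ => ?_
  rw [← Finset.sum_add_distrib]
  refine Finset.sum_congr rfl fun j _ => ?_
  split_ifs with h
  · rw [sum_superdiag_mul hu hv h, map_add]
  · simp

theorem haarN_eq : haarN n D = Measure.map
    (fun x : Ix n → ℝ => mkUnip (1 + nmat x) (isUpperUnip_one_add_nmat x)) volume := by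
  have h := (EuclideanSpace.volume_preserving_symm_measurableEquiv_toLp (Ix n))
  rw [haarN, ← h.map_eq, Measure.map_map _ (MeasurableEquiv.measurable _)]
  · congr 1
    funext x
    apply umat_injective
    simp only [umat_mkUnip, lieMat_eq_nmat, Function.comp_apply]
    rfl
  · exact (continuous_mkUnip _ (continuous_const.add continuous_nmat)).measurable

end Measurability

namespace Monomial

variable {n : ℕ} (d : Monomial n)

/-- Coordinates on `N` adapted to the stabilizer: `x` is mapped to the coordinates of
`exp(X) (1 + Y)`, where `X` lies in the Lie algebra of the stabilizer and `Y` in its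
complement. -/
def fact (D : Type) [NormedCommRing D] [NormedAlgebra ℝ D] [QuadAlg D] [QuadBasis D]
    (x : Ix n → ℝ) : Ix n → ℝ :=
  crd (nilExp (nmat (d.lie fun q => x q)) * (1 + nmat (d.ext fun q => x q)) :
    Matrix (Fin n) (Fin n) D)

/-- The coordinates of `lie w` at distance `h` from the diagonal depend only on those of `w` at the
same distance. -/
theorem lie_congr {w w' : d.KC → ℝ} {q : Ix n}
    (h : ∀ q' : d.KC, (q'.1.1.1.2 : ℕ) + q.1.1.1 = q.1.1.2 + q'.1.1.1.1 → w q' = w' q') :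
    d.lie w q = d.lie w' q := by
  simp only [lie]
  split_ifs with hK h0
  · rw [show coordAt (d.extC w) (d.σ q.1.1.2) (d.σ q.1.1.1) q.2 =
      coordAt (d.extC w') (d.σ q.1.1.2) (d.σ q.1.1.1) q.2 from ?_]
    simp only [coordAt, extC]
    split_ifs with h1 h2
    · rfl
    · apply h
      rcases d.order q.1.1.1 q.1.1.2 q.1.2 with h3 | h3
      · exact absurd h3.1 (lt_asymm h1)
      · simp only; omega
    · rfl
  · rw [show coordAt (d.extC w) (d.σ q.1.1.2) (d.σ q.1.1.1) q.2 =
      coordAt (d.extC w') (d.σ q.1.1.2) (d.σ q.1.1.1) q.2 from ?_]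
    simp only [coordAt, extC]
    split_ifs with h1 h2
    · rfl
    · apply h
      rcases d.order q.1.1.1 q.1.1.2 q.1.2 with h3 | h3
      · exact absurd h3.1 (lt_asymm h1)
      · simp only; omega
    · rfl
  · rw [extC, extC, dif_neg hK, dif_neg hK]
    exact h ⟨q, hK⟩ rfl

variable {D : Type} [NormedCommRing D] [NormedAlgebra ℝ D] [QuadAlg D] [QuadBasis D]

theorem nmat_lie_agreeBelow {w w' : d.KC → ℝ} {h : ℕ}
    (hw : ∀ q : d.KC, (q.1.1.1.2 : ℕ) < q.1.1.1.1 + h → w q = w' q) :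
    AgreeBelow h (nmat (d.lie w) : Matrix (Fin n) (Fin n) D) (nmat (d.lie w')) := by
  intro i j hij
  rcases lt_or_ge i j with hlt | hlt
  · rw [nmat_apply_of_lt _ hlt, nmat_apply_of_lt _ hlt]
    have : ∀ e, d.lie w (⟨(i, j), hlt⟩, e) = d.lie w' (⟨(i, j), hlt⟩, e) := fun e =>
      d.lie_congr fun q' hq' => hw q' (by simp only at hq'; omega)
    rw [this, this]
  · rw [nmat_apply_of_le _ hlt, nmat_apply_of_le _ hlt]

/-- The coordinates of `exp(X) (1 + Y)` differ from those of `X + Y` by terms that depend on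
entries closer to the diagonal. -/
theorem crd_nilExp_mul_congr {x x' y y' : Ix n → ℝ} {q : Ix n}
    (h1 : AgreeBelow ((q.1.1.2 : ℕ) - q.1.1.1) (nmat x : Matrix (Fin n) (Fin n) D) (nmat x'))
    (h2 : AgreeBelow ((q.1.1.2 : ℕ) - q.1.1.1) (nmat y : Matrix (Fin n) (Fin n) D) (nmat y')) :
    crd (nilExp (nmat x) * (1 + nmat y) : Matrix (Fin n) (Fin n) D) q - x q - y q =
      crd (nilExp (nmat x') * (1 + nmat y') : Matrix (Fin n) (Fin n) D) q - x' q - y' q := by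
  have h := (strictUpper_nmat (D := D) x).nilExp_mul_agreeBelow (strictUpper_nmat x')
    (strictUpper_nmat y) (strictUpper_nmat y') h1 h2 q.1.1.1 q.1.1.2
    (by have := q.1.2; rw [Fin.lt_def] at this; omega)
  have hx : ∀ z : Ix n → ℝ, (nmat z : Matrix (Fin n) (Fin n) D) q.1.1.1 q.1.1.2 =
      mkD (z (q.1, 0)) (z (q.1, 1)) := fun z => nmat_apply_of_lt z q.1.2
  simp only [Matrix.sub_apply, hx] at h
  obtain ⟨p, e⟩ := q
  fin_cases e
  · have := congrArg cs h
    simpa [crd] using this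
  · have := congrArg ct h
    simpa [crd] using this

/-- The height is twice the distance from the diagonal, plus one for the coordinates in `K`, since
`lie` expresses the coordinates in `K` through those outside `K` at the same distance. -/
theorem isTriangular_fact : IsTriangular
    (fun q : Ix n => 2 * ((q.1.1.2 : ℕ) - q.1.1.1) + if d.InK q then 1 else 0) (d.fact D) := by
  intro q x x' h
  have hq : (q.1.1.1 : ℕ) < q.1.1.2 := q.1.2
  have h1 : AgreeBelow ((q.1.1.2 : ℕ) - q.1.1.1)
      (nmat (d.lie fun q => x q) : Matrix (Fin n) (Fin n) D) (nmat (d.lie fun q => x' q)) := by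
    refine d.nmat_lie_agreeBelow fun q' hq' => h q' ?_
    simp only [if_neg q'.2]; omega
  have h2 : AgreeBelow ((q.1.1.2 : ℕ) - q.1.1.1)
      (nmat (d.ext fun q => x q) : Matrix (Fin n) (Fin n) D) (nmat (d.ext fun q => x' q)) := by
    intro i j hij
    rcases lt_or_ge i j with hlt | hlt
    · rw [nmat_apply_of_lt _ hlt, nmat_apply_of_lt _ hlt]
      have : ∀ e, d.ext (fun q => x q) (⟨(i, j), hlt⟩, e) =
          d.ext (fun q => x' q) (⟨(i, j), hlt⟩, e) := by
        intro e
        simp only [ext]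
        split_ifs with hK
        · refine h _ ?_
          simp only
          rw [Fin.lt_def] at hlt
          split_ifs <;> omega
        · rfl
      rw [this, this]
    · rw [nmat_apply_of_le _ hlt, nmat_apply_of_le _ hlt]
  have h3 := crd_nilExp_mul_congr h1 h2
  have h4 : d.lie (fun q => x q) q + d.ext (fun q => x q) q - x q =
      d.lie (fun q => x' q) q + d.ext (fun q => x' q) q - x' q := by
    by_cases hK : d.InK q
    · have : d.lie (fun q => x q) q = d.lie (fun q => x' q) q :=
        d.lie_congr fun q' hq' => h q' (by simp only [if_neg q'.2, if_pos hK]; omega)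
      rw [this]
      simp [ext, hK]
    · simp [lie, extC, ext, hK]
  simp only [fact]
  linarith

theorem continuous_lie : Continuous d.lie := by
  refine continuous_pi fun q => ?_
  have h : Continuous d.extC := by
    refine continuous_pi fun q => ?_
    unfold extC
    split_ifs <;> fun_prop
  have h2 : Continuous fun w => coordAt (d.extC w) (d.σ q.1.1.2) (d.σ q.1.1.1) q.2 :=
    (continuous_coordAt _ _ _).comp h
  have h3 : Continuous fun w => d.extC w q := (continuous_apply q).comp h
  unfold lie
  split_ifs
  · exact continuous_const.mul h2
  · exact continuous_const.mul h2
  · exact h3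

theorem continuous_ext : Continuous d.ext := by
  refine continuous_pi fun q => ?_
  unfold ext
  split_ifs <;> fun_prop

/-- The transversal to the stabilizer. -/
def U (y : d.K → ℝ) : Matrix (Fin n) (Fin n) D := 1 + nmat (d.ext y)

theorem isUpperUnip_U (y : d.K → ℝ) : IsUpperUnip (d.U y : Matrix (Fin n) (Fin n) D) :=
  isUpperUnip_one_add_nmat _

theorem continuous_U : Continuous (d.U : _ → Matrix (Fin n) (Fin n) D) :=
  continuous_const.add (continuous_nmat.comp d.continuous_ext)

/-- The exponential coordinates on the stabilizer. -/
def E (w : d.KC → ℝ) : Matrix (Fin n) (Fin n) D := nilExp (nmat (d.lie w))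

theorem isUpperUnip_E (w : d.KC → ℝ) : IsUpperUnip (d.E w : Matrix (Fin n) (Fin n) D) :=
  (strictUpper_nmat _).isUpperUnip_nilExp

theorem continuous_E : Continuous (d.E : _ → Matrix (Fin n) (Fin n) D) :=
  continuous_nilExp.comp (continuous_nmat.comp d.continuous_lie)

theorem E_stab (w : d.KC → ℝ) :
    star' (d.E w : Matrix (Fin n) (Fin n) D) * (d.herm D).1 * d.E w = (d.herm D).1 :=
  (strictUpper_nmat _).nilExp_stab ((d.stabLie_iff _).2 (d.isLie_lie w))

theorem crd_E_mul_congr (s : Matrix (Fin n) (Fin n) D) (hs : IsUpperUnip s) {w w' : d.KC → ℝ}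
    {q : d.KC} (h : ∀ q' : d.KC, (q'.1.1.1.2 : ℕ) - q'.1.1.1.1 < q.1.1.1.2 - q.1.1.1.1 →
      w q' = w' q') :
    crd (d.E w * s) q - w q = crd (d.E w' * s) q - w' q := by
  have hq : (q.1.1.1.1 : ℕ) < q.1.1.1.2 := q.1.1.2
  have h1 : AgreeBelow ((q.1.1.1.2 : ℕ) - q.1.1.1.1)
      (nmat (d.lie w) : Matrix (Fin n) (Fin n) D) (nmat (d.lie w')) :=
    d.nmat_lie_agreeBelow fun q' hq' => h q' (by have : (q'.1.1.1.1 : ℕ) < q'.1.1.1.2 := q'.1.1.2; omega)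
  have h3 := crd_nilExp_mul_congr (q := q.1) h1 (y := crd s) (y' := crd s) (fun _ _ _ => rfl)
  rw [one_add_nmat_crd hs, d.lie_apply_of_not, d.lie_apply_of_not] at h3
  simp only [E]
  linarith

theorem isTriangular_crd_E_mul (s : Matrix (Fin n) (Fin n) D) (hs : IsUpperUnip s) :
    IsTriangular (fun q : d.KC => (q.1.1.1.2 : ℕ) - q.1.1.1.1)
      (fun w (q : d.KC) => crd (d.E w * s) q) :=
  fun _ _ _ h => d.crd_E_mul_congr s hs h

theorem measurable_crd_E_mul (s : Matrix (Fin n) (Fin n) D) :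
    Measurable (fun w (q : d.KC) => crd (d.E w * s) q) :=
  (continuous_pi fun q : d.KC => (continuous_apply q.1).comp
    (continuous_crd.comp (d.continuous_E.matrix_mul continuous_const))).measurable

/-- Invariance of the Haar measure of the stabilizer under right translations, in exponential
coordinates. -/
theorem lintegral_E_mul_stab (f : Matrix (Fin n) (Fin n) D → ℝ≥0∞)
    {s : Matrix (Fin n) (Fin n) D} (hs : IsUpperUnip s)
    (h : star' s * (d.herm D).1 * s = (d.herm D).1) :
    ∫⁻ w, f (d.E w * s) = ∫⁻ w, f (d.E w) := by
  have h1 := d.isTriangular_crd_E_mul (1 : Matrix (Fin n) (Fin n) D) IsUpperUnip.one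
  have h2 := d.isTriangular_crd_E_mul s hs
  have e1 := h1.bijective_measurePreserving (d.measurable_crd_E_mul 1)
  have e2 := h2.bijective_measurePreserving (d.measurable_crd_E_mul s)
  have m1 := h1.measurableEmbedding (d.measurable_crd_E_mul 1)
  have m2 := h2.measurableEmbedding (d.measurable_crd_E_mul s)
  obtain ⟨H, hl, hr⟩ := Function.bijective_iff_has_inverse.1 e1.1
  have key : ∀ w, d.E w * s = d.E (H fun q : d.KC => crd (d.E w * s) q) := by
    intro w
    refine d.stab_ext ((d.isUpperUnip_E w).mul hs) (d.isUpperUnip_E _) ?_ (d.E_stab _) ?_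
    · have e : star' (d.E w * s) * (d.herm D).1 * (d.E w * s) =
          star' s * (star' (d.E w) * (d.herm D).1 * d.E w) * s := by
        rw [star'_mul]; simp only [Matrix.mul_assoc]
      rw [e, d.E_stab, h]
    · intro q
      have h3 := congrFun (hr fun q : d.KC => crd (d.E w * s) q) q
      simp only [Matrix.mul_one] at h3
      exact h3.symm
  have key2 : ∀ w, f (d.E w) = f (d.E (H fun q : d.KC => crd (d.E w * 1 : Matrix _ _ D) q)) :=
    fun w => congrArg (fun v => f (d.E v)) (hl w).symm
  rw [lintegral_congr fun w => congrArg f (key w), lintegral_congr key2,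
    e2.2.lintegral_comp_emb m2 (fun v => f (d.E (H v))),
    e1.2.lintegral_comp_emb m1 (fun v => f (d.E (H v)))]

/-- The stabilizer Lie algebra as a subspace of the coordinate space. -/
def lieSub : Submodule ℝ (Coord n) where
  carrier := {x | d.IsLie x.ofLp}
  add_mem' := by
    intro x y hx hy i j hij
    have h1 := hx i j hij
    have h2 := hy i j hij
    refine ⟨fun h e => ?_, fun h => ⟨?_, ?_⟩⟩
    · simp [h1.1 h e, h2.1 h e]
    · simp [(h1.2 h).1, (h2.2 h).1, add_comm]
    · simp [(h1.2 h).2, (h2.2 h).2]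
  zero_mem' := by intro i j hij; simp
  smul_mem' := by
    intro r x hx i j hij
    have h1 := hx i j hij
    refine ⟨fun h e => ?_, fun h => ⟨?_, ?_⟩⟩
    · simp [h1.1 h e]
    · simp [(h1.2 h).1]
    · simp [(h1.2 h).2]

theorem stabLie_eq : stabLie (d.herm D) = d.lieSub := by
  ext x
  change star' (lieMat x) * (d.herm D).1 + (d.herm D).1 * lieMat x = 0 ↔ d.IsLie x.ofLp
  rw [lieMat_eq_nmat, d.stabLie_iff]

/-- Linear coordinates on the stabilizer Lie algebra. -/
def lieEquiv : (d.KC → ℝ) ≃L[ℝ] d.lieSub :=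
  LinearEquiv.toContinuousLinearEquiv
    { toFun := fun w => ⟨WithLp.toLp 2 (d.lie w), d.isLie_lie w⟩
      map_add' := fun w w' => by
        apply Subtype.ext
        simp [d.lie_add]
      map_smul' := fun c w => by
        apply Subtype.ext
        simp [d.lie_smul]
      invFun := fun x q => x.1 q.1
      left_inv := fun w => by
        funext q
        exact d.lie_apply_of_not w q
      right_inv := fun x => by
        apply Subtype.ext
        apply PiLp.ext
        intro q
        exact (congrFun (d.eq_lie_of_isLie x.2) q).symm }

/-- The Jacobian of the linear coordinates `lieEquiv`. -/
def jac : NNReal := Measure.addHaarScalarFactor (volume : Measure d.lieSub)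
  (Measure.map d.lieEquiv volume)

theorem jac_pos : 0 < d.jac := by
  have : (Measure.map d.lieEquiv (volume : Measure (d.KC → ℝ))).IsAddHaarMeasure :=
    d.lieEquiv.isAddHaarMeasure_map _
  exact Measure.addHaarScalarFactor_pos_of_isAddHaarMeasure _ _

/-- The Haar measure of the stabilizer in the coordinates outside `K`. The Lie algebra has the same
equations for `ℝ ⊕ ℝ` and `ℂ`, so the constant `jac` does not depend on `D`. -/
theorem haarStab_eq : haarStab (d.herm D) = d.jac •
    Measure.map (fun w => mkUnip (d.E w) (d.isUpperUnip_E w)) (volume : Measure (d.KC → ℝ)) := by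
  have : (Measure.map d.lieEquiv (volume : Measure (d.KC → ℝ))).IsAddHaarMeasure :=
    d.lieEquiv.isAddHaarMeasure_map _
  have key : ∀ S : Submodule ℝ (Coord n), S = d.lieSub →
      Measure.map (fun x : S => mkUnip (nilExp (lieMat x.1) : Matrix (Fin n) (Fin n) D)
        (isUpperUnip_nilExp x.1)) volume = d.jac •
    Measure.map (fun w => mkUnip (d.E w : Matrix (Fin n) (Fin n) D) (d.isUpperUnip_E w))
      (volume : Measure (d.KC → ℝ)) := by
    rintro S rfl
    have h1 := Measure.isAddLeftInvariant_eq_smul (volume : Measure d.lieSub)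
      (Measure.map d.lieEquiv volume)
    have hc : Continuous fun x : d.lieSub =>
        mkUnip (nilExp (lieMat x.1) : Matrix (Fin n) (Fin n) D) (isUpperUnip_nilExp x.1) := by
      refine continuous_mkUnip _ (continuous_nilExp.comp ?_)
      have : (fun x : d.lieSub => (lieMat x.1 : Matrix (Fin n) (Fin n) D)) =
          fun x => nmat x.1.ofLp := by funext x; exact lieMat_eq_nmat _
      rw [this]
      exact continuous_nmat.comp ((PiLp.continuous_ofLp 2 _).comp continuous_subtype_val)
    rw [h1, Measure.map_smul, Measure.map_map hc.measurable
      d.lieEquiv.continuous.measurable]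
    congr 2
    funext w
    apply umat_injective
    simp only [umat_mkUnip, Function.comp_apply, lieMat_eq_nmat]
    rfl
  exact key _ d.stabLie_eq

end Monomial

namespace Monomial

variable {n : ℕ} (d : Monomial n) {D : Type} [NormedCommRing D] [NormedAlgebra ℝ D] [QuadAlg D]
  [QuadBasis D]

/-- The integral over the quotient of `N` by the stabilizer, written in coordinates. -/
def J (ψ : AddChar ℝ Circle) (Φ : Herm n D → ℂ) : ℂ :=
  ∫ y, Φ (actM (d.herm D) (d.U y)) * chiM ψ (d.U y : Matrix (Fin n) (Fin n) D)

variable (D) in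
/-- The transversal `U` as a map to `N`. -/
def UN (y : d.K → ℝ) : Unip n D := mkUnip (d.U y) (d.isUpperUnip_U y)

variable (D) in
/-- The exponential coordinates as a map to `N`. -/
def EN (w : d.KC → ℝ) : Unip n D := mkUnip (d.E w) (d.isUpperUnip_E w)

variable (D) in
/-- The projection to the quotient. -/
def toQuot (u : Unip n D) : QuotStab (d.herm D) := Quotient.mk _ u

theorem continuous_UN : Continuous (d.UN D) := continuous_mkUnip _ d.continuous_U

theorem continuous_EN : Continuous (d.EN D) := continuous_mkUnip _ d.continuous_E

theorem measurable_toQuot : Measurable (d.toQuot D) := measurable_quotient_mk''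

theorem EN_mem (w : d.KC → ℝ) : d.EN D w ∈ stab (d.herm D) :=
  (mem_stab_iff _ _).2 (d.E_stab w)

theorem exists_out (u : Unip n D) : ∃ s ∈ stab (d.herm D), (d.toQuot D u).out = s * u := by
  have h : (QuotientGroup.rightRel (stab (d.herm D))) u (d.toQuot D u).out :=
    (QuotientGroup.rightRel (stab (d.herm D))).symm
      (@Quotient.mk_out _ (QuotientGroup.rightRel (stab (d.herm D))) u)
  rw [QuotientGroup.rightRel_apply] at h
  exact ⟨_, h, by simp⟩

theorem toQuot_mul {s : Unip n D} (hs : s ∈ stab (d.herm D)) (u : Unip n D) :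
    d.toQuot D (s * u) = d.toQuot D u := by
  refine Quotient.sound (s := QuotientGroup.rightRel (stab (d.herm D))) ?_
  change (QuotientGroup.rightRel (stab (d.herm D))) (s * u) u
  rw [QuotientGroup.rightRel_apply]
  simpa using (stab (d.herm D)).inv_mem hs

theorem lintegral_haarStab (f : Unip n D → ℝ≥0∞) (hf : Measurable f) :
    ∫⁻ s, f s ∂(haarStab (d.herm D)) = d.jac * ∫⁻ w, f (d.EN D w) := by
  rw [haarStab_eq, lintegral_smul_measure]
  change d.jac • ∫⁻ a, f a ∂Measure.map (d.EN D) volume = _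
  rw [lintegral_map hf d.continuous_EN.measurable]
  rfl

theorem lintegral_haarStab_out (f : Unip n D → ℝ≥0∞) (hf : Measurable f) (u : Unip n D) :
    ∫⁻ s, f (s * (d.toQuot D u).out) ∂(haarStab (d.herm D)) =
      d.jac * ∫⁻ w, f (d.EN D w * u) := by
  obtain ⟨s, hs, h⟩ := d.exists_out u
  rw [h, d.lintegral_haarStab (fun t => f (t * (s * u))) (hf.comp (measurable_mul_const _))]
  congr 1
  classical
  have := d.lintegral_E_mul_stab (fun M => if hM : IsUpperUnip M then f (mkUnip M hM * u) else 0)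
    (umat_isUpperUnip s) ((mem_stab_iff _ _).1 hs)
  have e1 : ∀ w, d.EN D w * (s * u) = mkUnip (d.E w * umat s)
      ((d.isUpperUnip_E w).mul (umat_isUpperUnip s)) * u := by
    intro w
    rw [← mul_assoc]
    exact congrArg (· * u) (umat_injective rfl)
  simp only [dif_pos ((d.isUpperUnip_E _).mul (umat_isUpperUnip s)),
    dif_pos (d.isUpperUnip_E _), ← e1] at this
  exact this

theorem measurable_fact : Measurable (d.fact D) := by
  refine (continuous_crd.comp (Continuous.matrix_mul ?_ ?_)).measurable
  · refine d.continuous_E.comp (continuous_pi fun q => continuous_apply _)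
  · exact d.continuous_U.comp (continuous_pi fun q => continuous_apply _)

/-- Recombination of the coordinates inside and outside `K`. -/
def glue (w : d.KC → ℝ) (y : d.K → ℝ) : Ix n → ℝ :=
  (MeasurableEquiv.piEquivPiSubtypeProd (fun _ : Ix n => ℝ) d.InK).symm (y, w)

theorem mkUnip_fact (w : d.KC → ℝ) (y : d.K → ℝ) :
    mkUnip (1 + nmat (d.fact D (d.glue w y))) (isUpperUnip_one_add_nmat _) =
      d.EN D w * d.UN D y := by
  apply umat_injective
  rw [umat_mkUnip, umat_mul]
  have h1 : (fun q : d.KC => d.glue w y q) = w := by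
    funext q
    simp [glue, MeasurableEquiv.piEquivPiSubtypeProd, Equiv.piEquivPiSubtypeProd, q.2]
  have h2 : (fun q : d.K => d.glue w y q) = y := by
    funext q
    simp [glue, MeasurableEquiv.piEquivPiSubtypeProd, Equiv.piEquivPiSubtypeProd, q.2]
  rw [fact, h1, h2]
  exact one_add_nmat_crd ((d.isUpperUnip_E w).mul (d.isUpperUnip_U y))

theorem lintegral_haarN (f : Unip n D → ℝ≥0∞) (hf : Measurable f) :
    ∫⁻ u, f u ∂(haarN n D) = ∫⁻ y, ∫⁻ w, f (d.EN D w * d.UN D y) := by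
  have hc : Continuous fun x : Ix n → ℝ =>
      mkUnip (1 + nmat x : Matrix (Fin n) (Fin n) D) (isUpperUnip_one_add_nmat x) :=
    continuous_mkUnip _ (continuous_const.add continuous_nmat)
  have hF := d.isTriangular_fact.bijective_measurePreserving (d.measurable_fact (D := D))
  have hg := volume_preserving_piEquivPiSubtypeProd (fun _ : Ix n => ℝ) d.InK
  have hg' := hg.symm _
  rw [haarN_eq, lintegral_map hf hc.measurable]
  refine (hF.2.lintegral_comp (hf.comp hc.measurable)).symm.trans ?_
  refine (hg'.lintegral_comp ((hf.comp hc.measurable).comp d.measurable_fact)).symm.trans ?_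
  have e : ∀ p : (d.K → ℝ) × (d.KC → ℝ),
      f (mkUnip (1 + nmat (d.fact D
        ((MeasurableEquiv.piEquivPiSubtypeProd (fun _ : Ix n => ℝ) d.InK).symm p)))
        (isUpperUnip_one_add_nmat _)) = f (d.EN D p.2 * d.UN D p.1) := by
    intro p
    rw [← d.mkUnip_fact]
    rfl
  simp only [Function.comp_def]
  rw [lintegral_congr e]
  refine lintegral_prod _ (Measurable.aemeasurable ?_)
  exact hf.comp ((d.continuous_EN.comp continuous_snd).mul
    (d.continuous_UN.comp continuous_fst)).measurable

variable (D) in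
/-- The quotient measure in coordinates. -/
def quot : Measure (QuotStab (d.herm D)) :=
  (d.jac : ℝ≥0∞)⁻¹ • Measure.map (fun y => d.toQuot D (d.UN D y)) volume

theorem jac_ne_zero : (d.jac : ℝ≥0∞) ≠ 0 := by exact_mod_cast d.jac_pos.ne'

theorem measurable_toQuot_UN : Measurable fun y => d.toQuot D (d.UN D y) :=
  d.measurable_toQuot.comp d.continuous_UN.measurable

theorem isQuotientMeasure_quot : IsQuotientMeasure (d.herm D) (d.quot D) := by
  intro f hf
  have hm : Measurable fun q : QuotStab (d.herm D) =>
      ∫⁻ s, f (s * q.out) ∂(haarStab (d.herm D)) := by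
    refine measurable_from_quotient.2 ?_
    have : (fun q : QuotStab (d.herm D) => ∫⁻ s, f (s * q.out) ∂(haarStab (d.herm D))) ∘
        Quotient.mk'' = fun u => d.jac * ∫⁻ w, f (d.EN D w * u) := by
      funext u
      exact d.lintegral_haarStab_out f hf u
    rw [this]
    refine Measurable.const_mul ?_ _
    refine Measurable.lintegral_prod_right' (f := fun p : Unip n D × (d.KC → ℝ) =>
      f (d.EN D p.2 * p.1)) ?_
    exact hf.comp ((d.continuous_EN.comp continuous_snd).mul continuous_fst).measurable
  rw [quot, lintegral_smul_measure, lintegral_map hm d.measurable_toQuot_UN]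
  simp only [d.lintegral_haarStab_out f hf]
  rw [lintegral_const_mul', smul_eq_mul, ← mul_assoc,
    ENNReal.inv_mul_cancel d.jac_ne_zero ENNReal.coe_ne_top, one_mul, d.lintegral_haarN f hf]
  exact ENNReal.coe_ne_top

/-- Uniqueness of the quotient measure: the indicator function of the preimage of a set of cosets
is cut down to the unit cube in the exponential coordinates of the stabilizer, so that its
integrals over the cosets in the set are constant. -/
theorem eq_quot {ν : Measure (QuotStab (d.herm D))} (hν : IsQuotientMeasure (d.herm D) ν) :
    ν = d.quot D := by
  have hF := d.isTriangular_fact.bijective_measurePreserving (d.measurable_fact (D := D))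
  have hFe := d.isTriangular_fact.measurableEmbedding (d.measurable_fact (D := D))
  let S : Set (Ix n → ℝ) := {x | ∀ q : d.KC, x q ∈ Set.Icc (0 : ℝ) 1}
  have hS : MeasurableSet S := by
    simp only [S, Set.ofPred_forall]
    exact MeasurableSet.iInter fun q => measurableSet_Icc.preimage (measurable_pi_apply _)
  let T : Set (Unip n D) := (fun u => crd (umat u)) ⁻¹' (d.fact D '' S)
  have hT : MeasurableSet T :=
    (hFe.measurableSet_image.2 hS).preimage (continuous_crd.comp continuous_umat).measurable
  have hmem : ∀ w y, d.EN D w * d.UN D y ∈ T ↔ w ∈ Set.Icc (0 : d.KC → ℝ) 1 := by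
    intro w y
    rw [← d.mkUnip_fact]
    simp only [T, Set.mem_preimage, umat_mkUnip, crd_one_add_nmat]
    rw [hF.1.1.mem_set_image]
    simp only [S, Set.mem_ofPred_eq, Set.mem_Icc, Pi.le_def]
    rw [← forall_and]
    refine forall_congr' fun q => ?_
    have : d.glue w y q = w q := by
      simp [glue, MeasurableEquiv.piEquivPiSubtypeProd, Equiv.piEquivPiSubtypeProd, q.2]
    rw [this]
    rfl
  have key : ∀ ν' : Measure (QuotStab (d.herm D)), IsQuotientMeasure (d.herm D) ν' →
      ∀ A, MeasurableSet A → (d.jac : ℝ≥0∞) * ν' A = haarN n D (d.toQuot D ⁻¹' A ∩ T) := by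
    intro ν' h A hA
    have hA' : MeasurableSet (d.toQuot D ⁻¹' A ∩ T) := (d.measurable_toQuot hA).inter hT
    have h1 := h ((d.toQuot D ⁻¹' A ∩ T).indicator 1) (measurable_one.indicator hA')
    rw [lintegral_indicator_one hA'] at h1
    rw [h1]
    have h2 : ∀ q : QuotStab (d.herm D), ∫⁻ s, (d.toQuot D ⁻¹' A ∩ T).indicator 1 (s * q.out)
        ∂(haarStab (d.herm D)) = A.indicator (fun _ => (d.jac : ℝ≥0∞)) q := by
      intro q
      obtain ⟨u, rfl⟩ : ∃ u, d.toQuot D u = q := Quotient.exists_rep q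
      obtain ⟨x, hx⟩ := hF.1.2 (crd (umat u))
      obtain ⟨w, y, rfl⟩ : ∃ w y, d.glue w y = x :=
        ⟨fun q => x q, fun q => x q,
          (MeasurableEquiv.piEquivPiSubtypeProd (fun _ : Ix n => ℝ) d.InK).symm_apply_apply x⟩
      have hu : u = d.EN D w * d.UN D y := by
        rw [← d.mkUnip_fact]
        apply umat_injective
        rw [umat_mkUnip, hx, one_add_nmat_crd (umat_isUpperUnip u)]
      rw [hu, d.toQuot_mul (d.EN_mem w)]
      rw [d.lintegral_haarStab_out _ (measurable_one.indicator hA')]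
      by_cases hyA : d.toQuot D (d.UN D y) ∈ A
      · rw [Set.indicator_of_mem hyA]
        have h3 : ∀ w, (d.toQuot D ⁻¹' A ∩ T).indicator (1 : Unip n D → ℝ≥0∞)
            (d.EN D w * d.UN D y) = (Set.Icc (0 : d.KC → ℝ) 1).indicator 1 w := by
          intro w
          have : d.EN D w * d.UN D y ∈ d.toQuot D ⁻¹' A ∩ T ↔ w ∈ Set.Icc (0 : d.KC → ℝ) 1 := by
            rw [Set.mem_inter_iff, hmem, Set.mem_preimage, d.toQuot_mul (d.EN_mem w)]
            exact and_iff_right hyA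
          by_cases hw : w ∈ Set.Icc (0 : d.KC → ℝ) 1
          · rw [Set.indicator_of_mem hw, Set.indicator_of_mem (this.2 hw)]; rfl
          · rw [Set.indicator_of_notMem hw, Set.indicator_of_notMem (fun h => hw (this.1 h))]
        rw [lintegral_congr h3, lintegral_indicator_one measurableSet_Icc, Real.volume_Icc_pi]
        simp
      · rw [Set.indicator_of_notMem hyA]
        have h3 : ∀ w, (d.toQuot D ⁻¹' A ∩ T).indicator (1 : Unip n D → ℝ≥0∞)
            (d.EN D w * d.UN D y) = 0 := by
          intro w
          refine Set.indicator_of_notMem (fun h => hyA ?_) _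
          have := h.1
          rwa [Set.mem_preimage, d.toQuot_mul (d.EN_mem w)] at this
        simp [h3]
    rw [lintegral_congr h2, lintegral_indicator_const hA]
  ext A hA
  have h1 := key ν hν A hA
  rw [← key _ d.isQuotientMeasure_quot A hA] at h1
  exact (ENNReal.mul_right_inj d.jac_ne_zero ENNReal.coe_ne_top).1 h1

theorem isQuotientMeasure_quotMeasure : IsQuotientMeasure (d.herm D) (quotMeasure (d.herm D)) := by
  have h : ∃ ν : Measure (QuotStab (d.herm D)), IsQuotientMeasure (d.herm D) ν :=
    ⟨_, d.isQuotientMeasure_quot⟩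
  rw [quotMeasure, dif_pos h]
  exact h.choose_spec

theorem quotMeasure_eq : quotMeasure (d.herm D) = d.quot D :=
  d.eq_quot d.isQuotientMeasure_quotMeasure

/-- The character is trivial on the stabilizer: the superdiagonal positions that are not zero on
the stabilizer are permuted by `(i, j) ↦ (σ j, σ i)`, and partners cancel. -/
theorem chiM_stab (ψ : AddChar ℝ Circle) {u : Matrix (Fin n) (Fin n) D} (hu : IsUpperUnip u)
    (h : star' u * (d.herm D).1 * u = (d.herm D).1) : chiM ψ u = 1 := by
  have hz : ∀ i j : Fin n, (i : ℕ) + 1 = j → (if (i : ℕ) + 1 = j then tr (u i j) else 0) =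
      -(if (d.σ j : ℕ) + 1 = d.σ i then tr (u (d.σ j) (d.σ i)) else 0) := by
    intro i j hi
    have hij : i < j := by rw [Fin.lt_def]; omega
    rw [if_pos hi]
    rcases d.order i j hij with ho | ho
    · rw [if_neg (by have := ho.1; rw [Fin.lt_def] at this; omega),
        d.stab_apply_eq_zero hu h hij ho.1, map_zero, neg_zero]
    · have h1 : (d.σ j : ℕ) + 1 = d.σ i := by omega
      have ha : AgreeBelow ((j : ℕ) - i) u 1 := by
        intro a b hab
        rcases lt_or_eq_of_le (show (b : ℕ) ≤ a by omega) with hb | hb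
        · rw [hu.1 _ _ hb, Matrix.one_apply_ne (Fin.ne_of_val_ne (by omega))]
        · have : b = a := Fin.ext hb
          rw [this, hu.2, Matrix.one_apply_eq]
      have h2 := d.stab_sub_leading hu IsUpperUnip.one h (by simp [star'_one]) hij ha ho.1
      rw [Matrix.one_apply_ne hij.ne, Matrix.one_apply_ne ho.1.ne, sub_zero, sub_zero] at h2
      rw [if_pos h1, h2, map_neg, tr_conj]
  have key : ∀ i j : Fin n, (if (i : ℕ) + 1 = j then tr (u i j) else 0) =
      -(if (d.σ j : ℕ) + 1 = d.σ i then tr (u (d.σ j) (d.σ i)) else 0) := by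
    intro i j
    by_cases hi : (i : ℕ) + 1 = j
    · exact hz i j hi
    · by_cases hs : (d.σ j : ℕ) + 1 = d.σ i
      · have := hz _ _ hs
        simp only [d.invol] at this
        rw [this, neg_neg]
      · rw [if_neg hi, if_neg hs, neg_zero]
  let τ : Fin n ≃ Fin n := ⟨d.σ, d.σ, d.invol, d.invol⟩
  have hs : (∑ i : Fin n, ∑ j : Fin n, if (i : ℕ) + 1 = j then tr (u i j) else 0) =
      -∑ i : Fin n, ∑ j : Fin n, if (i : ℕ) + 1 = j then tr (u i j) else 0 := by
    refine (Finset.sum_congr (rfl : (Finset.univ : Finset (Fin n)) = _) fun i _ =>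
      Finset.sum_congr rfl fun j _ => key i j).trans ?_
    simp only [Finset.sum_neg_distrib]
    rw [Finset.sum_comm]
    congr 1
    exact (τ.sum_comp (fun i => ∑ j : Fin n, if (i : ℕ) + 1 = d.σ j then tr (u i (d.σ j)) else 0)).trans
      (Finset.sum_congr rfl fun i _ =>
        τ.sum_comp (fun j => if (i : ℕ) + 1 = j then tr (u i j) else 0))
  have h0 : (∑ i : Fin n, ∑ j : Fin n, if (i : ℕ) + 1 = j then tr (u i j) else 0) = 0 := by
    linarith
  rw [chiM, h0, AddChar.map_zero_eq_one, Circle.coe_one]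

theorem orbIntegrand_toQuot (ψ : AddChar ℝ Circle) (Φ : Herm n D → ℂ) (u : Unip n D) :
    orbIntegrand ψ Φ (d.herm D) (d.toQuot D u) =
      Φ (actM (d.herm D) (umat u)) * chiM ψ (umat u) := by
  obtain ⟨s, hs, h⟩ := d.exists_out u
  rw [orbIntegrand, h, act_mul, show act (d.herm D) s = d.herm D from hs, chi_eq_chiM, umat_mul,
    chiM_mul _ (umat_isUpperUnip s) (umat_isUpperUnip u),
    d.chiM_stab ψ (umat_isUpperUnip s) ((mem_stab_iff _ _).1 hs), one_mul]
  rfl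

theorem measurable_orbIntegrand {ψ : AddChar ℝ Circle} (hψ : Continuous ψ) {Φ : Herm n D → ℂ}
    (hΦ : Continuous Φ) : Measurable (orbIntegrand ψ Φ (d.herm D)) := by
  refine measurable_from_quotient.2 ?_
  have : orbIntegrand ψ Φ (d.herm D) ∘ Quotient.mk'' =
      fun u => Φ (actM (d.herm D) (umat u)) * chiM ψ (umat u) := by
    funext u
    exact d.orbIntegrand_toQuot ψ Φ u
  rw [this]
  exact ((hΦ.comp ((continuous_actM _).comp continuous_umat)).mul
    ((continuous_chiM hψ).comp continuous_umat)).measurable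

theorem integrable_orbIntegrand {ψ : AddChar ℝ Circle} (hψ : Continuous ψ) {Φ : Herm n D → ℂ}
    (hΦ : Continuous Φ) (h : Integrable fun y => Φ (actM (d.herm D) (d.U y)) *
      chiM ψ (d.U y : Matrix (Fin n) (Fin n) D)) :
    Integrable (orbIntegrand ψ Φ (d.herm D)) (quotMeasure (d.herm D)) := by
  rw [quotMeasure_eq, quot]
  refine Integrable.smul_measure ?_ (ENNReal.inv_ne_top.2 d.jac_ne_zero)
  rw [integrable_map_measure (d.measurable_orbIntegrand hψ hΦ).aestronglyMeasurable
    d.measurable_toQuot_UN.aemeasurable]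
  refine h.congr (Filter.Eventually.of_forall fun y => ?_)
  exact (d.orbIntegrand_toQuot ψ Φ (d.UN D y)).symm

theorem orbInt_eq {ψ : AddChar ℝ Circle} (hψ : Continuous ψ) {Φ : Herm n D → ℂ}
    (hΦ : Continuous Φ) : orbInt ψ Φ (d.herm D) = ((d.jac : ℝ)⁻¹ : ℂ) * d.J ψ Φ := by
  rw [orbInt, quotMeasure_eq, quot, integral_smul_measure,
    integral_map d.measurable_toQuot_UN.aemeasurable
      (d.measurable_orbIntegrand hψ hΦ).aestronglyMeasurable, J]
  simp only [d.orbIntegrand_toQuot]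
  rw [Complex.real_smul]
  simp [UN]

/-- The regular datum: a diagonal matrix. -/
def diag (a : Fin n → ℝ) (ha : ∀ i, a i ≠ 0) : Monomial n where
  σ := id
  α := a
  invol _ := rfl
  α_σ _ := rfl
  order i j h := Or.inl ⟨h, by rw [Fin.lt_def] at h; simp only [id]; omega, ha i⟩

theorem diag_herm (a : Fin n → ℝ) (ha : ∀ i, a i ≠ 0) : (diag a ha).herm D =
    ofReal (Matrix.diagonal a) (Matrix.diagonal_transpose a) := by
  apply Subtype.ext
  ext i j
  rw [herm_apply]
  change (if i = j then algebraMap ℝ D (a i) else 0) = algebraMap ℝ D (Matrix.diagonal a i j)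
  rw [Matrix.diagonal_apply]
  split_ifs <;> simp

theorem regInt_eq {ψ : AddChar ℝ Circle} (hψ : Continuous ψ) {Φ : Herm n D → ℂ}
    (hΦ : Continuous Φ) (a : Fin n → ℝ) (ha : ∀ i, a i ≠ 0) :
    regInt ψ Φ a = (diag a ha).J ψ Φ := by
  have hK : ∀ q, (diag a ha).InK q := fun q => Or.inl q.1.2
  have hc : Continuous fun x : Ix n → ℝ =>
      mkUnip (1 + nmat x : Matrix (Fin n) (Fin n) D) (isUpperUnip_one_add_nmat x) :=
    continuous_mkUnip _ (continuous_const.add continuous_nmat)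
  have hh : Continuous fun u : Unip n D =>
      Φ (act (ofReal (Matrix.diagonal a) (Matrix.diagonal_transpose a)) u) * chi ψ u :=
    (hΦ.comp ((continuous_actM _).comp continuous_umat)).mul
      ((continuous_chiM hψ).comp continuous_umat)
  rw [regInt, haarN_eq, integral_map hc.measurable.aemeasurable
    hh.measurable.aestronglyMeasurable, J]
  let e : (diag a ha).K ≃ Ix n := Equiv.subtypeUnivEquiv hK
  have hp := volume_measurePreserving_piCongrLeft (fun _ : Ix n => ℝ) e
  rw [← hp.integral_comp' (g := fun x : Ix n → ℝ => Φ (act (ofReal (Matrix.diagonal a)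
    (Matrix.diagonal_transpose a)) (mkUnip (1 + nmat x) (isUpperUnip_one_add_nmat x))) *
      chi ψ (mkUnip (1 + nmat x : Matrix (Fin n) (Fin n) D) (isUpperUnip_one_add_nmat x)))]
  refine integral_congr_ae (Filter.Eventually.of_forall fun y => ?_)
  have : (MeasurableEquiv.piCongrLeft (fun _ : Ix n => ℝ) e) y = (diag a ha).ext y := by
    funext q
    rw [ext, dif_pos (hK q)]
    exact MeasurableEquiv.piCongrLeft_apply_apply (β := fun _ => ℝ) e y ⟨q, hK q⟩
  simp only [this, chi_eq_chiM, act_eq_actM, umat_mkUnip, U, diag_herm]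

end Monomial

/-! ### Absolute convergence -/

namespace Monomial

variable {n : ℕ} (d : Monomial n) {D : Type} [NormedCommRing D] [NormedAlgebra ℝ D] [QuadAlg D]
  [QuadBasis D]

/-- The order in which the coordinates of a point of the orbit determine the coordinates of the
unipotent matrix: interval by interval, and by the distance from the diagonal. -/
def rk (i j : Fin n) : ℕ := ((i : ℕ) + d.σ i) * n + (j - i)

/-- The position of the hermitian matrix whose coordinate is led by the coordinate `q`. -/
def pos (q : Ix n) : Fin n × Fin n :=
  if q.2 = 0 then (d.σ q.1.1.1, q.1.1.2) else (q.1.1.2, d.σ q.1.1.1)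

theorem rk_lt {i j p q : Fin n} (h : (i : ℕ) + d.σ i < p + d.σ p) : d.rk i j < d.rk p q := by
  have h1 := Nat.mul_le_mul_right n (Nat.succ_le_of_lt h)
  have h2 := j.2
  simp only [rk]
  rw [Nat.succ_mul] at h1
  omega

theorem U_congr {y y' : d.K → ℝ} {i j : Fin n}
    (h : ∀ q : d.K, q.1.1.1.1 = i → q.1.1.1.2 = j → y q = y' q) :
    (d.U y : Matrix (Fin n) (Fin n) D) i j = d.U y' i j := by
  simp only [U, Matrix.add_apply]
  congr 1
  rcases lt_or_ge i j with hij | hij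
  · rw [nmat_apply_of_lt _ hij, nmat_apply_of_lt _ hij]
    have : ∀ e, d.ext y (⟨(i, j), hij⟩, e) = d.ext y' (⟨(i, j), hij⟩, e) := by
      intro e
      simp only [ext]
      split_ifs with hK
      · exact h _ rfl rfl
      · rfl
    rw [this, this]
  · rw [nmat_apply_of_le _ hij, nmat_apply_of_le _ hij]

theorem U_apply (y : d.K → ℝ) {i j : Fin n} (h : i < j) : (d.U y : Matrix (Fin n) (Fin n) D) i j =
    mkD (d.ext y (⟨(i, j), h⟩, 0)) (d.ext y (⟨(i, j), h⟩, 1)) := by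
  rw [U, Matrix.add_apply, Matrix.one_apply_ne h.ne, zero_add, nmat_apply_of_lt _ h]

/-- The leading term of an entry of a point of the orbit. -/
theorem actM_U_congr {y y' : d.K → ℝ} (q : d.K)
    (h : ∀ q' : d.K, d.rk q'.1.1.1.1 q'.1.1.1.2 < d.rk q.1.1.1.1 q.1.1.1.2 → y q' = y' q') :
    (actM (d.herm D) (d.U y)).1 (d.σ q.1.1.1.1) q.1.1.1.2 -
      d.α q.1.1.1.1 • ((d.U y : Matrix (Fin n) (Fin n) D) q.1.1.1.1 q.1.1.1.2 +
        if d.σ q.1.1.1.2 = q.1.1.1.1 then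
          QuadAlg.conj ((d.U y : Matrix (Fin n) (Fin n) D) q.1.1.1.1 q.1.1.1.2) else 0) =
    (actM (d.herm D) (d.U y')).1 (d.σ q.1.1.1.1) q.1.1.1.2 -
      d.α q.1.1.1.1 • ((d.U y' : Matrix (Fin n) (Fin n) D) q.1.1.1.1 q.1.1.1.2 +
        if d.σ q.1.1.1.2 = q.1.1.1.1 then
          QuadAlg.conj ((d.U y' : Matrix (Fin n) (Fin n) D) q.1.1.1.1 q.1.1.1.2) else 0) := by
  obtain ⟨⟨⟨⟨p, q⟩, hpq⟩, e⟩, hK⟩ := q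
  change p < q at hpq
  simp only at h ⊢
  -- The terms `k = σ p` and `k = σ q` give the leading part; all others only involve coordinates of
  -- smaller height.
  have hterm : ∀ k, ∀ z : d.K → ℝ, d.α k • (QuadAlg.conj ((d.U z : Matrix (Fin n) (Fin n) D) k
        (d.σ p)) * d.U z (d.σ k) q) -
      ((if k = d.σ p then d.α p • (d.U z : Matrix (Fin n) (Fin n) D) p q else 0) +
      (if k = d.σ q then (if d.σ q = p then d.α p •
        QuadAlg.conj ((d.U z : Matrix (Fin n) (Fin n) D) p q) else 0) else 0)) =
      if k < d.σ p ∧ d.σ k < q then d.α k • (QuadAlg.conj ((d.U z : Matrix (Fin n) (Fin n) D) k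
        (d.σ p)) * d.U z (d.σ k) q) else 0 := by
    intro k z
    have hne : d.σ p ≠ d.σ q := fun h => hpq.ne (d.σ_injective h)
    rcases lt_trichotomy k (d.σ p) with hk | rfl | hk
    · rw [if_neg hk.ne]
      rcases lt_trichotomy (d.σ k) q with hkq | hkq | hkq
      · have e1 : k ≠ d.σ q := fun h => hkq.ne (by rw [h, d.invol])
        rw [if_neg e1, if_pos (show k < d.σ p ∧ d.σ k < q from ⟨hk, hkq⟩)]; simp
      · have hkq' : k = d.σ q := by rw [← hkq, d.invol]
        have e1 : ¬ (k < d.σ p ∧ d.σ k < q) := fun h => hkq.not_lt h.2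
        rw [if_neg e1, hkq', if_pos rfl, d.invol, (d.isUpperUnip_U z).2, d.α_σ]
        rw [hkq'] at hk
        have hα : d.α p = d.α q := by
          rcases d.order p q hpq with h | h
          · exact absurd h.1 (lt_asymm hk)
          · exact h.2.2.1
        by_cases hqp : d.σ q = p
        · have : d.σ p = q := by rw [← hqp, d.invol]
          rw [if_pos hqp, this, hqp, hα]; simp
        · have hK' := hK
          have h1 : d.σ q < p := by
            rcases hK' with h3 | h3 | h3
            · exact absurd h3 (lt_asymm hk)
            · exact h3
            · exact absurd h3.1 hqp
          have h2 : ∀ e, ¬ d.InK (⟨(d.σ q, d.σ p), hk⟩, e) := by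
            intro e
            simp only [InK, d.invol]
            push Not
            exact ⟨hpq.le, h1.le, fun h => absurd h h1.ne'⟩
          rw [if_neg hqp, d.U_apply z hk]
          simp [ext, h2]
      · have e1 : k ≠ d.σ q := fun h => hkq.ne' (by rw [h, d.invol])
        have e2 : ¬ (k < d.σ p ∧ d.σ k < q) := fun h => hkq.not_gt h.2
        rw [if_neg e1, if_neg e2, (d.isUpperUnip_U z).1 _ _ hkq]; simp
    · have e2 : ¬ (d.σ p < d.σ p ∧ d.σ (d.σ p) < q) := fun h => lt_irrefl _ h.1
      rw [if_pos rfl, if_neg hne, if_neg e2, (d.isUpperUnip_U z).2, d.invol, d.α_σ]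
      simp
    · have e2 : ¬ (k < d.σ p ∧ d.σ k < q) := fun h => hk.not_gt h.1
      rw [if_neg hk.ne', if_neg e2, (d.isUpperUnip_U z).1 _ _ hk]
      by_cases h1 : k = d.σ q
      · have h2 : d.σ q ≠ p := by
          intro h2
          have h3 : d.σ p = q := by rw [← h2, d.invol]
          rw [h1, h2, h3] at hk
          exact absurd hpq (lt_asymm hk)
        rw [if_pos h1, if_neg h2]; simp
      · rw [if_neg h1]; simp
  have hX : ∀ z : d.K → ℝ, (actM (d.herm D) (d.U z)).1 (d.σ p) q -
      d.α p • ((d.U z : Matrix (Fin n) (Fin n) D) p q + if d.σ q = p then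
          QuadAlg.conj ((d.U z : Matrix (Fin n) (Fin n) D) p q) else 0) =
      ∑ k, if k < d.σ p ∧ d.σ k < q then d.α k • (QuadAlg.conj
        ((d.U z : Matrix (Fin n) (Fin n) D) k (d.σ p)) * d.U z (d.σ k) q) else 0 := by
    intro z
    rw [← Finset.sum_congr rfl fun k _ => hterm k z, Finset.sum_sub_distrib,
      Finset.sum_add_distrib, Finset.sum_ite_eq' Finset.univ (d.σ p),
      Finset.sum_ite_eq' Finset.univ (d.σ q), if_pos (Finset.mem_univ _),
      if_pos (Finset.mem_univ _), smul_add, actM]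
    simp only [star'_mul_herm_mul_apply]
    congr 2
    split_ifs <;> simp
  rw [hX, hX]
  refine Finset.sum_congr rfl fun k _ => ?_
  split_ifs with hk
  · obtain ⟨hk1, hk2⟩ := hk
    have ho := d.order k (d.σ p) hk1
    rw [d.invol] at ho
    rw [d.U_congr (i := k) (j := d.σ p) (y' := y') fun q' h1 h2 => h q' ?_,
      d.U_congr (i := d.σ k) (j := q) (y' := y') fun q' h1 h2 => h q' ?_]
    · rw [h1, h2]
      rcases ho with ho | ho
      · exact d.rk_lt (by rw [d.invol]; omega)
      · simp only [rk, d.invol, Fin.lt_def] at *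
        rw [show (d.σ k : ℕ) + k = p + d.σ p by omega]
        omega
    · rw [h1, h2]
      rcases ho with ho | ho
      · exact d.rk_lt (by omega)
      · simp only [rk, Fin.lt_def] at *
        rw [show (k : ℕ) + d.σ k = p + d.σ p by omega]
        omega
  · rfl

variable (D) in
/-- The real coordinates of the points of the orbit. -/
def Z (y : d.K → ℝ) : Fin n × Fin n → ℝ := (hm (D := D)).symm (actM (d.herm D) (d.U y))

theorem continuous_Z : Continuous (d.Z D) :=
  (hm (D := D)).symm.toLinearMap.continuous_of_finiteDimensional.comp
    ((continuous_actM _).comp d.continuous_U)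

/-- The coefficient of the leading term. -/
def coeff (q : d.K) : ℝ :=
  if d.σ q.1.1.1.1 = q.1.1.1.2 then Real.sqrt 2 * d.α q.1.1.1.1 else d.α q.1.1.1.1

theorem coeff_ne_zero (q : d.K) : d.coeff q ≠ 0 := by
  have h : d.α q.1.1.1.1 ≠ 0 := d.α_ne q.1.1.2
  have : Real.sqrt 2 ≠ 0 := by positivity
  unfold coeff
  split_ifs
  · exact mul_ne_zero this h
  · exact h

theorem Z_pos_congr (q : d.K) (y y' : d.K → ℝ)
    (h : ∀ q' : d.K, d.rk q'.1.1.1.1 q'.1.1.1.2 < d.rk q.1.1.1.1 q.1.1.1.2 → y q' = y' q') :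
    d.Z D y (d.pos q) - d.coeff q * y q = d.Z D y' (d.pos q) - d.coeff q * y' q := by
  have hX := d.actM_U_congr (D := D) q h
  obtain ⟨⟨⟨⟨p, q⟩, hpq⟩, e⟩, hK⟩ := q
  change p < q at hpq
  simp only at hX
  rw [d.U_apply y hpq, d.U_apply y' hpq] at hX
  have hy : ∀ z : d.K → ℝ, z ⟨(⟨(p, q), hpq⟩, e), hK⟩ = d.ext z (⟨(p, q), hpq⟩, e) := fun z => by
    simp [ext, hK]
  rw [hy y, hy y']
  by_cases hqp : d.σ q = p
  · have hpq' : d.σ p = q := by rw [← hqp, d.invol]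
    have he : e = 0 := by
      have hK' := hK
      rcases hK' with h3 | h3 | h3
      · simp only [hqp, hpq'] at h3; exact absurd h3 (lt_asymm hpq)
      · simp only [hqp] at h3; exact absurd h3 (lt_irrefl _)
      · exact h3.2
    subst he
    rw [if_pos hqp, if_pos hqp, hpq'] at hX
    have h2 := congrArg tr hX
    simp only [map_sub, map_smul, map_add, tr_conj, smul_eq_mul, tr_mkD] at h2
    simp only [Z, pos, coeff, if_true, hpq', hm_symm_apply, lt_irrefl, if_false]
    linarith
  · have hpq' : d.σ p ≠ q := fun h => hqp (by rw [← h, d.invol])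
    rw [if_neg hqp, if_neg hqp, add_zero, add_zero] at hX
    have hlt : d.σ p < q := by
      rcases d.order p q hpq with ho | ho
      · by_contra hcon
        have hcon' : q < d.σ p := lt_of_le_of_ne (not_lt.1 hcon) (Ne.symm hpq')
        have h2 := d.order q (d.σ p) hcon'
        rw [d.invol] at h2
        rw [Fin.lt_def] at *
        rcases h2 with h2 | h2 <;> omega
      · have hK' := hK
        have h1 : d.σ q < p := by
          rcases hK' with h3 | h3 | h3
          · exact absurd h3 (lt_asymm ho.1)
          · exact h3
          · exact absurd h3.1 hqp
        rw [Fin.lt_def] at *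
        omega
    have h0 := congrArg cs hX
    have h1 := congrArg ct hX
    simp only [map_sub, map_smul, smul_eq_mul, cs_mkD, ct_mkD] at h0 h1
    fin_cases e
    · simpa [Z, pos, coeff, hpq', hm_symm_apply, hlt] using h0
    · simpa [Z, pos, coeff, hpq', hm_symm_apply, hlt, hlt.not_gt, hlt.ne'] using h1

variable (D) in
/-- The coordinates of a point of the orbit at the leading positions. -/
def lead (y : d.K → ℝ) (q : d.K) : ℝ := d.Z D y (d.pos q)

theorem measurable_lead : Measurable (d.lead D) :=
  (continuous_pi fun q : d.K => (continuous_apply (d.pos q)).comp d.continuous_Z).measurable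

theorem lead_bijective_map : Function.Bijective (d.lead D) ∧ Measure.map (d.lead D) volume =
    ENNReal.ofReal (∏ q, |d.coeff q|)⁻¹ • (volume : Measure (d.K → ℝ)) :=
  IsTriangular.map_volume_of_scaled (ht := fun q : d.K => d.rk q.1.1.1.1 q.1.1.1.2)
    (F := d.lead D) (c := d.coeff) d.coeff_ne_zero (fun q y y' h => d.Z_pos_congr q y y' h) d.measurable_lead

/-- A Schwartz function is integrable over the orbit: its product with `∏ (1 + z²)` over the leading
coordinates `z` is bounded, and `∏ (1 + z²)⁻¹` is integrable by the triangular change of variables. -/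
theorem integrable_actM_U (Φ : 𝓢(Herm n D, ℂ)) :
    Integrable fun y => Φ (actM (d.herm D) (d.U y)) := by
  have hc : Continuous fun y => Φ (actM (d.herm D) (d.U y)) :=
    Φ.continuous.comp ((continuous_actM _).comp d.continuous_U)
  have hw : Integrable fun y : d.K → ℝ => ∏ q, (1 + y q ^ 2)⁻¹ :=
    Integrable.fintype_prod (f := fun (_ : d.K) (x : ℝ) => (1 + x ^ 2)⁻¹)
      fun _ => integrable_inv_one_add_sq
  have h1 : Integrable fun y => ∏ q, (1 + d.lead D y q ^ 2)⁻¹ := by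
    have h2 : Integrable (fun y : d.K → ℝ => ∏ q, (1 + y q ^ 2)⁻¹)
        (Measure.map (d.lead D) volume) := by
      rw [d.lead_bijective_map.2]
      exact hw.smul_measure ENNReal.ofReal_ne_top
    exact (integrable_map_measure h2.aestronglyMeasurable d.measurable_lead.aemeasurable).1 h2
  have htg : (fun X : Herm n D => ∏ q : d.K,
      (1 + ((hm (D := D)).symm X (d.pos q) : ℂ) ^ 2)).HasTemperateGrowth := by
    refine hasTemperateGrowth_prod _ fun q => ?_
    have hl : (fun X : Herm n D => ((hm (D := D)).symm X (d.pos q) : ℂ)).HasTemperateGrowth :=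
      hasTemperateGrowth_linearMap (Complex.ofRealCLM.toLinearMap ∘ₗ
        LinearMap.proj (d.pos q) ∘ₗ (hm (D := D)).symm.toLinearMap)
    simp only [sq]
    exact (Function.HasTemperateGrowth.const 1).add (hl.mul hl)
  let Φ' := SchwartzMap.smulLeftCLM ℂ (fun X : Herm n D => ∏ q : d.K,
      (1 + ((hm (D := D)).symm X (d.pos q) : ℂ) ^ 2)) Φ
  have hΦ' : ∀ X, Φ' X = (∏ q : d.K, (1 + ((hm (D := D)).symm X (d.pos q) : ℂ) ^ 2)) * Φ X :=
    fun X => SchwartzMap.smulLeftCLM_apply_apply htg Φ X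
  clear_value Φ'
  obtain ⟨C, hC⟩ : ∃ C, ∀ X, ‖Φ' X‖ ≤ C := by
    obtain ⟨C, -, hC⟩ := Φ'.decay 0 0
    exact ⟨C, fun X => by simpa using hC X⟩
  refine Integrable.mono' (h1.const_mul C) hc.aestronglyMeasurable
    (Filter.Eventually.of_forall fun y => ?_)
  have h3 := hC (actM (d.herm D) (d.U y))
  rw [hΦ', norm_mul] at h3
  have h4 : ‖∏ q : d.K, (1 + ((hm (D := D)).symm (actM (d.herm D) (d.U y)) (d.pos q) : ℂ) ^ 2)‖ =
      ∏ q : d.K, (1 + d.lead D y q ^ 2) := by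
    rw [norm_prod]
    refine Finset.prod_congr rfl fun q _ => ?_
    have : (1 + ((hm (D := D)).symm (actM (d.herm D) (d.U y)) (d.pos q) : ℂ) ^ 2) =
        ((1 + d.lead D y q ^ 2 : ℝ) : ℂ) := by simp [lead, Z]
    rw [this, Complex.norm_real, Real.norm_of_nonneg (by positivity)]
  rw [h4] at h3
  have h5 : 0 < ∏ q : d.K, (1 + d.lead D y q ^ 2) := Finset.prod_pos fun q _ => by positivity
  rw [Finset.prod_inv_distrib, ← div_eq_mul_inv, le_div_iff₀ h5, mul_comm]
  exact h3

theorem integrable_J_integrand {ψ : AddChar ℝ Circle} (hψ : Continuous ψ) (Φ : 𝓢(Herm n D, ℂ)) :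
    Integrable fun y => Φ (actM (d.herm D) (d.U y)) *
      chiM ψ (d.U y : Matrix (Fin n) (Fin n) D) :=
  (d.integrable_actM_U Φ).mul_bdd (c := 1)
    ((continuous_chiM hψ).comp d.continuous_U).aestronglyMeasurable
    (Filter.Eventually.of_forall fun _ => (norm_chiM ψ _).le)

end Monomial

/-! ### Block decompositions -/

section Blocks

variable {m r n : ℕ} {D : Type} [NormedCommRing D] [NormedAlgebra ℝ D] [QuadAlg D]

/-- The first `m` of `n = m + r` indices. -/
def inl (h : m + r = n) (i : Fin m) : Fin n := ⟨i, by have := i.2; omega⟩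

/-- The last `r` of `n = m + r` indices. -/
def inr (h : m + r = n) (j : Fin r) : Fin n := ⟨m + j, by have := j.2; omega⟩

@[simp] theorem inl_val (h : m + r = n) (i : Fin m) : (inl h i : ℕ) = i := rfl

@[simp] theorem inr_val (h : m + r = n) (i : Fin r) : (inr h i : ℕ) = m + i := rfl

/-- The decomposition of `n = m + r` indices into the first `m` and the last `r`. -/
def sumEquiv (h : m + r = n) : Fin m ⊕ Fin r ≃ Fin n := finSumFinEquiv.trans (finCongr h)

@[simp] theorem sumEquiv_inl (h : m + r = n) (i : Fin m) : sumEquiv h (Sum.inl i) = inl h i := rfl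

@[simp] theorem sumEquiv_inr (h : m + r = n) (i : Fin r) : sumEquiv h (Sum.inr i) = inr h i := rfl

@[simp] theorem sumEquiv_symm_inl (h : m + r = n) (i : Fin m) :
    (sumEquiv h).symm (inl h i) = Sum.inl i := by rw [← sumEquiv_inl, Equiv.symm_apply_apply]

@[simp] theorem sumEquiv_symm_inr (h : m + r = n) (i : Fin r) :
    (sumEquiv h).symm (inr h i) = Sum.inr i := by rw [← sumEquiv_inr, Equiv.symm_apply_apply]

@[elab_as_elim]
theorem inl_inr_cases (h : m + r = n) {P : Fin n → Prop} (i : Fin n) (hl : ∀ a, P (inl h a))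
    (hr : ∀ b, P (inr h b)) : P i := by
  obtain ⟨s, rfl⟩ := (sumEquiv h).surjective i
  rcases s with a | b
  · exact hl a
  · exact hr b

theorem inl_lt_inl (h : m + r = n) {i j : Fin m} : inl h i < inl h j ↔ i < j := Iff.rfl

theorem inr_lt_inr (h : m + r = n) {i j : Fin r} : inr h i < inr h j ↔ i < j := by
  rw [Fin.lt_def, Fin.lt_def, inr_val, inr_val, Nat.add_lt_add_iff_left]

theorem inl_lt_inr (h : m + r = n) (i : Fin m) (j : Fin r) : inl h i < inr h j := by
  simp only [Fin.lt_def, inl_val, inr_val]; omega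

theorem inl_inj (h : m + r = n) {i j : Fin m} : inl h i = inl h j ↔ i = j := by
  simp [Fin.ext_iff]

theorem inr_inj (h : m + r = n) {i j : Fin r} : inr h i = inr h j ↔ i = j := by
  simp [Fin.ext_iff]

theorem sum_inl_inr {M : Type*} [AddCommMonoid M] (h : m + r = n) (f : Fin n → M) :
    ∑ i, f i = ∑ a, f (inl h a) + ∑ b, f (inr h b) := by
  rw [← (sumEquiv h).sum_comp, Fintype.sum_sum_type]
  rfl

/-- The matrix with the given blocks. -/
def blk (h : m + r = n) (A : Matrix (Fin m) (Fin m) D) (B : Matrix (Fin m) (Fin r) D)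
    (C : Matrix (Fin r) (Fin m) D) (E : Matrix (Fin r) (Fin r) D) : Matrix (Fin n) (Fin n) D :=
  (Matrix.fromBlocks A B C E).submatrix (sumEquiv h).symm (sumEquiv h).symm

variable (h : m + r = n) (A A' : Matrix (Fin m) (Fin m) D) (B B' : Matrix (Fin m) (Fin r) D)
    (C C' : Matrix (Fin r) (Fin m) D) (E E' : Matrix (Fin r) (Fin r) D)

@[simp] theorem blk_ll (i j : Fin m) : blk h A B C E (inl h i) (inl h j) = A i j := by
  simp [blk]

@[simp] theorem blk_lr (i : Fin m) (j : Fin r) : blk h A B C E (inl h i) (inr h j) = B i j := by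
  simp [blk]

@[simp] theorem blk_rl (i : Fin r) (j : Fin m) : blk h A B C E (inr h i) (inl h j) = C i j := by
  simp [blk]

@[simp] theorem blk_rr (i j : Fin r) : blk h A B C E (inr h i) (inr h j) = E i j := by
  simp [blk]

theorem blk_ext {M M' : Matrix (Fin n) (Fin n) D}
    (hll : ∀ i j, M (inl h i) (inl h j) = M' (inl h i) (inl h j))
    (hlr : ∀ i j, M (inl h i) (inr h j) = M' (inl h i) (inr h j))
    (hrl : ∀ i j, M (inr h i) (inl h j) = M' (inr h i) (inl h j))
    (hrr : ∀ i j, M (inr h i) (inr h j) = M' (inr h i) (inr h j)) : M = M' := by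
  ext i j
  refine inl_inr_cases h i (fun a => ?_) (fun a => ?_) <;>
    refine inl_inr_cases h j (fun b => ?_) (fun b => ?_)
  · exact hll a b
  · exact hlr a b
  · exact hrl a b
  · exact hrr a b

theorem blk_mul : blk h A B C E * blk h A' B' C' E' =
    blk h (A * A' + B * C') (A * B' + B * E') (C * A' + E * C') (C * B' + E * E') := by
  rw [blk, blk, Matrix.submatrix_mul_equiv, Matrix.fromBlocks_multiply]
  rfl

/-- The conjugate transpose of a rectangular matrix. -/
def starR (B : Matrix (Fin m) (Fin r) D) : Matrix (Fin r) (Fin m) D :=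
  (B.map (QuadAlg.conj (D := D)))ᵀ

theorem starR_apply (i : Fin r) (j : Fin m) : starR B i j = QuadAlg.conj (B j i) := rfl

theorem starR_eq_star' : starR A = star' A := rfl

theorem starR_mul {k : ℕ} (F : Matrix (Fin r) (Fin k) D) : starR (B * F) = starR F * starR B := by
  simp [starR, Matrix.map_mul, Matrix.transpose_mul]

theorem starR_starR : starR (starR B) = B := by
  ext i j; simp [starR, QuadAlg.conj_conj]

theorem star'_blk : star' (blk h A B C E) = blk h (star' A) (starR C) (starR B) (star' E) := by
  refine blk_ext h ?_ ?_ ?_ ?_ <;> intro i j <;> simp [star', starR]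

theorem star'_coe (X : Herm n D) : star' X.1 = X.1 := X.2

/-- The hermitian matrix with the given blocks. -/
def hblk (X : Herm m D) (B : Matrix (Fin m) (Fin r) D) (Y : Herm r D) : Herm n D :=
  ⟨blk h X.1 B (starR B) Y.1, by
    change star' _ = _
    rw [star'_blk, star'_coe, star'_coe, starR_starR]⟩

/-- The hermitian form `B̄ᵗ R B`. -/
def quad (R : Herm m D) (B : Matrix (Fin m) (Fin r) D) : Herm r D :=
  ⟨starR B * R.1 * B, by
    change star' _ = _
    rw [← starR_eq_star', starR_mul, starR_mul, starR_starR, starR_eq_star', star'_coe,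
      Matrix.mul_assoc]⟩

variable [QuadBasis D]

theorem star'_adjugate (M : Matrix (Fin n) (Fin n) D) : star' M.adjugate = (star' M).adjugate := by
  have := (QuadAlg.conj (D := D)).toRingHom.map_adjugate M
  simp only [star']
  rw [← Matrix.adjugate_transpose]
  exact congrArg Matrix.transpose this

/-- The adjugate of a hermitian matrix. -/
def hadj (X : Herm n D) : Herm n D := ⟨X.1.adjugate, by
  change star' _ = _
  rw [star'_adjugate, star'_coe]⟩

theorem conj_det (M : Matrix (Fin n) (Fin n) D) : QuadAlg.conj M.det = (star' M).det := by
  have := (QuadAlg.conj (D := D)).toRingHom.map_det M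
  rw [star', Matrix.det_transpose]
  exact this

theorem algebraMap_hdet (X : Herm n D) : algebraMap ℝ D (hdet X) = X.1.det :=
  (eq_algebraMap_of_conj_eq (by rw [conj_det, star'_coe])).symm

theorem hdet_eq_of_det_eq {X : Herm n D} {t : ℝ} (h : X.1.det = algebraMap ℝ D t) :
    hdet X = t := by
  rw [hdet, h]
  have := tr_algebraMap (D := D) t
  simp only [tr] at this
  rw [this]; ring

theorem hdet_actM (X : Herm n D) {u : Matrix (Fin n) (Fin n) D} (hu : IsUpperUnip u) :
    hdet (actM X u) = hdet X := by
  refine hdet_eq_of_det_eq ?_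
  have : (star' u).det = 1 := by rw [← conj_det, hu.det, map_one]
  rw [actM, Matrix.det_mul, Matrix.det_mul, hu.det, this, algebraMap_hdet, one_mul, mul_one]

/-- The inverse of an invertible hermitian matrix. -/
def hinv (X : Herm n D) : Herm n D := (hdet X)⁻¹ • hadj X

theorem hinv_mul {X : Herm n D} (hX : hdet X ≠ 0) : (hinv X).1 * X.1 = 1 := by
  have : (hinv X).1 = (hdet X)⁻¹ • X.1.adjugate := rfl
  rw [this, Matrix.smul_mul, Matrix.adjugate_mul, ← algebraMap_hdet]
  ext i j
  rw [Matrix.smul_apply, Matrix.smul_apply, smul_eq_mul, Algebra.smul_def, ← mul_assoc, ← map_mul,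
    inv_mul_cancel₀ hX, map_one, one_mul]

/-- The trace of the lower left entry. -/
def corner (M : Matrix (Fin m) (Fin r) D) : ℝ :=
  ∑ i : Fin m, ∑ j : Fin r, if (i : ℕ) + 1 = m ∧ (j : ℕ) = 0 then tr (M i j) else 0

theorem corner_mul {u : Matrix (Fin m) (Fin m) D} (hu : IsUpperUnip u)
    (M : Matrix (Fin m) (Fin r) D) : corner (u * M) = corner M := by
  unfold corner
  refine Finset.sum_congr rfl fun i _ => Finset.sum_congr rfl fun j _ => ?_
  split_ifs with hij
  · rw [Matrix.mul_apply, Finset.sum_eq_single i, hu.2, one_mul]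
    · intro k _ hk
      rw [hu.1 i k (by
        have h1 := k.2
        have h2 : (k : ℕ) ≠ i := fun e => hk (Fin.ext e)
        rw [Fin.lt_def]
        omega), zero_mul]
    · simp
  · rfl

theorem chiM_blk (ψ : AddChar ℝ Circle) : chiM ψ (blk h A B 0 E) =
    chiM ψ A * chiM ψ E * (ψ (corner B) : ℂ) := by
  unfold chiM corner
  rw [← Circle.coe_mul, ← Circle.coe_mul, ← AddChar.map_add_eq_mul, ← AddChar.map_add_eq_mul]
  refine congrArg (fun x => ((ψ x : Circle) : ℂ)) ?_
  rw [sum_inl_inr h]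
  simp only [sum_inl_inr h, blk_ll, blk_lr, blk_rl, blk_rr, inl_val, inr_val]
  have e1 : ∀ (a : Fin m) (b : Fin r), ((a : ℕ) + 1 = m + b) ↔ ((a : ℕ) + 1 = m ∧ (b : ℕ) = 0) := by
    intro a b
    omega
  have e2 : ∀ (a : Fin r) (b : Fin m), ¬ (m + (a : ℕ) + 1 = b) := by
    intro a b
    omega
  have e3 : ∀ (a b : Fin r), (m + (a : ℕ) + 1 = m + b) ↔ ((a : ℕ) + 1 = b) := by
    intro a b
    omega
  simp only [e1, e2, e3, if_false, Finset.sum_const_zero, zero_add, Finset.sum_add_distrib]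
  ring

theorem actM_hblk_zero (g₁ : Herm m D) (g₂ : Herm r D) :
    actM (hblk h g₁ 0 g₂) (blk h A B 0 E) =
      hblk h (actM g₁ A) (star' A * g₁.1 * B) (quad g₁ B + actM g₂ E) := by
  apply Subtype.ext
  have h0 : ∀ {a b : ℕ}, starR (0 : Matrix (Fin a) (Fin b) D) = 0 := by
    intro a b; ext i j; simp [starR]
  simp only [actM, hblk, quad, Submodule.coe_add]
  rw [star'_blk, blk_mul, blk_mul, h0, h0]
  rw [← starR_eq_star' A, starR_mul, starR_mul, starR_starR, starR_eq_star' g₁.1, star'_coe]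
  simp [Matrix.mul_assoc, starR_eq_star']

end Blocks

namespace Monomial

variable {m r n : ℕ} (d₁ : Monomial m) (d₂ : Monomial r) (h : m + r = n) (hα : ∀ i, d₁.α i ≠ 0)
  {D : Type} [NormedCommRing D] [NormedAlgebra ℝ D] [QuadAlg D] [QuadBasis D]

/-- The block diagonal datum. -/
def cat : Monomial n where
  σ i := sumEquiv h (Sum.map d₁.σ d₂.σ ((sumEquiv h).symm i))
  α i := Sum.elim d₁.α d₂.α ((sumEquiv h).symm i)
  invol i := by
    refine inl_inr_cases h i (fun a => ?_) (fun a => ?_) <;> simp [invol]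
  α_σ i := by
    refine inl_inr_cases h i (fun a => ?_) (fun a => ?_) <;> simp [α_σ]
  order i j := by
    refine inl_inr_cases h i (fun a => ?_) (fun a => ?_) <;>
      refine inl_inr_cases h j (fun b => ?_) (fun b => ?_) <;> intro hij
    · have := d₁.order a b ((inl_lt_inl h).1 hij)
      simpa [inl_lt_inl] using this
    · left
      refine ⟨by simpa using inl_lt_inr h _ _, ?_, by simpa using hα a⟩
      have h1 := a.2
      have h2 := (d₁.σ a).2
      simp only [sumEquiv_symm_inl, sumEquiv_symm_inr, Sum.map_inl, Sum.map_inr, sumEquiv_inl,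
        sumEquiv_inr, inl_val, inr_val]
      omega
    · exact absurd hij (lt_asymm (inl_lt_inr h _ _))
    · have := d₂.order a b ((inr_lt_inr h).1 hij)
      simp only [sumEquiv_symm_inr, Sum.map_inr, sumEquiv_inr, inr_lt_inr, inr_val, Sum.elim_inr]
      rcases this with this | this
      · exact Or.inl ⟨this.1, by omega, this.2.2⟩
      · exact Or.inr ⟨this.1, by omega, this.2.2⟩

@[simp] theorem cat_σ_inl (a : Fin m) : (cat d₁ d₂ h hα).σ (inl h a) = inl h (d₁.σ a) := by
  simp [cat]

@[simp] theorem cat_σ_inr (a : Fin r) : (cat d₁ d₂ h hα).σ (inr h a) = inr h (d₂.σ a) := by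
  simp [cat]

@[simp] theorem cat_α_inl (a : Fin m) : (cat d₁ d₂ h hα).α (inl h a) = d₁.α a := by simp [cat]

@[simp] theorem cat_α_inr (a : Fin r) : (cat d₁ d₂ h hα).α (inr h a) = d₂.α a := by simp [cat]

theorem cat_herm : (cat d₁ d₂ h hα).herm D = hblk h (d₁.herm D) 0 (d₂.herm D) := by
  apply Subtype.ext
  refine blk_ext h ?_ ?_ ?_ ?_ <;> intro i j <;>
    simp only [hblk, blk_ll, blk_lr, blk_rl, blk_rr, herm_apply, cat_σ_inl, cat_σ_inr, cat_α_inl,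
      cat_α_inr, inl_inj, inr_inj]
  · rw [if_neg (inl_lt_inr h _ _).ne]; rfl
  · rw [if_neg (inl_lt_inr h _ _).ne']; simp [starR]

/-- The coordinates of a block diagonal datum: those of the blocks, and the coordinates in the
upper right block. -/
def catIndex : (d₁.K ⊕ d₂.K) ⊕ (Fin m × Fin r × Fin 2) → (cat d₁ d₂ h hα).K
  | Sum.inl (Sum.inl q) => ⟨(⟨(inl h q.1.1.1.1, inl h q.1.1.1.2), (inl_lt_inl h).2 q.1.1.2⟩, q.1.2),
      by
        have := q.2
        simpa only [InK, cat_σ_inl, inl_lt_inl, inl_inj] using this⟩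
  | Sum.inl (Sum.inr q) => ⟨(⟨(inr h q.1.1.1.1, inr h q.1.1.1.2), (inr_lt_inr h).2 q.1.1.2⟩, q.1.2),
      by
        have := q.2
        simpa only [InK, cat_σ_inr, inr_lt_inr, inr_inj] using this⟩
  | Sum.inr v => ⟨(⟨(inl h v.1, inr h v.2.1), inl_lt_inr h _ _⟩, v.2.2), by
        left
        simp only [cat_σ_inl, cat_σ_inr]
        exact inl_lt_inr h _ _⟩

theorem catIndex_bijective : Function.Bijective (catIndex d₁ d₂ h hα) := by
  constructor
  · rintro ((⟨⟨⟨⟨i, j⟩, hij⟩, e⟩, hK⟩ | ⟨⟨⟨⟨i, j⟩, hij⟩, e⟩, hK⟩) | ⟨i, j, e⟩)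
      ((⟨⟨⟨⟨i', j'⟩, hij'⟩, e'⟩, hK'⟩ | ⟨⟨⟨⟨i', j'⟩, hij'⟩, e'⟩, hK'⟩) | ⟨i', j', e'⟩) heq <;>
      (have h1 := congrArg (fun q => q.1.1.1.1) heq
       have h2 := congrArg (fun q => q.1.1.1.2) heq
       have h3 := congrArg (fun q => q.1.2) heq
       simp only [catIndex, inl_inj, inr_inj, (inl_lt_inr h _ _).ne, (inl_lt_inr h _ _).ne']
         at h1 h2 h3)
    · subst h1 h2 h3; rfl
    · subst h1 h2 h3; rfl
    · subst h1 h2 h3; rfl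
  · rintro ⟨⟨⟨⟨i, j⟩, hij⟩, e⟩, hK⟩
    change i < j at hij
    revert hij
    refine inl_inr_cases h i (fun a => ?_) (fun a => ?_) <;>
      refine inl_inr_cases h j (fun b => ?_) (fun b => ?_) <;> intro hij hK
    · refine ⟨Sum.inl (Sum.inl ⟨(⟨(a, b), (inl_lt_inl h).1 hij⟩, e), ?_⟩), rfl⟩
      simpa only [InK, cat_σ_inl, inl_lt_inl, inl_inj] using hK
    · exact ⟨Sum.inr (a, b, e), rfl⟩
    · exact absurd hij (lt_asymm (inl_lt_inr h _ _))
    · refine ⟨Sum.inl (Sum.inr ⟨(⟨(a, b), (inr_lt_inr h).1 hij⟩, e), ?_⟩), rfl⟩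
      simpa only [InK, cat_σ_inr, inr_lt_inr, inr_inj] using hK

/-- The coordinates of a block diagonal datum as an equivalence of measure spaces. -/
def catEquiv : ((d₁.K → ℝ) × (d₂.K → ℝ)) × (Fin m × Fin r × Fin 2 → ℝ) ≃ᵐ
    ((cat d₁ d₂ h hα).K → ℝ) :=
  ((((MeasurableEquiv.sumPiEquivProdPi fun _ : d₁.K ⊕ d₂.K => ℝ).symm.prodCongr
    (MeasurableEquiv.refl _)).trans (MeasurableEquiv.sumPiEquivProdPi fun _ => ℝ).symm).trans
    (MeasurableEquiv.piCongrLeft (fun _ => ℝ) (Equiv.ofBijective _ (catIndex_bijective d₁ d₂ h hα))))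

theorem measurePreserving_catEquiv : MeasurePreserving (catEquiv d₁ d₂ h hα) :=
  (volume_measurePreserving_piCongrLeft (fun _ => ℝ) _).comp
    ((volume_measurePreserving_sumPiEquivProdPi_symm fun _ => ℝ).comp
      ((volume_measurePreserving_sumPiEquivProdPi_symm fun _ => ℝ).prod (MeasurePreserving.id _)))

theorem catEquiv_apply (p : ((d₁.K → ℝ) × (d₂.K → ℝ)) × (Fin m × Fin r × Fin 2 → ℝ))
    (s : (d₁.K ⊕ d₂.K) ⊕ (Fin m × Fin r × Fin 2)) :
    catEquiv d₁ d₂ h hα p (catIndex d₁ d₂ h hα s) =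
      Sum.elim (Sum.elim p.1.1 p.1.2) p.2 s := by
  have := MeasurableEquiv.piCongrLeft_apply_apply (β := fun _ => ℝ)
    (Equiv.ofBijective _ (catIndex_bijective d₁ d₂ h hα))
    (fun s => Sum.elim (Sum.elim p.1.1 p.1.2) p.2 s) s
  refine Eq.trans ?_ this
  have h2 : (fun s => Sum.elim (Sum.elim p.1.1 p.1.2) p.2 s) =
      (MeasurableEquiv.sumPiEquivProdPi fun _ => ℝ).symm
        ((MeasurableEquiv.sumPiEquivProdPi fun _ : d₁.K ⊕ d₂.K => ℝ).symm p.1, p.2) := by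
    funext s
    rcases s with (s | s) | s <;> rfl
  rw [h2]
  rfl

theorem U_cat (p : ((d₁.K → ℝ) × (d₂.K → ℝ)) × (Fin m × Fin r × Fin 2 → ℝ)) :
    ((cat d₁ d₂ h hα).U (catEquiv d₁ d₂ h hα p) : Matrix (Fin n) (Fin n) D) =
      blk h (d₁.U p.1.1) (vmat p.2) 0 (d₂.U p.1.2) := by
  have hu := (cat d₁ d₂ h hα).isUpperUnip_U (D := D) (catEquiv d₁ d₂ h hα p)
  have key : ∀ (n : ℕ) (d : Monomial n) (y : d.K → ℝ) (i j : Fin n) (h : i < j),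
      (d.U y : Matrix (Fin n) (Fin n) D) i j = mkD (d.ext y (⟨(i, j), h⟩, 0))
        (d.ext y (⟨(i, j), h⟩, 1)) := fun n d y i j h => d.U_apply y h
  refine blk_ext h ?_ ?_ ?_ ?_ <;> intro i j
  · rw [blk_ll]
    rcases lt_trichotomy i j with hij | rfl | hij
    · rw [key _ _ _ _ _ ((inl_lt_inl h).2 hij), key _ _ _ _ _ hij]
      have : ∀ e, (cat d₁ d₂ h hα).ext (catEquiv d₁ d₂ h hα p)
          (⟨(inl h i, inl h j), (inl_lt_inl h).2 hij⟩, e) = d₁.ext p.1.1 (⟨(i, j), hij⟩, e) := by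
        intro e
        have hiff : (cat d₁ d₂ h hα).InK (⟨(inl h i, inl h j), (inl_lt_inl h).2 hij⟩, e) ↔
            d₁.InK (⟨(i, j), hij⟩, e) := by
          simp only [InK, cat_σ_inl, inl_lt_inl, inl_inj]
        by_cases hK : d₁.InK (⟨(i, j), hij⟩, e)
        · rw [ext, ext, dif_pos hK, dif_pos (hiff.2 hK)]
          exact catEquiv_apply d₁ d₂ h hα p (Sum.inl (Sum.inl ⟨_, hK⟩))
        · rw [ext, ext, dif_neg hK, dif_neg (fun h => hK (hiff.1 h))]
      rw [this, this]
    · rw [hu.2, (d₁.isUpperUnip_U _).2]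
    · rw [hu.1 _ _ ((inl_lt_inl h).2 hij), (d₁.isUpperUnip_U _).1 _ _ hij]
  · rw [blk_lr, key _ _ _ _ _ (inl_lt_inr h i j), vmat_apply]
    have : ∀ e, (cat d₁ d₂ h hα).ext (catEquiv d₁ d₂ h hα p)
        (⟨(inl h i, inr h j), inl_lt_inr h i j⟩, e) = p.2 (i, j, e) := by
      intro e
      have hK : (cat d₁ d₂ h hα).InK (⟨(inl h i, inr h j), inl_lt_inr h i j⟩, e) :=
        (catIndex d₁ d₂ h hα (Sum.inr (i, j, e))).2
      rw [ext, dif_pos hK]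
      exact catEquiv_apply d₁ d₂ h hα p (Sum.inr (i, j, e))
    rw [this, this]
  · rw [blk_rl, hu.1 _ _ (inl_lt_inr h _ _)]; rfl
  · rw [blk_rr]
    rcases lt_trichotomy i j with hij | rfl | hij
    · rw [key _ _ _ _ _ ((inr_lt_inr h).2 hij), key _ _ _ _ _ hij]
      have : ∀ e, (cat d₁ d₂ h hα).ext (catEquiv d₁ d₂ h hα p)
          (⟨(inr h i, inr h j), (inr_lt_inr h).2 hij⟩, e) = d₂.ext p.1.2 (⟨(i, j), hij⟩, e) := by
        intro e
        have hiff : (cat d₁ d₂ h hα).InK (⟨(inr h i, inr h j), (inr_lt_inr h).2 hij⟩, e) ↔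
            d₂.InK (⟨(i, j), hij⟩, e) := by
          simp only [InK, cat_σ_inr, inr_lt_inr, inr_inj]
        by_cases hK : d₂.InK (⟨(i, j), hij⟩, e)
        · rw [ext, ext, dif_pos hK, dif_pos (hiff.2 hK)]
          exact catEquiv_apply d₁ d₂ h hα p (Sum.inl (Sum.inr ⟨_, hK⟩))
        · rw [ext, ext, dif_neg hK, dif_neg (fun h => hK (hiff.1 h))]
      rw [this, this]
    · rw [hu.2, (d₂.isUpperUnip_U _).2]
    · rw [hu.1 _ _ ((inr_lt_inr h).2 hij), (d₂.isUpperUnip_U _).1 _ _ hij]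

/-- The Jacobian of `B ↦ ūᵗ g B`. -/
def catJac (r : ℕ) : ℝ := (∏ p : Fin m × Fin r × Fin 2, |d₁.α p.1|)⁻¹

theorem catJac_pos (hα : ∀ i, d₁.α i ≠ 0) (r : ℕ) : 0 < d₁.catJac r :=
  inv_pos.2 (Finset.prod_pos fun p _ => abs_pos.2 (hα p.1))

/-- After the permutation `σ` of the rows, `B ↦ ūᵗ g B` is triangular with diagonal entries `α`. -/
theorem integral_star'_mul (hα : ∀ i, d₁.α i ≠ 0) {u : Matrix (Fin m) (Fin m) D}
    (hu : IsUpperUnip u) (f : (Fin m × Fin r × Fin 2 → ℝ) → ℂ) :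
    ∫ v : Fin m × Fin r × Fin 2 → ℝ,
      f ((vmat (D := D)).symm (star' u * (d₁.herm D).1 * (vmat v : Matrix (Fin m) (Fin r) D))) = d₁.catJac r * ∫ v, f v := by
  let τ : Fin m × Fin r × Fin 2 ≃ Fin m × Fin r × Fin 2 :=
    ⟨fun p => (d₁.σ p.1, p.2), fun p => (d₁.σ p.1, p.2), fun p => by simp [d₁.invol],
      fun p => by simp [d₁.invol]⟩
  let G : (Fin m × Fin r × Fin 2 → ℝ) → Fin m × Fin r × Fin 2 → ℝ := fun v =>
    (vmat (D := D)).symm (star' u * (d₁.herm D).1 * (vmat v : Matrix (Fin m) (Fin r) D))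
  let F : (Fin m × Fin r × Fin 2 → ℝ) → Fin m × Fin r × Fin 2 → ℝ := fun v p => G v (τ p)
  have hentry : ∀ v (p : Fin m) (j : Fin r), (star' u * (d₁.herm D).1 * (vmat v : Matrix (Fin m) (Fin r) D) : Matrix (Fin m) (Fin r) D)
      (d₁.σ p) j = ∑ k, d₁.α k • (QuadAlg.conj (u k (d₁.σ p)) * (vmat v : Matrix (Fin m) (Fin r) D) (d₁.σ k) j) := by
    intro v p j
    rw [Matrix.mul_assoc, Matrix.mul_apply]
    refine Finset.sum_congr rfl fun k _ => ?_
    rw [herm_mul_apply, mul_smul_comm]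
    rfl
  have hm : Measurable F := by
    have hG : Continuous G := LinearMap.continuous_of_finiteDimensional
      ((vmat (D := D) (m := m) (r := r)).symm.toLinearMap ∘ₗ
        mulLeftLinearMap (Fin r) ℝ (star' u * (d₁.herm D).1) ∘ₗ
        (vmat (D := D) (m := m) (r := r)).toLinearMap)
    exact (continuous_pi fun p => (continuous_apply (τ p)).comp hG).measurable
  have hF := IsTriangular.map_volume_of_scaled (F := F) (ht := fun p => (d₁.σ p.1 : ℕ))
    (c := fun p => d₁.α p.1) (fun p => hα p.1) (fun p v v' hv => by
      obtain ⟨p, j, e⟩ := p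
      have key : (star' u * (d₁.herm D).1 * (vmat v : Matrix (Fin m) (Fin r) D) : Matrix (Fin m) (Fin r) D) (d₁.σ p) j -
          d₁.α p • (vmat v : Matrix (Fin m) (Fin r) D) p j =
          (star' u * (d₁.herm D).1 * (vmat v' : Matrix (Fin m) (Fin r) D) : Matrix (Fin m) (Fin r) D) (d₁.σ p) j -
          d₁.α p • (vmat v' : Matrix (Fin m) (Fin r) D) p j := by
        have h1 : ∀ v : Fin m × Fin r × Fin 2 → ℝ, d₁.α p • (vmat v : Matrix (Fin m) (Fin r) D) p j =
            ∑ k, if k = d₁.σ p then d₁.α p • (vmat v : Matrix (Fin m) (Fin r) D) p j else 0 := by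
          intro v; simp
        rw [h1 v, h1 v', hentry, hentry, ← Finset.sum_sub_distrib, ← Finset.sum_sub_distrib]
        refine Finset.sum_congr rfl fun k _ => ?_
        rcases lt_trichotomy k (d₁.σ p) with hk | rfl | hk
        · rw [if_neg hk.ne, if_neg hk.ne, vmat_apply, vmat_apply,
            hv (d₁.σ k, j, 0) (by simpa [d₁.invol] using hk),
            hv (d₁.σ k, j, 1) (by simpa [d₁.invol] using hk)]
        · rw [if_pos rfl, if_pos rfl, hu.2, d₁.invol, d₁.α_σ]; simp
        · rw [hu.1 _ _ hk, if_neg hk.ne', if_neg hk.ne']; simp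
      simp only [vmat_apply] at key
      have hs : ∀ v, F v (p, j, e) = if e = 0 then
          cs ((star' u * (d₁.herm D).1 * (vmat v : Matrix (Fin m) (Fin r) D) : Matrix (Fin m) (Fin r) D) (d₁.σ p) j) else
          ct ((star' u * (d₁.herm D).1 * (vmat v : Matrix (Fin m) (Fin r) D) : Matrix (Fin m) (Fin r) D) (d₁.σ p) j) := fun v => rfl
      rw [hs, hs]
      fin_cases e
      · have := congrArg cs key
        simpa using this
      · have := congrArg ct key
        simpa using this) hm
  have hG : ∀ v, G v = MeasurableEquiv.piCongrLeft (fun _ => ℝ) τ (F v) := by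
    intro v
    funext p
    obtain ⟨p, rfl⟩ := τ.surjective p
    exact (MeasurableEquiv.piCongrLeft_apply_apply (β := fun _ => ℝ) τ (F v) p).symm
  have he : MeasurableEmbedding F := hm.measurableEmbedding hF.1.1
  calc ∫ v, f (G v) = ∫ v, f (MeasurableEquiv.piCongrLeft (fun _ => ℝ) τ (F v)) := by
        simp only [hG]
    _ = ∫ v, f (MeasurableEquiv.piCongrLeft (fun _ => ℝ) τ v) ∂(Measure.map F volume) :=
        (he.integral_map (μ := volume)
          (fun v => f (MeasurableEquiv.piCongrLeft (fun _ => ℝ) τ v))).symm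
    _ = d₁.catJac r * ∫ v, f (MeasurableEquiv.piCongrLeft (fun _ => ℝ) τ v) := by
        rw [hF.2, integral_smul_measure]
        change (ENNReal.ofReal (d₁.catJac r)).toReal • _ = _
        rw [ENNReal.toReal_ofReal (d₁.catJac_pos hα r).le, Complex.real_smul]
    _ = _ := by
        rw [(volume_measurePreserving_piCongrLeft (fun _ => ℝ) τ).integral_comp']

end Monomial

section Cross

variable {m r n : ℕ} {D : Type} [NormedCommRing D] [NormedAlgebra ℝ D] [QuadAlg D] [QuadBasis D]

/-- The integral of `Φ` over the hermitian matrices with first block `X` and Schur complement `Y`;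
here `R` stands for the inverse of `X`. -/
def cross (ψ : AddChar ℝ Circle) (h : m + r = n) (Φ : Herm n D → ℂ) (R X : Herm m D)
    (Y : Herm r D) : ℂ :=
  ∫ v : Fin m × Fin r × Fin 2 → ℝ, Φ (hblk h X (vmat v) (quad R (vmat v) + Y)) *
    (ψ (corner (R.1 * (vmat v : Matrix (Fin m) (Fin r) D))) : ℂ)

end Cross

namespace Monomial

variable {m r n : ℕ} (d₁ : Monomial m) (d₂ : Monomial r) (h : m + r = n) (hα : ∀ i, d₁.α i ≠ 0)
  {D : Type} [NormedCommRing D] [NormedAlgebra ℝ D] [QuadAlg D] [QuadBasis D]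

theorem hdet_herm_ne_zero (hα : ∀ i, d₁.α i ≠ 0) : hdet (d₁.herm D) ≠ 0 := by
  intro h0
  have h1 := algebraMap_hdet (d₁.herm D)
  rw [h0, map_zero] at h1
  -- The inverse is again monomial.
  let M : Matrix (Fin m) (Fin m) D := Matrix.of fun i j =>
    if d₁.σ i = j then algebraMap ℝ D (d₁.α i)⁻¹ else 0
  have h2 : (d₁.herm D).1 * M = 1 := by
    ext i j
    rw [herm_mul_apply]
    simp only [M, Matrix.of_apply, d₁.invol, d₁.α_σ, Matrix.one_apply]
    split_ifs
    · rw [Algebra.smul_def, ← map_mul, mul_inv_cancel₀ (hα i), map_one]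
    · simp
  have h3 := congrArg Matrix.det h2
  rw [Matrix.det_mul, ← h1, zero_mul, Matrix.det_one] at h3
  have h4 := congrArg tr h3
  rw [map_zero] at h4
  have h5 : tr (1 : D) = 2 := QuadBasis.trace_one
  rw [h5] at h4
  norm_num at h4

/-- In the coordinates `v` with `B = ūᵗ g v` for the upper right block, the correction term of the
Schur complement of the first block `ūᵗ g u` is the value of `g` at `v`. -/
theorem exists_hinv_actM_mul (hα : ∀ i, d₁.α i ≠ 0) {u : Matrix (Fin m) (Fin m) D}
    (hu : IsUpperUnip u) (v : Matrix (Fin m) (Fin r) D) : ∃ V : Matrix (Fin m) (Fin r) D,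
    u * V = v ∧ (hinv (actM (d₁.herm D) u)).1 * (star' u * (d₁.herm D).1 * v) = V ∧
    quad (hinv (actM (d₁.herm D) u)) (star' u * (d₁.herm D).1 * v) = quad (d₁.herm D) v := by
  have hX : hdet (actM (d₁.herm D) u) ≠ 0 := by
    rw [hdet_actM _ hu]; exact d₁.hdet_herm_ne_zero hα
  have hud : IsUnit u.det := by rw [hu.det]; exact isUnit_one
  obtain ⟨V, rfl⟩ : ∃ V, u * V = v := ⟨u⁻¹ * v, by
    rw [← Matrix.mul_assoc, Matrix.mul_nonsing_inv u hud, Matrix.one_mul]⟩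
  have h1 : star' u * (d₁.herm D).1 * (u * V) = (actM (d₁.herm D) u).1 * V := by
    rw [← Matrix.mul_assoc]; rfl
  have h2 : (hinv (actM (d₁.herm D) u)).1 * (star' u * (d₁.herm D).1 * (u * V)) = V := by
    rw [h1, ← Matrix.mul_assoc, hinv_mul hX, Matrix.one_mul]
  refine ⟨V, rfl, h2, Subtype.ext ?_⟩
  change starR (star' u * (d₁.herm D).1 * (u * V)) * (hinv (actM (d₁.herm D) u)).1 *
    (star' u * (d₁.herm D).1 * (u * V)) = starR (u * V) * (d₁.herm D).1 * (u * V)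
  have hg : starR (d₁.herm D).1 = (d₁.herm D).1 := star'_coe _
  rw [Matrix.mul_assoc, h2]
  simp only [starR_mul, ← starR_eq_star', starR_starR, hg, Matrix.mul_assoc]

/-- The inner integral over the upper right block. -/
theorem integral_vmat_eq_cross (ψ : AddChar ℝ Circle) (Φ : Herm n D → ℂ)
    (hα : ∀ i, d₁.α i ≠ 0) {u : Matrix (Fin m) (Fin m) D} (hu : IsUpperUnip u) (Y : Herm r D) :
    ∫ v : Fin m × Fin r × Fin 2 → ℝ, Φ (hblk h (actM (d₁.herm D) u)
      (star' u * (d₁.herm D).1 * (vmat v : Matrix (Fin m) (Fin r) D)) (quad (d₁.herm D) (vmat v) + Y)) *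
        (ψ (corner (vmat v : Matrix (Fin m) (Fin r) D)) : ℂ) =
      d₁.catJac r * cross ψ h Φ (hinv (actM (d₁.herm D) u)) (actM (d₁.herm D) u) Y := by
  rw [cross, ← d₁.integral_star'_mul hα hu]
  refine integral_congr_ae (Filter.Eventually.of_forall fun v => ?_)
  obtain ⟨V, hV, h2, h3⟩ := d₁.exists_hinv_actM_mul hα hu (vmat v : Matrix (Fin m) (Fin r) D)
  simp only [LinearEquiv.apply_symm_apply]
  rw [h2, h3, ← hV, corner_mul hu]

/-- The orbit integral of a block diagonal matrix as an integral over the two diagonal blocks, the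
first block and the Schur complement. -/
theorem integrable_and_J_cat {ψ : AddChar ℝ Circle} (hψ : Continuous ψ) (Φ : 𝓢(Herm n D, ℂ)) :
    Integrable (fun p : (d₁.K → ℝ) × (d₂.K → ℝ) =>
      cross ψ h Φ (hinv (actM (d₁.herm D) (d₁.U p.1))) (actM (d₁.herm D) (d₁.U p.1))
        (actM (d₂.herm D) (d₂.U p.2)) *
      (chiM ψ (d₁.U p.1 : Matrix (Fin m) (Fin m) D) *
        chiM ψ (d₂.U p.2 : Matrix (Fin r) (Fin r) D))) ∧
    (cat d₁ d₂ h hα).J ψ Φ = d₁.catJac r * ∫ p : (d₁.K → ℝ) × (d₂.K → ℝ),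
      cross ψ h Φ (hinv (actM (d₁.herm D) (d₁.U p.1))) (actM (d₁.herm D) (d₁.U p.1))
        (actM (d₂.herm D) (d₂.U p.2)) *
      (chiM ψ (d₁.U p.1 : Matrix (Fin m) (Fin m) D) *
        chiM ψ (d₂.U p.2 : Matrix (Fin r) (Fin r) D)) := by
  have hint := (cat d₁ d₂ h hα).integrable_J_integrand hψ Φ
  have hmp := measurePreserving_catEquiv d₁ d₂ h hα
  have h1 : ∀ p, Φ (actM ((cat d₁ d₂ h hα).herm D) ((cat d₁ d₂ h hα).U
      (catEquiv d₁ d₂ h hα p))) *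
      chiM ψ ((cat d₁ d₂ h hα).U (catEquiv d₁ d₂ h hα p) : Matrix (Fin n) (Fin n) D) =
      Φ (hblk h (actM (d₁.herm D) (d₁.U p.1.1)) (star' (d₁.U p.1.1) * (d₁.herm D).1 *
        (vmat p.2 : Matrix (Fin m) (Fin r) D)) (quad (d₁.herm D) (vmat p.2) +
          actM (d₂.herm D) (d₂.U p.1.2))) * (ψ (corner (vmat p.2 : Matrix (Fin m) (Fin r) D)) : ℂ) *
      (chiM ψ (d₁.U p.1.1 : Matrix (Fin m) (Fin m) D) *
        chiM ψ (d₂.U p.1.2 : Matrix (Fin r) (Fin r) D)) := by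
    intro p
    rw [cat_herm, U_cat, actM_hblk_zero, chiM_blk]
    ring
  have hint2 := (hmp.integrable_comp_emb (MeasurableEquiv.measurableEmbedding _)).2 hint
  have hint3 := hint2.congr (Filter.Eventually.of_forall h1)
  rw [Measure.volume_eq_prod] at hint3
  have h2 : ∀ q : (d₁.K → ℝ) × (d₂.K → ℝ), ∫ v : Fin m × Fin r × Fin 2 → ℝ,
      Φ (hblk h (actM (d₁.herm D) (d₁.U q.1)) (star' (d₁.U q.1) * (d₁.herm D).1 *
        (vmat v : Matrix (Fin m) (Fin r) D)) (quad (d₁.herm D) (vmat v) +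
          actM (d₂.herm D) (d₂.U q.2))) * (ψ (corner (vmat v : Matrix (Fin m) (Fin r) D)) : ℂ) *
      (chiM ψ (d₁.U q.1 : Matrix (Fin m) (Fin m) D) *
        chiM ψ (d₂.U q.2 : Matrix (Fin r) (Fin r) D)) = d₁.catJac r *
      (cross ψ h Φ (hinv (actM (d₁.herm D) (d₁.U q.1))) (actM (d₁.herm D) (d₁.U q.1))
        (actM (d₂.herm D) (d₂.U q.2)) *
      (chiM ψ (d₁.U q.1 : Matrix (Fin m) (Fin m) D) *
        chiM ψ (d₂.U q.2 : Matrix (Fin r) (Fin r) D))) := by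
    intro q
    rw [integral_mul_const, d₁.integral_vmat_eq_cross h ψ Φ hα (d₁.isUpperUnip_U q.1), mul_assoc]
  have hc : (d₁.catJac r : ℂ) ≠ 0 := by exact_mod_cast (d₁.catJac_pos hα r).ne'
  refine ⟨?_, ?_⟩
  · have h3 := hint3.integral_prod_left
    simp only [h2] at h3
    have h4 := h3.const_mul (d₁.catJac r : ℂ)⁻¹
    simpa only [inv_mul_cancel_left₀ hc] using h4
  · rw [J, ← hmp.integral_comp', integral_congr_ae (Filter.Eventually.of_forall h1),
      Measure.volume_eq_prod, integral_prod _ hint3]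
    simp only [h2]
    rw [integral_const_mul]

end Monomial

/-! ### Schwartz functions of the blocks -/

theorem hasTemperateGrowth_addChar {ψ : AddChar ℝ Circle} (hψ : Continuous ψ) :
    (fun x : ℝ => (ψ x : ℂ)).HasTemperateGrowth := by
  obtain ⟨t, ht⟩ := exists_eq_exp_of_continuous ψ hψ
  have hd : ∀ k : ℕ, iteratedDeriv k (fun x : ℝ => (ψ x : ℂ)) =
      fun x : ℝ => (2 * Real.pi * Complex.I * t) ^ k * (ψ x : ℂ) := by
    intro k
    induction k with
    | zero => simp
    | succ k ih =>
      rw [iteratedDeriv_succ, ih]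
      funext x
      have h1 : HasDerivAt (fun x : ℝ => (ψ x : ℂ)) (2 * Real.pi * Complex.I * t * (ψ x : ℂ)) x := by
        simp only [ht]
        have h2 : HasDerivAt (fun x : ℝ => 2 * Real.pi * Complex.I * ((t * x : ℝ) : ℂ))
            (2 * Real.pi * Complex.I * t) x := by
          have h3 := ((hasDerivAt_id x).const_mul t).ofReal_comp.const_mul
            (2 * Real.pi * Complex.I)
          simpa using h3
        have := h2.cexp
        convert this using 1
        ring
      rw [(h1.const_mul _).deriv]
      ring
  refine ⟨?_, fun k => ⟨0, ‖(2 * Real.pi * Complex.I * t : ℂ)‖ ^ k, fun x => ?_⟩⟩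
  · simp only [ht]
    exact (contDiff_const.mul (Complex.ofRealCLM.contDiff.comp
      (contDiff_const.mul contDiff_id))).cexp
  · rw [norm_iteratedFDeriv_eq_norm_iteratedDeriv, hd, norm_mul, Circle.norm_coe, norm_pow]
    simp

section Cut

/-- A bump function at `δ`, supported in the half-line containing `δ`. -/
def bumpAt {δ : ℝ} (hδ : δ ≠ 0) : ContDiffBump δ :=
  ⟨|δ| / 4, |δ| / 2, by positivity, by have := abs_pos.2 hδ; linarith⟩

/-- A smooth function that agrees with the inverse on the support of `bumpAt`. -/
def smoothInv {δ : ℝ} (hδ : δ ≠ 0) (x : ℝ) : ℝ :=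
  (⟨|δ| / 2, 3 * |δ| / 4, by positivity, by have := abs_pos.2 hδ; linarith⟩ : ContDiffBump δ) x * x⁻¹

theorem bumpAt_self {δ : ℝ} (hδ : δ ≠ 0) : bumpAt hδ δ = 1 := 
  (bumpAt hδ).one_of_mem_closedBall (Metric.mem_closedBall_self (bumpAt hδ).rIn_pos.le)

theorem smoothInv_eq {δ x : ℝ} (hδ : δ ≠ 0) (h : bumpAt hδ x ≠ 0) : smoothInv hδ x = x⁻¹ := by
  have h1 : x ∈ Function.support (bumpAt hδ) := h
  rw [(bumpAt hδ).support_eq] at h1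
  rw [smoothInv, ContDiffBump.one_of_mem_closedBall, one_mul]
  exact Metric.ball_subset_closedBall h1

theorem sign_eq_of_bumpAt_ne_zero {δ x : ℝ} (hδ : δ ≠ 0) (h : bumpAt hδ x ≠ 0) :
    Real.sign x = Real.sign δ := by
  have h1 : x ∈ Function.support (bumpAt hδ) := h
  rw [(bumpAt hδ).support_eq, Metric.mem_ball, Real.dist_eq] at h1
  change |x - δ| < |δ| / 2 at h1
  rcases lt_or_gt_of_ne hδ with h2 | h2
  · rw [abs_of_neg h2, abs_lt] at h1
    rw [Real.sign_of_neg h2, Real.sign_of_neg (by linarith)]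
  · rw [abs_of_pos h2, abs_lt] at h1
    rw [Real.sign_of_pos h2, Real.sign_of_pos (by linarith)]

theorem bumpAt_hasTemperateGrowth {δ : ℝ} (hδ : δ ≠ 0) : (bumpAt hδ : ℝ → ℝ).HasTemperateGrowth :=
  (bumpAt hδ).hasCompactSupport.hasTemperateGrowth (bumpAt hδ).contDiff

theorem smoothInv_hasTemperateGrowth {δ : ℝ} (hδ : δ ≠ 0) :
    (smoothInv hδ).HasTemperateGrowth := by
  have hp := abs_pos.2 hδ
  set b : ContDiffBump δ := ⟨|δ| / 2, 3 * |δ| / 4, by positivity, by linarith⟩ with hb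
  have he : smoothInv hδ = fun x => b x * x⁻¹ := rfl
  refine HasCompactSupport.hasTemperateGrowth ?_ ?_
  · rw [he]
    exact b.hasCompactSupport.mul_right
  · rw [he, contDiff_iff_contDiffAt]
    intro x
    by_cases hx : x = 0
    · subst hx
      have h0 : (fun x => b x * x⁻¹) =ᶠ[nhds 0] fun _ => 0 := by
        have : ∀ᶠ x in nhds (0 : ℝ), x ∈ Metric.ball (0 : ℝ) (|δ| / 4) :=
          Metric.ball_mem_nhds _ (by linarith)
        filter_upwards [this] with x hx
        rw [b.zero_of_le_dist, zero_mul]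
        change 3 * |δ| / 4 ≤ dist x δ
        rw [Metric.mem_ball, dist_zero_right, Real.norm_eq_abs] at hx
        rw [Real.dist_eq]
        have := abs_sub_abs_le_abs_sub δ x
        rw [abs_sub_comm] at this
        linarith
      exact contDiffAt_const.congr_of_eventuallyEq h0
    · exact b.contDiffAt.mul (contDiffAt_inv ℝ hx)

end Cut

section Cross

variable {m r n : ℕ} {D : Type} [NormedCommRing D] [NormedAlgebra ℝ D] [QuadAlg D] [QuadBasis D]

theorem hasTemperateGrowth_starR {E : Type*} [NormedAddCommGroup E] [NormedSpace ℝ E]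
    {M : E → Matrix (Fin m) (Fin r) D} (hM : M.HasTemperateGrowth) :
    (fun x => starR (M x)).HasTemperateGrowth := by
  refine hasTemperateGrowth_matrix fun i j => ?_
  exact hasTemperateGrowth_linearMap_comp (QuadAlg.conj (D := D)).toLinearMap
    (hasTemperateGrowth_entry hM j i)

theorem hasTemperateGrowth_quad {E : Type*} [NormedAddCommGroup E] [NormedSpace ℝ E]
    {R : E → Herm m D} {M : E → Matrix (Fin m) (Fin r) D} (hR : R.HasTemperateGrowth)
    (hM : M.HasTemperateGrowth) : (fun x => quad (R x) (M x)).HasTemperateGrowth :=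
  hasTemperateGrowth_herm (hasTemperateGrowth_matrix_mul (hasTemperateGrowth_matrix_mul
    (hasTemperateGrowth_starR hM) (hasTemperateGrowth_herm_coe hR)) hM)

theorem hasTemperateGrowth_hblk {E : Type*} [NormedAddCommGroup E] [NormedSpace ℝ E]
    (h : m + r = n) {X : E → Herm m D} {M : E → Matrix (Fin m) (Fin r) D} {Y : E → Herm r D}
    (hX : X.HasTemperateGrowth) (hM : M.HasTemperateGrowth) (hY : Y.HasTemperateGrowth) :
    (fun x => hblk h (X x) (M x) (Y x)).HasTemperateGrowth := by
  refine hasTemperateGrowth_herm (hasTemperateGrowth_matrix fun i j => ?_)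
  refine inl_inr_cases h i (fun a => ?_) (fun a => ?_) <;>
    refine inl_inr_cases h j (fun b => ?_) (fun b => ?_) <;>
    simp only [hblk, blk_ll, blk_lr, blk_rl, blk_rr]
  · exact hasTemperateGrowth_entry (hasTemperateGrowth_herm_coe hX) a b
  · exact hasTemperateGrowth_entry hM a b
  · exact hasTemperateGrowth_entry (hasTemperateGrowth_starR hM) a b
  · exact hasTemperateGrowth_entry (hasTemperateGrowth_herm_coe hY) a b

theorem hasTemperateGrowth_hdet {E : Type*} [NormedAddCommGroup E] [NormedSpace ℝ E]
    {X : E → Herm m D} (hX : X.HasTemperateGrowth) :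
    (fun x => hdet (X x)).HasTemperateGrowth := by
  have h1 := hasTemperateGrowth_linearMap_comp ((2⁻¹ : ℝ) • (tr : D →ₗ[ℝ] ℝ))
    (hasTemperateGrowth_det (hasTemperateGrowth_herm_coe hX))
  convert h1 using 1
  funext x
  simp [hdet, div_eq_inv_mul]

theorem hasTemperateGrowth_hadj {E : Type*} [NormedAddCommGroup E] [NormedSpace ℝ E]
    {X : E → Herm m D} (hX : X.HasTemperateGrowth) :
    (fun x => hadj (X x)).HasTemperateGrowth :=
  hasTemperateGrowth_herm (hasTemperateGrowth_adjugate (hasTemperateGrowth_herm_coe hX))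

theorem hasTemperateGrowth_corner {E : Type*} [NormedAddCommGroup E] [NormedSpace ℝ E]
    {M : E → Matrix (Fin m) (Fin r) D} (hM : M.HasTemperateGrowth) :
    (fun x => corner (M x)).HasTemperateGrowth := by
  unfold corner
  refine Function.HasTemperateGrowth.sum fun i _ => Function.HasTemperateGrowth.sum fun j _ => ?_
  split_ifs
  · exact hasTemperateGrowth_linearMap_comp (tr : D →ₗ[ℝ] ℝ) (hasTemperateGrowth_entry hM i j)
  · exact Function.HasTemperateGrowth.const 0

variable (D) in
/-- The upper left block of a hermitian matrix. -/
def hll (h : m + r = n) : Herm n D →ₗ[ℝ] Herm m D where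
  toFun x := ⟨Matrix.of fun i j => x.1 (inl h i) (inl h j), by
    change star' _ = _
    ext i j
    exact herm_apply x _ _⟩
  map_add' _ _ := rfl
  map_smul' _ _ := rfl

variable (D) in
/-- The lower right block of a hermitian matrix. -/
def hrr (h : m + r = n) : Herm n D →ₗ[ℝ] Herm r D where
  toFun x := ⟨Matrix.of fun i j => x.1 (inr h i) (inr h j), by
    change star' _ = _
    ext i j
    exact herm_apply x _ _⟩
  map_add' _ _ := rfl
  map_smul' _ _ := rfl

variable (D) in
/-- The upper right block of a hermitian matrix. -/
def hlr (h : m + r = n) : Herm n D →ₗ[ℝ] Matrix (Fin m) (Fin r) D where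
  toFun x := Matrix.of fun i j => x.1 (inl h i) (inr h j)
  map_add' _ _ := rfl
  map_smul' _ _ := rfl

variable (h : m + r = n) (X : Herm m D) (B : Matrix (Fin m) (Fin r) D) (Y : Herm r D)

@[simp] theorem hll_hblk : hll D h (hblk h X B Y) = X := by
  apply Subtype.ext; ext i j; exact blk_ll h _ _ _ _ i j

@[simp] theorem hrr_hblk : hrr D h (hblk h X B Y) = Y := by
  apply Subtype.ext; ext i j; exact blk_rr h _ _ _ _ i j

@[simp] theorem hlr_hblk : hlr D h (hblk h X B Y) = B := by
  ext i j; exact blk_lr h _ _ _ _ i j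

/-- Composition of a Schwartz function with the parametrization of hermitian matrices by the first
block, the upper right block and the Schur complement, for a substitute `R` of temperate growth for
the inverse of the first block. -/
def schurComp (Φ : 𝓢(Herm n D, ℂ)) {R : Herm m D → Herm m D} (hR : R.HasTemperateGrowth) :
    𝓢((Herm m D × Herm r D) × (Fin m × Fin r × Fin 2 → ℝ), ℂ) :=
  compLeftInv (g := fun p : (Herm m D × Herm r D) × (Fin m × Fin r × Fin 2 → ℝ) =>
      hblk h p.1.1 (vmat p.2) (quad (R p.1.1) (vmat p.2) + p.1.2))
    (h := fun x => ((hll D h x, hrr D h x - quad (R (hll D h x)) (hlr D h x)),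
      (vmat (D := D)).symm (hlr D h x)))
    (by
      have h1 : (fun p : (Herm m D × Herm r D) × (Fin m × Fin r × Fin 2 → ℝ) =>
          p.1.1).HasTemperateGrowth := hasTemperateGrowth_fst_comp (hasTemperateGrowth_fst_comp
            (hasTemperateGrowth_linearMap LinearMap.id))
      have h2 : (fun p : (Herm m D × Herm r D) × (Fin m × Fin r × Fin 2 → ℝ) =>
          p.1.2).HasTemperateGrowth := hasTemperateGrowth_snd_comp (hasTemperateGrowth_fst_comp
            (hasTemperateGrowth_linearMap LinearMap.id))
      have h3 : (fun p : (Herm m D × Herm r D) × (Fin m × Fin r × Fin 2 → ℝ) =>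
          (vmat p.2 : Matrix (Fin m) (Fin r) D)).HasTemperateGrowth :=
        hasTemperateGrowth_linearMap_comp (vmat (D := D) (m := m) (r := r)).toLinearMap (hasTemperateGrowth_snd_comp
          (hasTemperateGrowth_linearMap LinearMap.id))
      exact hasTemperateGrowth_hblk h h1 h3 ((hasTemperateGrowth_quad (hR.comp h1) h3).add h2))
    (by
      have h1 := hasTemperateGrowth_linearMap (hll D h)
      have h2 := hasTemperateGrowth_linearMap (hrr D h)
      have h3 := hasTemperateGrowth_linearMap (hlr D h)
      refine hasTemperateGrowth_prodMk (hasTemperateGrowth_prodMk h1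
        (h2.sub (hasTemperateGrowth_quad (hR.comp h1) h3))) ?_
      exact hasTemperateGrowth_linearMap_comp (vmat (D := D)).symm.toLinearMap h3)
    (by
      rintro ⟨⟨X, Y⟩, v⟩
      simp) Φ

theorem schurComp_apply (Φ : 𝓢(Herm n D, ℂ)) {R : Herm m D → Herm m D}
    (hR : R.HasTemperateGrowth)
    (p : (Herm m D × Herm r D) × (Fin m × Fin r × Fin 2 → ℝ)) : schurComp h Φ hR p =
    Φ (hblk h p.1.1 (vmat p.2) (quad (R p.1.1) (vmat p.2) + p.1.2)) := rfl

/-- The smooth substitute for the inverse near hermitian matrices of determinant `δ`. -/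
def cutInv {δ : ℝ} (hδ : δ ≠ 0) (X : Herm m D) : Herm m D := smoothInv hδ (hdet X) • hadj X

theorem cutInv_hasTemperateGrowth {δ : ℝ} (hδ : δ ≠ 0) :
    (cutInv hδ : Herm m D → Herm m D).HasTemperateGrowth := by
  have h0 : (fun X : Herm m D => X).HasTemperateGrowth := hasTemperateGrowth_linearMap LinearMap.id
  exact ((smoothInv_hasTemperateGrowth hδ).comp (hasTemperateGrowth_hdet h0)).smul
    (hasTemperateGrowth_hadj h0)

variable (ψ : AddChar ℝ Circle)

/-- The Schwartz function of the first block and the Schur complement that is obtained from `Φ` by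
integration over the upper right block, cut off near first blocks of determinant `δ`. -/
def crossS (Φ : 𝓢(Herm n D, ℂ)) {δ : ℝ} (hδ : δ ≠ 0) : 𝓢(Herm m D × Herm r D, ℂ) :=
  partialIntegral volume (SchwartzMap.smulLeftCLM ℂ
    (fun p : (Herm m D × Herm r D) × (Fin m × Fin r × Fin 2 → ℝ) => (bumpAt hδ (hdet p.1.1) : ℂ) *
      (ψ (corner ((cutInv hδ p.1.1).1 * (vmat p.2 : Matrix (Fin m) (Fin r) D))) : ℂ))
    (schurComp h Φ (cutInv_hasTemperateGrowth hδ)))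

theorem crossS_apply {ψ : AddChar ℝ Circle} (hψ : Continuous ψ) (Φ : 𝓢(Herm n D, ℂ)) {δ : ℝ} (hδ : δ ≠ 0) (X : Herm m D) (Y : Herm r D) :
    crossS h ψ Φ hδ (X, Y) = bumpAt hδ (hdet X) * cross ψ h Φ (hinv X) X Y := by
  have h1 : (fun p : (Herm m D × Herm r D) × (Fin m × Fin r × Fin 2 → ℝ) =>
      p.1.1).HasTemperateGrowth := hasTemperateGrowth_fst_comp (hasTemperateGrowth_fst_comp
        (hasTemperateGrowth_linearMap LinearMap.id))
  have h3 : (fun p : (Herm m D × Herm r D) × (Fin m × Fin r × Fin 2 → ℝ) =>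
      (vmat p.2 : Matrix (Fin m) (Fin r) D)).HasTemperateGrowth :=
    hasTemperateGrowth_linearMap_comp (vmat (D := D) (m := m) (r := r)).toLinearMap (hasTemperateGrowth_snd_comp
          (hasTemperateGrowth_linearMap LinearMap.id))
  have htg : (fun p : (Herm m D × Herm r D) × (Fin m × Fin r × Fin 2 → ℝ) =>
      (bumpAt hδ (hdet p.1.1) : ℂ) *
      (ψ (corner ((cutInv hδ p.1.1).1 * (vmat p.2 : Matrix (Fin m) (Fin r) D))) : ℂ)).HasTemperateGrowth := by
    refine Function.HasTemperateGrowth.mul ?_ ?_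
    · exact hasTemperateGrowth_linearMap_comp Complex.ofRealCLM.toLinearMap
        ((bumpAt_hasTemperateGrowth hδ).comp (hasTemperateGrowth_hdet h1))
    · exact (hasTemperateGrowth_addChar hψ).comp (hasTemperateGrowth_corner
        (hasTemperateGrowth_matrix_mul (hasTemperateGrowth_herm_coe
          ((cutInv_hasTemperateGrowth hδ).comp h1)) h3))
  rw [crossS, partialIntegral_apply, cross, ← integral_const_mul]
  refine integral_congr_ae (Filter.Eventually.of_forall fun v => ?_)
  simp only [SchwartzMap.smulLeftCLM_apply_apply htg, schurComp_apply, smul_eq_mul]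
  by_cases hb : bumpAt hδ (hdet X) = 0
  · simp [hb]
  · have : cutInv hδ X = hinv X := by rw [cutInv, smoothInv_eq hδ hb, hinv]
    rw [this]
    ring

theorem crossS_apply_of_hdet {ψ : AddChar ℝ Circle} (hψ : Continuous ψ) (Φ : 𝓢(Herm n D, ℂ)) {δ : ℝ} (hδ : δ ≠ 0) {X : Herm m D}
    (hX : hdet X = δ) (Y : Herm r D) :
    crossS h ψ Φ hδ (X, Y) = cross ψ h Φ (hinv X) X Y := by
  rw [crossS_apply h hψ, hX, bumpAt_self]; simp

end Cross

/-! ### Splitting off one row and column -/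

section Slice

variable {E F : Type} [NormedAddCommGroup E] [NormedSpace ℝ E] [NormedAddCommGroup F]
  [NormedSpace ℝ F]

/-- Restriction of a Schwartz function on a product to a fixed value of the second variable. -/
def sliceR (f : 𝓢(E × F, ℂ)) (y : F) : 𝓢(E, ℂ) :=
  compLeftInv (g := fun x => (x, y)) (h := Prod.fst)
    (hasTemperateGrowth_prodMk (ContinuousLinearMap.id ℝ E).hasTemperateGrowth
      (Function.HasTemperateGrowth.const y))
    (ContinuousLinearMap.fst ℝ E F).hasTemperateGrowth (fun _ => rfl) f

theorem sliceR_apply (f : 𝓢(E × F, ℂ)) (y : F) (x : E) : sliceR f y x = f (x, y) := rfl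

/-- Restriction of a Schwartz function on a product to a fixed value of the first variable. -/
def sliceL (f : 𝓢(E × F, ℂ)) (x : E) : 𝓢(F, ℂ) :=
  compLeftInv (g := fun y => (x, y)) (h := Prod.snd)
    (hasTemperateGrowth_prodMk (Function.HasTemperateGrowth.const x)
      (ContinuousLinearMap.id ℝ F).hasTemperateGrowth)
    (ContinuousLinearMap.snd ℝ E F).hasTemperateGrowth (fun _ => rfl) f

theorem sliceL_apply (f : 𝓢(E × F, ℂ)) (x : E) (y : F) : sliceL f x y = f (x, y) := rfl

end Slice

namespace Monomial

theorem ext_of_eq {n : ℕ} {d d' : Monomial n} (hσ : d.σ = d'.σ) (hα : d.α = d'.α) : d = d' := by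
  cases d; cases d'; subst hσ hα; rfl

section Small

variable (d : Monomial 1) {D : Type} [NormedCommRing D] [NormedAlgebra ℝ D] [QuadAlg D]
  [QuadBasis D]

instance : IsEmpty d.K := ⟨fun q => absurd q.1.1.2 (by
  have h1 := q.1.1.1.1.2
  have h2 := q.1.1.1.2.2
  rw [Fin.lt_def]; omega)⟩

theorem U_one (y : d.K → ℝ) : (d.U y : Matrix (Fin 1) (Fin 1) D) = 1 := by
  ext i j
  have : i = j := Subsingleton.elim _ _
  rw [this, (d.isUpperUnip_U y).2, Matrix.one_apply_eq]

theorem actM_one {n : ℕ} (X : Herm n D) : actM X 1 = X := by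
  apply Subtype.ext
  simp [actM, star'_one]

theorem chiM_one {n : ℕ} (ψ : AddChar ℝ Circle) : chiM ψ (1 : Matrix (Fin n) (Fin n) D) = 1 := by
  have : ∀ i j : Fin n, (if (i : ℕ) + 1 = j then tr ((1 : Matrix (Fin n) (Fin n) D) i j) else 0) = 0 := by
    intro i j
    split_ifs with h
    · rw [Matrix.one_apply_ne (by rintro rfl; omega), map_zero]
    · rfl
  simp [chiM, this]

theorem integral_of_isEmpty {ι : Type*} [Fintype ι] [IsEmpty ι] (f : (ι → ℝ) → ℂ) :
    ∫ y, f y = f default := by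
  rw [Measure.volume_pi_eq_dirac default, integral_dirac]

theorem J_one (ψ : AddChar ℝ Circle) (Φ : Herm 1 D → ℂ) : d.J ψ Φ = Φ (d.herm D) := by
  rw [J, integral_of_isEmpty, U_one, actM_one, chiM_one, mul_one]

end Small

variable {m r n : ℕ} (h : m + r = n) {D : Type} [NormedCommRing D] [NormedAlgebra ℝ D] [QuadAlg D]
  [QuadBasis D]

/-- Splitting off a last diagonal entry. The function on the smaller matrices must be Schwartz, which
needs a cut-off away from the singular ones; the cut-off only depends on the determinant. -/
theorem J_cat_snoc (d₁ : Monomial m) (d₂ : Monomial 1) (h : m + 1 = n) (hα : ∀ i, d₁.α i ≠ 0)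
    {ψ : AddChar ℝ Circle} (hψ : Continuous ψ) (Φ : 𝓢(Herm n D, ℂ)) {δ : ℝ} (hδ : δ ≠ 0) :
    (bumpAt hδ (hdet (d₁.herm D)) : ℂ) * (cat d₁ d₂ h hα).J ψ Φ =
      d₁.catJac 1 * d₁.J ψ (sliceR (crossS h ψ Φ hδ) (d₂.herm D)) := by
  have h1 := integrable_and_J_cat d₁ d₂ h hα hψ Φ
  rw [Measure.volume_eq_prod] at h1
  rw [h1.2, integral_prod _ h1.1, J, mul_left_comm, ← integral_const_mul]
  congr 1
  refine integral_congr_ae (Filter.Eventually.of_forall fun y => ?_)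
  simp only [integral_of_isEmpty, U_one, actM_one, chiM_one, sliceR_apply, crossS_apply h hψ,
    hdet_actM _ (d₁.isUpperUnip_U y)]
  ring

theorem J_cat_cons (d₁ : Monomial 1) (d₂ : Monomial r) (h : 1 + r = n) (hα : ∀ i, d₁.α i ≠ 0)
    {ψ : AddChar ℝ Circle} (hψ : Continuous ψ) (Φ : 𝓢(Herm n D, ℂ)) {δ : ℝ} (hδ : δ ≠ 0)
    (hd : hdet (d₁.herm D) = δ) : (cat d₁ d₂ h hα).J ψ Φ =
      d₁.catJac r * d₂.J ψ (sliceL (crossS h ψ Φ hδ) (d₁.herm D)) := by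
  have h1 := integrable_and_J_cat d₁ d₂ h hα hψ Φ
  rw [Measure.volume_eq_prod] at h1
  rw [h1.2, integral_prod_symm _ h1.1, J]
  congr 1
  refine integral_congr_ae (Filter.Eventually.of_forall fun y => ?_)
  simp only [integral_of_isEmpty, U_one, actM_one, chiM_one, sliceL_apply,
    crossS_apply_of_hdet h hψ Φ hδ hd]
  ring

theorem hdet_herm (d : Monomial n) : hdet (d.herm D) = d.mat.det := by
  refine hdet_eq_of_det_eq ?_
  exact ((algebraMap ℝ D).map_det d.mat).symm

theorem diag_mat (a : Fin n → ℝ) (ha : ∀ i, a i ≠ 0) : (diag a ha).mat = Matrix.diagonal a := by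
  ext i j
  change (if i = j then a i else 0) = _
  rw [Matrix.diagonal_apply]

theorem hdet_diag (a : Fin n → ℝ) (ha : ∀ i, a i ≠ 0) : hdet ((diag a ha).herm D) = ∏ i, a i := by
  rw [hdet_herm, diag_mat, Matrix.det_diagonal]

theorem diag_eq_cat (a : Fin n → ℝ) (ha : ∀ i, a i ≠ 0) : diag a ha =
    cat (diag (fun i => a (inl h i)) fun _ => ha _) (diag (fun i => a (inr h i)) fun _ => ha _) h
      fun _ => ha _ := by
  refine ext_of_eq ?_ ?_ <;> funext i <;> refine inl_inr_cases h i (fun a => ?_) (fun a => ?_) <;>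
    simp [diag]

end Monomial

section RegFactor

/-- Extension of a finite sequence by ones. -/
def extOne {n : ℕ} (a : Fin n → ℝ) (i : ℕ) : ℝ := if h : i < n then a ⟨i, h⟩ else 1

theorem prod_extOne {n : ℕ} (a : Fin n → ℝ) : ∏ i, a i = ∏ i ∈ Finset.range n, extOne a i := by
  rw [Finset.prod_range]
  exact Finset.prod_congr rfl fun i _ => by simp [extOne]

theorem regFactor_eq {n : ℕ} (a : Fin n → ℝ) : regFactor a = ((∏ k ∈ Finset.range (n - 1),
    Real.sign (∏ i ∈ Finset.range (k + 1), extOne a i) : ℝ) : ℂ) := by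
  rw [regFactor]
  congr 1
  refine Finset.prod_bij (fun k _ => (k : ℕ)) ?_ ?_ ?_ ?_
  · intro k hk
    simp only [Finset.mem_filter, Finset.mem_univ, true_and] at hk
    simp only [Finset.mem_range]; omega
  · intro k _ k' _ h
    exact Fin.ext h
  · intro k hk
    simp only [Finset.mem_range] at hk
    exact ⟨⟨k, by omega⟩, by simp; omega, rfl⟩
  · intro k _
    congr 1
    refine Finset.prod_bij (fun i _ => (i : ℕ)) ?_ ?_ ?_ ?_
    · intro i hi
      simp only [Finset.mem_Iic, Fin.le_def] at hi
      simp only [Finset.mem_range]; omega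
    · intro i _ i' _ h
      exact Fin.ext h
    · intro i hi
      simp only [Finset.mem_range] at hi
      exact ⟨⟨i, by have := k.2; omega⟩, by simp [Fin.le_def]; omega, rfl⟩
    · intro i _
      simp [extOne]

/-- The proper partial products of `a` are those of the truncated sequence and its full product. -/
theorem regFactor_snoc {k n : ℕ} (h : k + 1 = n) (a : Fin n → ℝ) :
    regFactor a = regFactor (fun i => a (inl h i)) * ((Real.sign (∏ i, a (inl h i)) : ℝ) : ℂ) := by
  have he : ∀ i < k, extOne (fun i => a (inl h i)) i = extOne a i := by
    intro i hi
    have : i < n := by omega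
    simp only [extOne, hi, this, dif_pos]
    rfl
  rw [regFactor_eq, regFactor_eq, prod_extOne (fun i => a (inl h i)), ← Complex.ofReal_mul]
  congr 1
  rcases k with _ | k
  · subst h; simp
  · subst h
    rw [show k + 1 + 1 - 1 = (k + 1 - 1) + 1 by omega, Finset.prod_range_succ]
    congr 1
    · refine Finset.prod_congr rfl fun j hj => ?_
      rw [Finset.mem_range] at hj
      congr 1
      refine Finset.prod_congr rfl fun i hi => ?_
      rw [Finset.mem_range] at hi
      rw [he i (by omega)]
    · congr 1
      rw [show k + 1 - 1 + 1 = k + 1 by omega]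
      refine Finset.prod_congr rfl fun i hi => ?_
      rw [he i (by simpa using hi)]

theorem sign_mul (x y : ℝ) : Real.sign (x * y) = Real.sign x * Real.sign y := by
  rcases lt_trichotomy x 0 with hx | rfl | hx <;> rcases lt_trichotomy y 0 with hy | rfl | hy <;>
    simp [*, Real.sign_of_pos, Real.sign_of_neg, mul_pos_of_neg_of_neg, mul_neg_of_neg_of_pos,
      mul_neg_of_pos_of_neg]

/-- The proper partial products of `a` are `a₀` times the proper partial products, including the empty
one, of the remaining sequence. -/
theorem regFactor_cons {k n : ℕ} (h : 1 + k = n) (a : Fin n → ℝ) :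
    regFactor a = ((Real.sign (a (inl h 0)) : ℝ) : ℂ) ^ k * regFactor (fun i => a (inr h i)) := by
  have he : ∀ i, extOne (fun i => a (inr h i)) i = extOne a (i + 1) := by
    intro i
    simp only [extOne]
    by_cases hi : i < k
    · rw [dif_pos hi, dif_pos (by omega)]
      congr 1
      apply Fin.ext
      simp [add_comm]
    · rw [dif_neg hi, dif_neg (by omega)]
  have h0 : extOne a 0 = a (inl h 0) := by
    rw [extOne, dif_pos (by omega)]
    rfl
  rw [regFactor_eq, regFactor_eq, ← Complex.ofReal_pow, ← Complex.ofReal_mul]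
  congr 1
  subst h
  rcases k with _ | k
  · simp
  · have hp : ∀ j, ∏ i ∈ Finset.range (j + 1), extOne a i =
        (∏ i ∈ Finset.range j, extOne a (i + 1)) * a (inl rfl 0) := fun j => by
      rw [Finset.prod_range_succ', h0]
    simp only [hp, he, sign_mul, Finset.prod_mul_distrib, Finset.prod_const, Finset.card_range]
    rw [show 1 + (k + 1) - 1 = k + 1 by omega, show k + 1 - 1 = k by omega,
      Finset.prod_range_succ']
    simp only [Finset.range_zero, Finset.prod_empty, Real.sign_one, mul_one]
    rw [mul_comm]

end RegFactor

/-- Two Schwartz functions whose regular integrals differ by the regular transfer factor, up to a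
constant `κ`. -/
def Matching {n : ℕ} (ψ : AddChar ℝ Circle) (κ : ℂ) (Φ : 𝓢(Herm n (ℝ × ℝ), ℂ))
    (Ψ : 𝓢(Herm n ℂ, ℂ)) : Prop :=
  ∀ (a : Fin n → ℝ) (ha : ∀ i, a i ≠ 0),
    (Monomial.diag a ha).J ψ Φ = κ * regFactor a * (Monomial.diag a ha).J ψ Ψ

/-- Splitting off the last diagonal entry preserves matching. The cut-off fixes the sign of the
determinant of the first block, so that the additional sign in the regular transfer factor is
constant. -/
theorem Matching.snoc {k n : ℕ} (h : k + 1 = n) {ψ : AddChar ℝ Circle} (hψ : Continuous ψ) {κ : ℂ}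
    {Φ : 𝓢(Herm n (ℝ × ℝ), ℂ)} {Ψ : 𝓢(Herm n ℂ, ℂ)} (hm : Matching ψ κ Φ Ψ) {δ : ℝ} (hδ : δ ≠ 0)
    {t : ℝ} (ht : t ≠ 0) : Matching ψ (κ * (Real.sign δ : ℝ))
      (sliceR (crossS h ψ Φ hδ) ((Monomial.diag (fun _ : Fin 1 => t) fun _ => ht).herm _))
      (sliceR (crossS h ψ Ψ hδ) ((Monomial.diag (fun _ : Fin 1 => t) fun _ => ht).herm _)) := by
  intro a ha
  let a' : Fin n → ℝ := fun i => Sum.elim a (fun _ => t) ((sumEquiv h).symm i)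
  have ha' : ∀ i, a' i ≠ 0 := by
    intro i
    refine inl_inr_cases h i (fun j => ?_) (fun j => ?_)
    · simpa [a'] using ha j
    · simpa [a'] using ht
  have hl : (fun i => a' (inl h i)) = a := by funext i; simp [a']
  have hcat : Monomial.diag a' ha' = Monomial.cat (Monomial.diag a ha)
      (Monomial.diag (fun _ : Fin 1 => t) fun _ => ht) h ha := by
    rw [Monomial.diag_eq_cat h a' ha']
    refine Monomial.ext_of_eq ?_ ?_ <;> funext i <;>
      refine inl_inr_cases h i (fun j => ?_) (fun j => ?_) <;> simp [Monomial.diag, a']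
  have h1 := Monomial.J_cat_snoc (Monomial.diag a ha) (Monomial.diag (fun _ : Fin 1 => t)
    fun _ => ht) h ha hψ Φ hδ
  have h2 := Monomial.J_cat_snoc (Monomial.diag a ha) (Monomial.diag (fun _ : Fin 1 => t)
    fun _ => ht) h ha hψ Ψ hδ
  have h3 := hm a' ha'
  rw [regFactor_snoc h, hl, hcat] at h3
  rw [Monomial.hdet_diag] at h1 h2
  have hc : ((Monomial.diag a ha).catJac 1 : ℂ) ≠ 0 := by
    exact_mod_cast (Monomial.catJac_pos _ ha 1).ne'
  have hb : (bumpAt hδ (∏ i, a i) : ℂ) * (Real.sign (∏ i, a i) : ℝ) =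
      bumpAt hδ (∏ i, a i) * (Real.sign δ : ℝ) := by
    by_cases hb : bumpAt hδ (∏ i, a i) = 0
    · simp [hb]
    · rw [sign_eq_of_bumpAt_ne_zero hδ hb]
  apply mul_left_cancel₀ hc
  rw [← h1, h3, mul_left_comm _ (κ * _ * _), ← h2]
  linear_combination κ * regFactor a * (Monomial.cat (Monomial.diag a ha)
      (Monomial.diag (fun _ : Fin 1 => t) fun _ => ht) h ha).J ψ Ψ * hb

/-! ### Fourier inversion in coordinates -/

section FourierPi

variable {ι : Type} [Fintype ι]

/-- The Fourier transform on `ι → ℝ`. -/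
def fourierPi (f : 𝓢(ι → ℝ, ℂ)) : 𝓢(ι → ℝ, ℂ) :=
  SchwartzMap.compCLMOfContinuousLinearEquiv ℂ (EuclideanSpace.equiv ι ℝ).symm
    (FourierTransform.fourier
      (SchwartzMap.compCLMOfContinuousLinearEquiv ℂ (EuclideanSpace.equiv ι ℝ) f))

theorem fourierPi_apply (f : 𝓢(ι → ℝ, ℂ)) (w : ι → ℝ) : fourierPi f w =
    ∫ v, f v * Complex.exp (-(2 * Real.pi * Complex.I * (∑ i, v i * w i : ℝ))) := by
  change FourierTransform.fourier (fun x : EuclideanSpace ℝ ι => f (EuclideanSpace.equiv ι ℝ x))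
    ((EuclideanSpace.equiv ι ℝ).symm w) = _
  rw [Real.fourier_eq', ← (PiLp.volume_preserving_toLp ι).integral_comp
    (MeasurableEquiv.toLp 2 (ι → ℝ)).measurableEmbedding]
  refine integral_congr_ae (Filter.Eventually.of_forall fun v => ?_)
  simp only [smul_eq_mul]
  rw [mul_comm]
  congr 2
  simp only [PiLp.inner_apply, EuclideanSpace.equiv, RCLike.inner_apply, conj_trivial]
  push_cast
  simp [mul_comm]
  ring

theorem integral_fourierPi_mul (f : 𝓢(ι → ℝ, ℂ)) (v : ι → ℝ) :
    ∫ w, fourierPi f w * Complex.exp (2 * Real.pi * Complex.I * (∑ i, v i * w i : ℝ)) = f v := by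
  set g := SchwartzMap.compCLMOfContinuousLinearEquiv ℂ (EuclideanSpace.equiv ι ℝ) f with hg
  have h : FourierTransformInv.fourierInv (FourierTransform.fourier g)
      ((EuclideanSpace.equiv ι ℝ).symm v) = g ((EuclideanSpace.equiv ι ℝ).symm v) := by
    rw [FourierTransform.fourierInv_fourier_eq]
  have h2 : g ((EuclideanSpace.equiv ι ℝ).symm v) = f v := by
    rw [hg]
    exact congrArg f ((EuclideanSpace.equiv ι ℝ).apply_symm_apply v)
  rw [← h2, ← h, SchwartzMap.fourierInv_coe, Real.fourierInv_eq',
    ← (PiLp.volume_preserving_toLp ι).integral_comp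
    (MeasurableEquiv.toLp 2 (ι → ℝ)).measurableEmbedding]
  refine integral_congr_ae (Filter.Eventually.of_forall fun w => ?_)
  simp only [smul_eq_mul]
  have h3 : FourierTransform.fourier g (WithLp.toLp 2 w) = fourierPi f w := rfl
  rw [mul_comm, h3]
  congr 2
  simp only [PiLp.inner_apply, EuclideanSpace.equiv, RCLike.inner_apply, conj_trivial]
  push_cast
  simp [mul_comm]
  ring

end FourierPi

theorem exists_freq {ψ : AddChar ℝ Circle} (hψ : Continuous ψ) (hψ1 : ψ ≠ 1) :
    ∃ t : ℝ, t ≠ 0 ∧ ∀ x, (ψ x : ℂ) = Complex.exp (2 * Real.pi * Complex.I * (t * x : ℝ)) := by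
  obtain ⟨t, ht⟩ := exists_eq_exp_of_continuous ψ hψ
  refine ⟨t, ?_, ht⟩
  rintro rfl
  apply hψ1
  ext x
  simp [ht x]

section PartialInversion

variable {A A' B : Type} [Fintype A] [Fintype A'] [Fintype B]

/-- Reindexing and rescaling of coordinates. -/
def scaleEquiv (τ : A ≃ A') (c : A → ℝ) (hc : ∀ a, c a ≠ 0) : (A' → ℝ) ≃ₗ[ℝ] (A → ℝ) where
  toFun ξ a := c a * ξ (τ a)
  map_add' ξ ξ' := by funext a; simp [mul_add]
  map_smul' r ξ := by funext a; simp [mul_left_comm]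
  invFun w a' := (c (τ.symm a'))⁻¹ * w (τ.symm a')
  left_inv ξ := by funext a; simp [hc]
  right_inv w := by funext a; simp [hc]

theorem integral_scaleEquiv (τ : A ≃ A') (c : A → ℝ) (hc : ∀ a, c a ≠ 0) (f : (A → ℝ) → ℂ) :
    ∫ ξ, f (scaleEquiv τ c hc ξ) = ((∏ a, |c a|)⁻¹ : ℝ) * ∫ w, f w := by
  have h1 : ∫ ξ : A' → ℝ, f (scaleEquiv τ c hc ξ) = ∫ w : A → ℝ, f (fun a => c a * w a) := by
    have := (volume_measurePreserving_piCongrLeft (fun _ : A' => ℝ) τ).integral_comp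
      (MeasurableEquiv.measurableEmbedding _) fun ξ => f (scaleEquiv τ c hc ξ)
    rw [← this]
    refine integral_congr_ae (Filter.Eventually.of_forall fun w => ?_)
    refine congrArg f (funext fun a => ?_)
    change c a * _ = _
    rw [MeasurableEquiv.piCongrLeft_apply_apply (β := fun _ => ℝ) τ w a]
  rw [h1]
  obtain ⟨hb, hm⟩ := IsTriangular.map_volume_of_scaled (ht := fun _ : A => 0)
    (F := fun w a => c a * w a) hc (fun _ _ _ _ => by simp) (by fun_prop)
  have hemb : MeasurableEmbedding fun (w : A → ℝ) a => c a * w a :=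
    (LinearMap.continuous_of_finiteDimensional
      ((scaleEquiv (Equiv.refl A) c hc).toLinearMap)).measurableEmbedding hb.1
  rw [← hemb.integral_map, hm, integral_smul_measure, ENNReal.toReal_ofReal (by positivity)]
  rw [Complex.real_smul]

theorem integrable_schwartz_prod (f : 𝓢((A → ℝ) × (B → ℝ), ℂ)) : Integrable f := by
  have : (volume : Measure ((A → ℝ) × (B → ℝ))).IsAddHaarMeasure := by
    exact Measure.prod.instIsAddHaarMeasure _ _
  exact f.integrable

/-- Fourier inversion in some of the variables. -/
theorem exists_integral_partial_fourier {ψ : AddChar ℝ Circle} (hψ : Continuous ψ) (hψ1 : ψ ≠ 1) :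
    ∃ t : ℝ, 0 < t ∧ ∀ (A A' B : Type) [Fintype A] [Fintype A'] [Fintype B] (τ : A ≃ A') (c : A → ℝ),
      (∀ a, |c a| = 1) → ∀ (f : 𝓢((A → ℝ) × (B → ℝ), ℂ)) (x : A → ℝ),
      ∫ ξ : A' → ℝ, (∫ p : (A → ℝ) × (B → ℝ), f p * (ψ (-∑ a, c a * p.1 a * ξ (τ a)) : ℂ)) *
        (ψ (∑ a, c a * x a * ξ (τ a)) : ℂ) = ((t ^ Fintype.card A)⁻¹ : ℝ) * ∫ y, f (x, y) := by
  obtain ⟨t, ht, hψt⟩ := exists_freq hψ hψ1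
  refine ⟨|t|, abs_pos.2 ht, ?_⟩
  intro A A' B _ _ _ τ c hc f x
  have hc0 : ∀ a, t * c a ≠ 0 := fun a => mul_ne_zero ht fun h => by simpa [h] using hc a
  have h1 : ∀ ξ : A' → ℝ, ∫ p : (A → ℝ) × (B → ℝ), f p * (ψ (-∑ a, c a * p.1 a * ξ (τ a)) : ℂ) =
      fourierPi (partialIntegral volume f) (scaleEquiv τ (fun a => t * c a) hc0 ξ) := by
    intro ξ
    have hi : Integrable (fun p : (A → ℝ) × (B → ℝ) =>
        f p * (ψ (-∑ a, c a * p.1 a * ξ (τ a)) : ℂ)) :=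
      (integrable_schwartz_prod f).mul_bdd (c := 1) (Continuous.aestronglyMeasurable
        ((hasTemperateGrowth_addChar hψ).1.continuous.comp (by fun_prop)))
        (Filter.Eventually.of_forall fun _ => (Circle.norm_coe _).le)
    rw [Measure.volume_eq_prod] at hi ⊢
    rw [integral_prod _ hi, fourierPi_apply]
    refine integral_congr_ae (Filter.Eventually.of_forall fun v => ?_)
    simp only [partialIntegral_apply]
    rw [← integral_mul_const]
    refine integral_congr_ae (Filter.Eventually.of_forall fun y => ?_)
    simp only [hψt, scaleEquiv, LinearEquiv.coe_mk, LinearMap.coe_mk, AddHom.coe_mk]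
    congr 2
    push_cast
    rw [mul_neg, mul_neg, Finset.mul_sum]
    congr 2
    refine Finset.sum_congr rfl fun a _ => ?_
    ring
  have h2 : ∀ ξ : A' → ℝ, (ψ (∑ a, c a * x a * ξ (τ a)) : ℂ) = Complex.exp (2 * Real.pi * Complex.I *
      (∑ a, x a * scaleEquiv τ (fun a => t * c a) hc0 ξ a : ℝ)) := by
    intro ξ
    rw [hψt]
    congr 3
    simp only [scaleEquiv, LinearEquiv.coe_mk, LinearMap.coe_mk, AddHom.coe_mk, Finset.mul_sum]
    refine Finset.sum_congr rfl fun a _ => ?_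
    ring
  simp only [h1, h2]
  rw [integral_scaleEquiv τ _ hc0 (fun w => fourierPi (partialIntegral volume f) w *
    Complex.exp (2 * Real.pi * Complex.I * (∑ a, x a * w a : ℝ))), integral_fourierPi_mul]
  simp [abs_mul, hc, partialIntegral_apply]

end PartialInversion

section Reindex

variable {A B ι : Type} [Fintype A] [Fintype B] [Fintype ι]

/-- Functions on a disjoint union as pairs of functions. -/
def piSum (e : A ⊕ B ≃ ι) : (A → ℝ) × (B → ℝ) ≃ᵐ (ι → ℝ) :=
  (MeasurableEquiv.sumPiEquivProdPi fun _ => ℝ).symm.trans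
    (MeasurableEquiv.piCongrLeft (fun _ => ℝ) e)

theorem measurePreserving_piSum (e : A ⊕ B ≃ ι) : MeasurePreserving (piSum e) :=
  (volume_measurePreserving_piCongrLeft (fun _ => ℝ) e).comp
    (volume_measurePreserving_sumPiEquivProdPi_symm fun _ => ℝ)

theorem piSum_apply (e : A ⊕ B ≃ ι) (p : (A → ℝ) × (B → ℝ)) :
    piSum e p = fun i => Sum.elim p.1 p.2 (e.symm i) := by
  funext i
  obtain ⟨s, rfl⟩ := e.surjective i
  rw [e.symm_apply_apply]
  have := MeasurableEquiv.piCongrLeft_apply_apply (β := fun _ => ℝ) e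
    (fun s => Sum.elim p.1 p.2 s) s
  refine Eq.trans ?_ this
  have h2 : (fun s => Sum.elim p.1 p.2 s) = (MeasurableEquiv.sumPiEquivProdPi fun _ => ℝ).symm p := by
    funext s
    rcases s with s | s <;> rfl
  rw [h2]
  rfl

theorem integral_piSum (e : A ⊕ B ≃ ι) (f : (ι → ℝ) → ℂ) :
    ∫ p, f (piSum e p) = ∫ v, f v :=
  (measurePreserving_piSum e).integral_comp (MeasurableEquiv.measurableEmbedding _) f

end Reindex

/-! ### The Fourier transform on hermitian matrices -/

section Pair

variable {m r n : ℕ} {D : Type} [NormedCommRing D] [NormedAlgebra ℝ D] [QuadAlg D] [QuadBasis D]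

/-- The pairing `½ Tr ∑ x_{ij} ξ_{n-1-j,n-1-i}`, for which the conjugate group acts dually. -/
def pair (x ξ : Herm n D) : ℝ := (∑ i, ∑ j, tr (x.1 i j * ξ.1 j.rev i.rev)) / 2

/-- Reflection of positions in the antidiagonal. -/
def flip : Fin n × Fin n ≃ Fin n × Fin n where
  toFun p := (p.2.rev, p.1.rev)
  invFun p := (p.2.rev, p.1.rev)
  left_inv p := by simp
  right_inv p := by simp

theorem flip_flip (p : Fin n × Fin n) : flip (flip p) = p := flip.left_inv p

variable (D) in
/-- The coefficients of the pairing in coordinates. -/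
def pairCoeff (p : Fin n × Fin n) : ℝ := if p.1 ≤ p.2 then 1 else eps D

theorem abs_eps : |eps D| = 1 := by
  have h := QuadBasis.ε_sq (D := D)
  have h2 : |eps D| * |eps D| = 1 := by rw [← abs_mul, h, abs_one]
  nlinarith [abs_nonneg (eps D)]

theorem abs_pairCoeff (p : Fin n × Fin n) : |pairCoeff D p| = 1 := by
  unfold pairCoeff
  split_ifs
  · simp
  · exact abs_eps

theorem pairCoeff_flip (p : Fin n × Fin n) : pairCoeff D (flip p) = pairCoeff D p := by
  simp [pairCoeff, flip]

theorem pair_hm (v w : Fin n × Fin n → ℝ) :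
    pair (hm v : Herm n D) (hm w) = ∑ p, pairCoeff D p * v p * w (flip p) := by
  let F : Fin n → Fin n → ℝ := fun i j =>
    tr ((hm v : Herm n D).1 i j * (hm w : Herm n D).1 j.rev i.rev)
  let G : Fin n → Fin n → ℝ := fun i j => pairCoeff D (i, j) * v (i, j) * w (flip (i, j))
  have hlt : ∀ i j, i < j → F i j = G i j + G j i := by
    intro i j hij
    have h2 : j.rev < i.rev := Fin.rev_lt_rev.2 hij
    simp only [F, G, hm_apply_lt _ hij, hm_apply_lt _ h2, tr_mkD_mul, pairCoeff, flip,
      Equiv.coe_fn_mk, hij.le, not_le_of_gt hij, if_true, if_false]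
    ring
  have hsymm : ∀ i j, F i j = F j i := by
    intro i j
    simp only [F]
    rw [← tr_conj, map_mul, herm_apply, herm_apply]
  have hFG : ∀ i j, F i j + F j i = 2 * (G i j + G j i) := by
    intro i j
    rcases lt_trichotomy i j with h | rfl | h
    · rw [← hsymm i j, hlt i j h]; ring
    · have : F i i = 2 * G i i := by
        simp only [F, G, hm_apply_self, ← map_mul, tr_algebraMap, pairCoeff, flip, Equiv.coe_fn_mk,
          le_refl, if_true]
        ring
      rw [this]; ring
    · rw [hsymm i j, hlt j i h]; ring
  have h1 : ∑ i, ∑ j, F i j + ∑ i, ∑ j, F j i = 2 * (∑ i, ∑ j, G i j + ∑ i, ∑ j, G j i) := by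
    simp only [← Finset.sum_add_distrib, hFG, Finset.mul_sum]
  rw [Finset.sum_comm (f := fun i j => F j i), Finset.sum_comm (f := fun i j => G j i)] at h1
  rw [pair, Fintype.sum_prod_type]
  change (∑ i, ∑ j, F i j) / 2 = ∑ i, ∑ j, G i j
  linarith

theorem pair_comm (x ξ : Herm n D) : pair x ξ = pair ξ x := by
  obtain ⟨v, rfl⟩ := hm.surjective x
  obtain ⟨w, rfl⟩ := hm.surjective ξ
  rw [pair_hm, pair_hm, ← Equiv.sum_comp flip]
  refine Finset.sum_congr rfl fun p _ => ?_
  rw [pairCoeff_flip, flip_flip]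
  ring

theorem pair_add_right (x ξ ξ' : Herm n D) : pair x (ξ + ξ') = pair x ξ + pair x ξ' := by
  simp only [pair, Submodule.coe_add, Matrix.add_apply, mul_add, map_add, Finset.sum_add_distrib]
  ring

theorem continuous_pair_hm (ξ : Herm n D) : Continuous fun v => pair (hm v : Herm n D) ξ := by
  obtain ⟨w, rfl⟩ := hm.surjective ξ
  simp only [pair_hm]
  fun_prop

/-- `G` is the Fourier transform of `Φ`. -/
def IsFourier (ψ : AddChar ℝ Circle) (Φ G : 𝓢(Herm n D, ℂ)) : Prop :=
  ∀ ξ, G ξ = ∫ v, Φ (hm v) * (ψ (-pair (hm v) ξ) : ℂ)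

/-- A Schwartz function in coordinates. -/
def compHm (Φ : 𝓢(Herm n D, ℂ)) : 𝓢(Fin n × Fin n → ℝ, ℂ) :=
  compLeftInv (g := (hm (n := n) (D := D))) (h := (hm (n := n) (D := D)).symm)
    (hasTemperateGrowth_linearMap (hm (n := n) (D := D)).toLinearMap)
    (hasTemperateGrowth_linearMap (hm (n := n) (D := D)).symm.toLinearMap)
    (fun v => by simp) Φ

theorem compHm_apply (Φ : 𝓢(Herm n D, ℂ)) (v : Fin n × Fin n → ℝ) : compHm Φ v = Φ (hm v) := rfl

/-- The Fourier transform of a Schwartz function is a Schwartz function: in coordinates it is the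
usual one, with the frequencies reflected in the antidiagonal and rescaled by non-zero constants. -/
theorem exists_isFourier {ψ : AddChar ℝ Circle} (hψ : Continuous ψ) (hψ1 : ψ ≠ 1)
    (Φ : 𝓢(Herm n D, ℂ)) : ∃ G, IsFourier ψ Φ G := by
  obtain ⟨t, ht, hψt⟩ := exists_freq hψ hψ1
  have hc : ∀ p : Fin n × Fin n, t * pairCoeff D p ≠ 0 := fun p =>
    mul_ne_zero ht fun h => by simpa [h] using abs_pairCoeff (D := D) p
  let L : Herm n D ≃ₗ[ℝ] (Fin n × Fin n → ℝ) := (hm (n := n) (D := D)).symm.trans (scaleEquiv flip _ hc)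
  refine ⟨compLeftInv (g := L) (h := L.symm) (hasTemperateGrowth_linearMap L.toLinearMap)
    (hasTemperateGrowth_linearMap L.symm.toLinearMap) (fun v => by simp) (fourierPi (compHm Φ)),
    fun ξ => ?_⟩
  obtain ⟨w, rfl⟩ := hm.surjective ξ
  rw [compLeftInv_apply, fourierPi_apply]
  refine integral_congr_ae (Filter.Eventually.of_forall fun v => ?_)
  simp only [compHm_apply, hψt, pair_hm, L, LinearEquiv.trans_apply, LinearEquiv.symm_apply_apply,
    scaleEquiv, LinearEquiv.coe_mk, LinearMap.coe_mk, AddHom.coe_mk]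
  have hs : t * -(∑ p, pairCoeff D p * v p * w (flip p)) =
      -∑ p, v p * (t * pairCoeff D p * w (flip p)) := by
    rw [mul_neg, Finset.mul_sum]
    congr 1
    exact Finset.sum_congr rfl fun a _ => by ring
  rw [hs, Complex.ofReal_neg, mul_neg]

end Pair

/-! ### Multiples of antidiagonal matrices -/

section Anti

variable {n : ℕ}

/-- The index of the last row, if it lies outside the antidiagonal block of size `s`. -/
abbrev Last (n s : ℕ) : Type := {i : Fin n // (i : ℕ) = s}

/-- Positions strictly above the antidiagonal number `s`. -/
abbrev Low (n s : ℕ) : Type := {p : Fin n × Fin n // (p.1 : ℕ) + p.2 < s}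

/-- Positions on or below the antidiagonal number `s`. -/
abbrev High (n s : ℕ) : Type := {p : Fin n × Fin n // ¬ (p.1 : ℕ) + p.2 < s}

/-- The positions as a disjoint union. -/
def lowHigh (n s : ℕ) : Low n s ⊕ High n s ≃ Fin n × Fin n := Equiv.sumCompl _

namespace Monomial

/-- The datum of `a w_s` for `n = s`, and of the block diagonal matrix with blocks `a w_s` and `d`
for `n = s + 1`. -/
def anti (n s : ℕ) (a : ℝ) (d : Last n s → ℝ) (h1 : s ≤ n) (h2 : n ≤ s + 1) (ha : a ≠ 0 ∨ n ≤ 1) :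
    Monomial n where
  σ i := if h : (i : ℕ) < s then ⟨s - 1 - i, by omega⟩ else i
  α i := if h : (i : ℕ) < s then a else d ⟨i, by omega⟩
  invol i := by
    apply Fin.ext
    by_cases h : (i : ℕ) < s
    · have h' : s - 1 - (i : ℕ) < s := by omega
      simp only [h, h', dif_pos]
      omega
    · simp [h]
  α_σ i := by
    by_cases h : (i : ℕ) < s
    · have h' : s - 1 - (i : ℕ) < s := by omega
      simp [h, h']
    · simp [h]
  order i j hij := by
    rw [Fin.lt_def] at hij
    have hi : (i : ℕ) < s := by omega
    have ha' : a ≠ 0 := ha.resolve_right (by omega)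
    by_cases hj : (j : ℕ) < s
    · right
      simp only [hi, hj, dif_pos, Fin.mk_lt_mk]
      refine ⟨by omega, by omega, trivial, ha'⟩
    · left
      simp only [hi, hj, dif_pos, dif_neg, not_false_iff, Fin.lt_def]
      exact ⟨by omega, by omega, ha'⟩

variable {s : ℕ} {a : ℝ} {d : Last n s → ℝ} (h1 : s ≤ n) (h2 : n ≤ s + 1) (ha : a ≠ 0 ∨ n ≤ 1)

theorem anti_σ_of_lt {i : Fin n} (h : (i : ℕ) < s) :
    ((anti n s a d h1 h2 ha).σ i : ℕ) = s - 1 - i := by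
  simp [anti, h]

theorem anti_σ_of_eq {i : Fin n} (h : (i : ℕ) = s) : (anti n s a d h1 h2 ha).σ i = i := by
  simp [anti, h]

theorem anti_α_of_lt {i : Fin n} (h : (i : ℕ) < s) : (anti n s a d h1 h2 ha).α i = a := by
  simp [anti, h]

theorem anti_α_last (i : Last n s) : (anti n s a d h1 h2 ha).α i.1 = d i := by
  have : ¬ (i.1 : ℕ) < s := by have := i.2; omega
  simp [anti, this]

/-- The positions of the leading coordinates, and the last diagonal position. -/
def antiIndex : (anti n s a d h1 h2 ha).K ⊕ Last n s → High n s
  | Sum.inl q => ⟨(anti n s a d h1 h2 ha).pos q, by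
      obtain ⟨⟨⟨⟨i, j⟩, hij⟩, e⟩, hK⟩ := q
      have hij' : (i : ℕ) < j := hij
      have hi : (i : ℕ) < s := by omega
      simp only [InK] at hK
      have hσi := anti_σ_of_lt (d := d) h1 h2 ha hi
      simp only [pos]
      rcases lt_or_ge (j : ℕ) s with hj | hj
      · have hσj := anti_σ_of_lt (d := d) h1 h2 ha hj
        rw [Fin.lt_def, Fin.lt_def, Fin.ext_iff] at hK
        split_ifs with he
        · simp only; omega
        · simp only [he, and_false, or_false] at hK
          simp only; omega
      · split_ifs <;> simp only <;> omega⟩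
  | Sum.inr i => ⟨(i, i), by have := i.2; simp only; omega⟩

/-- The leading coordinates of the orbit of `a w_s ⊕ d`, together with `d`, are exactly the
coordinates on and below the antidiagonal number `s`. -/
theorem antiIndex_bijective : Function.Bijective (antiIndex (d := d) h1 h2 ha) := by
  constructor
  · rintro (q | i) (q' | i') h
    · obtain ⟨⟨⟨⟨i, j⟩, hij⟩, e⟩, hK⟩ := q
      obtain ⟨⟨⟨⟨i', j'⟩, hij'⟩, e'⟩, hK'⟩ := q'
      have hij1 : (i : ℕ) < j := hij
      have hij1' : (i' : ℕ) < j' := hij'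
      have hi : (i : ℕ) < s := by omega
      have hi' : (i' : ℕ) < s := by omega
      have hσ : ∀ p : Fin n, (p : ℕ) < s → ((anti n s a d h1 h2 ha).σ p : ℕ) = s - 1 - p :=
        fun p h => anti_σ_of_lt (d := d) h1 h2 ha h
      have hle : ∀ (i j : Fin n) (hij : i < j) (e : Fin 2),
          (anti n s a d h1 h2 ha).InK (⟨(i, j), hij⟩, e) →
          (e = 1 → ((anti n s a d h1 h2 ha).σ i : ℕ) < j) ∧
            (e = 0 → ((anti n s a d h1 h2 ha).σ i : ℕ) ≤ j) := by
        intro i j hij e hK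
        rw [Fin.lt_def] at hij
        have hσi := hσ i (by omega)
        simp only [InK] at hK
        rw [Fin.lt_def, Fin.lt_def, Fin.ext_iff] at hK
        rcases lt_or_ge (j : ℕ) s with hj | hj
        · have hσj := hσ j hj
          constructor <;> rintro rfl <;> simp at hK <;> omega
        · constructor <;> intro <;> omega
      obtain ⟨key, key0⟩ := hle i j hij e hK
      obtain ⟨key', key0'⟩ := hle i' j' hij' e' hK'
      have hinj : ((anti n s a d h1 h2 ha).σ i : ℕ) = (anti n s a d h1 h2 ha).σ i' → i = i' :=
        fun h => (anti n s a d h1 h2 ha).σ_injective (Fin.ext h)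
      have h0 : (anti n s a d h1 h2 ha).pos (⟨(i, j), hij⟩, e) =
          (anti n s a d h1 h2 ha).pos (⟨(i', j'), hij'⟩, e') := congrArg Subtype.val
            (show (antiIndex (d := d) h1 h2 ha _ : High n s) = _ from h)
      have h3 : i = i' ∧ j = j' ∧ e = e' := by
        fin_cases e <;> fin_cases e'
        · simp only [pos, Fin.zero_eta, if_true, Prod.mk.injEq] at h0
          exact ⟨hinj (congrArg _ h0.1), h0.2, rfl⟩
        · simp [pos, Prod.mk.injEq, Fin.ext_iff] at h0 key0 key'
          omega
        · simp [pos, Prod.mk.injEq, Fin.ext_iff] at h0 key key0'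
          omega
        · simp only [pos, Fin.mk_one, one_ne_zero, if_false, Prod.mk.injEq] at h0
          exact ⟨hinj (congrArg _ h0.2), h0.1, rfl⟩
      obtain ⟨rfl, rfl, rfl⟩ := h3
      rfl
    · exfalso
      obtain ⟨⟨⟨⟨i, j⟩, hij⟩, e⟩, hK⟩ := q
      have hij' : (i : ℕ) < j := hij
      have hi : (i : ℕ) < s := by omega
      have hσi := anti_σ_of_lt (d := d) h1 h2 ha hi
      have h0 : (anti n s a d h1 h2 ha).pos (⟨(i, j), hij⟩, e) = (i'.1, i'.1) := congrArg Subtype.val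
        (show (antiIndex (d := d) h1 h2 ha _ : High n s) = _ from h)
      have hi' := i'.2
      simp only [pos] at h0
      split_ifs at h0 <;> simp only [Prod.mk.injEq, Fin.ext_iff] at h0 <;> omega
    · exfalso
      obtain ⟨⟨⟨⟨i', j⟩, hij⟩, e⟩, hK⟩ := q'
      have hij' : (i' : ℕ) < j := hij
      have hi : (i' : ℕ) < s := by omega
      have hσi := anti_σ_of_lt (d := d) h1 h2 ha hi
      have h0 : (i.1, i.1) = (anti n s a d h1 h2 ha).pos (⟨(i', j), hij⟩, e) := congrArg Subtype.val
        (show (antiIndex (d := d) h1 h2 ha _ : High n s) = _ from h)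
      have hi' := i.2
      simp only [pos] at h0
      split_ifs at h0 <;> simp only [Prod.mk.injEq, Fin.ext_iff] at h0 <;> omega
    · have h0 : (i.1, i.1) = (i'.1, i'.1) := congrArg Subtype.val
        (show (antiIndex (d := d) h1 h2 ha _ : High n s) = _ from h)
      rw [Prod.mk.injEq] at h0
      exact congrArg Sum.inr (Subtype.ext h0.1)
  · rintro ⟨⟨p1, p2⟩, hp⟩
    simp only [not_lt] at hp
    have hb1 := p1.2
    have hb2 := p2.2
    have hσ : ∀ p : Fin n, (p : ℕ) < s → ((anti n s a d h1 h2 ha).σ p : ℕ) = s - 1 - p :=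
      fun p h => anti_σ_of_lt (d := d) h1 h2 ha h
    have hσ' : ∀ p : Fin n, ¬ (p : ℕ) < s → (anti n s a d h1 h2 ha).σ p = p :=
      fun p h => anti_σ_of_eq (d := d) h1 h2 ha (by omega)
    rcases le_or_gt (p1 : ℕ) p2 with hle | hlt
    · by_cases hs : (p1 : ℕ) < s
      · have h3 := hσ p1 hs
        have hlt : (anti n s a d h1 h2 ha).σ p1 < p2 := by rw [Fin.lt_def]; omega
        refine ⟨Sum.inl ⟨(⟨((anti n s a d h1 h2 ha).σ p1, p2), hlt⟩, 0), ?_⟩, ?_⟩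
        · simp only [InK, invol]
          by_cases h4 : (p2 : ℕ) < s
          · have h5 := hσ p2 h4
            rw [Fin.lt_def, Fin.lt_def, Fin.ext_iff]
            simp only [and_true]
            omega
          · left; rw [hσ' p2 h4, Fin.lt_def]; omega
        · simp [antiIndex, pos, invol]
      · have : p1 = p2 := Fin.ext (by omega)
        subst this
        exact ⟨Sum.inr ⟨p1, by omega⟩, rfl⟩
    · have hs : (p2 : ℕ) < s := by omega
      have h3 := hσ p2 hs
      have hlt : (anti n s a d h1 h2 ha).σ p2 < p1 := by rw [Fin.lt_def]; omega
      refine ⟨Sum.inl ⟨(⟨((anti n s a d h1 h2 ha).σ p2, p1), hlt⟩, 1), ?_⟩, ?_⟩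
      · simp only [InK, invol]
        by_cases h4 : (p1 : ℕ) < s
        · have h5 := hσ p1 h4
          rw [Fin.lt_def, Fin.lt_def, Fin.ext_iff]
          omega
        · left; rw [hσ' p1 h4, Fin.lt_def]; omega
      · simp [antiIndex, pos, invol]

end Monomial

end Anti

section AntiOrbit

variable {n s : ℕ} {a : ℝ} {D : Type} [NormedCommRing D] [NormedAlgebra ℝ D] [QuadAlg D]
  [QuadBasis D]

/-- The entry above the diagonal in a given column. -/
def superdiag (u : Matrix (Fin n) (Fin n) D) (j : Fin n) : D :=
  if h : 0 < (j : ℕ) then u ⟨j - 1, by omega⟩ j else 0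

theorem chiM_eq_superdiag (ψ : AddChar ℝ Circle) (u : Matrix (Fin n) (Fin n) D) :
    chiM ψ u = (ψ (∑ j, tr (superdiag u j)) : ℂ) := by
  rw [chiM, Finset.sum_comm]
  refine congrArg (fun x => ((ψ x : Circle) : ℂ)) (Finset.sum_congr rfl fun j _ => ?_)
  by_cases h : 0 < (j : ℕ)
  · rw [superdiag, dif_pos h, Finset.sum_eq_single ⟨j - 1, by omega⟩]
    · rw [if_pos (by simp only; omega)]
    · intro i _ hi
      rw [if_neg]
      intro h2
      exact hi (Fin.ext (by simp only; omega))
    · simp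
  · rw [superdiag, dif_neg h, map_zero]
    exact Finset.sum_eq_zero fun i _ => if_neg (by omega)

/-- Half of the trace of the sum of the entries on the antidiagonal number `s`. -/
def antiTrace (s : ℕ) (x : Herm n D) : ℝ :=
  (∑ i : Fin n, ∑ j : Fin n, if (i : ℕ) + j = s then tr (x.1 i j) else 0) / 2

namespace Monomial

variable (d : Last n s → ℝ) (h1 : s ≤ n) (h2 : n ≤ s + 1) (ha : a ≠ 0 ∨ n ≤ 1)

/-- The entries above the antidiagonal number `s` are constant on the orbit. -/
theorem anti_actM_of_lt {u : Matrix (Fin n) (Fin n) D} (hu : IsUpperUnip u) {i j : Fin n}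
    (h : (i : ℕ) + j < s) : (actM ((anti n s a d h1 h2 ha).herm D) u).1 i j =
      ((anti n s a d h1 h2 ha).herm D).1 i j := by
  have hσ : ∀ k : Fin n, (k : ℕ) < s → ((anti n s a d h1 h2 ha).σ k : ℕ) = s - 1 - k :=
    fun k hk => anti_σ_of_lt h1 h2 ha hk
  change (star' u * ((anti n s a d h1 h2 ha).herm D).1 * u) i j = _
  rw [star'_mul_herm_mul_apply, Finset.sum_eq_single i, herm_apply, hu.2, map_one, one_mul]
  · have hi := hσ i (by omega)
    split_ifs with h3
    · rw [h3, hu.2, Algebra.algebraMap_eq_smul_one]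
    · rw [hu.1 _ _ (by rw [Fin.lt_def]; rw [Fin.ext_iff] at h3; omega), smul_zero]
  · intro k _ hk
    rw [Ne, Fin.ext_iff] at hk
    rcases lt_or_ge (i : ℕ) k with h3 | h3
    · rw [hu.1 k i h3, map_zero, zero_mul, smul_zero]
    · have h4 := hσ k (by omega)
      rw [hu.1 _ j (by rw [Fin.lt_def]; omega), mul_zero, smul_zero]
  · simp

/-- The entries on the antidiagonal number `s` are the superdiagonal entries of `u`, symmetrized. So
the character is a function of the point of the orbit. -/
theorem anti_actM_of_eq {u : Matrix (Fin n) (Fin n) D} (hu : IsUpperUnip u) (hs : 1 ≤ s)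
    {i j : Fin n} (h : (i : ℕ) + j = s) : (actM ((anti n s a d h1 h2 ha).herm D) u).1 i j =
      a • (superdiag u j + QuadAlg.conj (superdiag u i)) := by
  have hσ : ∀ k : Fin n, (k : ℕ) < s → ((anti n s a d h1 h2 ha).σ k : ℕ) = s - 1 - k :=
    fun k hk => anti_σ_of_lt h1 h2 ha hk
  have hα : ∀ k : Fin n, (k : ℕ) < s → (anti n s a d h1 h2 ha).α k = a :=
    fun k hk => anti_α_of_lt h1 h2 ha hk
  change (star' u * ((anti n s a d h1 h2 ha).herm D).1 * u) i j = _
  rw [star'_mul_herm_mul_apply]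
  have key : ∀ k : Fin n, (anti n s a d h1 h2 ha).α k •
      (QuadAlg.conj (u k i) * u ((anti n s a d h1 h2 ha).σ k) j) =
      (if k = i then a • superdiag u j else 0) +
        if (k : ℕ) + 1 = i then a • QuadAlg.conj (superdiag u i) else 0 := by
    intro k
    rcases lt_trichotomy (k : ℕ) i with h3 | h3 | h3
    · have h4 := hσ k (by omega)
      have h5 : k ≠ i := fun h => by rw [h] at h3; omega
      rw [if_neg h5, zero_add, hα k (by omega)]
      split_ifs with h6
      · have h7 : (anti n s a d h1 h2 ha).σ k = j := Fin.ext (by omega)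
        have h8 : k = ⟨i - 1, by omega⟩ := Fin.ext (by simp only; omega)
        rw [h7, hu.2, mul_one, superdiag, dif_pos (by omega), ← h8]
      · rw [hu.1 _ j (by rw [Fin.lt_def]; omega), mul_zero, smul_zero]
    · have h5 : k = i := Fin.ext h3
      subst h5
      rw [if_pos rfl, if_neg (by omega), add_zero, hu.2, map_one, one_mul]
      rcases lt_or_ge (k : ℕ) s with h6 | h6
      · have h4 := hσ k h6
        have h8 : (anti n s a d h1 h2 ha).σ k = ⟨j - 1, by omega⟩ :=
          Fin.ext (by simp only; omega)
        rw [hα k h6, superdiag, dif_pos (by omega), h8]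
      · have h7 : (anti n s a d h1 h2 ha).σ k = k := anti_σ_of_eq h1 h2 ha (by omega)
        rw [h7, superdiag, dif_neg (by omega), hu.1 k j (by rw [Fin.lt_def]; omega), smul_zero,
          smul_zero]
    · rw [hu.1 k i h3, map_zero, zero_mul, smul_zero, if_neg (by rintro rfl; omega),
        if_neg (by omega), add_zero]
  simp only [key, Finset.sum_add_distrib, Finset.sum_ite_eq', Finset.mem_univ, if_true, smul_add]
  congr 1
  by_cases h3 : 0 < (i : ℕ)
  · rw [Finset.sum_eq_single ⟨i - 1, by omega⟩]
    · rw [if_pos (by simp only; omega)]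
    · intro k _ hk
      rw [if_neg]
      intro h4
      exact hk (Fin.ext (by simp only; omega))
    · simp
  · rw [superdiag, dif_neg h3]
    simp

theorem antiTrace_anti_actM {u : Matrix (Fin n) (Fin n) D} (hu : IsUpperUnip u) (hs : 1 ≤ s) :
    antiTrace s (actM ((anti n s a d h1 h2 ha).herm D) u) = a * ∑ j, tr (superdiag u j) := by
  have hz : ∀ j : Fin n, (j : ℕ) = 0 → superdiag u j = 0 := fun j hj => by
    rw [superdiag, dif_neg (by omega)]
  have key : ∀ i j : Fin n, (if (i : ℕ) + j = s then
      tr ((actM ((anti n s a d h1 h2 ha).herm D) u).1 i j) else 0) =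
      a * (if (i : ℕ) + j = s then tr (superdiag u j) else 0) +
        a * if (j : ℕ) + i = s then tr (superdiag u i) else 0 := by
    intro i j
    rw [add_comm (j : ℕ)]
    split_ifs with h
    · rw [anti_actM_of_eq d h1 h2 ha hu hs h, map_smul, map_add, tr_conj, smul_eq_mul, mul_add]
    · ring
  have hone : ∀ j : Fin n, ∑ i : Fin n, (if (i : ℕ) + j = s then tr (superdiag u j) else 0) =
      tr (superdiag u j) := by
    intro j
    by_cases h0 : (j : ℕ) = 0
    · rw [hz j h0, map_zero]; simp
    · have := j.2
      rw [Finset.sum_eq_single ⟨s - j, by omega⟩]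
      · rw [if_pos (by simp only; omega)]
      · intro i _ hi
        rw [if_neg]
        intro h
        exact hi (Fin.ext (by simp only; omega))
      · simp
  rw [antiTrace]
  simp only [key, Finset.sum_add_distrib, ← Finset.mul_sum, hone]
  rw [Finset.sum_comm]
  simp only [hone]
  ring

theorem chiM_anti (ψ : AddChar ℝ Circle) (ha0 : a ≠ 0) {u : Matrix (Fin n) (Fin n) D}
    (hu : IsUpperUnip u) (hs : 1 ≤ s) : chiM ψ u =
      (ψ (a⁻¹ * antiTrace s (actM ((anti n s a d h1 h2 ha).herm D) u)) : ℂ) := by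
  rw [antiTrace_anti_actM d h1 h2 ha hu hs, chiM_eq_superdiag, inv_mul_cancel_left₀ ha0]

end Monomial

variable (n s a) in
/-- The coordinates of `a w_s` above the antidiagonal number `s`. -/
def antiLow (p : Low n s) : ℝ := if (p.1.1 : ℕ) + p.1.2 + 1 = s then
  (if p.1.1 < p.1.2 then Real.sqrt 2 * a else if p.1.1 = p.1.2 then a else 0) else 0

namespace Monomial

variable (d : Last n s → ℝ) (h1 : s ≤ n) (h2 : n ≤ s + 1) (ha : a ≠ 0 ∨ n ≤ 1)

theorem anti_herm_apply {i j : Fin n} (h : (i : ℕ) + j < s) :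
    ((anti n s a d h1 h2 ha).herm D).1 i j =
      if (i : ℕ) + j + 1 = s then algebraMap ℝ D a else 0 := by
  have hσ : ((anti n s a d h1 h2 ha).σ i : ℕ) = s - 1 - i := anti_σ_of_lt h1 h2 ha (by omega)
  rw [herm_apply, anti_α_of_lt h1 h2 ha (by omega)]
  refine if_congr ?_ rfl rfl
  rw [Fin.ext_iff]
  omega

theorem Z_anti_low (y : (anti n s a d h1 h2 ha).K → ℝ) (p : Low n s) :
    (anti n s a d h1 h2 ha).Z D y p = antiLow n s a p := by
  obtain ⟨⟨i, j⟩, hp⟩ := p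
  simp only at hp
  have hu := (anti n s a d h1 h2 ha).isUpperUnip_U (D := D) y
  have hk : ∀ i j : Fin n, (i : ℕ) + j < s →
      (actM ((anti n s a d h1 h2 ha).herm D) ((anti n s a d h1 h2 ha).U y)).1 i j =
        if (i : ℕ) + j + 1 = s then algebraMap ℝ D a else 0 := fun i j h => by
    rw [anti_actM_of_lt d h1 h2 ha hu h, anti_herm_apply d h1 h2 ha h]
  rw [Z, hm_symm_apply, antiLow]
  simp only
  rcases lt_trichotomy i j with h | rfl | h
  · rw [if_pos h, if_pos h, hk i j hp]
    split_ifs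
    · rw [algebraMap_eq_mkD, cs_mkD]
    · rw [map_zero]
  · rw [if_neg (lt_irrefl _), if_pos rfl, if_neg (lt_irrefl _), if_pos rfl, hk i i hp]
    split_ifs
    · rw [tr_algebraMap]; ring
    · rw [map_zero, zero_div]
  · rw [if_neg (not_lt_of_gt h), if_neg h.ne', if_neg (not_lt_of_gt h), if_neg h.ne',
      hk j i (by omega), ite_self]
    split_ifs
    · rw [algebraMap_eq_mkD, ct_mkD]
    · rw [map_zero]

end Monomial

/-- Coordinates equal to those of `a w_s` above the antidiagonal number `s`. -/
def antiFill (n s : ℕ) (a : ℝ) (v : High n s → ℝ) : Fin n × Fin n → ℝ :=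
  piSum (lowHigh n s) (antiLow n s a, v)

theorem antiFill_low (v : High n s → ℝ) {p : Fin n × Fin n} (h : (p.1 : ℕ) + p.2 < s) :
    antiFill n s a v p = antiLow n s a ⟨p, h⟩ := by
  simp [antiFill, piSum_apply, lowHigh, h]

theorem antiFill_high (v : High n s → ℝ) {p : Fin n × Fin n} (h : ¬ (p.1 : ℕ) + p.2 < s) :
    antiFill n s a v p = v ⟨p, h⟩ := by
  simp [antiFill, piSum_apply, lowHigh, h]

namespace Monomial

variable (d : Last n s → ℝ) (h1 : s ≤ n) (h2 : n ≤ s + 1) (ha : a ≠ 0 ∨ n ≤ 1)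

/-- The last entry `d` of the representative only enters the last diagonal entry, additively. -/
theorem Z_anti (y : (anti n s a 0 h1 h2 ha).K → ℝ) (p : Fin n × Fin n) :
    (anti n s a d h1 h2 ha).Z D y p = (anti n s a 0 h1 h2 ha).Z D y p +
      if h : p.1 = p.2 ∧ (p.1 : ℕ) = s then d ⟨p.1, h.2⟩ else 0 := by
  have hu : IsUpperUnip ((anti n s a 0 h1 h2 ha).U y : Matrix (Fin n) (Fin n) D) :=
    (anti n s a 0 h1 h2 ha).isUpperUnip_U (D := D) y
  have hX : ∀ i j, (actM ((anti n s a d h1 h2 ha).herm D) ((anti n s a 0 h1 h2 ha).U y)).1 i j =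
      (actM ((anti n s a 0 h1 h2 ha).herm D) ((anti n s a 0 h1 h2 ha).U y)).1 i j +
        if h : i = j ∧ (i : ℕ) = s then algebraMap ℝ D (d ⟨i, h.2⟩) else 0 := by
    generalize ((anti n s a 0 h1 h2 ha).U y : Matrix (Fin n) (Fin n) D) = u at hu
    intro i j
    change (star' u * ((anti n s a d h1 h2 ha).herm D).1 * u) i j =
      (star' u * ((anti n s a 0 h1 h2 ha).herm D).1 * u) i j + _
    rw [star'_mul_herm_mul_apply, star'_mul_herm_mul_apply, ← sub_eq_iff_eq_add',
      ← Finset.sum_sub_distrib]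
    have key : ∀ k : Fin n, (k : ℕ) < s → (anti n s a d h1 h2 ha).α k •
        (QuadAlg.conj (u k i) * u ((anti n s a d h1 h2 ha).σ k) j) -
        (anti n s a 0 h1 h2 ha).α k •
        (QuadAlg.conj (u k i) * u ((anti n s a 0 h1 h2 ha).σ k) j) = 0 := by
      intro k hk
      rw [anti_α_of_lt h1 h2 ha hk, anti_α_of_lt h1 h2 ha hk, sub_eq_zero]
      rfl
    split_ifs with h
    · obtain ⟨rfl, h⟩ := h
      rw [Finset.sum_eq_single i]
      · have e1 := anti_α_last (d := d) h1 h2 ha ⟨i, h⟩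
        have e2 := anti_α_last (d := 0) h1 h2 ha ⟨i, h⟩
        have e3 : (anti n s a d h1 h2 ha).σ i = i := anti_σ_of_eq h1 h2 ha h
        simp only at e1 e2
        rw [e1, e2, e3, hu.2, Algebra.algebraMap_eq_smul_one]
        simp
      · intro k _ hk
        refine key k ?_
        have : (k : ℕ) ≠ i := fun h => hk (Fin.ext h)
        have := k.2
        omega
      · simp
    · refine Finset.sum_eq_zero fun k _ => ?_
      rcases lt_or_ge (k : ℕ) s with hk | hk
      · exact key k hk
      · have hk2 := k.2
        have hks : (k : ℕ) = s := by omega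
        have e3 : (anti n s a d h1 h2 ha).σ k = k := anti_σ_of_eq h1 h2 ha hks
        have e4 : (anti n s a 0 h1 h2 ha).σ k = k := anti_σ_of_eq h1 h2 ha hks
        rw [e3, e4]
        have hi := i.2
        have hj := j.2
        rcases lt_or_ge (i : ℕ) s with h3 | h3
        · rw [hu.1 k i (by rw [Fin.lt_def]; omega)]; simp
        · have : (j : ℕ) ≠ s := fun h5 => h ⟨Fin.ext (by omega), by omega⟩
          rw [hu.1 k j (by rw [Fin.lt_def]; omega)]; simp
  obtain ⟨i, j⟩ := p
  change (hm (D := D)).symm (actM ((anti n s a d h1 h2 ha).herm D) ((anti n s a 0 h1 h2 ha).U y))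
    (i, j) = (hm (D := D)).symm (actM ((anti n s a 0 h1 h2 ha).herm D)
      ((anti n s a 0 h1 h2 ha).U y)) (i, j) + _
  rw [hm_symm_apply, hm_symm_apply]
  simp only [hX]
  rcases lt_trichotomy i j with h | rfl | h
  · simp [h, h.ne]
  · by_cases h3 : (i : ℕ) = s
    · simp only [lt_irrefl, if_false, if_true, h3, and_self, dif_pos, map_add, tr_algebraMap]
      ring
    · simp [h3]
  · simp [not_lt_of_gt h, h.ne', h.ne]

/-- The Jacobian of the leading coordinates. -/
def antiJac (n s : ℕ) (a : ℝ) (h1 : s ≤ n) (h2 : n ≤ s + 1) (ha : a ≠ 0 ∨ n ≤ 1) : ℝ :=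
  (∏ q, |(anti n s a 0 h1 h2 ha).coeff q|)⁻¹

theorem antiJac_pos : 0 < antiJac n s a h1 h2 ha :=
  inv_pos.2 (Finset.prod_pos fun q _ => abs_pos.2 (coeff_ne_zero _ q))

variable (D) in
/-- The coordinates on and below the antidiagonal number `s` of a point of an orbit. -/
def antiHigh (p : ((anti n s a 0 h1 h2 ha).K → ℝ) × (Last n s → ℝ)) : High n s → ℝ :=
  fun q => (anti n s a p.2 h1 h2 ha).Z D p.1 q

theorem antiHigh_eq (p : ((anti n s a 0 h1 h2 ha).K → ℝ) × (Last n s → ℝ)) :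
    antiHigh D h1 h2 ha p = piSum (Equiv.ofBijective _ (antiIndex_bijective h1 h2 ha))
      ((anti n s a 0 h1 h2 ha).lead D p.1,
        (fun i : Last n s => (anti n s a 0 h1 h2 ha).Z D p.1 (i.1, i.1)) + p.2) := by
  rw [piSum_apply]
  funext q
  obtain ⟨t, rfl⟩ := (Equiv.ofBijective _ (antiIndex_bijective (d := 0) h1 h2 ha)).surjective q
  rw [Equiv.symm_apply_apply]
  rcases t with q | i
  · simp only [antiHigh, Sum.elim_inl]
    rw [Z_anti, dif_neg]
    · rw [add_zero]; rfl
    · rintro ⟨h3, h4⟩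
      have h5 : antiIndex (d := 0) h1 h2 ha (Sum.inl q) = antiIndex (d := 0) h1 h2 ha
          (Sum.inr ⟨_, h4⟩) := Subtype.ext (Prod.ext rfl h3.symm)
      have := (antiIndex_bijective (d := 0) h1 h2 ha).1 h5
      simp at this
  · simp only [antiHigh, Sum.elim_inr]
    rw [Z_anti]
    have h3 : ((Equiv.ofBijective _ (antiIndex_bijective (d := 0) h1 h2 ha) (Sum.inr i) :
      High n s) : Fin n × Fin n) = (i.1, i.1) := rfl
    rw [h3, dif_pos ⟨rfl, i.2⟩]
    rfl

/-- The orbits of `a w_s ⊕ d` for all `d` together fill the affine space of hermitian matrices with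
the prescribed entries above the antidiagonal number `s`, up to a null set. -/
theorem measurePreserving_antiHigh : MeasurePreserving (antiHigh D h1 h2 ha)
    ((volume : Measure ((anti n s a 0 h1 h2 ha).K → ℝ)).prod (volume : Measure (Last n s → ℝ)))
    (ENNReal.ofReal (antiJac n s a h1 h2 ha) • volume) := by
  have hl : MeasurePreserving ((anti n s a 0 h1 h2 ha).lead D) volume
      (ENNReal.ofReal (antiJac n s a h1 h2 ha) • volume) :=
    ⟨measurable_lead _, (lead_bijective_map _).2⟩
  have hS := hl.skew_product (μc := (volume : Measure (Last n s → ℝ)))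
    (μd := (volume : Measure (Last n s → ℝ)))
    (g := fun y d => (fun i : Last n s => (anti n s a 0 h1 h2 ha).Z D y (i.1, i.1)) + d)
    (by
      have h3 := (anti n s a 0 h1 h2 ha).continuous_Z (D := D)
      refine Continuous.measurable (Continuous.add ?_ continuous_snd)
      exact continuous_pi fun i => (continuous_apply (i.1, i.1)).comp (h3.comp continuous_fst))
    (Filter.Eventually.of_forall fun y => map_add_left_eq_self _ _)
  rw [Measure.prod_smul_left] at hS
  have h4 := (measurePreserving_piSum (Equiv.ofBijective _
    (antiIndex_bijective (d := 0) h1 h2 ha))).smul_measure (ENNReal.ofReal (antiJac n s a h1 h2 ha))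
  have h5 := h4.comp hS
  have h6 : antiHigh D h1 h2 ha = _ := funext (antiHigh_eq h1 h2 ha)
  rw [h6]
  exact h5

end Monomial

theorem hasTemperateGrowth_antiFill {E : Type} [NormedAddCommGroup E] [NormedSpace ℝ E]
    {f : E → High n s → ℝ} (hf : f.HasTemperateGrowth) :
    (fun x => (hm (antiFill n s a (f x)) : Herm n D)).HasTemperateGrowth := by
  refine hasTemperateGrowth_linearMap_comp (hm (n := n) (D := D)).toLinearMap
    (hasTemperateGrowth_pi fun p => ?_)
  by_cases h : (p.1 : ℕ) + p.2 < s
  · simp only [antiFill_low _ h]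
    exact Function.HasTemperateGrowth.const _
  · simp only [antiFill_high _ h]
    exact hasTemperateGrowth_linearMap_comp (LinearMap.proj ⟨p, h⟩) hf

theorem hasTemperateGrowth_antiTrace {E : Type} [NormedAddCommGroup E] [NormedSpace ℝ E]
    {X : E → Herm n D} (hX : X.HasTemperateGrowth) :
    (fun x => antiTrace s (X x)).HasTemperateGrowth := by
  have h : (fun x => ∑ i : Fin n, ∑ j : Fin n,
      if (i : ℕ) + j = s then tr ((X x).1 i j) else 0).HasTemperateGrowth := by
    refine Function.HasTemperateGrowth.sum fun i _ => Function.HasTemperateGrowth.sum fun j _ => ?_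
    split_ifs
    · exact hasTemperateGrowth_linearMap_comp (tr (D := D))
        (hasTemperateGrowth_entry (hasTemperateGrowth_herm_coe hX) i j)
    · exact Function.HasTemperateGrowth.const _
  simp only [antiTrace, div_eq_inv_mul]
  exact (Function.HasTemperateGrowth.const _).mul h

variable (s a) in
/-- Restriction of a Schwartz function to the affine space of hermitian matrices that agree with
`a w_s` above the antidiagonal number `s`. -/
def antiComp {E : Type} [NormedAddCommGroup E] [NormedSpace ℝ E] (S : 𝓢(Herm n D × E, ℂ)) :
    𝓢(E × (High n s → ℝ), ℂ) :=
  compLeftInv (g := fun p : E × (High n s → ℝ) => ((hm (antiFill n s a p.2) : Herm n D), p.1))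
    (h := fun q => (q.2, fun p : High n s => (hm (D := D)).symm q.1 p))
    (hasTemperateGrowth_prodMk (hasTemperateGrowth_antiFill
        (ContinuousLinearMap.snd ℝ E (High n s → ℝ)).hasTemperateGrowth)
      (ContinuousLinearMap.fst ℝ E (High n s → ℝ)).hasTemperateGrowth)
    (hasTemperateGrowth_prodMk (ContinuousLinearMap.snd ℝ (Herm n D) E).hasTemperateGrowth
      (hasTemperateGrowth_linearMap_comp (LinearMap.pi fun p : High n s =>
        LinearMap.proj (p : Fin n × Fin n) ∘ₗ (hm (n := n) (D := D)).symm.toLinearMap)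
        (ContinuousLinearMap.fst ℝ (Herm n D) E).hasTemperateGrowth))
    (fun p => by
      refine Prod.ext rfl (funext fun q => ?_)
      simp only [LinearEquiv.symm_apply_apply]
      rw [antiFill_high _ q.2])
    S

theorem antiComp_apply {E : Type} [NormedAddCommGroup E] [NormedSpace ℝ E]
    (S : 𝓢(Herm n D × E, ℂ)) (p : E × (High n s → ℝ)) :
    antiComp s a S p = S (hm (antiFill n s a p.2), p.1) := rfl

variable (s a) in
/-- The integral of a Schwartz function against the character over the affine space of hermitian
matrices that agree with `a w_s` above the antidiagonal number `s`. -/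
def antiInt {E : Type} [NormedAddCommGroup E] [NormedSpace ℝ E] (ψ : AddChar ℝ Circle)
    (S : 𝓢(Herm n D × E, ℂ)) : 𝓢(E, ℂ) :=
  partialIntegral volume (SchwartzMap.smulLeftCLM ℂ (fun p : E × (High n s → ℝ) =>
    (ψ (a⁻¹ * antiTrace s (hm (antiFill n s a p.2) : Herm n D)) : ℂ)) (antiComp s a S))

theorem antiInt_apply {E : Type} [NormedAddCommGroup E] [NormedSpace ℝ E] {ψ : AddChar ℝ Circle}
    (hψ : Continuous ψ) (S : 𝓢(Herm n D × E, ℂ)) (x : E) : antiInt s a ψ S x =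
      ∫ v, S (hm (antiFill n s a v), x) *
        (ψ (a⁻¹ * antiTrace s (hm (antiFill n s a v) : Herm n D)) : ℂ) := by
  have htg : (fun p : E × (High n s → ℝ) =>
      (ψ (a⁻¹ * antiTrace s (hm (antiFill n s a p.2) : Herm n D)) : ℂ)).HasTemperateGrowth :=
    (hasTemperateGrowth_addChar hψ).comp ((Function.HasTemperateGrowth.const _).mul
      (hasTemperateGrowth_antiTrace (hasTemperateGrowth_antiFill
        (ContinuousLinearMap.snd ℝ E (High n s → ℝ)).hasTemperateGrowth)))
  rw [antiInt, partialIntegral_apply]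
  refine integral_congr_ae (Filter.Eventually.of_forall fun v => ?_)
  simp only [SchwartzMap.smulLeftCLM_apply_apply htg, antiComp_apply, smul_eq_mul]
  rw [mul_comm]

/-- Extension of a Schwartz function by a trivial variable. -/
def trivVar (Φ : 𝓢(Herm n D, ℂ)) : 𝓢(Herm n D × (Fin 0 → ℝ), ℂ) :=
  compLeftInv (g := Prod.fst) (h := fun X => (X, 0))
    (ContinuousLinearMap.fst ℝ (Herm n D) (Fin 0 → ℝ)).hasTemperateGrowth
    (ContinuousLinearMap.inl ℝ (Herm n D) (Fin 0 → ℝ)).hasTemperateGrowth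
    (fun _ => Prod.ext rfl (Subsingleton.elim _ _)) Φ

theorem trivVar_apply (Φ : 𝓢(Herm n D, ℂ)) (p : Herm n D × (Fin 0 → ℝ)) :
    trivVar Φ p = Φ p.1 := rfl

theorem integrable_antiFill (Φ : 𝓢(Herm n D, ℂ)) :
    Integrable fun v : High n s → ℝ => Φ (hm (antiFill n s a v)) :=
  (sliceL (antiComp s a (trivVar Φ)) 0).integrable

namespace Monomial

variable (d : Last n s → ℝ) (h1 : s ≤ n) (h2 : n ≤ s + 1) (ha : a ≠ 0 ∨ n ≤ 1)

theorem hm_antiFill_antiHigh (p : ((anti n s a 0 h1 h2 ha).K → ℝ) × (Last n s → ℝ)) :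
    (hm (antiFill n s a (antiHigh D h1 h2 ha p)) : Herm n D) =
      actM ((anti n s a p.2 h1 h2 ha).herm D) ((anti n s a p.2 h1 h2 ha).U p.1) := by
  rw [← LinearEquiv.eq_symm_apply]
  funext q
  by_cases h : (q.1 : ℕ) + q.2 < s
  · rw [antiFill_low _ h]
    exact (Z_anti_low p.2 h1 h2 ha p.1 ⟨q, h⟩).symm
  · rw [antiFill_high _ h]
    rfl

/-- The orbit integral of `a w_s`, or its integral over the last entry `d` of the representative,
is an integral over an affine space. -/
theorem integral_J_anti {ψ : AddChar ℝ Circle} (hψ : Continuous ψ) (Φ : 𝓢(Herm n D, ℂ))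
    (ha0 : a ≠ 0) (hs : 1 ≤ s) : ∫ d : Last n s → ℝ, (anti n s a d h1 h2 ha).J ψ Φ =
      antiJac n s a h1 h2 ha * ∫ v, Φ (hm (antiFill n s a v)) *
        (ψ (a⁻¹ * antiTrace s (hm (antiFill n s a v) : Herm n D)) : ℂ) := by
  set F : (High n s → ℝ) → ℂ := fun v => Φ (hm (antiFill n s a v)) *
        (ψ (a⁻¹ * antiTrace s (hm (antiFill n s a v) : Herm n D)) : ℂ) with hF
  have hFi : Integrable F := by
    refine (integrable_antiFill Φ).mul_bdd (c := 1) ?_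
      (Filter.Eventually.of_forall fun _ => (Circle.norm_coe _).le)
    exact (((hasTemperateGrowth_addChar hψ).comp ((Function.HasTemperateGrowth.const _).mul
      (hasTemperateGrowth_antiTrace (hasTemperateGrowth_antiFill (D := D)
        (ContinuousLinearMap.id ℝ (High n s → ℝ)).hasTemperateGrowth)))).1.continuous).aestronglyMeasurable
  have hT := measurePreserving_antiHigh (D := D) h1 h2 ha
  have hFi' : Integrable F (ENNReal.ofReal (antiJac n s a h1 h2 ha) • volume) :=
    hFi.smul_measure ENNReal.ofReal_ne_top
  have hi := (hT.integrable_comp hFi'.aestronglyMeasurable).2 hFi'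
  have h3 : ∀ d : Last n s → ℝ, (anti n s a d h1 h2 ha).J ψ Φ =
      ∫ y : (anti n s a 0 h1 h2 ha).K → ℝ, F (antiHigh D h1 h2 ha (y, d)) := by
    intro d
    refine integral_congr_ae (Filter.Eventually.of_forall fun y => ?_)
    simp only [hF]
    rw [hm_antiFill_antiHigh, ← chiM_anti d h1 h2 ha ψ ha0 (isUpperUnip_U _ _) hs]
  have h5 := integral_prod_symm _ hi
  simp only [Function.comp_apply] at h5
  simp only [h3]
  rw [← h5]
  have h4 := integral_map hT.measurable.aemeasurable (f := F)
    (by rw [hT.map_eq]; exact hFi'.aestronglyMeasurable)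
  rw [hT.map_eq, integral_smul_measure, ENNReal.toReal_ofReal (antiJac_pos h1 h2 ha).le,
    Complex.real_smul] at h4
  rw [h4]

end Monomial

end AntiOrbit

section AntiSingle

variable {n : ℕ} {a : ℝ} {D : Type} [NormedCommRing D] [NormedAlgebra ℝ D] [QuadAlg D]
  [QuadBasis D]

instance : IsEmpty (Last n n) := ⟨fun i => absurd i.2 i.1.2.ne⟩

namespace Monomial

/-- The datum of `a w_n`. -/
def single (n : ℕ) (a : ℝ) (ha : a ≠ 0 ∨ n ≤ 1) : Monomial n :=
  anti n n a 0 le_rfl (Nat.le_succ n) ha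

theorem single_α {ha : a ≠ 0 ∨ n ≤ 1} (i : Fin n) : (single n a ha).α i = a :=
  anti_α_of_lt _ _ ha i.2

theorem J_single {ψ : AddChar ℝ Circle} (hψ : Continuous ψ) (Φ : 𝓢(Herm n D, ℂ))
    (ha0 : a ≠ 0) (hn : 1 ≤ n) : (single n a (Or.inl ha0)).J ψ Φ =
      antiJac n n a le_rfl (Nat.le_succ n) (Or.inl ha0) * ∫ v, Φ (hm (antiFill n n a v)) *
        (ψ (a⁻¹ * antiTrace n (hm (antiFill n n a v) : Herm n D)) : ℂ) := by
  rw [← integral_J_anti le_rfl (Nat.le_succ n) (Or.inl ha0) hψ Φ ha0 hn, integral_of_isEmpty]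
  congr 1

/-- A first block `a w_m` can be integrated out: what remains is the orbit integral of a Schwartz
function of the other blocks. -/
theorem J_cat_single {m r : ℕ} (d : Monomial r) (h : m + r = n) (ha0 : a ≠ 0)
    (hα : ∀ i, (single m a (Or.inl ha0)).α i ≠ 0)
    {ψ : AddChar ℝ Circle} (hψ : Continuous ψ) (Φ : 𝓢(Herm n D, ℂ)) (hm1 : 1 ≤ m) {δ : ℝ}
    (hδ : δ ≠ 0) (hd : hdet ((single m a (Or.inl ha0)).herm D) = δ) :
    (cat (single m a (Or.inl ha0)) d h hα).J ψ Φ = (single m a (Or.inl ha0)).catJac r *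
      (antiJac m m a le_rfl (Nat.le_succ m) (Or.inl ha0) *
        d.J ψ (antiInt m a ψ (crossS h ψ Φ hδ))) := by
  have h1 := integrable_and_J_cat (single m a (Or.inl ha0)) d h hα hψ Φ
  rw [Measure.volume_eq_prod] at h1
  rw [h1.2, integral_prod_symm _ h1.1]
  congr 1
  rw [J, ← integral_const_mul]
  refine integral_congr_ae (Filter.Eventually.of_forall fun y => ?_)
  simp only
  have h2 := J_single (n := m) (D := D) hψ (sliceR (crossS h ψ Φ hδ) (actM (d.herm D) (d.U y))) ha0 hm1
  rw [antiInt_apply hψ (crossS h ψ Φ hδ), ← mul_assoc]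
  simp only [sliceR_apply] at h2
  rw [← h2, J, ← integral_mul_const]
  refine integral_congr_ae (Filter.Eventually.of_forall fun x => ?_)
  simp only
  rw [sliceR_apply, crossS_apply_of_hdet h hψ Φ hδ (by rw [hdet_actM _ (isUpperUnip_U _ _), hd])]
  ring

end Monomial

end AntiSingle

section AntiFourier

variable {n : ℕ} {a : ℝ} {D : Type} [NormedCommRing D] [NormedAlgebra ℝ D] [QuadAlg D]
  [QuadBasis D]

/-- The coefficients of `antiTrace` in coordinates. -/
def antiCoeff (p : Fin n × Fin n) : ℝ :=
  if p.1 < p.2 then Real.sqrt 2 else if p.1 = p.2 then 1 else 0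

theorem antiTrace_hm (s : ℕ) (v : Fin n × Fin n → ℝ) : antiTrace s (hm v : Herm n D) =
    ∑ p : Fin n × Fin n, if (p.1 : ℕ) + p.2 = s then antiCoeff p * v p else 0 := by
  let F : Fin n → Fin n → ℝ := fun i j =>
    if (i : ℕ) + j = s then tr ((hm v : Herm n D).1 i j) else 0
  let G : Fin n → Fin n → ℝ := fun i j =>
    if (i : ℕ) + j = s then antiCoeff (i, j) * v (i, j) else 0
  have hlt : ∀ i j, i < j → F i j = G i j + G j i := by
    intro i j hij
    simp only [F, G, hm_apply_lt _ hij, tr_mkD, antiCoeff, hij, not_lt_of_gt hij, hij.ne', if_true,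
      if_false, zero_mul, ite_self, add_zero]
  have hsymm : ∀ i j, F i j = F j i := by
    intro i j
    simp only [F]
    rw [← tr_conj, herm_apply, add_comm]
  have hFG : ∀ i j, F i j + F j i = 2 * (G i j + G j i) := by
    intro i j
    rcases lt_trichotomy i j with h | rfl | h
    · rw [← hsymm i j, hlt i j h]; ring
    · have : F i i = 2 * G i i := by
        simp only [F, G, hm_apply_self, tr_algebraMap, antiCoeff, lt_irrefl, if_true, if_false]
        split_ifs <;> ring
      rw [this]; ring
    · rw [hsymm i j, hlt j i h]; ring
  have h1 : ∑ i, ∑ j, F i j + ∑ i, ∑ j, F j i = 2 * (∑ i, ∑ j, G i j + ∑ i, ∑ j, G j i) := by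
    simp only [← Finset.sum_add_distrib, hFG, Finset.mul_sum]
  rw [Finset.sum_comm (f := fun i j => F j i), Finset.sum_comm (f := fun i j => G j i)] at h1
  rw [antiTrace, Fintype.sum_prod_type]
  change (∑ i, ∑ j, F i j) / 2 = ∑ i, ∑ j, G i j
  linarith

theorem antiLow_eq (s : ℕ) (p : Low n s) :
    antiLow n s a p = if (p.1.1 : ℕ) + p.1.2 + 1 = s then antiCoeff p.1 * a else 0 := by
  rw [antiLow, antiCoeff]
  split_ifs <;> simp

theorem pairCoeff_mul_antiCoeff (p : Fin n × Fin n) :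
    pairCoeff D p * antiCoeff p = antiCoeff p := by
  rw [pairCoeff, antiCoeff]
  rcases lt_trichotomy p.1 p.2 with h | h | h
  · simp [h, h.le]
  · simp [h]
  · simp [not_lt_of_gt h, h.ne']

theorem antiCoeff_flip (p : Fin n × Fin n) : antiCoeff (flip p) = antiCoeff p := by
  simp [antiCoeff, flip, eq_comm]

theorem flip_add (p : Fin n × Fin n) :
    ((flip p).1 : ℕ) + (flip p).2 + (p.1 + p.2) = 2 * n - 2 := by
  have h1 := p.1.2
  have h2 := p.2.2
  simp only [flip, Equiv.coe_fn_mk, Fin.val_rev]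
  omega

end AntiFourier

section PartialInversion

variable {A A' B ι : Type} [Fintype A] [Fintype A'] [Fintype B] [Fintype ι]

/-- A Schwartz function of two sets of coordinates. -/
def splitS (e : A ⊕ B ≃ ι) (φ : 𝓢(ι → ℝ, ℂ)) : 𝓢((A → ℝ) × (B → ℝ), ℂ) :=
  compLeftInv (g := fun p i => Sum.elim p.1 p.2 (e.symm i))
    (h := fun v => (fun a => v (e (Sum.inl a)), fun b => v (e (Sum.inr b))))
    (hasTemperateGrowth_pi fun i => by
      rcases e.symm i with a | b
      · exact hasTemperateGrowth_linearMap (LinearMap.proj a ∘ₗ LinearMap.fst ℝ (A → ℝ) (B → ℝ))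
      · exact hasTemperateGrowth_linearMap (LinearMap.proj b ∘ₗ LinearMap.snd ℝ (A → ℝ) (B → ℝ)))
    (hasTemperateGrowth_prodMk
      (hasTemperateGrowth_pi fun a => hasTemperateGrowth_linearMap
        (LinearMap.proj (e (Sum.inl a)) : (ι → ℝ) →ₗ[ℝ] ℝ))
      (hasTemperateGrowth_pi fun b => hasTemperateGrowth_linearMap
        (LinearMap.proj (e (Sum.inr b)) : (ι → ℝ) →ₗ[ℝ] ℝ)))
    (fun p => by simp) φ

theorem splitS_apply (e : A ⊕ B ≃ ι) (φ : 𝓢(ι → ℝ, ℂ)) (p : (A → ℝ) × (B → ℝ)) :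
    splitS e φ p = φ (piSum e p) := by
  rw [piSum_apply]; rfl

/-- Fourier inversion in some of the variables, at a fixed frequency in the others. -/
theorem exists_integral_split_fourier {ψ : AddChar ℝ Circle} (hψ : Continuous ψ) (hψ1 : ψ ≠ 1) :
    ∃ t : ℝ, 0 < t ∧ ∀ (A A' B ι : Type) [Fintype A] [Fintype A'] [Fintype B] [Fintype ι]
      (e : A ⊕ B ≃ ι) (τ : A ≃ A') (c : A → ℝ), (∀ a, |c a| = 1) → ∀ (l : B → ℝ)
      (φ : 𝓢(ι → ℝ, ℂ)) (x : A → ℝ),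
      ∫ ξ : A' → ℝ, (∫ v, φ v * (ψ (-(∑ a, c a * v (e (Sum.inl a)) * ξ (τ a) +
          ∑ b, l b * v (e (Sum.inr b)))) : ℂ)) * (ψ (∑ a, c a * x a * ξ (τ a)) : ℂ) =
        ((t ^ Fintype.card A)⁻¹ : ℝ) *
          ∫ y, φ (piSum e (x, y)) * (ψ (-∑ b, l b * y b) : ℂ) := by
  obtain ⟨t, ht, H⟩ := exists_integral_partial_fourier hψ hψ1
  refine ⟨t, ht, ?_⟩
  intro A A' B ι _ _ _ _ e τ c hc l φ x
  have htg : (fun p : (A → ℝ) × (B → ℝ) => (ψ (-∑ b, l b * p.2 b) : ℂ)).HasTemperateGrowth :=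
    (hasTemperateGrowth_addChar hψ).comp (hasTemperateGrowth_linearMap
      (-∑ b, l b • (LinearMap.proj b ∘ₗ LinearMap.snd ℝ (A → ℝ) (B → ℝ)))) |> fun h => by
        convert h using 2
        simp
  have h := H A A' B τ c hc (SchwartzMap.smulLeftCLM ℂ (fun p : (A → ℝ) × (B → ℝ) =>
    (ψ (-∑ b, l b * p.2 b) : ℂ)) (splitS e φ)) x
  simp only [SchwartzMap.smulLeftCLM_apply_apply htg, splitS_apply, smul_eq_mul] at h
  have h2 : ∀ y, φ (piSum e (x, y)) * (ψ (-∑ b, l b * y b) : ℂ) =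
      (ψ (-∑ b, l b * y b) : ℂ) * φ (piSum e (x, y)) := fun y => mul_comm _ _
  simp only [h2]
  rw [← h]
  refine integral_congr_ae (Filter.Eventually.of_forall fun ξ => ?_)
  simp only
  congr 1
  rw [← integral_piSum e]
  refine integral_congr_ae (Filter.Eventually.of_forall fun p => ?_)
  have h3 : ∀ a, piSum e p (e (Sum.inl a)) = p.1 a := fun a => by simp [piSum_apply]
  have h4 : ∀ b, piSum e p (e (Sum.inr b)) = p.2 b := fun b => by simp [piSum_apply]
  simp only [h3, h4]
  rw [neg_add, AddChar.map_add_eq_mul]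
  push_cast
  ring

end PartialInversion

section AntiFourier

variable {n : ℕ} {a : ℝ}

/-- Reflection of positions exchanges the parts above the antidiagonal and on or below the
previous antidiagonal. -/
def flipLow (n s : ℕ) (h : s + 1 = n) : Low n n ≃ High n s :=
  flip.subtypeEquiv fun p => by
    have h1 := flip_add p
    have h2 := p.1.2
    omega

theorem sum_low_high {s : ℕ} (f : Fin n × Fin n → ℝ) :
    ∑ p, f p = ∑ p : Low n s, f p + ∑ p : High n s, f p := by
  rw [← Equiv.sum_comp (lowHigh n s), Fintype.sum_sum_type]
  rfl

theorem continuous_inv_addChar {ψ : AddChar ℝ Circle} (hψ : Continuous ψ) :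
    Continuous (ψ⁻¹ : AddChar ℝ Circle) := by
  have : (ψ⁻¹ : AddChar ℝ Circle) = fun x => ψ (-x) := funext fun x => AddChar.inv_apply _ _
  rw [this]
  exact hψ.comp continuous_neg

/-- The orbit integral of `a w_n` is, up to a constant, the integral over `d` of the orbit
integrals of the block diagonal matrices with blocks `-a⁻¹ w_{n-1}` and `d` for the Fourier
transform. Both are integrals over affine spaces, to which partial Fourier inversion applies. -/
theorem exists_J_single_eq {s n : ℕ} (h : s + 1 = n) (hs : 1 ≤ s) {ψ : AddChar ℝ Circle}
    (hψ : Continuous ψ) (hψ1 : ψ ≠ 1) (ha0 : a ≠ 0) (ha1 : -a⁻¹ ≠ 0) : ∃ C : ℂ,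
    ∀ (D : Type) [NormedCommRing D] [NormedAlgebra ℝ D] [QuadAlg D] [QuadBasis D]
      (Φ G : 𝓢(Herm n D, ℂ)), IsFourier ψ Φ G →
      (Monomial.single n a (Or.inl ha0)).J ψ Φ = C * ∫ d : Last n s → ℝ,
        (Monomial.anti n s (-a⁻¹) d (by omega) (by omega) (Or.inl ha1)).J ψ⁻¹ G := by
  obtain ⟨t, ht, H⟩ := exists_integral_split_fourier hψ hψ1
  have hψ' := continuous_inv_addChar hψ
  refine ⟨Monomial.antiJac n n a le_rfl (Nat.le_succ n) (Or.inl ha0) *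
    (Monomial.antiJac n s (-a⁻¹) (by omega) (by omega) (Or.inl ha1) : ℂ)⁻¹ *
    (t ^ Fintype.card (Low n n) : ℝ), ?_⟩
  intro D _ _ _ _ Φ G hG
  have hj : (Monomial.antiJac n s (-a⁻¹) (by omega) (by omega) (Or.inl ha1) : ℂ) ≠ 0 := by
    exact_mod_cast (Monomial.antiJac_pos (n := n) (s := s) (by omega) (by omega) (Or.inl ha1)).ne'
  have htc : ((t ^ Fintype.card (Low n n) : ℝ) : ℂ) ≠ 0 := by
    exact_mod_cast (pow_pos ht _).ne'
  have hb : ∀ b : High n n, (b.1.1 : ℕ) + b.1.2 ≥ n := fun b => not_lt.1 b.2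
  have hflip : ∀ b : High n n, ((flip b.1).1 : ℕ) + (flip b.1).2 < s := fun b => by
    have h1 := flip_add b.1
    have h2 := hb b
    omega
  -- the frequency in the remaining coordinates
  let l : High n n → ℝ := fun b => pairCoeff D b.1 * antiLow n s (-a⁻¹) ⟨flip b.1, hflip b⟩
  have h1 := H (Low n n) (High n s) (High n n) (Fin n × Fin n) (lowHigh n n) (flipLow n s h)
    (fun p => pairCoeff D p.1) (fun p => abs_pairCoeff _) l (compHm Φ) (antiLow n n a)
  have hl : ∀ y : High n n → ℝ, -∑ b, l b * y b =
      a⁻¹ * antiTrace n (hm (antiFill n n a y) : Herm n D) := by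
    intro y
    rw [antiTrace_hm, sum_low_high (s := n), mul_add, Finset.mul_sum, Finset.mul_sum,
      ← Finset.sum_neg_distrib, Finset.sum_eq_zero (s := (Finset.univ : Finset (Low n n))),
      zero_add]
    · refine Finset.sum_congr rfl fun b _ => ?_
      have h3 := flip_add b.1
      have h4 := hb b
      have h5 := pairCoeff_mul_antiCoeff (D := D) b.1
      simp only [l, antiLow_eq, antiCoeff_flip, antiFill_high _ b.2]
      by_cases h6 : (b.1.1 : ℕ) + b.1.2 = n
      · rw [if_pos h6, if_pos (by omega)]
        linear_combination a⁻¹ * y b * h5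
      · rw [if_neg h6, if_neg (by omega)]
        ring
    · intro p _
      rw [if_neg p.2.ne, mul_zero]
  have h2 : ∀ ξ : High n s → ℝ, G (hm (antiFill n s (-a⁻¹) ξ)) *
      ((ψ⁻¹ : AddChar ℝ Circle) ((-a⁻¹)⁻¹ * antiTrace s (hm (antiFill n s (-a⁻¹) ξ) : Herm n D)) : ℂ) =
      (∫ v, compHm Φ v * (ψ (-(∑ p : Low n n, pairCoeff D p.1 * v (lowHigh n n (Sum.inl p)) *
        ξ (flipLow n s h p) + ∑ b, l b * v (lowHigh n n (Sum.inr b)))) : ℂ)) *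
        (ψ (∑ p : Low n n, pairCoeff D p.1 * antiLow n n a p * ξ (flipLow n s h p)) : ℂ) := by
    intro ξ
    have hlow : ∀ p : Low n n, antiFill n s (-a⁻¹) ξ (flip p.1) = ξ (flipLow n s h p) :=
      fun p => antiFill_high _ (flipLow n s h p).2
    congr 1
    · rw [hG]
      refine integral_congr_ae (Filter.Eventually.of_forall fun v => ?_)
      simp only [compHm_apply]
      congr 3
      rw [pair_hm, sum_low_high (s := n)]
      congr 2
      · refine Finset.sum_congr rfl fun p _ => ?_
        rw [hlow p]
        rfl
      · refine Finset.sum_congr rfl fun b _ => ?_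
        rw [antiFill_low _ (hflip b)]
        simp only [l]
        rw [mul_right_comm]
        rfl
    · rw [AddChar.inv_apply, antiTrace_hm, ← Equiv.sum_comp flip, sum_low_high (s := n),
        Finset.sum_eq_zero (s := (Finset.univ : Finset (High n n))), add_zero, inv_neg, inv_inv,
        neg_mul, neg_neg, Finset.mul_sum]
      · refine congrArg (fun x => ((ψ x : Circle) : ℂ)) (Finset.sum_congr rfl fun p _ => ?_)
        have h3 := flip_add p.1
        have h4 := p.2
        have h5 := pairCoeff_mul_antiCoeff (D := D) p.1
        rw [hlow p, antiCoeff_flip, antiLow_eq]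
        by_cases h6 : (p.1.1 : ℕ) + p.1.2 + 1 = n
        · rw [if_pos h6, if_pos (by omega)]
          linear_combination -a * ξ (flipLow n s h p) * h5
        · rw [if_neg h6, if_neg (by omega)]
          ring
      · intro b _
        rw [if_neg (hflip b).ne]
  rw [Monomial.J_single hψ Φ ha0 (by omega), Monomial.integral_J_anti _ _ _ hψ' G ha1 hs]
  rw [integral_congr_ae (Filter.Eventually.of_forall h2), h1]
  simp only [hl, compHm_apply]
  have h3 : ((((t ^ Fintype.card (Low n n))⁻¹ : ℝ)) : ℂ) =
    ((t ^ Fintype.card (Low n n) : ℝ) : ℂ)⁻¹ := Complex.ofReal_inv _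
  rw [h3]
  generalize ((t ^ Fintype.card (Low n n) : ℝ) : ℂ) = z at htc
  change _ = _ * (_ * (_ * ∫ y, Φ (hm (antiFill n n a y)) *
    (ψ (a⁻¹ * antiTrace n (hm (antiFill n n a y) : Herm n D)) : ℂ)))
  generalize ∫ y, Φ (hm (antiFill n n a y)) *
    (ψ (a⁻¹ * antiTrace n (hm (antiFill n n a y) : Herm n D)) : ℂ) = I
  generalize (Monomial.antiJac n s (-a⁻¹) _ _ _ : ℂ) = j at hj
  field_simp

end AntiFourier

/-! ### Integrals over block decompositions -/

section BlockCoordinates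

variable {m r k n : ℕ} {D : Type} [NormedCommRing D] [NormedAlgebra ℝ D] [QuadAlg D] [QuadBasis D]

/-- A Schwartz function of a hermitian matrix and further coordinates is integrable over the
product of an orbit and the space of these coordinates. -/
theorem Monomial.integrable_actM_U_prod {B : Type} [Fintype B] (d : Monomial n)
    (S : 𝓢(Herm n D × (B → ℝ), ℂ)) :
    Integrable fun p : (d.K → ℝ) × (B → ℝ) => S (actM (d.herm D) (d.U p.1), p.2) := by
  have hc : Continuous fun p : (d.K → ℝ) × (B → ℝ) => S (actM (d.herm D) (d.U p.1), p.2) :=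
    S.continuous.comp ((((continuous_actM _).comp d.continuous_U).comp continuous_fst).prodMk
      continuous_snd)
  have h1 : Integrable fun y => ∏ q, (1 + d.lead D y q ^ 2)⁻¹ := by
    have h2 : Integrable (fun y : d.K → ℝ => ∏ q, (1 + y q ^ 2)⁻¹)
        (Measure.map (d.lead D) volume) := by
      rw [d.lead_bijective_map.2]
      exact (Integrable.fintype_prod (f := fun (_ : d.K) (x : ℝ) => (1 + x ^ 2)⁻¹)
        fun _ => integrable_inv_one_add_sq).smul_measure ENNReal.ofReal_ne_top
    exact (integrable_map_measure h2.aestronglyMeasurable d.measurable_lead.aemeasurable).1 h2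
  have h2 : Integrable fun b : B → ℝ => ∏ q, (1 + b q ^ 2)⁻¹ :=
    Integrable.fintype_prod (f := fun (_ : B) (x : ℝ) => (1 + x ^ 2)⁻¹)
      fun _ => integrable_inv_one_add_sq
  let W : Herm n D × (B → ℝ) → ℂ := fun p =>
    (∏ q : d.K, (1 + ((hm (D := D)).symm p.1 (d.pos q) : ℂ) ^ 2)) * ∏ q : B, (1 + (p.2 q : ℂ) ^ 2)
  have htg : W.HasTemperateGrowth := by
    refine Function.HasTemperateGrowth.mul (hasTemperateGrowth_prod _ fun q => ?_)
      (hasTemperateGrowth_prod _ fun q => ?_)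
    · have hl : (fun X : Herm n D × (B → ℝ) =>
          ((hm (D := D)).symm X.1 (d.pos q) : ℂ)).HasTemperateGrowth :=
        hasTemperateGrowth_linearMap (Complex.ofRealCLM.toLinearMap ∘ₗ
          LinearMap.proj (d.pos q) ∘ₗ (hm (D := D)).symm.toLinearMap ∘ₗ LinearMap.fst ℝ _ (B → ℝ))
      simp only [sq]
      exact (Function.HasTemperateGrowth.const 1).add (hl.mul hl)
    · have hl : (fun X : Herm n D × (B → ℝ) => (X.2 q : ℂ)).HasTemperateGrowth :=
        hasTemperateGrowth_linearMap (Complex.ofRealCLM.toLinearMap ∘ₗ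
          (LinearMap.proj q : (B → ℝ) →ₗ[ℝ] ℝ) ∘ₗ LinearMap.snd ℝ (Herm n D) (B → ℝ))
      simp only [sq]
      exact (Function.HasTemperateGrowth.const 1).add (hl.mul hl)
  have hS : ∀ p, SchwartzMap.smulLeftCLM ℂ W S p = W p * S p :=
    fun X => SchwartzMap.smulLeftCLM_apply_apply htg S X
  obtain ⟨C, -, hC⟩ := (SchwartzMap.smulLeftCLM ℂ W S).decay 0 0
  refine Integrable.mono' ((h1.mul_prod h2).const_mul C) hc.aestronglyMeasurable
    (Filter.Eventually.of_forall fun p => ?_)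
  have h3 : ‖W (actM (d.herm D) (d.U p.1), p.2)‖ *
      ‖S (actM (d.herm D) (d.U p.1), p.2)‖ ≤ C := by
    have := hC (actM (d.herm D) (d.U p.1), p.2)
    rwa [pow_zero, one_mul, norm_iteratedFDeriv_zero, hS, norm_mul] at this
  have h4 : ‖W (actM (d.herm D) (d.U p.1), p.2)‖ =
      (∏ q : d.K, (1 + d.lead D p.1 q ^ 2)) * ∏ q, (1 + p.2 q ^ 2) := by
    have : W (actM (d.herm D) (d.U p.1), p.2) =
        (((∏ q : d.K, (1 + d.lead D p.1 q ^ 2)) * ∏ q, (1 + p.2 q ^ 2) : ℝ) : ℂ) := by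
      simp [W, Monomial.lead, Monomial.Z]
    rw [this, Complex.norm_real, Real.norm_of_nonneg (by positivity)]
  rw [h4] at h3
  have h5 : 0 < (∏ q : d.K, (1 + d.lead D p.1 q ^ 2)) * ∏ q, (1 + p.2 q ^ 2) := by positivity
  rw [Finset.prod_inv_distrib, Finset.prod_inv_distrib, ← mul_inv, ← div_eq_mul_inv,
    le_div_iff₀ h5, mul_comm]
  exact h3

/-- The coordinates of a hermitian matrix, sorted by blocks. -/
def blkIdx (h : m + r = n) : (Fin m × Fin m) ⊕ ((Fin m × Fin r × Fin 2) ⊕ (Fin r × Fin r)) →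
    Fin n × Fin n
  | .inl p => (inl h p.1, inl h p.2)
  | .inr (.inl p) => if p.2.2 = 0 then (inl h p.1, inr h p.2.1) else (inr h p.2.1, inl h p.1)
  | .inr (.inr p) => (inr h p.1, inr h p.2)

theorem blkIdx_bijective (h : m + r = n) : Function.Bijective (blkIdx h) := by
  rw [Fintype.bijective_iff_surjective_and_card]
  constructor
  · rintro ⟨i, j⟩
    refine inl_inr_cases h i (fun i => ?_) (fun i => ?_) <;>
      refine inl_inr_cases h j (fun j => ?_) (fun j => ?_)
    · exact ⟨.inl (i, j), rfl⟩
    · exact ⟨.inr (.inl (i, j, 0)), rfl⟩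
    · exact ⟨.inr (.inl (j, i, 1)), rfl⟩
    · exact ⟨.inr (.inr (i, j)), rfl⟩
  · simp only [Fintype.card_sum, Fintype.card_prod, Fintype.card_fin, ← h]
    ring

/-- The sorting of coordinates by blocks as an equivalence. -/
def blkIndex (h : m + r = n) : (Fin m × Fin m) ⊕ ((Fin m × Fin r × Fin 2) ⊕ (Fin r × Fin r)) ≃
    Fin n × Fin n := Equiv.ofBijective _ (blkIdx_bijective h)

theorem hm_piSum_blkIndex (h : m + r = n) (x : Fin m × Fin m → ℝ)
    (y : (Fin m × Fin r × Fin 2) ⊕ (Fin r × Fin r) → ℝ) :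
    (hm (piSum (blkIndex h) (x, y)) : Herm n D) =
      hblk h (hm x) (vmat fun p => y (.inl p)) (hm fun p => y (.inr p)) := by
  have h0 : ∀ s, piSum (blkIndex h) (x, y) (blkIdx h s) = Sum.elim x y s := fun s => by
    rw [piSum_apply]
    exact congrArg _ ((blkIndex h).symm_apply_apply s)
  have h1 : ∀ i j, piSum (blkIndex h) (x, y) (inl h i, inl h j) = x (i, j) := fun i j =>
    h0 (.inl (i, j))
  have h2 : ∀ i j, piSum (blkIndex h) (x, y) (inl h i, inr h j) = y (.inl (i, j, 0)) := fun i j =>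
    h0 (.inr (.inl (i, j, 0)))
  have h3 : ∀ i j, piSum (blkIndex h) (x, y) (inr h j, inl h i) = y (.inl (i, j, 1)) := fun i j =>
    h0 (.inr (.inl (i, j, 1)))
  have h4 : ∀ i j, piSum (blkIndex h) (x, y) (inr h i, inr h j) = y (.inr (i, j)) := fun i j =>
    h0 (.inr (.inr (i, j)))
  refine herm_ext fun i j => ?_
  refine inl_inr_cases h i (fun i => ?_) (fun i => ?_) <;>
    refine inl_inr_cases h j (fun j => ?_) (fun j => ?_) <;> intro hij
  · change _ = blk h _ _ _ _ _ _
    rcases lt_or_eq_of_le hij with hl | he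
    · have hl' : i < j := hl
      rw [hm_apply_lt _ hl, h1, h1, blk_ll, hm_apply_lt _ hl']
    · obtain rfl := (inl_inj h).1 he
      rw [hm_apply_self, h1, blk_ll, hm_apply_self]
  · change _ = blk h _ _ _ _ _ _
    rw [hm_apply_lt _ (inl_lt_inr h i j), h2, h3, blk_lr, vmat_apply]
  · exact absurd hij (not_le_of_gt (inl_lt_inr h j i))
  · change _ = blk h _ _ _ _ _ _
    rcases lt_or_eq_of_le hij with hl | he
    · have hl' : i < j := (inr_lt_inr h).1 hl
      rw [hm_apply_lt _ hl, h4, h4, blk_rr, hm_apply_lt _ hl']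
    · obtain rfl := (inr_inj h).1 he
      rw [hm_apply_self, h4, blk_rr, hm_apply_self]

/-- The pairing of the last column above the diagonal with the first row right of it. -/
def colPair (b : Matrix (Fin k) (Fin 1) D) (w : Matrix (Fin 1) (Fin k) D) : ℝ :=
  ∑ i, tr (b i 0 * w 0 i.rev)

theorem pair_hblk (h : k + 1 = n) (h' : 1 + k = n) (X Y : Herm k D) (T d : Herm 1 D)
    (b : Matrix (Fin k) (Fin 1) D) (w : Matrix (Fin 1) (Fin k) D) :
    pair (hblk h X b d) (hblk h' T w Y) = pair X Y + colPair b w + pair d T := by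
  have hl : ∀ i : Fin k, (inl h i).rev = inr h' i.rev := fun i => by
    apply Fin.ext
    have := i.2
    simp only [inl, inr, Fin.val_rev]
    omega
  have hr : ∀ i : Fin 1, (inr h i).rev = inl h' i := fun i => by
    apply Fin.ext
    have := i.2
    simp only [inl, inr, Fin.val_rev]
    omega
  have h2 : ∀ i : Fin 1, i.rev = i := fun i => Subsingleton.elim _ _
  unfold pair colPair
  simp only [hblk, sum_inl_inr h, hl, hr, blk_ll, blk_lr, blk_rl, blk_rr,
    starR_apply, Finset.sum_add_distrib, Fin.sum_univ_one, ← map_mul, tr_conj, h2]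
  ring

/-- The row vector that corresponds to a column vector under conjugation and reversal. -/
def rowOf (w : Matrix (Fin k) (Fin 1) D) : Matrix (Fin 1) (Fin k) D :=
  Matrix.of fun _ j => QuadAlg.conj (w j.rev 0)

/-- A unipotent linear change of variables among row vectors. -/
theorem integral_rowOf_mul {q : Matrix (Fin k) (Fin k) D} (hq : IsUpperUnip q)
    (F : Matrix (Fin 1) (Fin k) D → ℂ) :
    ∫ w : Fin 1 × Fin k × Fin 2 → ℝ, F (vmat w) =
      ∫ v : Fin k × Fin 1 × Fin 2 → ℝ, F (rowOf (q * (vmat v : Matrix (Fin k) (Fin 1) D))) := by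
  let one : Monomial k := Monomial.diag (fun _ => 1) fun _ => one_ne_zero
  let q' : Matrix (Fin k) (Fin k) D := Matrix.of fun i j => q j.rev i.rev
  have hq' : IsUpperUnip q' :=
    ⟨fun i j hij => hq.1 _ _ (Fin.rev_lt_rev.2 hij), fun i => hq.2 _⟩
  let τ : Fin k × Fin 1 × Fin 2 ≃ Fin 1 × Fin k × Fin 2 :=
    ⟨fun p => (p.2.1, p.1, p.2.2), fun p => (p.2.1, p.1, p.2.2), fun _ => rfl, fun _ => rfl⟩
  let ρ : Fin k × Fin 1 × Fin 2 ≃ Fin k × Fin 1 × Fin 2 :=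
    ⟨fun p => (p.1.rev, p.2), fun p => (p.1.rev, p.2), fun p => by simp, fun p => by simp⟩
  let c : Fin k × Fin 1 × Fin 2 → ℝ := fun p => if p.2.2 = 0 then 1 else -1
  have hc : ∀ p, c p ≠ 0 := fun p => by simp only [c]; split_ifs <;> norm_num
  have hc1 : ∏ p, |c p| = 1 := Finset.prod_eq_one fun p _ => by
    simp only [c]; split_ifs <;> norm_num
  have h1 := integral_scaleEquiv τ (fun _ => 1) (fun _ => one_ne_zero) fun y =>
    F (vmat y : Matrix (Fin k) (Fin 1) D)ᵀ
  have h2 := one.integral_star'_mul (fun _ => one_ne_zero) hq' fun y =>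
    F (vmat y : Matrix (Fin k) (Fin 1) D)ᵀ
  have h3 := integral_scaleEquiv ρ c hc fun y => F ((star' q' * (one.herm D).1 *
    (vmat y : Matrix (Fin k) (Fin 1) D) : Matrix (Fin k) (Fin 1) D))ᵀ
  have h4 : one.catJac 1 = 1 := by simp [Monomial.catJac, one, Monomial.diag]
  simp only [LinearEquiv.apply_symm_apply] at h2
  rw [h2, h4, hc1] at h3
  simp only [abs_one, Finset.prod_const_one, inv_one, Complex.ofReal_one, one_mul] at h1 h3
  rw [← h1] at h3
  have h5 : ∀ w : Fin 1 × Fin k × Fin 2 → ℝ, (vmat w : Matrix (Fin 1) (Fin k) D) =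
      (vmat (scaleEquiv τ (fun _ => 1) (fun _ => one_ne_zero) w) : Matrix (Fin k) (Fin 1) D)ᵀ := by
    intro w
    ext i j
    simp [vmat_apply, scaleEquiv, τ, Subsingleton.elim i 0]
  have h6 : ∀ v, rowOf (q * (vmat v : Matrix (Fin k) (Fin 1) D)) = (star' q' * (one.herm D).1 *
      (vmat (scaleEquiv ρ c hc v) : Matrix (Fin k) (Fin 1) D))ᵀ := by
    intro v
    have ho : (one.herm D).1 = 1 := by
      ext i j
      rw [Monomial.herm_apply, Matrix.one_apply]
      simp [one, Monomial.diag]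
    ext i j
    rw [ho, Matrix.mul_one, rowOf, Matrix.of_apply, Matrix.transpose_apply, Matrix.mul_apply,
      Matrix.mul_apply, map_sum, ← Equiv.sum_comp Fin.revPerm]
    refine Finset.sum_congr rfl fun l _ => ?_
    simp [star', q', vmat_apply, scaleEquiv, ρ, c, conj_mkD, Subsingleton.elim i 0]
  simp only [h5, h6]
  exact h3.symm

end BlockCoordinates

/-! ### Partial Fourier inversion for block decompositions -/

section BlockFourier

variable {k n : ℕ} {D : Type} [NormedCommRing D] [NormedAlgebra ℝ D] [QuadAlg D] [QuadBasis D]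

/-- Fourier inversion on hermitian matrices. -/
theorem exists_isFourier_inv {ψ : AddChar ℝ Circle} (hψ : Continuous ψ) (hψ1 : ψ ≠ 1) (n : ℕ) :
    ∃ C : ℂ, C ≠ 0 ∧ ∀ (D : Type) [NormedCommRing D] [NormedAlgebra ℝ D] [QuadAlg D] [QuadBasis D]
      (Φ G : 𝓢(Herm n D, ℂ)), IsFourier ψ Φ G → IsFourier ψ⁻¹ G (C • Φ) := by
  obtain ⟨t, ht, H⟩ := exists_integral_split_fourier hψ hψ1
  refine ⟨((t ^ Fintype.card (Fin n × Fin n))⁻¹ : ℝ), by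
    exact_mod_cast (inv_pos.2 (pow_pos ht _)).ne', fun D _ _ _ _ Φ G hG ξ => ?_⟩
  obtain ⟨x, rfl⟩ := hm.surjective ξ
  have h1 := H (Fin n × Fin n) (Fin n × Fin n) Empty (Fin n × Fin n) (Equiv.sumEmpty _ _) flip
    (pairCoeff D) abs_pairCoeff (fun _ => 0) (compHm Φ) x
  have h2 : ∀ y : Empty → ℝ, piSum (Equiv.sumEmpty _ _) (x, y) = x := fun y => by
    rw [piSum_apply]; rfl
  simp only [h2, Monomial.integral_of_isEmpty, Finset.univ_eq_empty, Finset.sum_empty, neg_zero,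
    AddChar.map_zero_eq_one, Circle.coe_one, mul_one, add_zero, compHm_apply] at h1
  rw [_root_.smul_apply, smul_eq_mul]
  refine h1.symm.trans ?_
  refine integral_congr_ae (Filter.Eventually.of_forall fun ξ => ?_)
  simp only
  rw [hG, AddChar.inv_apply, neg_neg, pair_comm, pair_hm]
  congr 1
  refine integral_congr_ae (Filter.Eventually.of_forall fun v => ?_)
  simp only [pair_hm]
  rfl

/-- The real number `t` as a hermitian matrix of size one. -/
def point (D : Type) [NormedCommRing D] [NormedAlgebra ℝ D] [QuadAlg D] [QuadBasis D] {t : ℝ}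
    (ht : t ≠ 0) : Herm 1 D := (Monomial.diag (fun _ : Fin 1 => t) fun _ => ht).herm D

variable {t : ℝ} (ht : t ≠ 0)

theorem point_apply : (point D ht).1 0 0 = algebraMap ℝ D t := by
  rw [point, Monomial.herm_apply]; rfl

theorem hdet_point : hdet (point D ht) = t := by
  rw [point, Monomial.hdet_diag]; simp

theorem pair_hm_point (d : Fin 1 × Fin 1 → ℝ) : pair (hm d : Herm 1 D) (point D ht) =
    t * d (0, 0) := by
  have : (Fin.rev 0 : Fin 1) = 0 := rfl
  simp only [pair, Fin.sum_univ_one, this, point_apply, hm_apply_self, ← map_mul, tr_algebraMap]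
  ring

theorem hinv_point_apply : (hinv (point D ht)).1 0 0 = algebraMap ℝ D t⁻¹ := by
  rw [hinv, hdet_point, Algebra.algebraMap_eq_smul_one]
  change t⁻¹ • (Matrix.adjugate (point D ht).1) 0 0 = _
  rw [Matrix.adjugate_fin_one, Matrix.one_apply_eq]

/-- The Fourier transform of `Φ` in the last diagonal entry at the frequency `t`, as a function of
the last column above the diagonal, for a fixed first block. -/
def colS (h : k + 1 = n) (ψ : AddChar ℝ Circle) (Φ : 𝓢(Herm n D, ℂ)) (X : Herm k D) :
    𝓢(Fin k × Fin 1 × Fin 2 → ℝ, ℂ) :=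
  partialIntegral volume (splitS (Equiv.refl _) (SchwartzMap.smulLeftCLM ℂ
    (fun y : (Fin k × Fin 1 × Fin 2) ⊕ (Fin 1 × Fin 1) → ℝ =>
      (ψ (-(t * y (.inr (0, 0)))) : ℂ))
    (sliceL (splitS (blkIndex h) (compHm Φ)) ((hm (D := D)).symm X))))

theorem colS_weight {ψ : AddChar ℝ Circle} (hψ : Continuous ψ) :
    (fun y : (Fin k × Fin 1 × Fin 2) ⊕ (Fin 1 × Fin 1) → ℝ =>
      (ψ (-(t * y (.inr (0, 0)))) : ℂ)).HasTemperateGrowth :=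
  (hasTemperateGrowth_addChar hψ).comp (hasTemperateGrowth_linearMap
    (-(t • (LinearMap.proj (.inr (0, 0)) :
      ((Fin k × Fin 1 × Fin 2) ⊕ (Fin 1 × Fin 1) → ℝ) →ₗ[ℝ] ℝ))))

/-- Integration of `Φ` against a character of the last column and the last diagonal entry. -/
theorem integral_colS_mul (h : k + 1 = n) {ψ : AddChar ℝ Circle} (hψ : Continuous ψ)
    (Φ : 𝓢(Herm n D, ℂ)) (X : Herm k D) (w : Matrix (Fin 1) (Fin k) D) :
    ∫ y : (Fin k × Fin 1 × Fin 2) ⊕ (Fin 1 × Fin 1) → ℝ,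
      Φ (hblk h X (vmat fun p => y (.inl p)) (hm fun p => y (.inr p))) *
        (ψ (-(colPair (vmat fun p => y (.inl p)) w + t * y (.inr (0, 0)))) : ℂ) =
    ∫ b, colS (t := t) h ψ Φ X b * (ψ (-colPair (vmat b) w) : ℂ) := by
  have hs := integrable_schwartz_prod (splitS (Equiv.refl _) (SchwartzMap.smulLeftCLM ℂ
    (fun y : (Fin k × Fin 1 × Fin 2) ⊕ (Fin 1 × Fin 1) → ℝ =>
      (ψ (-(t * y (.inr (0, 0)))) : ℂ))
    (sliceL (splitS (blkIndex h) (compHm Φ)) ((hm (D := D)).symm X))))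
  have hcont : Continuous fun b : Fin k × Fin 1 × Fin 2 → ℝ =>
      (ψ (-colPair (vmat b : Matrix (Fin k) (Fin 1) D) w) : ℂ) := by
    refine (hasTemperateGrowth_addChar hψ).1.continuous.comp (Continuous.neg ?_)
    simp only [colPair, vmat_apply]
    refine continuous_finsetSum _ fun i _ => continuous_tr.comp (Continuous.mul ?_ continuous_const)
    exact (continuous_mkD (D := D)).comp (f := fun x : Fin k × Fin 1 × Fin 2 → ℝ =>
      (x (i, 0, 0), x (i, 0, 1))) ((continuous_apply (i, 0, 0)).prodMk (continuous_apply (i, 0, 1)))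
  have hi := hs.mul_bdd (c := 1) (hcont.comp continuous_fst).aestronglyMeasurable
    (Filter.Eventually.of_forall fun p => (Circle.norm_coe _).le)
  rw [Measure.volume_eq_prod] at hi
  rw [← integral_piSum (Equiv.refl _)]
  have h1 : ∀ p : (Fin k × Fin 1 × Fin 2 → ℝ) × (Fin 1 × Fin 1 → ℝ),
      Φ (hblk h X (vmat fun q => piSum (Equiv.refl _) p (.inl q))
        (hm fun q => piSum (Equiv.refl _) p (.inr q))) *
        (ψ (-(colPair (vmat fun q => piSum (Equiv.refl _) p (.inl q)) w +
          t * piSum (Equiv.refl _) p (.inr (0, 0)))) : ℂ) =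
      splitS (Equiv.refl _) (SchwartzMap.smulLeftCLM ℂ
        (fun y : (Fin k × Fin 1 × Fin 2) ⊕ (Fin 1 × Fin 1) → ℝ =>
          (ψ (-(t * y (.inr (0, 0)))) : ℂ))
        (sliceL (splitS (blkIndex h) (compHm Φ)) ((hm (D := D)).symm X))) p *
        (ψ (-colPair (vmat p.1) w) : ℂ) := by
    intro p
    rw [splitS_apply, SchwartzMap.smulLeftCLM_apply_apply (colS_weight hψ), sliceL_apply,
      splitS_apply, compHm_apply, hm_piSum_blkIndex, LinearEquiv.apply_symm_apply, neg_add,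
      AddChar.map_add_eq_mul]
    have h2 : ∀ q, piSum (Equiv.refl ((Fin k × Fin 1 × Fin 2) ⊕ (Fin 1 × Fin 1))) p (.inl q) =
        p.1 q := fun q => by rw [piSum_apply]; rfl
    simp only [h2, smul_eq_mul]
    push_cast
    ring
  rw [integral_congr_ae (Filter.Eventually.of_forall h1), Measure.volume_eq_prod]
  refine (integral_prod _ hi).trans ?_
  refine integral_congr_ae (Filter.Eventually.of_forall fun b => ?_)
  simp only [Function.comp_apply]
  exact integral_mul_const (L := ℂ) _ _

theorem colS_apply (h : k + 1 = n) {ψ : AddChar ℝ Circle} (hψ : Continuous ψ)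
    (Φ : 𝓢(Herm n D, ℂ)) (X : Herm k D) (b : Fin k × Fin 1 × Fin 2 → ℝ) :
    colS (t := t) h ψ Φ X b =
      ∫ d : Fin 1 × Fin 1 → ℝ, Φ (hblk h X (vmat b) (hm d)) * (ψ (-(t * d (0, 0))) : ℂ) := by
  rw [colS, partialIntegral_apply]
  refine integral_congr_ae (Filter.Eventually.of_forall fun d => ?_)
  simp only
  rw [splitS_apply, SchwartzMap.smulLeftCLM_apply_apply (colS_weight hψ), sliceL_apply,
    splitS_apply, compHm_apply, hm_piSum_blkIndex, LinearEquiv.apply_symm_apply, piSum_apply]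
  simp only [Equiv.refl_symm, Equiv.refl_apply, Sum.elim_inl, Sum.elim_inr, smul_eq_mul]
  ring

theorem colPair_vmat (b : Fin k × Fin 1 × Fin 2 → ℝ) (w : Fin 1 × Fin k × Fin 2 → ℝ) :
    colPair (vmat b : Matrix (Fin k) (Fin 1) D) (vmat w) =
      ∑ p : Fin k × Fin 1 × Fin 2, (if p.2.2 = 0 then 1 else eps D) * w (0, p.1.rev, p.2.2) * b p := by
  simp only [colPair, vmat_apply, tr_mkD_mul, Fintype.sum_prod_type, Fin.sum_univ_one,
    Fin.sum_univ_two]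
  refine Finset.sum_congr rfl fun i _ => ?_
  simp
  ring

/-- A Schwartz function as a function of the upper right block `B` and the last block minus
`B̄ᵗ R B`, for a fixed first block. -/
def fixS {m r : ℕ} (h : m + r = n) (Φ : 𝓢(Herm n D, ℂ)) (X R : Herm m D) :
    𝓢((Fin r × Fin r → ℝ) × (Fin m × Fin r × Fin 2 → ℝ), ℂ) :=
  compLeftInv (g := fun p => ((X, (hm p.1 : Herm r D)), p.2))
    (h := fun q => ((hm (D := D)).symm q.1.2, q.2))
    (hasTemperateGrowth_prodMk (hasTemperateGrowth_prodMk (Function.HasTemperateGrowth.const X)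
      (hasTemperateGrowth_linearMap_comp (hm (n := r) (D := D)).toLinearMap
        (hasTemperateGrowth_fst_comp (hasTemperateGrowth_linearMap LinearMap.id))))
      (hasTemperateGrowth_snd_comp (hasTemperateGrowth_linearMap LinearMap.id)))
    (hasTemperateGrowth_prodMk (hasTemperateGrowth_linearMap_comp
      (hm (n := r) (D := D)).symm.toLinearMap (hasTemperateGrowth_snd_comp
        (hasTemperateGrowth_fst_comp (hasTemperateGrowth_linearMap LinearMap.id))))
      (hasTemperateGrowth_snd_comp (hasTemperateGrowth_linearMap LinearMap.id)))
    (fun p => by simp) (schurComp h Φ (R := fun _ => R) (Function.HasTemperateGrowth.const R))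

theorem fixS_apply {m r : ℕ} (h : m + r = n) (Φ : 𝓢(Herm n D, ℂ)) (X R : Herm m D)
    (p : (Fin r × Fin r → ℝ) × (Fin m × Fin r × Fin 2 → ℝ)) : fixS h Φ X R p =
      Φ (hblk h X (vmat p.2) (quad R (vmat p.2) + hm p.1)) := rfl

set_option maxHeartbeats 400000 in
/-- The Fourier transform of the slice at `t` of the Fourier transform of `Φ`, before the Gaussian
integral over the first row is carried out. -/
theorem exists_fourier_sliceL_crossS (h : k + 1 = n) (h' : 1 + k = n) {ψ : AddChar ℝ Circle}
    (hψ : Continuous ψ) (hψ1 : ψ ≠ 1) : ∃ C : ℂ,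
    ∀ (D : Type) [NormedCommRing D] [NormedAlgebra ℝ D] [QuadAlg D] [QuadBasis D]
      (Φ G : 𝓢(Herm n D, ℂ)) (A : 𝓢(Herm k D, ℂ)), IsFourier ψ Φ G →
      IsFourier ψ⁻¹ (sliceL (crossS h' ψ⁻¹ G ht) (point D ht)) A → ∀ X : Herm k D,
      A X = C * ∫ w : Fin 1 × Fin k × Fin 2 → ℝ,
        (ψ (-(pair X (quad (hinv (point D ht)) (vmat w)) +
          corner ((hinv (point D ht)).1 * (vmat w : Matrix (Fin 1) (Fin k) D)))) : ℂ) *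
        ∫ b, colS (t := t) h ψ Φ X b *
          (ψ (-colPair (vmat b : Matrix (Fin k) (Fin 1) D) (vmat w)) : ℂ) := by
  obtain ⟨s, hs, H⟩ := exists_integral_split_fourier hψ hψ1
  refine ⟨((s ^ Fintype.card (Fin k × Fin k))⁻¹ : ℝ), fun D _ _ _ _ Φ G A hG hA X => ?_⟩
  set T := point D ht with hT
  set R := hinv T with hR
  have hψ' := continuous_inv_addChar hψ
  have hcψ := (hasTemperateGrowth_addChar hψ).1.continuous
  obtain ⟨x, rfl⟩ := hm.surjective X
  have hS := fun p => fixS_apply h' G T R p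
  set S := fixS h' G T R
  have hcR : Continuous fun w : Fin 1 × Fin k × Fin 2 → ℝ =>
      corner (R.1 * (vmat w : Matrix (Fin 1) (Fin k) D)) :=
    (hasTemperateGrowth_corner (hasTemperateGrowth_matrix_mul (Function.HasTemperateGrowth.const R.1)
      (hasTemperateGrowth_linearMap (vmat (D := D) (m := 1) (r := k)).toLinearMap))).1.continuous
  have hi : Integrable (fun p : (Fin k × Fin k → ℝ) × (Fin 1 × Fin k × Fin 2 → ℝ) => S p *
      (ψ (pair (hm p.1) (hm x : Herm k D) - corner (R.1 * (vmat p.2 : Matrix (Fin 1) (Fin k) D))) : ℂ)) :=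
    (integrable_schwartz_prod S).mul_bdd (c := 1) (hcψ.comp (((continuous_pair_hm _).comp
      continuous_fst).sub (hcR.comp continuous_snd))).aestronglyMeasurable
      (Filter.Eventually.of_forall fun p => (Circle.norm_coe _).le)
  rw [Measure.volume_eq_prod] at hi
  have h1 : ∀ v, sliceL (crossS h' ψ⁻¹ G ht) T (hm v) * ((ψ⁻¹ : AddChar ℝ Circle)
      (-pair (hm v) (hm x : Herm k D)) : ℂ) = ∫ w : Fin 1 × Fin k × Fin 2 → ℝ, S (v, w) *
      (ψ (pair (hm v) (hm x : Herm k D) - corner (R.1 * (vmat w : Matrix (Fin 1) (Fin k) D))) : ℂ) := by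
    intro v
    rw [sliceL_apply, crossS_apply_of_hdet h' hψ' G ht (hdet_point ht), cross, ← integral_mul_const]
    refine integral_congr_ae (Filter.Eventually.of_forall fun w => ?_)
    simp only
    rw [AddChar.inv_apply, AddChar.inv_apply, neg_neg, hS, sub_eq_add_neg, AddChar.map_add_eq_mul]
    push_cast
    ring
  rw [hA, integral_congr_ae (Filter.Eventually.of_forall h1), integral_integral_swap hi,
    ← integral_const_mul]
  refine integral_congr_ae (Filter.Eventually.of_forall fun w => ?_)
  simp only
  let l : (Fin k × Fin 1 × Fin 2) ⊕ (Fin 1 × Fin 1) → ℝ :=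
    Sum.elim (fun p => (if p.2.2 = 0 then 1 else eps D) * w (0, p.1.rev, p.2.2)) fun _ => t
  have hl : ∀ y : (Fin k × Fin 1 × Fin 2) ⊕ (Fin 1 × Fin 1) → ℝ, ∑ b, l b * y b =
      colPair (vmat (fun p => y (.inl p)) : Matrix (Fin k) (Fin 1) D) (vmat w) +
        t * y (.inr (0, 0)) := by
    intro y
    rw [Fintype.sum_sum_type, colPair_vmat]
    simp only [l, Sum.elim_inl, Sum.elim_inr]
    congr 1
    rw [Fintype.sum_prod_type, Fin.sum_univ_one, Fin.sum_univ_one]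
  have h2 := H (Fin k × Fin k) (Fin k × Fin k) _ (Fin n × Fin n) (blkIndex h) flip (pairCoeff D)
    abs_pairCoeff l (compHm Φ) x
  simp only [hl, compHm_apply] at h2
  have h3 : ∀ y, Φ (hm ((piSum (blkIndex h)) (x, y))) = Φ (hblk h (hm x)
      (vmat fun p => y (.inl p)) (hm fun p => y (.inr p))) := fun y => by rw [hm_piSum_blkIndex]
  simp only [h3] at h2
  rw [integral_colS_mul h hψ] at h2
  rw [mul_left_comm, ← h2, ← integral_const_mul]
  -- translation by the quadratic form of the row
  rw [← integral_add_left_eq_self _ (-((hm (D := D)).symm (quad R (vmat w))))]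
  refine integral_congr_ae (Filter.Eventually.of_forall fun v => ?_)
  simp only
  have h4 : quad R (vmat w) + hm (-(hm (D := D)).symm (quad R (vmat w)) + v) = hm v := by
    rw [map_add, map_neg, LinearEquiv.apply_symm_apply]
    abel
  have h5 : pair (hm (-(hm (D := D)).symm (quad R (vmat w)) + v) : Herm k D) (hm x) =
      pair (hm x : Herm k D) (hm v) - pair (hm x) (quad R (vmat w)) := by
    rw [pair_comm, ← h4, pair_add_right]
    simp only [map_add, map_neg, LinearEquiv.apply_symm_apply]
    ring
  rw [hS, h4, h5, hG, sub_sub, sub_eq_neg_add, AddChar.map_add_eq_mul, Circle.coe_mul,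
    pair_hm x v, mul_left_comm]
  congr 2
  refine integral_congr_ae (Filter.Eventually.of_forall fun z => ?_)
  simp only
  refine congrArg (fun x => Φ (hm z) * ((ψ (-x) : Circle) : ℂ)) ?_
  obtain ⟨p, rfl⟩ := (piSum (blkIndex h)).surjective z
  have h6 : ∀ a, piSum (blkIndex h) p (blkIndex h a) = Sum.elim p.1 p.2 a := fun a => by
    rw [piSum_apply]; exact congrArg _ ((blkIndex h).symm_apply_apply a)
  simp only [h6, Sum.elim_inl, Sum.elim_inr]
  rw [← Prod.mk.eta (p := p), hm_piSum_blkIndex, pair_hblk h h', pair_hm, hT, pair_hm_point ht (D := D),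
    add_assoc]

end BlockFourier

/-! ### The Gaussian integral over the first row -/

section RowGauss

variable {k n : ℕ} {D : Type} [NormedCommRing D] [NormedAlgebra ℝ D] [QuadAlg D] [QuadBasis D]

variable (D) in
/-- The signs of the form `x x̄` in the coordinates of a column. -/
def normSign (p : Fin k × Fin 1 × Fin 2) : ℝ := if p.2.2 = 0 then 1 else -eps D

theorem normSign_ne_zero (p : Fin k × Fin 1 × Fin 2) : normSign D p ≠ 0 := by
  have := abs_eps (D := D)
  unfold normSign
  split_ifs
  · exact one_ne_zero
  · intro h
    rw [neg_eq_zero] at h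
    simp [h] at this

/-- The trace of the hermitian form with diagonal matrix `a`. -/
def hform (a : Fin k → ℝ) (ha : ∀ i, a i ≠ 0) (x v : Matrix (Fin k) (Fin 1) D) : ℝ :=
  tr ((starR x * ((Monomial.diag a ha).herm D).1 * v) 0 0)

theorem hform_vmat (a : Fin k → ℝ) (ha : ∀ i, a i ≠ 0) (x v : Fin k × Fin 1 × Fin 2 → ℝ) :
    hform a ha (vmat x : Matrix (Fin k) (Fin 1) D) (vmat v) =
      ∑ p, normSign D p * a p.1 * x p * v p := by
  rw [hform, Matrix.mul_assoc, Matrix.mul_apply, map_sum, Fintype.sum_prod_type]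
  refine Finset.sum_congr rfl fun i _ => ?_
  rw [Monomial.herm_mul_apply, starR_apply, vmat_apply, conj_mkD]
  change tr (_ * a i • mkD (v (i, 0, 0)) (v (i, 0, 1))) = _
  rw [mul_smul_comm, map_smul, tr_mkD_mul, Fintype.sum_prod_type, Fin.sum_univ_one,
    Fin.sum_univ_two]
  simp [normSign]
  ring

theorem colPair_rowOf (b w : Matrix (Fin k) (Fin 1) D) :
    colPair b (rowOf w) = tr ((starR w * b) 0 0) := by
  rw [colPair, Matrix.mul_apply, map_sum]
  refine Finset.sum_congr rfl fun i _ => ?_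
  simp [rowOf, starR_apply, mul_comm]

variable {t : ℝ} (ht : t ≠ 0)

theorem pair_quad_hinv_point (X : Herm k D) (w : Matrix (Fin k) (Fin 1) D) :
    pair X (quad (hinv (point D ht)) (rowOf w)) = t⁻¹ * (tr ((starR w * X.1 * w) 0 0) / 2) := by
  have h1 : ∀ i j, (quad (hinv (point D ht)) (rowOf w)).1 i j =
      t⁻¹ • (w i.rev 0 * QuadAlg.conj (w j.rev 0)) := by
    intro i j
    change (starR (rowOf w) * (hinv (point D ht)).1 * rowOf w) i j = _
    rw [Matrix.mul_apply, Fin.sum_univ_one, Matrix.mul_apply, Fin.sum_univ_one, hinv_point_apply,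
      starR_apply, Algebra.smul_def]
    simp only [rowOf, Matrix.of_apply, QuadAlg.conj_conj]
    ring
  simp only [pair, h1, Fin.rev_rev, mul_smul_comm, map_smul, smul_eq_mul, ← Finset.mul_sum]
  rw [mul_div_assoc, Matrix.mul_apply, map_sum, Finset.sum_comm]
  congr 2
  refine Finset.sum_congr rfl fun j _ => ?_
  rw [Matrix.mul_apply, Finset.sum_mul, map_sum]
  refine Finset.sum_congr rfl fun i _ => congrArg _ ?_
  rw [starR_apply]
  ring

theorem corner_hinv_point (w : Matrix (Fin k) (Fin 1) D) :
    corner ((hinv (point D ht)).1 * rowOf w) = t⁻¹ * corner w := by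
  unfold corner
  rw [Fin.sum_univ_one, ← Equiv.sum_comp Fin.revPerm, Finset.mul_sum]
  refine Finset.sum_congr rfl fun j _ => ?_
  rw [Fin.sum_univ_one]
  have h1 : ((((0 : Fin 1) : ℕ) + 1 = 1 ∧ ((Fin.revPerm j : Fin k) : ℕ) = 0) ↔
      ((j : ℕ) + 1 = k ∧ (((0 : Fin 1) : ℕ) = 0))) := by
    have := j.2
    simp only [Fin.revPerm_apply, Fin.val_rev, Fin.val_zero, zero_add, true_and, and_true]
    omega
  simp only [h1]
  split_ifs with h2
  · rw [Matrix.mul_apply, Fin.sum_univ_one, hinv_point_apply, ← Algebra.smul_def, map_smul]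
    simp [rowOf, tr_conj]
  · simp

theorem corner_vmat (v : Fin k × Fin 1 × Fin 2 → ℝ) : corner (vmat v : Matrix (Fin k) (Fin 1) D) =
    ∑ p : Fin k × Fin 1 × Fin 2, (if (p.1 : ℕ) + 1 = k ∧ p.2.2 = 0 then Real.sqrt 2 else 0) * v p := by
  unfold corner
  rw [Fintype.sum_prod_type]
  refine Finset.sum_congr rfl fun i _ => ?_
  rw [Fin.sum_univ_one, Fintype.sum_prod_type, Fin.sum_univ_one, Fin.sum_univ_two, vmat_apply,
    tr_mkD]
  by_cases h : (i : ℕ) + 1 = k <;> simp [h]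

/-- The Gaussian integral with the Fourier transform of a Schwartz function. -/
theorem integral_gaussian_fourierPi {B : Type} [Fintype B] (c l μ : B → ℝ) (hc : ∀ j, c j ≠ 0)
    (hμ : ∀ j, μ j ≠ 0) (φ : 𝓢(B → ℝ, ℂ)) :
    ∫ w : B → ℝ, Complex.exp (2 * Real.pi * Complex.I * (∑ j, (c j * w j ^ 2 / 2 + l j * w j) : ℝ))
        * ∫ b, φ b * Complex.exp (-(2 * Real.pi * Complex.I * (∑ j, μ j * b j * w j : ℝ)))
      = (∏ j, (Complex.I / c j) ^ (1 / 2 : ℂ)) * ∫ b, φ b * Complex.exp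
          (-(2 * Real.pi * Complex.I * (∑ j, (μ j * b j - l j) ^ 2 / (2 * c j) : ℝ))) := by
  refine integral_oscillating_gaussian_mul_fourier c l μ hc φ φ.integrable ?_
  let L := scaleEquiv (Equiv.refl B) μ hμ
  have h1 := (compLeftInv (g := L) (h := L.symm) (hasTemperateGrowth_linearMap L.toLinearMap)
    (hasTemperateGrowth_linearMap L.symm.toLinearMap) (fun v => by simp) (fourierPi φ)).integrable
    (μ := volume)
  refine h1.congr (Filter.Eventually.of_forall fun w => ?_)
  rw [compLeftInv_apply, fourierPi_apply]
  refine integral_congr_ae (Filter.Eventually.of_forall fun b => ?_)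
  simp only
  congr 5
  refine Finset.sum_congr rfl fun j _ => ?_
  simp only [L, scaleEquiv, LinearEquiv.coe_mk, LinearMap.coe_mk, AddHom.coe_mk, Equiv.refl_apply]
  ring

variable (D) in
/-- The constant of the Gaussian integral over the first row, for the character `x ↦ e(s x)`. -/
def gaussProd (s t : ℝ) (a : Fin k → ℝ) : ℂ :=
  ∏ p : Fin k × Fin 1 × Fin 2, (Complex.I / (-(s * normSign D p * a p.1) / t : ℝ)) ^ (1 / 2 : ℂ)

/-- The Gaussian integral against the character of the corner entry. Completing the square produces a
phase `K`, which is the same for `ℝ ⊕ ℝ` and `ℂ` because the linear term only involves the coordinate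
in which the two norm forms agree. -/
theorem integral_gauss_row {t : ℝ} (ht : t ≠ 0) {s : ℝ} (hs : s ≠ 0) {ψ : AddChar ℝ Circle}
    (hψs : ∀ x, (ψ x : ℂ) = Complex.exp (2 * Real.pi * Complex.I * (s * x : ℝ)))
    (a : Fin k → ℝ) (ha : ∀ i, a i ≠ 0) : ∃ K : ℂ,
    ∀ (D : Type) [NormedCommRing D] [NormedAlgebra ℝ D] [QuadAlg D] [QuadBasis D]
      (φ : 𝓢(Fin k × Fin 1 × Fin 2 → ℝ, ℂ)),
      ∫ x : Fin k × Fin 1 × Fin 2 → ℝ,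
        (ψ (-(t⁻¹ * (hform a ha (vmat x : Matrix (Fin k) (Fin 1) D) (vmat x) / 2) +
          t⁻¹ * corner (vmat x : Matrix (Fin k) (Fin 1) D))) : ℂ) *
        ∫ v, φ v * (ψ (-hform a ha (vmat x : Matrix (Fin k) (Fin 1) D) (vmat v)) : ℂ) =
      K * gaussProd D s t a * ∫ v, φ v * (ψ (t * (hform a ha (vmat v : Matrix (Fin k) (Fin 1) D) (vmat v) / 2) +
          corner (vmat v : Matrix (Fin k) (Fin 1) D)) : ℂ) := by
  let l : Fin k × Fin 1 × Fin 2 → ℝ := fun p =>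
    -(s * (if (p.1 : ℕ) + 1 = k ∧ p.2.2 = 0 then Real.sqrt 2 else 0)) / t
  refine ⟨Complex.exp (2 * Real.pi * Complex.I * (∑ p, t * l p ^ 2 / (2 * (s * a p.1)) : ℝ)),
    fun D _ _ _ _ φ => ?_⟩
  have hn := normSign_ne_zero (k := k) (D := D)
  have hμ : ∀ p : Fin k × Fin 1 × Fin 2, s * normSign D p * a p.1 ≠ 0 := fun p =>
    mul_ne_zero (mul_ne_zero hs (hn p)) (ha _)
  have h := integral_gaussian_fourierPi (fun p : Fin k × Fin 1 × Fin 2 =>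
    -(s * normSign D p * a p.1) / t) l (fun p => s * normSign D p * a p.1)
    (fun p => div_ne_zero (neg_ne_zero.2 (hμ p)) ht) hμ φ
  have h1 : ∀ x : Fin k × Fin 1 × Fin 2 → ℝ,
      (ψ (-(t⁻¹ * (hform a ha (vmat x : Matrix (Fin k) (Fin 1) D) (vmat x) / 2) +
          t⁻¹ * corner (vmat x : Matrix (Fin k) (Fin 1) D))) : ℂ) =
      Complex.exp (2 * Real.pi * Complex.I *
        (∑ p, (-(s * normSign D p * a p.1) / t * x p ^ 2 / 2 + l p * x p) : ℝ)) := by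
    intro x
    rw [hψs, hform_vmat, corner_vmat]
    congr 3
    rw [Finset.sum_div, Finset.mul_sum, Finset.mul_sum, ← Finset.sum_add_distrib,
      ← Finset.sum_neg_distrib, Finset.mul_sum]
    refine Finset.sum_congr rfl fun p _ => ?_
    simp only [l]
    field_simp
    ring
  have h2 : ∀ x v : Fin k × Fin 1 × Fin 2 → ℝ,
      (ψ (-hform a ha (vmat x : Matrix (Fin k) (Fin 1) D) (vmat v)) : ℂ) =
      Complex.exp (-(2 * Real.pi * Complex.I * (∑ p, s * normSign D p * a p.1 * v p * x p : ℝ))) := by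
    intro x v
    rw [hψs, hform_vmat, mul_neg, Complex.ofReal_neg, mul_neg, Finset.mul_sum]
    congr 4
    exact Finset.sum_congr rfl fun p _ => by ring
  have h3 : ∀ v : Fin k × Fin 1 × Fin 2 → ℝ,
      Complex.exp (-(2 * Real.pi * Complex.I * (∑ p, (s * normSign D p * a p.1 * v p - l p) ^ 2 /
        (2 * (-(s * normSign D p * a p.1) / t)) : ℝ))) =
      Complex.exp (2 * Real.pi * Complex.I * (∑ p, t * l p ^ 2 / (2 * (s * a p.1)) : ℝ)) *
      (ψ (t * (hform a ha (vmat v : Matrix (Fin k) (Fin 1) D) (vmat v) / 2) +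
          corner (vmat v : Matrix (Fin k) (Fin 1) D)) : ℂ) := by
    intro v
    rw [hψs, hform_vmat, corner_vmat, ← Complex.exp_add, ← mul_add, ← mul_neg,
      ← Complex.ofReal_neg, ← Complex.ofReal_add]
    congr 3
    rw [Finset.sum_div, Finset.mul_sum, ← Finset.sum_add_distrib, Finset.mul_sum,
      ← Finset.sum_add_distrib, ← Finset.sum_neg_distrib]
    refine Finset.sum_congr rfl fun p _ => ?_
    have := hn p
    have := ha p.1
    simp only [l]
    by_cases hp : (p.1 : ℕ) + 1 = k ∧ p.2.2 = 0
    · have h4 : normSign D p = 1 := if_pos hp.2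
      rw [if_pos hp, h4]
      field_simp
      ring
    · rw [if_neg hp]
      field_simp
      ring
  rw [integral_congr_ae (Filter.Eventually.of_forall fun x => congrArg₂ (· * ·) (h1 x)
    (integral_congr_ae (Filter.Eventually.of_forall fun v => congrArg (φ v * ·) (h2 x v))))]
  refine h.trans ?_
  rw [integral_congr_ae (Filter.Eventually.of_forall fun v => congrArg (φ v * ·) (h3 v))]
  simp only [mul_left_comm (φ _)]
  rw [integral_const_mul, gaussProd]
  ring

end RowGauss

section SliceFourier

variable {k n : ℕ} {D : Type} [NormedCommRing D] [NormedAlgebra ℝ D] [QuadAlg D] [QuadBasis D]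

/-- The function on `H^k` obtained from `Φ` by integrating over the last column and, against a
character, over the last diagonal entry. The square of the last column is completed. -/
theorem integral_colS_mul_hinv (h : k + 1 = n) {ψ : AddChar ℝ Circle} (hψ : Continuous ψ) {t : ℝ}
    (ht : t ≠ 0) (Φ : 𝓢(Herm n D, ℂ)) (X R : Herm k D) :
    ∫ b, colS (t := t) h ψ Φ X b * (ψ (pair (quad R (vmat b)) (point D ht) +
        corner (R.1 * (vmat b : Matrix (Fin k) (Fin 1) D))) : ℂ) =
      ∫ d : Fin 1 × Fin 1 → ℝ, cross ψ h Φ R X (hm d) * (ψ (-(t * d (0, 0))) : ℂ) := by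
  have hcψ := (hasTemperateGrowth_addChar hψ).1.continuous
  have hcR : Continuous fun w : Fin k × Fin 1 × Fin 2 → ℝ =>
      corner (R.1 * (vmat w : Matrix (Fin k) (Fin 1) D)) :=
    (hasTemperateGrowth_corner (hasTemperateGrowth_matrix_mul (Function.HasTemperateGrowth.const R.1)
      (hasTemperateGrowth_linearMap (vmat (D := D) (m := k) (r := 1)).toLinearMap))).1.continuous
  have hi : Integrable (fun p : (Fin 1 × Fin 1 → ℝ) × (Fin k × Fin 1 × Fin 2 → ℝ) =>
      fixS h Φ X R p * (ψ (corner (R.1 * (vmat p.2 : Matrix (Fin k) (Fin 1) D)) - t * p.1 (0, 0)) : ℂ)) :=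
    (integrable_schwartz_prod _).mul_bdd (c := 1) (hcψ.comp ((hcR.comp continuous_snd).sub
      (by fun_prop))).aestronglyMeasurable
      (Filter.Eventually.of_forall fun p => (Circle.norm_coe _).le)
  rw [Measure.volume_eq_prod] at hi
  have h1 : ∀ d : Fin 1 × Fin 1 → ℝ, cross ψ h Φ R X (hm d) * (ψ (-(t * d (0, 0))) : ℂ) =
      ∫ b, fixS h Φ X R (d, b) *
        (ψ (corner (R.1 * (vmat b : Matrix (Fin k) (Fin 1) D)) - t * d (0, 0)) : ℂ) := by
    intro d
    rw [cross, ← integral_mul_const]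
    refine integral_congr_ae (Filter.Eventually.of_forall fun b => ?_)
    simp only
    rw [fixS_apply, sub_eq_add_neg, AddChar.map_add_eq_mul, Circle.coe_mul, mul_assoc]
  rw [integral_congr_ae (Filter.Eventually.of_forall h1), integral_integral_swap hi]
  refine integral_congr_ae (Filter.Eventually.of_forall fun b => ?_)
  simp only
  rw [colS_apply h hψ, ← integral_mul_const,
    ← integral_add_left_eq_self _ ((hm (D := D)).symm (quad R (vmat b)))]
  refine integral_congr_ae (Filter.Eventually.of_forall fun d => ?_)
  simp only
  rw [fixS_apply, map_add, LinearEquiv.apply_symm_apply, mul_assoc, ← Circle.coe_mul,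
    ← AddChar.map_add_eq_mul]
  have h2 : pair (quad R (vmat b)) (point D ht) =
      t * (hm (D := D)).symm (quad R (vmat b)) (0, 0) := by
    rw [← pair_hm_point ht (D := D), LinearEquiv.apply_symm_apply]
  rw [h2]
  refine congrArg (fun x => _ * ((ψ x : Circle) : ℂ)) ?_
  simp only [Pi.add_apply]
  ring

theorem pair_quad_point {t : ℝ} (ht : t ≠ 0) (a : Fin k → ℝ) (ha : ∀ i, a i ≠ 0)
    (v : Matrix (Fin k) (Fin 1) D) :
    pair (quad ((Monomial.diag a ha).herm D) v) (point D ht) = t * (hform a ha v v / 2) := by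
  have : (Fin.rev 0 : Fin 1) = 0 := rfl
  simp only [pair, Fin.sum_univ_one, this, point_apply]
  rw [mul_comm ((quad _ v).1 0 0), ← Algebra.smul_def, map_smul, smul_eq_mul, mul_div_assoc]
  rfl

/-- The Fourier transform of `sliceL`, on the orbit of a diagonal matrix. The unipotent group acts
on the first row by changes of variables of determinant one, which makes the quadratic form
diagonal. -/
theorem exists_fourier_slice_actM (h : k + 1 = n) (h' : 1 + k = n) {ψ : AddChar ℝ Circle}
    (hψ : Continuous ψ) (hψ1 : ψ ≠ 1) {s : ℝ} (hs : s ≠ 0)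
    (hψs : ∀ x, (ψ x : ℂ) = Complex.exp (2 * Real.pi * Complex.I * (s * x : ℝ)))
    {t : ℝ} (ht : t ≠ 0) (a : Fin k → ℝ) (ha : ∀ i, a i ≠ 0) : ∃ K : ℂ,
    ∀ (D : Type) [NormedCommRing D] [NormedAlgebra ℝ D] [QuadAlg D] [QuadBasis D]
      (Φ G : 𝓢(Herm n D, ℂ)) (A : 𝓢(Herm k D, ℂ)), IsFourier ψ Φ G →
      IsFourier ψ⁻¹ (sliceL (crossS h' ψ⁻¹ G ht) (point D ht)) A →
      ∀ u : Matrix (Fin k) (Fin k) D, IsUpperUnip u →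
      A (actM ((Monomial.diag a ha).herm D) u) = K * gaussProd D s t a *
        ∫ d : Fin 1 × Fin 1 → ℝ, cross ψ h Φ (hinv (actM ((Monomial.diag a ha).herm D) u))
          (actM ((Monomial.diag a ha).herm D) u) (hm d) * (ψ (-(t * d (0, 0))) : ℂ) := by
  obtain ⟨C, hC⟩ := exists_fourier_sliceL_crossS ht h h' hψ hψ1
  obtain ⟨K, hK⟩ := integral_gauss_row ht hs hψs a ha
  refine ⟨C * K, fun D _ _ _ _ Φ G A hG hA u hu => ?_⟩
  set d₁ := Monomial.diag a ha with hd₁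
  set X := actM (d₁.herm D) u with hX
  have hα : ∀ i, d₁.α i ≠ 0 := ha
  have hud : IsUnit u.det := by rw [hu.det]; exact isUnit_one
  obtain ⟨q, huq⟩ : ∃ q, u * q = 1 := ⟨u⁻¹, Matrix.mul_nonsing_inv u hud⟩
  have hq : IsUpperUnip q := hu.inv huq
  have hsq : starR q * star' u = 1 := by
    rw [← starR_eq_star', ← starR_mul, huq, starR_eq_star', star'_one]
  have hj : (d₁.catJac 1 : ℂ) ≠ 0 := by exact_mod_cast (d₁.catJac_pos hα 1).ne'
  let L : (Fin k × Fin 1 × Fin 2 → ℝ) →ₗ[ℝ] (Fin k × Fin 1 × Fin 2 → ℝ) :=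
    (vmat (D := D) (m := k) (r := 1)).symm.toLinearMap ∘ₗ
        mulLeftLinearMap (Fin 1) ℝ (star' u * (d₁.herm D).1) ∘ₗ
        (vmat (D := D) (m := k) (r := 1)).toLinearMap
  let L' : (Fin k × Fin 1 × Fin 2 → ℝ) →ₗ[ℝ] (Fin k × Fin 1 × Fin 2 → ℝ) :=
    (vmat (D := D) (m := k) (r := 1)).symm.toLinearMap ∘ₗ
        mulLeftLinearMap (Fin 1) ℝ ((hinv (d₁.herm D)).1 * starR q) ∘ₗ
        (vmat (D := D) (m := k) (r := 1)).toLinearMap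
  have hL : ∀ v, (vmat (L v) : Matrix (Fin k) (Fin 1) D) =
      star' u * (d₁.herm D).1 * (vmat v : Matrix (Fin k) (Fin 1) D) := fun v =>
    (vmat (D := D)).apply_symm_apply _
  have hLL : ∀ v, L' (L v) = v := by
    intro v
    change (vmat (D := D)).symm ((hinv (d₁.herm D)).1 * starR q * (vmat (L v) :
      Matrix (Fin k) (Fin 1) D)) = v
    rw [hL, ← Matrix.mul_assoc, Matrix.mul_assoc _ (starR q), ← Matrix.mul_assoc (starR q), hsq,
      Matrix.one_mul, hinv_mul (d₁.hdet_herm_ne_zero hα), Matrix.one_mul,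
      LinearEquiv.symm_apply_apply]
  let φ : 𝓢(Fin k × Fin 1 × Fin 2 → ℝ, ℂ) := compLeftInv (g := L) (h := L')
    (hasTemperateGrowth_linearMap L) (hasTemperateGrowth_linearMap L') hLL (colS (t := t) h ψ Φ X)
  have hint : ∀ f : (Fin k × Fin 1 × Fin 2 → ℝ) → ℂ,
      ∫ v, f (L v) = d₁.catJac 1 * ∫ v, f v := fun f => d₁.integral_star'_mul hα hu f
  -- the quadratic and linear forms in the new variables
  have h1 : ∀ x : Fin k × Fin 1 × Fin 2 → ℝ,
      starR (q * (vmat x : Matrix (Fin k) (Fin 1) D)) * X.1 * (q * (vmat x : Matrix (Fin k) (Fin 1) D)) =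
        starR (vmat x : Matrix (Fin k) (Fin 1) D) * (d₁.herm D).1 * (vmat x : Matrix (Fin k) (Fin 1) D) := by
    intro x
    change starR (q * (vmat x : Matrix (Fin k) (Fin 1) D)) * (star' u * (d₁.herm D).1 * u) *
      (q * (vmat x : Matrix (Fin k) (Fin 1) D)) = _
    rw [starR_mul]
    calc _ = starR (vmat x : Matrix (Fin k) (Fin 1) D) * (starR q * star' u) * (d₁.herm D).1 *
          ((u * q) * (vmat x : Matrix (Fin k) (Fin 1) D)) := by simp only [Matrix.mul_assoc]
      _ = _ := by rw [hsq, huq, Matrix.mul_one, Matrix.one_mul]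
  have h2 : ∀ x v : Fin k × Fin 1 × Fin 2 → ℝ,
      colPair (vmat (L v)) (rowOf (q * (vmat x : Matrix (Fin k) (Fin 1) D))) =
        hform a ha (vmat x : Matrix (Fin k) (Fin 1) D) (vmat v) := by
    intro x v
    rw [colPair_rowOf, hL, starR_mul, hform]
    refine congrArg (fun M : Matrix (Fin 1) (Fin 1) D => tr (M 0 0)) ?_
    calc _ = starR (vmat x : Matrix (Fin k) (Fin 1) D) * (starR q * star' u) * (d₁.herm D).1 *
          (vmat v : Matrix (Fin k) (Fin 1) D) := by simp only [Matrix.mul_assoc]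
      _ = _ := by rw [hsq, Matrix.mul_one]
  have h3 : ∀ x : Fin k × Fin 1 × Fin 2 → ℝ, ∫ b, colS (t := t) h ψ Φ X b *
      (ψ (-colPair (vmat b) (rowOf (q * (vmat x : Matrix (Fin k) (Fin 1) D)))) : ℂ) =
      (d₁.catJac 1 : ℂ)⁻¹ * ∫ v, φ v *
        (ψ (-hform a ha (vmat x : Matrix (Fin k) (Fin 1) D) (vmat v)) : ℂ) := by
    intro x
    rw [eq_inv_mul_iff_mul_eq₀ hj, ← hint]
    simp only [h2]
    rfl
  rw [hC D Φ G A hG hA X, integral_rowOf_mul hq (fun w =>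
    (ψ (-(pair X (quad (hinv (point D ht)) w) + corner ((hinv (point D ht)).1 * w))) : ℂ) *
      ∫ b, colS (t := t) h ψ Φ X b * (ψ (-colPair (vmat b) w) : ℂ))]
  have h4 : ∀ x : Fin k × Fin 1 × Fin 2 → ℝ,
      pair X (quad (hinv (point D ht)) (rowOf (q * (vmat x : Matrix (Fin k) (Fin 1) D)))) +
        corner ((hinv (point D ht)).1 * rowOf (q * (vmat x : Matrix (Fin k) (Fin 1) D))) =
      t⁻¹ * (hform a ha (vmat x : Matrix (Fin k) (Fin 1) D) (vmat x) / 2) +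
        t⁻¹ * corner (vmat x : Matrix (Fin k) (Fin 1) D) := by
    intro x
    rw [pair_quad_hinv_point, corner_hinv_point, corner_mul hq, h1, hform]
  simp only [h3, h4, mul_left_comm _ (d₁.catJac 1 : ℂ)⁻¹]
  rw [integral_const_mul, hK D φ, ← integral_colS_mul_hinv h hψ ht Φ X (hinv X)]
  have h5 : ∀ v, φ v * (ψ (t * (hform a ha (vmat v : Matrix (Fin k) (Fin 1) D) (vmat v) / 2) +
        corner (vmat v : Matrix (Fin k) (Fin 1) D)) : ℂ) =
      colS (t := t) h ψ Φ X (L v) * (ψ (pair (quad (hinv X) (vmat (L v))) (point D ht) +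
        corner ((hinv X).1 * (vmat (L v) : Matrix (Fin k) (Fin 1) D))) : ℂ) := by
    intro v
    obtain ⟨V, hV, h6, h7⟩ := d₁.exists_hinv_actM_mul hα hu (vmat v : Matrix (Fin k) (Fin 1) D)
    rw [hL, h6, h7, pair_quad_point, ← hV, corner_mul hu]
    rfl
  rw [integral_congr_ae (Filter.Eventually.of_forall h5), hint fun b =>
    colS (t := t) h ψ Φ X b * (ψ (pair (quad (hinv X) (vmat b)) (point D ht) +
        corner ((hinv X).1 * (vmat b : Matrix (Fin k) (Fin 1) D))) : ℂ)]
  generalize (∫ b, colS (t := t) h ψ Φ X b * _ : ℂ) = I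
  field_simp

/-- The regular integrals of the Fourier transform of `sliceL` in terms of those of `Φ` for diagonal
matrices with one more entry. -/
theorem exists_J_fourier_slice (h : k + 1 = n) (h' : 1 + k = n) {ψ : AddChar ℝ Circle}
    (hψ : Continuous ψ) (hψ1 : ψ ≠ 1) {s : ℝ} (hs : s ≠ 0)
    (hψs : ∀ x, (ψ x : ℂ) = Complex.exp (2 * Real.pi * Complex.I * (s * x : ℝ)))
    {t : ℝ} (ht : t ≠ 0) (a : Fin k → ℝ) (ha : ∀ i, a i ≠ 0) {δ : ℝ} (hδ : δ ≠ 0)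
    (had : ∏ i, a i = δ) : ∃ K : ℂ,
    ∀ (D : Type) [NormedCommRing D] [NormedAlgebra ℝ D] [QuadAlg D] [QuadBasis D]
      (Φ G : 𝓢(Herm n D, ℂ)) (A : 𝓢(Herm k D, ℂ)), IsFourier ψ Φ G →
      IsFourier ψ⁻¹ (sliceL (crossS h' ψ⁻¹ G ht) (point D ht)) A →
      (Monomial.diag a ha).J ψ A = K * gaussProd D s t a *
        ∫ d : Fin 1 × Fin 1 → ℝ, (ψ (-(t * d (0, 0))) : ℂ) *
          (Monomial.diag a ha).J ψ (sliceR (crossS h ψ Φ hδ) (hm d)) := by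
  obtain ⟨K, hK⟩ := exists_fourier_slice_actM h h' hψ hψ1 hs hψs ht a ha
  refine ⟨K, fun D _ _ _ _ Φ G A hG hA => ?_⟩
  set d₁ := Monomial.diag a ha with hd₁
  have hcψ := (hasTemperateGrowth_addChar hψ).1.continuous
  let S : 𝓢(Herm k D × (Fin 1 × Fin 1 → ℝ), ℂ) :=
    compLeftInv (g := fun p => (p.1, (hm p.2 : Herm 1 D))) (h := fun q => (q.1, (hm (D := D)).symm q.2))
      (hasTemperateGrowth_prodMk
        (hasTemperateGrowth_fst_comp (hasTemperateGrowth_linearMap LinearMap.id))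
        (hasTemperateGrowth_linearMap_comp (hm (n := 1) (D := D)).toLinearMap
          (hasTemperateGrowth_snd_comp (hasTemperateGrowth_linearMap LinearMap.id))))
      (hasTemperateGrowth_prodMk
        (hasTemperateGrowth_fst_comp (hasTemperateGrowth_linearMap LinearMap.id))
        (hasTemperateGrowth_linearMap_comp (hm (n := 1) (D := D)).symm.toLinearMap
          (hasTemperateGrowth_snd_comp (hasTemperateGrowth_linearMap LinearMap.id))))
      (fun p => by simp) (crossS h ψ Φ hδ)
  have hi : Integrable (fun p : (d₁.K → ℝ) × (Fin 1 × Fin 1 → ℝ) =>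
      S (actM (d₁.herm D) (d₁.U p.1), p.2) * ((ψ (-(t * p.2 (0, 0))) : ℂ) *
        chiM ψ (d₁.U p.1 : Matrix (Fin k) (Fin k) D))) := by
    refine (d₁.integrable_actM_U_prod S).mul_bdd (c := 1) (Continuous.aestronglyMeasurable ?_)
      (Filter.Eventually.of_forall fun p => ?_)
    · exact (hcψ.comp (by fun_prop)).mul
        (((continuous_chiM hψ).comp d₁.continuous_U).comp continuous_fst)
    · rw [norm_mul, norm_chiM, Circle.norm_coe, mul_one]
  rw [Measure.volume_eq_prod] at hi
  have h1 : ∀ d : Fin 1 × Fin 1 → ℝ, (ψ (-(t * d (0, 0))) : ℂ) *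
      d₁.J ψ (sliceR (crossS h ψ Φ hδ) (hm d)) = ∫ y : d₁.K → ℝ,
        S (actM (d₁.herm D) (d₁.U y), d) * ((ψ (-(t * d (0, 0))) : ℂ) *
        chiM ψ (d₁.U y : Matrix (Fin k) (Fin k) D)) := by
    intro d
    rw [Monomial.J, ← integral_const_mul]
    refine integral_congr_ae (Filter.Eventually.of_forall fun y => ?_)
    change _ * (S (actM (d₁.herm D) (d₁.U y), d) * _) = _
    ring
  rw [integral_congr_ae (Filter.Eventually.of_forall h1), ← integral_integral_swap hi, Monomial.J,
    ← integral_const_mul]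
  refine integral_congr_ae (Filter.Eventually.of_forall fun y => ?_)
  simp only
  rw [hK D Φ G A hG hA _ (d₁.isUpperUnip_U y), mul_assoc, ← integral_mul_const]
  congr 1
  refine integral_congr_ae (Filter.Eventually.of_forall fun d => ?_)
  have hX : hdet (actM (d₁.herm D) (d₁.U y)) = δ := by
    rw [hdet_actM _ (d₁.isUpperUnip_U y), hd₁, Monomial.hdet_diag, had]
  change _ = crossS h ψ Φ hδ (actM (d₁.herm D) (d₁.U y), hm d) * _
  rw [crossS_apply_of_hdet h hψ Φ hδ hX]
  exact mul_assoc _ _ _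

end SliceFourier

/-! ### Matching and the Fourier transform -/

section GaussSign

/-- The Gaussian constants of the forms `x² - y²` and `x² + y²` differ by `-i sign x`. -/
theorem cpow_half_mul_cpow_half_neg {x : ℝ} (hx : x ≠ 0) :
    (Complex.I / x) ^ (1 / 2 : ℂ) * (Complex.I / (-x : ℝ)) ^ (1 / 2 : ℂ) =
      (Complex.I / x) ^ (1 / 2 : ℂ) * (Complex.I / x) ^ (1 / 2 : ℂ) *
        (-(Complex.I * (Real.sign x : ℝ))) := by
  set z : ℂ := Complex.I / x with hz
  have hx' : (x : ℂ) ≠ 0 := by exact_mod_cast hx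
  have hz0 : z ≠ 0 := div_ne_zero Complex.I_ne_zero hx'
  have hconj : Complex.I / (-x : ℝ) = (starRingEnd ℂ) z := by
    rw [hz, map_div₀, Complex.conj_I, Complex.conj_ofReal, Complex.ofReal_neg, div_neg, neg_div]
  have hre : z.re = 0 := by simp [hz, Complex.div_re]
  have harg : z.arg ≠ Real.pi := by
    rw [Ne, Complex.arg_eq_pi_iff, hre]
    simp
  have h2 : z ^ (1 / 2 : ℂ) * z ^ (1 / 2 : ℂ) = z := by
    rw [← Complex.cpow_add _ _ hz0]
    norm_num
  have h3 : (1 / 2 : ℂ) = (starRingEnd ℂ) (1 / 2 : ℂ) := by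
    rw [map_div₀, map_one, map_ofNat]
  rw [h2, hconj, Complex.conj_cpow _ _ harg, ← h3, Complex.mul_conj, Complex.normSq_eq_norm_sq, sq, ← norm_mul, h2, hz]
  rw [norm_div, Complex.norm_I, Complex.norm_real, Real.norm_eq_abs]
  rcases lt_or_gt_of_ne hx with h | h
  · rw [Real.sign_of_neg h, abs_of_neg h]
    push_cast
    field_simp
    rw [Complex.I_sq]
  · rw [Real.sign_of_pos h, abs_of_pos h]
    push_cast
    field_simp
    rw [Complex.I_sq]; ring

/-- Comparison of the Gaussian constants for `ℝ ⊕ ℝ` and `ℂ`: a hyperbolic plane against a definite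
one. -/
theorem gaussProd_prod_eq {k : ℕ} {s t : ℝ} (hs : s ≠ 0) (ht : t ≠ 0) (a : Fin k → ℝ)
    (ha : ∀ i, a i ≠ 0) : gaussProd (ℝ × ℝ) s t a = gaussProd ℂ s t a *
      ((Complex.I * (Real.sign s : ℝ)) * (Real.sign t : ℝ)) ^ k * (Real.sign (∏ i, a i) : ℝ) := by
  have hsign : ((Real.sign (∏ i, a i) : ℝ) : ℂ) = ∏ i, ((Real.sign (a i) : ℝ) : ℂ) := by
    rw [← Complex.ofReal_prod]
    congr 1
    induction (Finset.univ : Finset (Fin k)) using Finset.induction_on with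
    | empty => simp
    | insert i S hi ih => rw [Finset.prod_insert hi, Finset.prod_insert hi, sign_mul, ih]
  have hk : ((Complex.I * (Real.sign s : ℝ)) * (Real.sign t : ℝ)) ^ k =
      ∏ _i : Fin k, ((Complex.I * (Real.sign s : ℝ)) * (Real.sign t : ℝ)) := by
    rw [Finset.prod_const, Finset.card_univ, Fintype.card_fin]
  rw [hsign, hk, gaussProd, gaussProd, Fintype.prod_prod_type, Fintype.prod_prod_type,
    ← Finset.prod_mul_distrib, ← Finset.prod_mul_distrib]
  refine Finset.prod_congr rfl fun i _ => ?_
  rw [Fintype.prod_prod_type, Fintype.prod_prod_type, Fin.prod_univ_one, Fin.prod_univ_one,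
    Fin.prod_univ_two, Fin.prod_univ_two]
  have h1 : ∀ (D : Type) [NormedCommRing D] [NormedAlgebra ℝ D] [QuadAlg D] [QuadBasis D],
      normSign D (i, (0 : Fin 1), (0 : Fin 2)) = 1 := fun D _ _ _ _ => if_pos rfl
  have h2 : normSign (ℝ × ℝ) (i, (0 : Fin 1), (1 : Fin 2)) = -1 := if_neg one_ne_zero
  have h3 : normSign ℂ (i, (0 : Fin 1), (1 : Fin 2)) = 1 := by
    change (if _ then _ else -(-1 : ℝ)) = (1 : ℝ)
    rw [if_neg one_ne_zero, neg_neg]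
  rw [h1, h1, h2, h3]
  have hx : -(s * 1 * a i) / t ≠ 0 := by
    have := ha i
    simp [hs, ht, this]
  have h4 : -(s * -1 * a i) / t = -(-(s * 1 * a i) / t) := by ring
  have h5 : Real.sign (-(s * 1 * a i) / t) = -(Real.sign s * Real.sign t * Real.sign (a i)) := by
    have h6 : -(s * 1 * a i) / t = -((s * a i) * t) * (t⁻¹ ^ 2) := by field_simp
    rw [h6, sign_mul, Real.sign_neg, sign_mul, sign_mul, Real.sign_of_pos (r := t⁻¹ ^ 2) (by positivity)]
    ring
  rw [h4, cpow_half_mul_cpow_half_neg hx, h5]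
  push_cast
  ring

end GaussSign

section MatchingFourier

theorem isFourier_zero {D : Type} [NormedCommRing D] [NormedAlgebra ℝ D] [QuadAlg D] [QuadBasis D]
    {ψ : AddChar ℝ Circle} {Φ G : 𝓢(Herm 0 D, ℂ)} (hG : IsFourier ψ Φ G) (d : Monomial 0) :
    d.J ψ⁻¹ G = d.J ψ Φ := by
  have : IsEmpty d.K := ⟨fun q => q.1.1.1.1.elim0⟩
  have hs : ∀ x y : Herm 0 D, x = y := fun x y => herm_ext fun i => i.elim0
  rw [Monomial.J, Monomial.J, Monomial.integral_of_isEmpty, Monomial.integral_of_isEmpty, hG,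
    Monomial.integral_of_isEmpty, hs (hm default) (actM (d.herm D) (d.U default))]
  simp [pair, chiM]

theorem ae_eval_ne_zero {ι : Type} [Fintype ι] (i : ι) : ∀ᵐ d : ι → ℝ, d i ≠ 0 :=
  Measure.ae_eval_ne _ i 0

theorem hm_eq_point {D : Type} [NormedCommRing D] [NormedAlgebra ℝ D] [QuadAlg D] [QuadBasis D]
    {d : Fin 1 × Fin 1 → ℝ} (hd : d (0, 0) ≠ 0) : (hm d : Herm 1 D) = point D hd := by
  refine herm_ext fun i j _ => ?_
  rw [Subsingleton.elim i 0, Subsingleton.elim j 0, hm_apply_self, point_apply]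

theorem Monomial.J_smul {n : ℕ} {D : Type} [NormedCommRing D] [NormedAlgebra ℝ D] [QuadAlg D]
    [QuadBasis D] (d : Monomial n) (ψ : AddChar ℝ Circle) (C : ℂ) (Φ : 𝓢(Herm n D, ℂ)) :
    d.J ψ (C • Φ : 𝓢(Herm n D, ℂ)) = C * d.J ψ Φ := by
  rw [Monomial.J, Monomial.J, ← integral_const_mul]
  refine integral_congr_ae (Filter.Eventually.of_forall fun y => ?_)
  simp only [_root_.smul_apply, smul_eq_mul]
  ring

/-- One step of the induction: if `Φ` and `Ψ` match, so do the functions on matrices of smaller size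
whose Fourier transforms are the slices of the Fourier transforms of `Φ` and `Ψ`. -/
theorem Matching.fourier_slice {k n : ℕ} (h : k + 1 = n) (h' : 1 + k = n) {ψ : AddChar ℝ Circle}
    (hψ : Continuous ψ) (hψ1 : ψ ≠ 1) {s : ℝ} (hs : s ≠ 0)
    (hψs : ∀ x, (ψ x : ℂ) = Complex.exp (2 * Real.pi * Complex.I * (s * x : ℝ)))
    {t : ℝ} (ht : t ≠ 0) {κ : ℂ} {Φ G : 𝓢(Herm n (ℝ × ℝ), ℂ)} {Ψ G' : 𝓢(Herm n ℂ, ℂ)}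
    (hm : Matching ψ κ Φ Ψ) (hG : IsFourier ψ Φ G) (hG' : IsFourier ψ Ψ G')
    {A : 𝓢(Herm k (ℝ × ℝ), ℂ)} {A' : 𝓢(Herm k ℂ, ℂ)}
    (hA : IsFourier ψ⁻¹ (sliceL (crossS h' ψ⁻¹ G ht) (point _ ht)) A)
    (hA' : IsFourier ψ⁻¹ (sliceL (crossS h' ψ⁻¹ G' ht) (point _ ht)) A') :
    Matching ψ (κ * ((Complex.I * (Real.sign s : ℝ)) * (Real.sign t : ℝ)) ^ k) A A' := by
  intro a ha
  have hδ : ∏ i, a i ≠ 0 := Finset.prod_ne_zero_iff.2 fun i _ => ha i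
  obtain ⟨K, hK⟩ := exists_J_fourier_slice h h' hψ hψ1 hs hψs ht a ha hδ rfl
  rw [hK _ Φ G A hG hA, hK _ Ψ G' A' hG' hA', gaussProd_prod_eq hs ht a ha]
  have h1 : ∀ᵐ d : Fin 1 × Fin 1 → ℝ, (ψ (-(t * d (0, 0))) : ℂ) *
      (Monomial.diag a ha).J ψ (sliceR (crossS h ψ Φ hδ) (Kloosterman.hm d)) =
      (κ * (Real.sign (∏ i, a i) : ℝ) * regFactor a) * ((ψ (-(t * d (0, 0))) : ℂ) *
      (Monomial.diag a ha).J ψ (sliceR (crossS h ψ Ψ hδ) (Kloosterman.hm d))) := by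
    filter_upwards [ae_eval_ne_zero (0, 0)] with d hd
    rw [hm_eq_point hd, hm_eq_point hd]
    have := hm.snoc h hψ hδ hd a ha
    unfold point
    rw [this]
    ring
  rw [integral_congr_ae h1, integral_const_mul]
  have h2 : ((Real.sign (∏ i, a i) : ℝ) : ℂ) * (Real.sign (∏ i, a i) : ℝ) = 1 := by
    rcases Real.sign_apply_eq_of_ne_zero _ hδ with h | h <;> simp [h]
  linear_combination (K * gaussProd ℂ s t a *
    ((Complex.I * (Real.sign s : ℝ)) * (Real.sign t : ℝ)) ^ k * κ * regFactor a *
    ∫ d : Fin 1 × Fin 1 → ℝ, (ψ (-(t * d (0, 0))) : ℂ) *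
      (Monomial.diag a ha).J ψ (sliceR (crossS h ψ Ψ hδ) (Kloosterman.hm d))) * h2

/-- The Fourier transforms of matching functions match for the conjugate character. -/
theorem Matching.fourier {ψ : AddChar ℝ Circle} (hψ : Continuous ψ) (hψ1 : ψ ≠ 1) {s : ℝ}
    (hs : s ≠ 0) (hψs : ∀ x, (ψ x : ℂ) = Complex.exp (2 * Real.pi * Complex.I * (s * x : ℝ)))
    {n : ℕ} {κ : ℂ} {Φ G : 𝓢(Herm n (ℝ × ℝ), ℂ)} {Ψ G' : 𝓢(Herm n ℂ, ℂ)}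
    (hm : Matching ψ κ Φ Ψ) (hG : IsFourier ψ Φ G) (hG' : IsFourier ψ Ψ G') :
    Matching ψ⁻¹ (κ * (Complex.I * (Real.sign s : ℝ)) ^ (n * (n - 1) / 2)) G G' := by
  induction n generalizing κ with
  | zero =>
    intro a ha
    rw [isFourier_zero hG, isFourier_zero hG', hm a ha]
    simp
  | succ k ih =>
    intro b hb
    have h : k + 1 = k + 1 := rfl
    have h' : 1 + k = k + 1 := add_comm 1 k
    have hψ' := continuous_inv_addChar hψ
    have hψ1' : ψ⁻¹ ≠ 1 := inv_ne_one.2 hψ1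
    -- Split off the first diagonal entry `t`. The Fourier transforms of the slices at `t` match by
    -- `Matching.fourier_slice`. The induction hypothesis and Fourier inversion lead back to the slices.
    set t := b (inl h' 0) with htd
    have ht : t ≠ 0 := hb _
    obtain ⟨A, hA⟩ := exists_isFourier hψ' hψ1' (sliceL (crossS h' ψ⁻¹ G ht) (point _ ht))
    obtain ⟨A', hA'⟩ := exists_isFourier hψ' hψ1' (sliceL (crossS h' ψ⁻¹ G' ht) (point _ ht))
    obtain ⟨C, hC, hinv⟩ := exists_isFourier_inv hψ' hψ1' k
    have h1 := hinv _ _ _ hA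
    have h2 := hinv _ _ _ hA'
    rw [inv_inv] at h1 h2
    have h3 := ih (hm.fourier_slice h h' hψ hψ1 hs hψs ht hG hG' hA hA') h1 h2
      (fun i => b (inr h' i)) (fun i => hb _)
    rw [Monomial.J_smul, Monomial.J_smul, mul_left_comm] at h3
    have h4 := mul_left_cancel₀ hC h3
    have hcat : Monomial.diag b hb = Monomial.cat (Monomial.diag (fun _ : Fin 1 => t) fun _ => ht)
        (Monomial.diag (fun i => b (inr h' i)) fun i => hb _) h' fun _ => ht := by
      rw [Monomial.diag_eq_cat h' b hb]
      congr 1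
      refine Monomial.ext_of_eq rfl (funext fun i => ?_)
      rw [Subsingleton.elim i 0]
      rfl
    have e1 := Monomial.J_cat_cons (Monomial.diag (fun _ : Fin 1 => t) fun _ => ht)
      (Monomial.diag (fun i => b (inr h' i)) fun i => hb _) h' (fun _ => ht) hψ' G ht (hdet_point ht)
    have e2 := Monomial.J_cat_cons (Monomial.diag (fun _ : Fin 1 => t) fun _ => ht)
      (Monomial.diag (fun i => b (inr h' i)) fun i => hb _) h' (fun _ => ht) hψ' G' ht (hdet_point ht)
    rw [hcat]
    refine e1.trans (Eq.trans ?_ (congrArg (_ * ·) e2).symm)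
    unfold point at h4
    rw [h4, regFactor_cons h', Nat.triangle_succ, pow_add, mul_pow]
    ring

end MatchingFourier

/-! ### The Weil constant -/

section Weil

/-- A Schwartz function on `ℂ` in real coordinates. -/
def toPlane (f : 𝓢(ℂ, ℂ)) : 𝓢(Fin 2 → ℝ, ℂ) :=
  compLeftInv (g := Complex.basisOneI.equivFun.symm) (h := Complex.basisOneI.equivFun)
    (hasTemperateGrowth_linearMap Complex.basisOneI.equivFun.symm.toLinearMap)
    (hasTemperateGrowth_linearMap Complex.basisOneI.equivFun.toLinearMap)
    (fun v => LinearEquiv.apply_symm_apply _ v) f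

theorem toPlane_apply (f : 𝓢(ℂ, ℂ)) (v : Fin 2 → ℝ) :
    toPlane f v = f (v 0 + v 1 * Complex.I) := by
  rw [toPlane, compLeftInv_apply, Complex.basisOneI.equivFun_symm_apply]
  simp [Fin.sum_univ_two]

theorem integral_plane (f : ℂ → ℂ) :
    ∫ x, f x = ∫ v : Fin 2 → ℝ, f (v 0 + v 1 * Complex.I) :=
  ((Complex.volume_preserving_equiv_pi.symm).integral_comp
    (MeasurableEquiv.measurableEmbedding _) f).symm

theorem trace_mul_conj (v w : Fin 2 → ℝ) : Algebra.trace ℝ ℂ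
    ((v 0 + v 1 * Complex.I) * starRingEnd ℂ (w 0 + w 1 * Complex.I)) =
      2 * ∑ j, v j * w j := by
  rw [Algebra.trace_complex_apply, Fin.sum_univ_two]
  simp

theorem normSq_plane (v : Fin 2 → ℝ) :
    Complex.normSq (v 0 + v 1 * Complex.I) = ∑ j, v j ^ 2 := by
  rw [Complex.normSq_add_mul_I, Fin.sum_univ_two]

variable {ψ : AddChar ℝ Circle} {s : ℝ}

/-- The Fourier transform on `ℂ` in real coordinates; the trace doubles the frequency. -/
theorem weil_transform (hs : ∀ x, (ψ x : ℂ) = Complex.exp (2 * Real.pi * Complex.I * (s * x : ℝ)))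
    (f : 𝓢(ℂ, ℂ)) (v : Fin 2 → ℝ) :
    ∫ y, f y * (ψ (Algebra.trace ℝ ℂ ((v 0 + v 1 * Complex.I) * starRingEnd ℂ y)) : ℂ) =
      ∫ b, toPlane f b *
        Complex.exp (-(2 * Real.pi * Complex.I * (∑ j, (-(2 * s)) * b j * v j : ℝ))) := by
  rw [integral_plane]
  refine integral_congr_ae (Filter.Eventually.of_forall fun b => ?_)
  simp only [trace_mul_conj, toPlane_apply, hs, ← mul_neg, ← Complex.ofReal_neg]
  congr 4
  rw [Finset.mul_sum, Finset.mul_sum, ← Finset.sum_neg_distrib]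
  exact Finset.sum_congr rfl fun j _ => by ring

theorem weil_inversion (hs0 : s ≠ 0)
    (hs : ∀ x, (ψ x : ℂ) = Complex.exp (2 * Real.pi * Complex.I * (s * x : ℝ)))
    (f : 𝓢(ℂ, ℂ)) (z : ℂ) :
    ∫ x, (∫ y, f y * (ψ (Algebra.trace ℝ ℂ (x * starRingEnd ℂ y)) : ℂ)) *
      (ψ (-Algebra.trace ℝ ℂ (x * starRingEnd ℂ z)) : ℂ) = ((2 * |s|) ^ 2 : ℝ)⁻¹ * f z := by
  obtain ⟨w, rfl⟩ : ∃ w : Fin 2 → ℝ, z = w 0 + w 1 * Complex.I :=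
    ⟨![z.re, z.im], by simp [Complex.re_add_im]⟩
  have hc : ∀ _ : Fin 2, -(2 * s) ≠ 0 := fun _ => by simpa using hs0
  have h := integral_scaleEquiv (Equiv.refl (Fin 2)) _ hc fun x => fourierPi (toPlane f) x *
    Complex.exp (2 * Real.pi * Complex.I * (∑ i, w i * x i : ℝ))
  rw [integral_fourierPi_mul, toPlane_apply] at h
  rw [integral_plane]
  refine Eq.trans (integral_congr_ae (Filter.Eventually.of_forall fun v => ?_)) (h.trans ?_)
  · beta_reduce
    rw [weil_transform hs]
    simp only [fourierPi_apply, trace_mul_conj, scaleEquiv, LinearEquiv.coe_mk,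
      LinearMap.coe_mk, AddHom.coe_mk, Equiv.refl_apply, hs]
    congr 1
    · refine integral_congr_ae (Filter.Eventually.of_forall fun b => ?_)
      simp only
      congr 5
      exact Finset.sum_congr rfl fun j _ => by ring
    · congr 3
      rw [Finset.mul_sum, ← Finset.sum_neg_distrib, Finset.mul_sum]
      exact Finset.sum_congr rfl fun j _ => by ring
  · simp [abs_mul]

theorem weil_gauss (hs0 : s ≠ 0)
    (hs : ∀ x, (ψ x : ℂ) = Complex.exp (2 * Real.pi * Complex.I * (s * x : ℝ)))
    (f : 𝓢(ℂ, ℂ)) {a : ℝ} (ha : a ≠ 0) :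
    ∫ x, (ψ (a * Complex.normSq x) : ℂ) *
      (∫ y, f y * (ψ (Algebra.trace ℝ ℂ (x * starRingEnd ℂ y)) : ℂ)) =
      Complex.I / (2 * s * a : ℝ) * ∫ x, (ψ (-(Complex.normSq x / a)) : ℂ) * f x := by
  have hc : ∀ _ : Fin 2, 2 * s * a ≠ 0 := fun _ => by simp [hs0, ha]
  have hμ : ∀ _ : Fin 2, -(2 * s) ≠ 0 := fun _ => by simpa using hs0
  have h := integral_gaussian_fourierPi (fun _ : Fin 2 => 2 * s * a) (fun _ => 0)
    (fun _ => -(2 * s)) hc hμ (toPlane f)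
  have h2 : (∏ j : Fin 2, (Complex.I / ((fun _ => 2 * s * a : Fin 2 → ℝ) j : ℝ)) ^ (1 / 2 : ℂ)) =
      Complex.I / (2 * s * a : ℝ) := by
    rw [Fin.prod_univ_two, ← Complex.cpow_add _ _
      (div_ne_zero Complex.I_ne_zero (Complex.ofReal_ne_zero.2 (hc 0)))]
    norm_num
  rw [h2] at h
  rw [integral_plane, integral_plane]
  refine Eq.trans (integral_congr_ae (Filter.Eventually.of_forall fun v => ?_)) (h.trans ?_)
  · beta_reduce
    rw [weil_transform hs, hs, normSq_plane]
    congr 4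
    rw [Finset.mul_sum, Finset.mul_sum]
    exact Finset.sum_congr rfl fun j _ => by ring
  · congr 1
    refine integral_congr_ae (Filter.Eventually.of_forall fun v => ?_)
    simp only [toPlane_apply, normSq_plane, hs, ← mul_neg, ← Complex.ofReal_neg]
    rw [mul_comm]
    congr 4
    rw [Finset.sum_div, ← Finset.sum_neg_distrib, ← Finset.sum_neg_distrib, Finset.mul_sum]
    refine Finset.sum_congr rfl fun j _ => ?_
    field_simp
    ring

theorem weil_inversion_smul (hs0 : s ≠ 0)
    (hs : ∀ x, (ψ x : ℂ) = Complex.exp (2 * Real.pi * Complex.I * (s * x : ℝ)))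
    (k : NNReal) (f : 𝓢(ℂ, ℂ)) (z : ℂ) :
    ∫ x, (∫ y, f y * (ψ (Algebra.trace ℝ ℂ (x * starRingEnd ℂ y)) : ℂ) ∂(k • volume)) *
      (ψ (-Algebra.trace ℝ ℂ (x * starRingEnd ℂ z)) : ℂ) ∂(k • volume) =
      ((k : ℝ) : ℂ) ^ 2 * (((2 * |s|) ^ 2 : ℝ)⁻¹ * f z) := by
  rw [← weil_inversion hs0 hs, integral_smul_nnreal_measure, NNReal.smul_def, Complex.real_smul, sq,
    mul_assoc]
  refine congrArg (((k : ℝ) : ℂ) * ·) ((integral_congr_ae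
    (Filter.Eventually.of_forall fun x => ?_)).trans (integral_const_mul (L := ℂ) _ _))
  rw [integral_smul_nnreal_measure, NNReal.smul_def, Complex.real_smul]
  exact mul_assoc _ _ _

theorem weil_gauss_smul (hs0 : s ≠ 0)
    (hs : ∀ x, (ψ x : ℂ) = Complex.exp (2 * Real.pi * Complex.I * (s * x : ℝ)))
    {k : NNReal} (f : 𝓢(ℂ, ℂ)) {a : ℝ} (ha : a ≠ 0) :
    ∫ x, (ψ (a * Complex.normSq x) : ℂ) *
      (∫ y, f y * (ψ (Algebra.trace ℝ ℂ (x * starRingEnd ℂ y)) : ℂ) ∂(k • volume)) ∂(k • volume) =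
      ((k : ℝ) : ℂ) ^ 2 *
        (Complex.I / (2 * s * a : ℝ) * ∫ x, (ψ (-(Complex.normSq x / a)) : ℂ) * f x) := by
  rw [← weil_gauss hs0 hs f ha, integral_smul_nnreal_measure, NNReal.smul_def, Complex.real_smul, sq,
    mul_assoc]
  refine congrArg (((k : ℝ) : ℂ) * ·) ((integral_congr_ae
    (Filter.Eventually.of_forall fun x => ?_)).trans (integral_const_mul (L := ℂ) _ _))
  rw [integral_smul_nnreal_measure, NNReal.smul_def, Complex.real_smul]
  exact mul_left_comm _ _ _

/-- A bump function divided by the oscillating factor has a non-zero integral against it. -/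
theorem exists_weil_test
    (hs : ∀ x, (ψ x : ℂ) = Complex.exp (2 * Real.pi * Complex.I * (s * x : ℝ))) :
    ∃ f : 𝓢(ℂ, ℂ), ∫ x, (ψ (-(Complex.normSq x / 1)) : ℂ) * f x ≠ 0 := by
  let b : ContDiffBump (0 : ℂ) := default
  let F : ℂ → ℂ := fun x =>
    Complex.exp (2 * Real.pi * Complex.I * (s * ‖x‖ ^ 2 : ℝ)) * ((b x : ℝ) : ℂ)
  have hsm : ContDiff ℝ ∞ F := by
    refine ContDiff.mul ?_ (Complex.ofRealCLM.contDiff.comp b.contDiff)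
    refine ContDiff.cexp (contDiff_const.mul (Complex.ofRealCLM.contDiff.comp ?_))
    exact contDiff_const.mul (contDiff_norm_sq ℝ)
  have hcs : HasCompactSupport F := by
    refine HasCompactSupport.mul_left ?_
    exact b.hasCompactSupport.comp_left (g := fun x : ℝ => (x : ℂ)) Complex.ofReal_zero
  refine ⟨hcs.toSchwartzMap hsm, ?_⟩
  have h1 : ∀ x, (ψ (-(Complex.normSq x / 1)) : ℂ) * hcs.toSchwartzMap hsm x = ((b x : ℝ) : ℂ) := by
    intro x
    change _ * F x = _
    rw [← mul_assoc, hs, ← Complex.exp_add, div_one, Complex.normSq_eq_norm_sq]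
    have : (2 * Real.pi * Complex.I * (s * -‖x‖ ^ 2 : ℝ) +
        2 * Real.pi * Complex.I * (s * ‖x‖ ^ 2 : ℝ) : ℂ) = 0 := by
      push_cast; ring
    rw [this, Complex.exp_zero, one_mul]
  rw [integral_congr_ae (Filter.Eventually.of_forall h1), integral_complex_ofReal]
  exact_mod_cast (b.integral_pos (μ := volume)).ne'

/-- The Weil constant is `i sign(s)` for the character `x ↦ e(s x)`; the self-dual measure is
`2 |s|` times Lebesgue measure. -/
theorem isWeilConst_iff (hs0 : s ≠ 0)
    (hs : ∀ x, (ψ x : ℂ) = Complex.exp (2 * Real.pi * Complex.I * (s * x : ℝ))) (c : ℂ) :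
    IsWeilConst ψ c ↔ c = Complex.I * (Real.sign s : ℝ) := by
  have hsC : (s : ℂ) ≠ 0 := Complex.ofReal_ne_zero.2 hs0
  have habs : ((|s| : ℝ) : ℂ) = s * Real.sign s := by
    rw [← Complex.ofReal_mul]
    congr 1
    rcases lt_or_gt_of_ne hs0 with h | h
    · rw [Real.sign_of_neg h, abs_of_neg h]; ring
    · rw [Real.sign_of_pos h, abs_of_pos h]; ring
  have hsign : ∀ a : ℝ, a ≠ 0 → ((|a|⁻¹ * Real.sign a : ℝ) : ℂ) = (a : ℂ)⁻¹ := by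
    intro a ha
    rw [← Complex.ofReal_inv]
    congr 1
    rcases lt_or_gt_of_ne ha with h | h
    · rw [Real.sign_of_neg h, abs_of_neg h, inv_neg]; ring
    · rw [Real.sign_of_pos h, abs_of_pos h]; ring
  constructor
  · rintro ⟨μ, hμ, h1, h2⟩
    set k := Measure.addHaarScalarFactor μ volume with hk
    have hμk : μ = k • volume := Measure.isAddLeftInvariant_eq_smul μ volume
    have hk0 : 0 < k := Measure.addHaarScalarFactor_pos_of_isAddHaarMeasure μ volume
    obtain ⟨f, hf⟩ := exists_weil_test hs
    have h2' := h2 f 1 one_ne_zero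
    have hf0 : ∃ z, f z ≠ 0 := by
      by_contra! h0
      simp [h0] at hf
    obtain ⟨z, hz⟩ := hf0
    have h1' := h1 f z
    rw [hμk] at h1' h2'
    rw [weil_inversion_smul hs0 hs] at h1'
    rw [weil_gauss_smul hs0 hs f one_ne_zero, hsign 1 one_ne_zero, integral_smul_nnreal_measure,
      NNReal.smul_def, Complex.real_smul] at h2'
    have hkC : ((k : ℝ) : ℂ) ≠ 0 := Complex.ofReal_ne_zero.2 (by exact_mod_cast hk0.ne')
    -- Inversion forces the self-dual measure to be `2|s|` times Lebesgue measure.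
    have hk2 : (k : ℝ) = 2 * |s| := by
      have h3 : (((k : ℝ) ^ 2 * ((2 * |s|) ^ 2)⁻¹ : ℝ) : ℂ) = (1 : ℝ) := by
        apply mul_right_cancel₀ hz
        rw [Complex.ofReal_one, one_mul]
        conv_rhs => rw [← h1']
        push_cast
        ring
      have h4 := Complex.ofReal_injective h3
      have h5 : (k : ℝ) ^ 2 = (2 * |s|) ^ 2 := by
        have : (0 : ℝ) < |s| := abs_pos.2 hs0
        field_simp at h4
        linarith
      exact (pow_left_inj₀ k.2 (by positivity) two_ne_zero).1 h5
    have h6 : ((k : ℝ) : ℂ) * (Complex.I / (2 * s : ℝ)) = c := by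
      apply mul_left_cancel₀ hkC
      apply mul_right_cancel₀ hf
      refine Eq.trans ?_ (h2'.trans ?_)
      · rw [mul_one]; ring
      · rw [Complex.ofReal_one]; ring
    rw [← h6, hk2]
    push_cast
    rw [habs]
    field_simp
  · rintro rfl
    set k : NNReal := 2 * ‖s‖₊ with hk
    have hkr : (k : ℝ) = 2 * |s| := by simp [hk]
    have hk0 : k ≠ 0 := by simpa [hk] using hs0
    refine ⟨k • volume, Measure.IsAddHaarMeasure.nnreal_smul volume hk0, fun f z => ?_,
      fun f a ha => ?_⟩
    · rw [weil_inversion_smul hs0 hs, hkr]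
      have : ((|s| : ℝ) : ℂ) ≠ 0 := Complex.ofReal_ne_zero.2 (abs_ne_zero.2 hs0)
      push_cast
      field_simp
    · rw [weil_gauss_smul hs0 hs f ha, hsign a ha, integral_smul_nnreal_measure, NNReal.smul_def,
        Complex.real_smul, hkr]
      have : (a : ℂ) ≠ 0 := Complex.ofReal_ne_zero.2 ha
      generalize ∫ x, (ψ (-(Complex.normSq x / a)) : ℂ) * f x = X
      push_cast
      rw [habs]
      field_simp

theorem weilConst_eq (hs0 : s ≠ 0)
    (hs : ∀ x, (ψ x : ℂ) = Complex.exp (2 * Real.pi * Complex.I * (s * x : ℝ))) :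
    weilConst ψ = Complex.I * (Real.sign s : ℝ) := by
  have h : ∃ c, IsWeilConst ψ c := ⟨_, (isWeilConst_iff hs0 hs _).2 rfl⟩
  rw [weilConst, dif_pos h]
  exact (isWeilConst_iff hs0 hs _).1 h.choose_spec

end Weil

/-! ### Transfer of orbit integrals -/

section Transfers

variable {m r n : ℕ} {ψ : AddChar ℝ Circle} {f g : ℂ}

/-- `f` is the transfer factor at `d`: it relates the orbit integrals at `d` of all matching
functions. -/
def Transfers (ψ : AddChar ℝ Circle) (d : Monomial n) (f : ℂ) : Prop :=
  ∀ (κ : ℂ) (Φ : 𝓢(Herm n (ℝ × ℝ), ℂ)) (Ψ : 𝓢(Herm n ℂ, ℂ)), Matching ψ κ Φ Ψ →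
    d.J ψ Φ = κ * f * d.J ψ Ψ

namespace Monomial

theorem cat_det (d₁ : Monomial m) (d₂ : Monomial r) (h : m + r = n) (hα : ∀ i, d₁.α i ≠ 0) :
    (cat d₁ d₂ h hα).mat.det = d₁.mat.det * d₂.mat.det := by
  rw [← Matrix.det_submatrix_equiv_self (sumEquiv h), ← Matrix.det_fromBlocks_zero₂₁ _ 0]
  congr 1
  ext i j
  rcases i with i | i <;> rcases j with j | j <;>
    simp [mat, inl_inj, inr_inj, (inl_lt_inr h _ _).ne, (inl_lt_inr h _ _).ne']

theorem det_ne_zero (d : Monomial n) (hα : ∀ i, d.α i ≠ 0) : d.mat.det ≠ 0 := by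
  rw [← hdet_herm (D := ℂ)]
  exact d.hdet_herm_ne_zero hα

theorem single_mat {a : ℝ} (ha : a ≠ 0 ∨ n ≤ 1) : (single n a ha).mat = a • antidiag n := by
  ext i j
  have h := anti_σ_of_lt (n := n) (d := (0 : Last n n → ℝ)) le_rfl (Nat.le_succ n) ha i.2
  simp only [mat, Matrix.of_apply, single_α, Matrix.smul_apply, antidiag, smul_eq_mul, mul_ite,
    mul_one, mul_zero]
  refine if_congr ?_ rfl rfl
  rw [Fin.ext_iff]
  change ((anti n n a 0 le_rfl (Nat.le_succ n) ha).σ i : ℕ) = j ↔ _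
  rw [h]
  omega

end Monomial

/-- The sign of the determinant comes from `Matching.snoc`. -/
theorem Transfers.snoc {d : Monomial m} (hd : Transfers ψ d f) (h : m + 1 = n) (hψ : Continuous ψ)
    (hα : ∀ i, d.α i ≠ 0) {t : ℝ} (ht : t ≠ 0) :
    Transfers ψ (d.cat (Monomial.diag (fun _ : Fin 1 => t) fun _ => ht) h hα)
      (f * (Real.sign d.mat.det : ℝ)) := by
  intro κ Φ Ψ hm
  have hδ := d.det_ne_zero hα
  have h1 := d.J_cat_snoc (Monomial.diag (fun _ : Fin 1 => t) fun _ => ht) h hα hψ Φ hδ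
  have h2 := d.J_cat_snoc (Monomial.diag (fun _ : Fin 1 => t) fun _ => ht) h hα hψ Ψ hδ
  rw [d.hdet_herm, bumpAt_self, Complex.ofReal_one, one_mul] at h1 h2
  rw [h1, h2, hd _ _ _ (hm.snoc h hψ hδ ht)]
  ring

theorem Transfers.cat_diag {d : Monomial m} (hd : Transfers ψ d f) (hψ : Continuous ψ)
    (hα : ∀ i, d.α i ≠ 0) (h : m + r = n) (b : Fin r → ℝ) (hb : ∀ i, b i ≠ 0) :
    Transfers ψ (d.cat (Monomial.diag b hb) h hα)
      (f * ((Real.sign d.mat.det : ℝ) : ℂ) ^ r * regFactor b) := by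
  induction r generalizing n with
  | zero =>
    obtain rfl : m = n := h
    have hcat : d.cat (Monomial.diag b hb) rfl hα = d := by
      have e : ∀ j : Fin m, inl (rfl : m + 0 = m) j = j := fun j => Fin.ext (inl_val _ j)
      refine Monomial.ext_of_eq ?_ ?_ <;> funext i <;> refine inl_inr_cases (rfl : m + 0 = m) i
        (fun j => ?_) (fun j => j.elim0)
      · rw [Monomial.cat_σ_inl, e, e]
      · rw [Monomial.cat_α_inl, e]
    rw [hcat, pow_zero, mul_one]
    have : regFactor b = 1 := by simp [regFactor]
    rwa [this, mul_one]
  | succ r ih =>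
    let b' : Fin r → ℝ := fun i => b (inl rfl i)
    have h1 := (ih (n := m + r) rfl b' fun i => hb _).snoc (n := n) (by omega) hψ
      (fun i => by refine inl_inr_cases rfl i (fun j => ?_) (fun j => ?_)
                   · rw [Monomial.cat_α_inl]; exact hα j
                   · rw [Monomial.cat_α_inr]; exact hb _) (hb (inr rfl 0))
    have hcat : d.cat (Monomial.diag b hb) h hα = (d.cat (Monomial.diag b' fun i => hb _)
        (rfl : m + r = m + r) hα).cat (Monomial.diag (fun _ : Fin 1 => b (inr rfl 0))
          fun _ => hb _) (by omega) (fun i => by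
            refine inl_inr_cases rfl i (fun j => ?_) (fun j => ?_)
            · rw [Monomial.cat_α_inl]; exact hα j
            · rw [Monomial.cat_α_inr]; exact hb _) := by
      have h' : m + r + 1 = n := by omega
      have e1 : ∀ j, inl h j = inl h' (inl rfl j) := fun j => Fin.ext (by simp)
      have e2 : ∀ j, inr h (inl rfl j) = inl h' (inr rfl j) := fun j => Fin.ext (by simp)
      have e3 : ∀ j, inr h (inr rfl j) = inr h' j := fun j => Fin.ext (by simp [add_assoc])
      refine Monomial.ext_of_eq ?_ ?_ <;> funext i <;> refine inl_inr_cases h i (fun j => ?_)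
        (fun j => inl_inr_cases (rfl : r + 1 = r + 1) j (fun j => ?_) (fun j => ?_))
      · rw [Monomial.cat_σ_inl, e1, e1, Monomial.cat_σ_inl, Monomial.cat_σ_inl]
      · rw [Monomial.cat_σ_inr, e2, Monomial.cat_σ_inl, Monomial.cat_σ_inr]
        exact e2 j
      · rw [Monomial.cat_σ_inr, e3, Monomial.cat_σ_inr]
        exact e3 j
      · rw [Monomial.cat_α_inl, e1, Monomial.cat_α_inl, Monomial.cat_α_inl]
      · rw [Monomial.cat_α_inr, e2, Monomial.cat_α_inl, Monomial.cat_α_inr]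
        rfl
      · rw [Monomial.cat_α_inr, e3, Monomial.cat_α_inr, Subsingleton.elim j 0]
        rfl
    rw [hcat]
    convert! h1 using 1
    rw [Monomial.cat_det, Monomial.diag_mat, Matrix.det_diagonal, sign_mul,
      regFactor_snoc (rfl : r + 1 = r + 1) b]
    push_cast
    ring

theorem transfers_of_isEmpty (d : Monomial 0) : Transfers ψ d 1 := by
  intro κ Φ Ψ hm
  have h := hm (fun i => i.elim0) fun i => i.elim0
  have hd : d = Monomial.diag (fun i => i.elim0) fun i => i.elim0 :=
    Monomial.ext_of_eq (Subsingleton.elim _ _) (Subsingleton.elim _ _)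
  have h1 : regFactor (fun i : Fin 0 => (i.elim0 : ℝ)) = 1 := by simp [regFactor]
  rw [h1] at h
  rw [hd, h]

/-- Matching functions of size one are proportional away from zero, so everywhere by continuity. This
covers a vanishing last block. -/
theorem transfers_of_eq_one (d : Monomial 1) : Transfers ψ d 1 := by
  intro κ Φ Ψ hmat
  have hherm : ∀ (D : Type) [NormedCommRing D] [NormedAlgebra ℝ D] [QuadAlg D] [QuadBasis D],
      d.herm D = hm (fun _ => d.α 0) := by
    intro D _ _ _ _
    refine herm_ext fun i j _ => ?_
    rw [Subsingleton.elim i 0, Subsingleton.elim j 0, hm_apply_self, Monomial.herm_apply,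
      if_pos (Subsingleton.elim _ _)]
  have h1 : (fun v => compHm Φ v) =ᵐ[volume] fun v => κ * compHm Ψ v := by
    filter_upwards [ae_eval_ne_zero ((0, 0) : Fin 1 × Fin 1)] with v hv
    rw [compHm_apply, compHm_apply, hm_eq_point hv, hm_eq_point hv]
    have h2 := hmat (fun _ => v (0, 0)) fun _ => hv
    rw [Monomial.J_one, Monomial.J_one] at h2
    have h3 : regFactor (fun _ : Fin 1 => v (0, 0)) = 1 := by simp [regFactor]
    rwa [h3, mul_one] at h2
  have h4 := (Continuous.ae_eq_iff_eq volume (compHm Φ).continuous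
    (continuous_const.mul (compHm Ψ).continuous)).1 h1
  rw [Monomial.J_one, Monomial.J_one, hherm, hherm, mul_one]
  exact congrFun h4 fun _ => d.α 0

/-- Induction on the size: by `exists_J_single_eq` the orbit integral of `a w_{s+1}` is an integral,
over `d`, of orbit integrals of the Fourier transform at `-a⁻¹ w_s ⊕ d`, and the Fourier transforms of
matching functions match. -/
theorem transfers_single {s : ℕ} {a : ℝ} (ha : a ≠ 0 ∨ s + 1 ≤ 1) {ψ : AddChar ℝ Circle}
    (hψ : Continuous ψ) (hψ1 : ψ ≠ 1) :
    Transfers ψ (Monomial.single (s + 1) a ha) (antidiagFactor (s + 1) a ψ) := by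
  induction s generalizing a ψ with
  | zero =>
    have : antidiagFactor (0 + 1) a ψ = 1 := by simp [antidiagFactor]
    rw [this]
    exact transfers_of_eq_one _
  | succ s ih =>
    have ha0 : a ≠ 0 := ha.resolve_right (by omega)
    have ha1 : -a⁻¹ ≠ 0 := neg_ne_zero.2 (inv_ne_zero ha0)
    have hψ' := continuous_inv_addChar hψ
    have hψ1' : ψ⁻¹ ≠ 1 := inv_ne_one.2 hψ1
    obtain ⟨t, ht, hψt⟩ := exists_freq hψ hψ1
    obtain ⟨C, hC⟩ := exists_J_single_eq (rfl : s + 1 + 1 = s + 1 + 1) (by omega) hψ hψ1 ha0 ha1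
    intro κ Φ Ψ hm
    obtain ⟨G, hG⟩ := exists_isFourier hψ hψ1 Φ
    obtain ⟨G', hG'⟩ := exists_isFourier hψ hψ1 Ψ
    have hm' := hm.fourier hψ hψ1 ht hψt hG hG'
    rw [← weilConst_eq ht hψt] at hm'
    have hs := ih (Or.inl ha1) hψ' hψ1'
    rw [hC _ Φ G hG, hC _ Ψ G' hG', mul_left_comm (κ * _)]
    congr 1
    rw [← integral_const_mul]
    refine integral_congr_ae ?_
    filter_upwards [ae_eval_ne_zero (⟨⟨s + 1, by omega⟩, rfl⟩ : Last (s + 1 + 1) (s + 1))] with d hd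
    have hα : ∀ i, (Monomial.single (s + 1) (-a⁻¹) (Or.inl ha1)).α i ≠ 0 := fun i => by
      rw [Monomial.single_α]; exact ha1
    have hcat : Monomial.anti (s + 1 + 1) (s + 1) (-a⁻¹) d (by omega) (by omega) (Or.inl ha1) =
        (Monomial.single (s + 1) (-a⁻¹) (Or.inl ha1)).cat
          (Monomial.diag (fun _ : Fin 1 => d ⟨⟨s + 1, by omega⟩, rfl⟩) fun _ => hd) rfl hα := by
      refine Monomial.ext_of_eq ?_ ?_ <;> funext i <;>
        refine inl_inr_cases rfl i (fun j => ?_) (fun j => ?_)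
      · rw [Monomial.cat_σ_inl]
        apply Fin.ext
        rw [Monomial.anti_σ_of_lt _ _ _ (by rw [inl_val]; exact j.2), inl_val, inl_val]
        exact (Monomial.anti_σ_of_lt _ _ _ j.2).symm
      · rw [Monomial.cat_σ_inr, Monomial.anti_σ_of_eq _ _ _ (by simp)]
        rfl
      · rw [Monomial.cat_α_inl, Monomial.single_α, Monomial.anti_α_of_lt _ _ _ (by rw [inl_val]; exact j.2)]
      · rw [Monomial.cat_α_inr, Subsingleton.elim j 0]
        simp [Monomial.anti, Monomial.diag]
        rfl
    rw [hcat, hs.snoc rfl hψ' hα hd _ _ _ hm', Monomial.single_mat, Nat.add_sub_cancel,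
      antidiagFactor.eq_def (s + 1 + 1) a ψ]
    simp only
    ring

/-- When the first block is integrated out, the two resulting functions match again: their regular
integrals are the orbit integrals at `a w_m` followed by a diagonal matrix. -/
theorem Transfers.cons {d : Monomial r} (hd : Transfers ψ d g) (hψ : Continuous ψ) (hψ1 : ψ ≠ 1)
    (h : m + r = n) (hm1 : 1 ≤ m) {a : ℝ} (ha : a ≠ 0)
    (hα : ∀ i, (Monomial.single m a (Or.inl ha)).α i ≠ 0) :
    Transfers ψ ((Monomial.single m a (Or.inl ha)).cat d h hα)
      (antidiagFactor m a ψ * g * ((Real.sign (a • antidiag m).det : ℝ) : ℂ) ^ r) := by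
  intro κ Φ Ψ hm
  rw [← Monomial.single_mat (Or.inl ha)]
  have hδ := (Monomial.single m a (Or.inl ha)).det_ne_zero hα
  have hsingle : Transfers ψ (Monomial.single m a (Or.inl ha)) (antidiagFactor m a ψ) := by
    obtain ⟨s, rfl⟩ : ∃ s, m = s + 1 := ⟨m - 1, by omega⟩
    exact transfers_single (Or.inl ha) hψ hψ1
  have hc : ((Monomial.single m a (Or.inl ha)).catJac r : ℂ) ≠ 0 := by
    exact_mod_cast (Monomial.catJac_pos _ hα r).ne'
  have hj : (Monomial.antiJac m m a le_rfl (Nat.le_succ m) (Or.inl ha) : ℂ) ≠ 0 := by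
    exact_mod_cast (Monomial.antiJac_pos le_rfl (Nat.le_succ m) (Or.inl ha)).ne'
  have hint : Matching ψ (κ * antidiagFactor m a ψ *
      ((Real.sign (Monomial.single m a (Or.inl ha)).mat.det : ℝ) : ℂ) ^ r)
      (antiInt m a ψ (crossS h ψ Φ hδ)) (antiInt m a ψ (crossS h ψ Ψ hδ)) := by
    intro b hb
    have h1 := hsingle.cat_diag hψ hα h b hb κ Φ Ψ hm
    rw [Monomial.J_cat_single _ h ha hα hψ Φ hm1 hδ (Monomial.hdet_herm _),
      Monomial.J_cat_single _ h ha hα hψ Ψ hm1 hδ (Monomial.hdet_herm _)] at h1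
    apply mul_left_cancel₀ hj
    apply mul_left_cancel₀ hc
    rw [h1]
    ring
  rw [Monomial.J_cat_single _ h ha hα hψ Φ hm1 hδ (Monomial.hdet_herm _),
    Monomial.J_cat_single _ h ha hα hψ Ψ hm1 hδ (Monomial.hdet_herm _), hd _ _ _ hint]
  ring

end Transfers

/-! ### Lists of blocks and compositions -/

section ListMat

/-- The entries of the block diagonal matrix with blocks `a w_m` for `(m, a)` in a list. -/
def listMat : List (ℕ × ℝ) → ℕ → ℕ → ℝ
  | [], _, _ => 0
  | (m, a) :: l, i, j =>
    if i < m then if i + j + 1 = m then a else 0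
    else if j < m then 0 else listMat l (i - m) (j - m)

/-- The blocks have positive size, and only a last block of size one may be zero. -/
def Admissible : List (ℕ × ℝ) → Prop
  | [] => True
  | (m, a) :: l => 1 ≤ m ∧ (a ≠ 0 ∨ m = 1 ∧ l = []) ∧ Admissible l

/-- A block `a w_m` with `a ≠ 0` is integrated out by `Transfers.cons`; a zero block is the last one
and has size one. -/
theorem exists_transfers {ψ : AddChar ℝ Circle} (hψ : Continuous ψ) (hψ1 : ψ ≠ 1)
    (l : List (ℕ × ℝ)) (hl : Admissible l) (n : ℕ) (hn : (l.map Prod.fst).sum = n) :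
    ∃ d : Monomial n, (∀ i j, d.mat i j = listMat l i j) ∧ Transfers ψ d (listFactor ψ l) := by
  induction l generalizing n with
  | nil =>
    obtain rfl : 0 = n := hn
    exact ⟨Monomial.diag (fun i => i.elim0) fun i => i.elim0, fun i => i.elim0,
      transfers_of_isEmpty _⟩
  | cons p l ih =>
    obtain ⟨m, a⟩ := p
    obtain ⟨hm1, ha, hl'⟩ := hl
    have h : m + (l.map Prod.fst).sum = n := by simpa using hn
    rcases ha with ha | ⟨rfl, rfl⟩
    · obtain ⟨d, hd, ht⟩ := ih hl' _ rfl
      have hα : ∀ i, (Monomial.single m a (Or.inl ha)).α i ≠ 0 := fun i => by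
        rw [Monomial.single_α]; exact ha
      refine ⟨(Monomial.single m a (Or.inl ha)).cat d h hα, fun i j => ?_,
        ht.cons hψ hψ1 h hm1 ha hα⟩
      have hs := Monomial.single_mat (n := m) (Or.inl ha)
      refine inl_inr_cases h i (fun i => ?_) (fun i => ?_) <;>
        refine inl_inr_cases h j (fun j => ?_) (fun j => ?_)
      · have h1 := congrFun (congrFun hs i) j
        simp only [Monomial.mat, Matrix.of_apply, Monomial.cat_σ_inl, Monomial.cat_α_inl, inl_inj,
          Matrix.smul_apply, antidiag, smul_eq_mul, mul_ite, mul_one, mul_zero] at h1 ⊢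
        rw [h1]
        simp only [listMat, inl_val, i.2, if_true]
        congr
      · have h2 : (i : ℕ) + (m + j) + 1 ≠ m := by omega
        simp [Monomial.mat, listMat, (inl_lt_inr h _ _).ne, h2]
      · simp [Monomial.mat, listMat, (inl_lt_inr h _ _).ne']
      · have h1 := hd i j
        simp only [Monomial.mat, Matrix.of_apply, Monomial.cat_σ_inr, Monomial.cat_α_inr, inr_inj]
          at h1 ⊢
        rw [h1]
        simp [listMat]
    · obtain rfl : 1 = n := h
      refine ⟨Monomial.single 1 a (Or.inr le_rfl), fun i j => ?_, ?_⟩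
      · rw [Monomial.single_mat]
        simp [antidiag, listMat]
      · have : listFactor ψ [(1, a)] = antidiagFactor 1 a ψ := by simp [listFactor]
        rw [this]
        exact transfers_single _ hψ hψ1

theorem sign_pow_four {x : ℝ} (hx : x ≠ 0) : ((Real.sign x : ℝ) : ℂ) ^ 4 = 1 := by
  rcases Real.sign_apply_eq_of_ne_zero _ hx with h | h <;> rw [h] <;> norm_num

theorem weilConst_pow_four {ψ : AddChar ℝ Circle} (hψ : Continuous ψ) (hψ1 : ψ ≠ 1) :
    weilConst ψ ^ 4 = 1 := by
  obtain ⟨t, ht, hψt⟩ := exists_freq hψ hψ1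
  rw [weilConst_eq ht hψt, mul_pow, Complex.I_pow_four, sign_pow_four ht, one_mul]

theorem det_smul_antidiag_ne_zero {m : ℕ} {a : ℝ} (ha : a ≠ 0) : (a • antidiag m).det ≠ 0 := by
  rw [← Monomial.single_mat (Or.inl ha)]
  exact Monomial.det_ne_zero _ fun i => by rw [Monomial.single_α]; exact ha

theorem antidiagFactor_pow_four {m : ℕ} {a : ℝ} (ha : a ≠ 0 ∨ m ≤ 1) {ψ : AddChar ℝ Circle}
    (hψ : Continuous ψ) (hψ1 : ψ ≠ 1) : antidiagFactor m a ψ ^ 4 = 1 := by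
  induction m generalizing a ψ with
  | zero => simp [antidiagFactor]
  | succ m ih =>
    have ha' : -a⁻¹ ≠ 0 ∨ m = 0 := by
      rcases ha with ha | ha
      · exact Or.inl (neg_ne_zero.2 (inv_ne_zero ha))
      · exact Or.inr (by omega)
    have hd : ((-a⁻¹) • antidiag m).det ≠ 0 := by
      rcases ha' with h | rfl
      · exact det_smul_antidiag_ne_zero h
      · simp
    rw [antidiagFactor.eq_def]
    simp only
    rw [mul_pow, mul_pow, ih (ha'.imp_right fun h => by omega) (continuous_inv_addChar hψ)
      (inv_ne_one.2 hψ1), ← pow_mul, mul_comm _ 4, pow_mul, weilConst_pow_four hψ hψ1,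
      sign_pow_four hd]
    simp

theorem listFactor_pow_four {ψ : AddChar ℝ Circle} (hψ : Continuous ψ) (hψ1 : ψ ≠ 1)
    (l : List (ℕ × ℝ)) (hl : Admissible l) : listFactor ψ l ^ 4 = 1 := by
  induction l with
  | nil => simp [listFactor]
  | cons p l ih =>
    obtain ⟨m, a⟩ := p
    obtain ⟨hm1, ha, hl'⟩ := hl
    rw [listFactor, mul_pow, mul_pow, ih hl', antidiagFactor_pow_four
      (ha.imp_right fun h => h.1.le) hψ hψ1]
    rcases ha with ha | ⟨-, rfl⟩
    · rw [← pow_mul, mul_comm _ 4, pow_mul, sign_pow_four (det_smul_antidiag_ne_zero ha)]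
      simp
    · simp

theorem listMat_apply (l : List (ℕ × ℝ)) (k k' : ℕ) (hk : k < l.length) (hk' : k' < l.length)
    (x y : ℕ) (hx : x < l[k].1) (hy : y < l[k'].1) :
    listMat l (((l.map Prod.fst).take k).sum + x) (((l.map Prod.fst).take k').sum + y) =
      if k = k' ∧ x + y + 1 = l[k].1 then l[k].2 else 0 := by
  induction l generalizing k k' with
  | nil => simp at hk
  | cons p l ih =>
    obtain ⟨m, a⟩ := p
    rcases k with _ | k <;> rcases k' with _ | k'
    · simp at hx
      simp [listMat, hx]
    · simp at hx
      have : ¬ (x + (m + ((l.map Prod.fst).take k').sum + y) + 1 = m) := by omega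
      simp [listMat, hx, this]
    · simp at hy
      simp [listMat, hy, add_assoc]
    · have h1 := ih k k' (by simpa using hk) (by simpa using hk') (by simpa using hx)
        (by simpa using hy)
      simp only [List.map_cons, List.take_succ_cons, List.sum_cons, List.getElem_cons_succ,
        Nat.add_right_cancel_iff]
      rw [← h1, listMat, if_neg (by omega), if_neg (by omega)]
      congr 1 <;> omega

theorem admissible_of_getElem (l : List (ℕ × ℝ))
    (h : ∀ k (hk : k < l.length), 1 ≤ l[k].1 ∧ (l[k].2 ≠ 0 ∨ l[k].1 = 1 ∧ k + 1 = l.length)) :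
    Admissible l := by
  induction l with
  | nil => trivial
  | cons p l ih =>
    obtain ⟨m, a⟩ := p
    have h0 := h 0 (by simp)
    refine ⟨h0.1, h0.2.imp_right fun h => ⟨h.1, ?_⟩, ih fun k hk => ?_⟩
    · have := h.2
      simp at this
      exact this
    · have h1 := h (k + 1) (by simpa using hk)
      simpa using h1

end ListMat

section Composition

variable {n : ℕ} (c : Composition n) (a : Fin c.length → ℝ)

/-- The list of blocks of `blockRep c a`. -/
def blockList : List (ℕ × ℝ) := List.ofFn fun k => (c.blocksFun k, a k)

theorem map_fst_blockList : (blockList c a).map Prod.fst = c.blocks := by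
  rw [blockList, List.map_ofFn]
  exact c.ofFn_blocksFun

theorem coe_eq_sizeUpTo (i : Fin n) :
    (i : ℕ) = (c.blocks.take (c.index i)).sum + c.invEmbedding i := by
  conv_lhs => rw [← c.embedding_comp_inv i]
  rw [c.coe_embedding]
  rfl

theorem blockRep_eq_listMat (i j : Fin n) : blockRep c a i j = listMat (blockList c a) i j := by
  have hi := coe_eq_sizeUpTo c i
  have hj := coe_eq_sizeUpTo c j
  have hlen : (blockList c a).length = c.length := by simp [blockList]
  have h := listMat_apply (blockList c a) (c.index i) (c.index j) (by rw [hlen]; exact (c.index i).2)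
    (by rw [hlen]; exact (c.index j).2) (c.invEmbedding i) (c.invEmbedding j)
    (by simpa [blockList] using (c.invEmbedding i).2)
    (by simpa [blockList] using (c.invEmbedding j).2)
  rw [map_fst_blockList, ← hi, ← hj] at h
  rw [h, blockRep]
  simp [blockList, Fin.ext_iff]

/-- A zero block makes its rows vanish. So if the determinant or the leading principal minor of size
`n - 1` is non-zero, only the last block may be zero, and then it has size one. -/
theorem admissible_blockList
    (h : (blockRep c a).det ≠ 0 ∨ minor (n - 1) (blockRep c a) ≠ 0) : Admissible (blockList c a) := by
  refine admissible_of_getElem _ fun k hk => ?_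
  have hlen : (blockList c a).length = c.length := by simp [blockList]
  have hk' : k < c.length := by rwa [hlen] at hk
  set K : Fin c.length := ⟨k, hk'⟩ with hK
  have e1 : (blockList c a)[k].1 = c.blocksFun K := by simp [blockList, hK]
  have e2 : (blockList c a)[k].2 = a K := by simp [blockList, hK]
  rw [e1, e2, hlen]
  have hpos : 1 ≤ c.blocksFun K := c.one_le_blocksFun K
  refine ⟨hpos, ?_⟩
  by_contra! hcon
  obtain ⟨ha0, hlast⟩ := hcon
  have hrow : ∀ x : Fin (c.blocksFun K), ∀ j, blockRep c a (c.embedding K x) j = 0 := by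
    intro x j
    rw [blockRep]
    simp only [c.index_embedding, ha0, ite_self]
  have hmin : minor (n - 1) (blockRep c a) ≠ 0 := by
    refine h.resolve_left fun h0 => h0 ?_
    exact Matrix.det_eq_zero_of_row_eq_zero (c.embedding K ⟨0, hpos⟩) fun j => hrow _ j
  have hend : ∀ x : Fin (c.blocksFun K), n - 1 ≤ (c.embedding K x : ℕ) := by
    intro x
    by_contra! hx
    exact hmin (Matrix.det_eq_zero_of_row_eq_zero ⟨c.embedding K x, hx⟩ fun j => hrow x j)
  have h0 := hend ⟨0, hpos⟩
  rw [c.coe_embedding] at h0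
  have h1 : c.sizeUpTo (k + 1) = c.sizeUpTo k + c.blocksFun K := c.sizeUpTo_succ' K
  have h2 : c.sizeUpTo (k + 1) ≤ n := c.sizeUpTo_le _
  have h3 : c.sizeUpTo K = c.sizeUpTo k := rfl
  simp only [h3, add_zero] at h0
  have h4 : k + 1 ≠ c.length := hlast (by omega)
  have h5 : k + 1 < c.length := by omega
  have h6 : c.sizeUpTo (k + 1 + 1) = c.sizeUpTo (k + 1) + c.blocksFun ⟨k + 1, h5⟩ :=
    c.sizeUpTo_succ' ⟨k + 1, h5⟩
  have h7 := c.one_le_blocksFun ⟨k + 1, h5⟩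
  have h8 := c.sizeUpTo_le (k + 1 + 1)
  omega

end Composition

/-! ### Functions that are Schwartz along the determinant -/

section Cutoff

variable {n : ℕ} {V : Set ℝ} {D : Type} [NormedCommRing D] [NormedAlgebra ℝ D] [QuadAlg D]
  [QuadBasis D]

/-- A bump function at `t` with support in `V`. -/
theorem exists_isSchwartzOn_eq_one (hV : IsOpen V) {t : ℝ} (ht : t ∈ V) :
    ∃ f : 𝓢(ℝ, ℂ), IsSchwartzOn V f ∧ f t = 1 := by
  obtain ⟨ε, hε, hball⟩ := Metric.isOpen_iff.1 hV t ht
  let b : ContDiffBump t := ⟨ε / 3, ε / 2, by positivity, by linarith⟩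
  have hcs : HasCompactSupport fun x => ((b x : ℝ) : ℂ) :=
    b.hasCompactSupport.comp_left (g := fun x : ℝ => (x : ℂ)) Complex.ofReal_zero
  have hsm : ContDiff ℝ ∞ fun x => ((b x : ℝ) : ℂ) := Complex.ofRealCLM.contDiff.comp b.contDiff
  refine ⟨hcs.toSchwartzMap hsm, fun x hx k => ?_, ?_⟩
  · by_contra h
    have h1 : x ∈ tsupport fun x => ((b x : ℝ) : ℂ) := support_iteratedFDeriv_subset k h
    have h2 : tsupport (fun x => ((b x : ℝ) : ℂ)) = tsupport b := by
      rw [tsupport, tsupport]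
      congr 1
      ext y
      simp
    rw [h2, b.tsupport_eq] at h1
    exact hx (hball (lt_of_le_of_lt (Metric.mem_closedBall.1 h1) (half_lt_self hε)))
  · change ((b t : ℝ) : ℂ) = 1
    rw [b.one_of_mem_closedBall (Metric.mem_closedBall_self b.rIn_pos.le), Complex.ofReal_one]

theorem regInt_mul_det {Φ F : Herm n D → ℂ} {f : ℝ → ℂ}
    (hF : ∀ x, hdet x ∈ V → F x = f (hdet x) * Φ x) (ψ : AddChar ℝ Circle) (a : Fin n → ℝ)
    (ha : ∀ i, a i ≠ 0) (hV : ∏ i, a i ∈ V) : regInt ψ F a = f (∏ i, a i) * regInt ψ Φ a := by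
  rw [regInt, regInt, ← integral_const_mul]
  refine integral_congr_ae (Filter.Eventually.of_forall fun u => ?_)
  have h : hdet (act (ofReal (D := D) (Matrix.diagonal a) (Matrix.diagonal_transpose a)) u) =
      ∏ i, a i := by
    rw [act_eq_actM, hdet_actM _ (u := umat u) u.2, ← Monomial.diag_herm a ha, Monomial.hdet_diag]
  simp only
  rw [hF _ (by rw [h]; exact hV), h, mul_assoc]

theorem orbIntegrand_mul_det {Φ F : Herm n D → ℂ} {f : ℝ → ℂ}
    (hF : ∀ x, hdet x ∈ V → F x = f (hdet x) * Φ x) (ψ : AddChar ℝ Circle) (d : Monomial n)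
    (hV : d.mat.det ∈ V) (hf : f d.mat.det = 1) :
    orbIntegrand ψ F (d.herm D) = orbIntegrand ψ Φ (d.herm D) := by
  funext q
  have h : hdet (act (d.herm D) (Quotient.out q)) = d.mat.det := by
    rw [act_eq_actM, hdet_actM _ (u := umat (Quotient.out q)) (Quotient.out q).2, Monomial.hdet_herm]
  rw [orbIntegrand, orbIntegrand, hF _ (by rw [h]; exact hV), h, hf, one_mul]

/-- The comparison of orbit integrals for functions that are Schwartz along the determinant, at a
datum with known transfer factor. Multiplication by a function of the determinant, which is constant
on orbits, reduces it to Schwartz functions. -/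
theorem Transfers.orbInt_eq {ψ : AddChar ℝ Circle} (hψ : Continuous ψ) (hV : V = Set.univ ∨ V = {0}ᶜ)
    {Φ : Herm n (ℝ × ℝ) → ℂ} {Ψ : Herm n ℂ → ℂ}
    (hΦ : IsSchwartzAlongDet V Φ) (hΨ : IsSchwartzAlongDet V Ψ)
    (hmatch : ∀ a : Fin n → ℝ, (∀ i, a i ≠ 0) → regInt ψ Φ a = regFactor a * regInt ψ Ψ a)
    {d : Monomial n} {γ : ℂ} (hd : Transfers ψ d γ) (hdV : d.mat.det ∈ V) :
    Integrable (orbIntegrand ψ Φ (d.herm _)) (quotMeasure (d.herm _)) ∧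
      Integrable (orbIntegrand ψ Ψ (d.herm _)) (quotMeasure (d.herm _)) ∧
      orbInt ψ Φ (d.herm _) = γ * orbInt ψ Ψ (d.herm _) := by
  have hVo : IsOpen V := by
    rcases hV with rfl | rfl
    · exact isOpen_univ
    · exact isOpen_compl_singleton
  have hV0 : ∀ t, t ≠ 0 → t ∈ V := by
    rcases hV with rfl | rfl
    · exact fun t _ => Set.mem_univ t
    · exact fun t ht => ht
  -- A function of the determinant that is `1` at `det d`.
  obtain ⟨f, hfV, hf⟩ := exists_isSchwartzOn_eq_one hVo hdV
  obtain ⟨F, -, hF⟩ := hΦ.2 f hfV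
  obtain ⟨G, -, hG⟩ := hΨ.2 f hfV
  have hm : Matching ψ 1 F G := by
    intro a ha
    have hp : ∏ i, a i ∈ V := hV0 _ (Finset.prod_ne_zero_iff.2 fun i _ => ha i)
    rw [← Monomial.regInt_eq hψ F.continuous, ← Monomial.regInt_eq hψ G.continuous,
      regInt_mul_det hF ψ a ha hp, regInt_mul_det hG ψ a ha hp, hmatch a ha]
    ring
  have h1 := orbIntegrand_mul_det hF ψ d hdV hf
  have h2 := orbIntegrand_mul_det hG ψ d hdV hf
  refine ⟨?_, ?_, ?_⟩
  · rw [← h1]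
    exact d.integrable_orbIntegrand hψ F.continuous (d.integrable_J_integrand hψ F)
  · rw [← h2]
    exact d.integrable_orbIntegrand hψ G.continuous (d.integrable_J_integrand hψ G)
  · rw [orbInt, orbInt, ← h1, ← h2]
    change orbInt ψ F (d.herm _) = γ * orbInt ψ G (d.herm _)
    rw [d.orbInt_eq hψ F.continuous, d.orbInt_eq hψ G.continuous, hd 1 F G hm]
    ring

end Cutoff

end Kloosterman

end

open Kloosterman in
theorem mainTheorem4 (n : ℕ) (ψ : AddChar ℝ Circle) (hψc : Continuous ψ) (hψ : ψ ≠ 1)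
    (V : Set ℝ) (hV : V = Set.univ ∨ V = {0}ᶜ)
    (Φ : Herm n (ℝ × ℝ) → ℂ) (Ψ : Herm n ℂ → ℂ)
    (hΦ : IsSchwartzAlongDet V Φ) (hΨ : IsSchwartzAlongDet V Ψ)
    (hmatch : ∀ a : Fin n → ℝ, (∀ i, a i ≠ 0) → regInt ψ Φ a = regFactor a * regInt ψ Ψ a)
    (c : Composition n) (a : Fin c.length → ℝ)
    (hdetV : (blockRep c a).det ∈ V)
    (hminor : (blockRep c a).det = 0 → minor (n - 1) (blockRep c a) ≠ 0) :
    (IsQuotientMeasure _ (quotMeasure (ofReal (D := ℝ × ℝ) (blockRep c a) (blockRep_transpose c a))) ∧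
      Integrable (orbIntegrand ψ Φ (ofReal (blockRep c a) (blockRep_transpose c a)))
        (quotMeasure _)) ∧
    (IsQuotientMeasure _ (quotMeasure (ofReal (D := ℂ) (blockRep c a) (blockRep_transpose c a))) ∧
      Integrable (orbIntegrand ψ Ψ (ofReal (blockRep c a) (blockRep_transpose c a)))
        (quotMeasure _)) ∧
    orbInt ψ Φ (ofReal (blockRep c a) (blockRep_transpose c a)) =
      factor ψ c a * orbInt ψ Ψ (ofReal (blockRep c a) (blockRep_transpose c a)) ∧
    factor ψ c a ^ 4 = 1 := by
  have hadm : Admissible (blockList c a) := admissible_blockList c a (by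
    by_cases h : (blockRep c a).det = 0
    · exact Or.inr (hminor h)
    · exact Or.inl h)
  obtain ⟨d, hd, ht⟩ := exists_transfers hψc hψ (blockList c a) hadm n (by
    rw [map_fst_blockList, c.blocks_sum])
  have hmat : d.mat = blockRep c a := by
    ext i j
    rw [hd, blockRep_eq_listMat]
  have e : ∀ (D : Type) [NormedCommRing D] [NormedAlgebra ℝ D] [QuadAlg D] [QuadBasis D],
      d.herm D = ofReal (blockRep c a) (blockRep_transpose c a) := by
    intro D _ _ _ _
    simp only [Monomial.herm, hmat]
  have h := ht.orbInt_eq hψc hV hΦ hΨ hmatch (by rw [hmat]; exact hdetV)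
  have h1 := d.isQuotientMeasure_quotMeasure (D := ℝ × ℝ)
  have h2 := d.isQuotientMeasure_quotMeasure (D := ℂ)
  rw [e] at h1 h2
  rw [e, e] at h
  exact ⟨⟨h1, h.1⟩, ⟨h2, h.2.1⟩, h.2.2, listFactor_pow_four hψc hψ _ hadm⟩
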